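/- Let $\mathbb K$ be a field of characteristic $0$ and $n\in\mathbb Z$. All graphs are finite and directed, with numbered internal vertices, external vertices and edges; multiple edges and tadpoles are allowed. Let $v,s,e$ denote the numbers of internal vertices, external vertices and edges. An edge joining two different internal vertices may be contracted; write $\Gamma/a$ for the result. For $N\in\mathbb Z$ put $\deg_N\Gamma=(N-1)e-Nv-Ns+N$, so that $\deg_N(\Gamma/a)=\deg_N\Gamma+1$. **The hairy complex $\mathsf{HG}_{n,n}$.** It is the graded $\mathbb K$-vector space (direct sum) spanned by connected graphs $\Gamma$ with $v\ge 1$, $s\ge 1$, all of whose internal vertices are at least 3-valent and all of whose external vertices are 1-valent, placed in degree $\deg_n\Gamma$, modulo the following relations. Renumbering by $(\sigma,\rho,\pi)\in\mathbb S_v\times\mathbb S_s\times\mathbb S_e$ multiplies a graph by $\operatorname{sgn}\pi$ if $n$ is even and by $\operatorname{sgn}\sigma\operatorname{sgn}\rho$ if $n$ is odd. Reversing the direction of one edge multiplies it by $1$ if $n$ is even and by $-1$ if $n$ is odd. The differential is $d\Gamma=\sum_a\pm\Gamma/a$, summed over the edges $a$ between two different internal vertices. The sign is $(-1)^{i}$,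 where $i$ is the number (counted from $0$) of the edge $a$ if $n$ is even and of the target $y$ of $a$ if $n$ is odd. The merged vertex takes the number of the source of $a$, the numbers of $a$ and $y$ are removed, and the order of the rest is kept. **The fixed target oriented complex $(\mathsf{OG}_{N},d_0)$.** It is the graded $\mathbb K$-vector space (direct sum) spanned by connected graphs $\Gamma$ with $v\ge 1$, $s=0$, all vertices at least 2-valent, no passing vertices (exactly one incoming and exactly one outgoing edge) and no directed cycles, placed in degree $\deg_N\Gamma$. Renumbering by $(\sigma,\pi)\in\mathbb S_v\times\mathbb S_e$ multiplies a graph by $\operatorname{sgn}\pi$ if $N$ is even and by $\operatorname{sgn}\sigma$ if $N$ is odd (the directions of edges are kept). The differential $d_0$ is given by the same signed sum of contractions $\Gamma/a$, restricted to those edges $a$ for which $\Gamma/a$ again has no directed cycle and has the same number of targets (vertices without outgoing edges) as $\Gamma$. **The map.** Let $\Gamma$ be one of the graphs that span $\mathsf{HG}_{n,n}$. A *hair forest* $\tau$ of $\Gamma$ is a spanning forest (a cycle-free subgraph containing all vertices) such that every component contains exactly one external vertex and such that all edges at external vertices belong to $\tau$. For an internal vertex $x$ let $\tau(x)$ be the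 first edge of the path in $\tau$ from $x$ to an external vertex; thus $\tau$ is a bijection from the internal vertices to the edges of the forest. Let $\Gamma_\tau$ be the oriented graph obtained from $\Gamma$ as follows. Direct the edges of $\tau$ towards the external vertices; replace each edge $b=(p\to q)$ not in $\tau$ by a zigzag $p\leftarrow\bullet\to q$ with a new vertex $\bullet$; delete all external vertices and the edges at them. Its vertices are numbered by the edges of $\Gamma$: the internal vertex $x$ gets the number of $\tau(x)$, and the new vertex of the zigzag replacing $b$ gets the number of $b$. Its edges are ordered as follows: first the remaining forest edges $\tau(x)$, in the order of the vertices $x$, then for each $b\notin\tau$, in order, the edge $\bullet\to p$ followed by the edge $\bullet\to q$. Let $\epsilon_\tau=1$ if $n$ is even. If $n$ is odd, let $\epsilon_\tau=(-1)^{k}\epsilon'$, where $k$ is the number of internal vertices $x$ that are not the source of $\tau(x)$ in $\Gamma$, and $\epsilon'$ is the sign of the permutation that rearranges the internal vertices such that those $x$ for which $\tau(x)$ has no external end come first, in their order, followed by the others in the order of their external vertices. Put $$f(\Gamma)=\sum_{\tau}\epsilon_\tau\,\Gamma_\tau ,$$ summed over all hair forests $\tau$ of $\Gamma$. **Statement.**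 For every $n\in\mathbb Z$ the formula above is well defined and gives a map of complexes $$f:\ (\mathsf{HG}_{n,n},d)\longrightarrow(\mathsf{OG}_{n+1},d_0)[1],$$ where $(C[1])^D=C^{D+1}$ with differential $-d_C$, and $f$ is a quasi-isomorphism. -/

import Mathlib

open CategoryTheory

/-- A finite directed graph with `v` numbered internal vertices, `s` numbered external vertices and
`e` numbered edges.  Multiple edges and tadpoles are allowed. -/
structure Gr where
  v : ℕ
  s : ℕ
  e : ℕ
  src : Fin e → Fin v ⊕ Fin s
  tgt : Fin e → Fin v ⊕ Fin s

namespace Gr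

/-! ### Renumbering after the removal of one element -/

/-- The increasing map `{0, …, k-2} → {0, …, k-1}` that misses `y`. -/
def skip {k : ℕ} (y : Fin k) (i : Fin (k - 1)) : Fin k :=
  ⟨if i.1 < y.1 then i.1 else i.1 + 1, by have := i.2; split_ifs <;> omega⟩

/-- The new number of `w ≠ y` after the removal of `y`; inverse to `skip y`. -/
def unskip {k : ℕ} (y w : Fin k) (h : w ≠ y) : Fin (k - 1) :=
  ⟨if w.1 < y.1 then w.1 else w.1 - 1, by
    have h1 := w.2; have h2 := y.2; have h3 : w.1 ≠ y.1 := fun h' => h (Fin.ext h')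
    split_ifs <;> omega⟩

/-- The map that identifies `y` with `x` and afterwards removes the number of `y`. -/
def merge {k : ℕ} (x y : Fin k) (h : x ≠ y) (w : Fin k) : Fin (k - 1) :=
  unskip y (if w = y then x else w) (by split_ifs <;> assumption)

theorem skip_ne {k : ℕ} (y : Fin k) (i : Fin (k - 1)) : skip y i ≠ y := by
  intro h; have := congrArg Fin.val h; simp only [skip] at this; split_ifs at this <;> omega

theorem skip_unskip {k : ℕ} (y w : Fin k) (h : w ≠ y) : skip y (unskip y w h) = w := by
  have h3 : w.1 ≠ y.1 := fun h' => h (Fin.ext h')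
  ext; simp only [skip, unskip]; split_ifs <;> omega

theorem skip_inj {k : ℕ} {y : Fin k} {i j : Fin (k - 1)} (h : skip y i = skip y j) : i = j := by
  have := congrArg Fin.val h; simp only [skip] at this; ext; split_ifs at this <;> omega

theorem unskip_skip {k : ℕ} (y : Fin k) (i : Fin (k - 1)) (h : skip y i ≠ y) :
    unskip y (skip y i) h = i := skip_inj (skip_unskip _ _ _)

theorem skip_merge {k : ℕ} (x y : Fin k) (h : x ≠ y) (w : Fin k) :
    skip y (merge x y h w) = if w = y then x else w := skip_unskip _ _ _

theorem merge_skip {k : ℕ} (x y : Fin k) (h : x ≠ y) (i : Fin (k - 1)) :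
    merge x y h (skip y i) = i := by
  apply skip_inj (y := y); rw [skip_merge, if_neg (skip_ne y i)]

/-- The permutation induced by `σ` after the removal of `y` from the source and of `σ y` from the
target. -/
def removePerm {k : ℕ} (σ : Equiv.Perm (Fin k)) (y y' : Fin k) (h : σ y = y') :
    Equiv.Perm (Fin (k - 1)) where
  toFun i := unskip y' (σ (skip y i)) (fun h' => skip_ne y i (σ.injective (h'.trans h.symm)))
  invFun i := unskip y (σ.symm (skip y' i)) (fun h' =>
    skip_ne y' i (((Equiv.symm_apply_eq σ).1 h').trans h))
  left_inv i := by apply skip_inj (y := y); simp [skip_unskip]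
  right_inv i := by apply skip_inj (y := y'); simp [skip_unskip]

theorem skip_removePerm {k : ℕ} (σ : Equiv.Perm (Fin k)) (y y' : Fin k) (h : σ y = y')
    (i : Fin (k - 1)) : skip y' (removePerm σ y y' h i) = σ (skip y i) :=
  skip_unskip y' (σ (skip y i)) (fun h' => skip_ne y i (σ.injective (h'.trans h.symm)))

theorem sign_removePerm {k : ℕ} (σ : Equiv.Perm (Fin k)) (y y' : Fin k) (h : σ y = y') :
    Equiv.Perm.sign (removePerm σ y y' h) =
      Equiv.Perm.sign σ * ((-1) ^ y.1 * (-1) ^ y'.1) := by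
  obtain _ | m := k
  · exact y.elim0
  have hs : ∀ (z : Fin (m + 1)) (i : Fin m), skip z i = z.succAbove i := by
    intro z i; ext; simp only [skip, Fin.succAbove, Fin.lt_def, Fin.val_castSucc]
    split_ifs <;> simp
  have key : Equiv.Perm.decomposeFin.symm ((0 : Fin (m + 1)), removePerm σ y y' h) =
      Fin.cycleRange y' * σ * (Fin.cycleRange y)⁻¹ := by
    ext i
    refine congrArg Fin.val ?_
    refine Fin.cases ?_ (fun j => ?_) i
    · simp [Equiv.Perm.decomposeFin_symm_apply_zero, Equiv.Perm.inv_def, h]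
    · have h2 := skip_removePerm σ y y' h j
      rw [hs, hs] at h2
      simp only [Equiv.Perm.decomposeFin_symm_apply_succ, Equiv.Perm.inv_def,
        Equiv.Perm.mul_apply, Fin.cycleRange_symm_succ, Equiv.swap_self, Equiv.refl_apply]
      rw [← h2, Fin.cycleRange_succAbove]
  have := congrArg Equiv.Perm.sign key
  rw [Equiv.Perm.decomposeFin.symm_sign] at this
  simp only [if_true, one_mul, map_mul, map_inv, Fin.sign_cycleRange] at this
  rw [this]
  rcases Nat.even_or_odd y.1 with h1 | h1 <;> rcases Nat.even_or_odd y'.1 with h2 | h2 <;>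
    simp [h1.neg_one_pow, h2.neg_one_pow]


/-! ### Operations on graphs -/

/-- Renumbering of internal vertices, external vertices and edges. -/
def relabel (Γ : Gr) (σ : Equiv.Perm (Fin Γ.v)) (ρ : Equiv.Perm (Fin Γ.s))
    (π : Equiv.Perm (Fin Γ.e)) : Gr where
  v := Γ.v
  s := Γ.s
  e := Γ.e
  src b := Sum.map σ ρ (Γ.src (π.symm b))
  tgt b := Sum.map σ ρ (Γ.tgt (π.symm b))

/-- Reversal of the direction of the edge `c`. -/
def flip (Γ : Gr) (c : Fin Γ.e) : Gr where
  v := Γ.v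
  s := Γ.s
  e := Γ.e
  src b := if b = c then Γ.tgt b else Γ.src b
  tgt b := if b = c then Γ.src b else Γ.tgt b

/-- The edges that can be contracted: edges `a = (x → y)` between two different internal vertices,
recorded as triples `(a, x, y)`. -/
def Inner (Γ : Gr) : Type :=
  {p : Fin Γ.e × Fin Γ.v × Fin Γ.v //
    Γ.src p.1 = Sum.inl p.2.1 ∧ Γ.tgt p.1 = Sum.inl p.2.2 ∧ p.2.1 ≠ p.2.2}

noncomputable instance (Γ : Gr) : Fintype Γ.Inner := by
  classical exact inferInstanceAs (Fintype (Subtype _))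

/-- The number of the edge. -/
def Inner.a {Γ : Gr} (p : Γ.Inner) : Fin Γ.e := p.1.1

/-- The source of the edge. -/
def Inner.x {Γ : Gr} (p : Γ.Inner) : Fin Γ.v := p.1.2.1

/-- The target of the edge. -/
def Inner.y {Γ : Gr} (p : Γ.Inner) : Fin Γ.v := p.1.2.2

theorem Inner.src_eq {Γ : Gr} (p : Γ.Inner) : Γ.src p.a = Sum.inl p.x := p.2.1

theorem Inner.tgt_eq {Γ : Gr} (p : Γ.Inner) : Γ.tgt p.a = Sum.inl p.y := p.2.2.1

theorem Inner.ne {Γ : Gr} (p : Γ.Inner) : p.x ≠ p.y := p.2.2.2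

theorem Inner.ext {Γ : Gr} {p q : Γ.Inner} (h : p.a = q.a) : p = q := by
  have hx : p.x = q.x := Sum.inl_injective (p.src_eq.symm.trans ((congrArg Γ.src h).trans q.src_eq))
  have hy : p.y = q.y := Sum.inl_injective (p.tgt_eq.symm.trans ((congrArg Γ.tgt h).trans q.tgt_eq))
  exact Subtype.ext (Prod.ext h (Prod.ext hx hy))

/-- The graph `Γ/a`: the edge `a` is removed and its target `y` is identified with its source `x`.
The remaining edges and vertices keep their order (the merged vertex takes the place of `x`). -/
def contract (Γ : Gr) (p : Γ.Inner) : Gr where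
  v := Γ.v - 1
  s := Γ.s
  e := Γ.e - 1
  src b := Sum.map (merge p.x p.y p.ne) id (Γ.src (skip p.a b))
  tgt b := Sum.map (merge p.x p.y p.ne) id (Γ.tgt (skip p.a b))

/-- The sign of a renumbering: edges are odd for even `N`; internal and external vertices are odd
for odd `N`. -/
def relSign (N : ℤ) {v s e : ℕ} (σ : Equiv.Perm (Fin v)) (ρ : Equiv.Perm (Fin s))
    (π : Equiv.Perm (Fin e)) : ℤˣ :=
  if Even N then Equiv.Perm.sign π else Equiv.Perm.sign σ * Equiv.Perm.sign ρ

/-- The sign of reversing an edge. -/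
def flipSign (N : ℤ) : ℤˣ := if Even N then 1 else -1

/-- The sign of `Γ/a` in the differential: the removed odd element (the edge `a` for even `N`, the
vertex `y` for odd `N`) is moved to the first place. -/
def contractSign (N : ℤ) {Γ : Gr} (p : Γ.Inner) : ℤˣ :=
  if Even N then (-1) ^ p.a.1 else (-1) ^ p.y.1

/-- The cohomological degree of a graph: edges have degree `N - 1`, internal vertices `-N`, external
vertices `-N`, and there is an overall shift by `N`. -/
def degree (N : ℤ) (Γ : Gr) : ℤ := (N - 1) * Γ.e - N * Γ.v - N * Γ.s + N

theorem mk_congr {v s e : ℕ} {f f' g g' : Fin e → Fin v ⊕ Fin s} (h : ∀ b, f b = f' b)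
    (h' : ∀ b, g b = g' b) : (⟨v, s, e, f, g⟩ : Gr) = ⟨v, s, e, f', g'⟩ := by
  rw [funext h, funext h']

theorem Inner.v_pos {Γ : Gr} (p : Γ.Inner) : 2 ≤ Γ.v := by
  have h1 := p.x.2; have h2 := p.y.2
  have h3 : p.x.1 ≠ p.y.1 := fun h => p.ne (Fin.ext h)
  omega

theorem degree_contract (N : ℤ) {Γ : Gr} (p : Γ.Inner) :
    (Γ.contract p).degree N = Γ.degree N + 1 := by
  have h1 : ((Γ.v - 1 : ℕ) : ℤ) = Γ.v - 1 := by have := p.x.2; omega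
  have h2 : ((Γ.e - 1 : ℕ) : ℤ) = Γ.e - 1 := by have := p.a.2; omega
  simp only [degree, contract, h1, h2]
  ring

/-! ### Compatibility of contraction with renumbering and reversal -/

/-- The image of a contractible edge under a renumbering. -/
def Inner.relabel {Γ : Gr} (p : Γ.Inner) (σ : Equiv.Perm (Fin Γ.v)) (ρ : Equiv.Perm (Fin Γ.s))
    (π : Equiv.Perm (Fin Γ.e)) : (Γ.relabel σ ρ π).Inner :=
  ⟨(π p.a, σ p.x, σ p.y), by simp [Gr.relabel, p.src_eq], by simp [Gr.relabel, p.tgt_eq],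
    σ.injective.ne p.ne⟩

theorem merge_perm {k : ℕ} (σ : Equiv.Perm (Fin k)) (x y : Fin k) (h : x ≠ y) (h' : σ x ≠ σ y)
    (w : Fin k) : merge (σ x) (σ y) h' (σ w) = removePerm σ y (σ y) rfl (merge x y h w) := by
  apply skip_inj (y := σ y)
  rw [skip_merge, skip_removePerm, skip_merge]
  by_cases hw : w = y <;> simp [hw]

theorem merge_comm {k : ℕ} (x y : Fin k) (h : x ≠ y) (w : Fin k) :
    merge y x h.symm w =
      removePerm (Equiv.swap x y) y x (Equiv.swap_apply_right x y) (merge x y h w) := by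
  apply skip_inj (y := x)
  rw [skip_merge, skip_removePerm, skip_merge]
  by_cases hw : w = y
  · simp [hw, h.symm]
  · by_cases hx : w = x
    · simp [hx, h]
    · simp [hw, hx, Equiv.swap_apply_of_ne_of_ne]

theorem contract_relabel {Γ : Gr} (p : Γ.Inner) (σ : Equiv.Perm (Fin Γ.v))
    (ρ : Equiv.Perm (Fin Γ.s)) (π : Equiv.Perm (Fin Γ.e)) :
    (Γ.relabel σ ρ π).contract (p.relabel σ ρ π) =
      (Γ.contract p).relabel (removePerm σ p.y (σ p.y) rfl) ρ (removePerm π p.a (π p.a) rfl) := by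
  have key : ∀ b : Fin (Γ.e - 1), π.symm (skip (π p.a) b) =
      skip p.a ((removePerm π p.a (π p.a) rfl).symm b) := by
    intro b
    obtain ⟨c, rfl⟩ := (removePerm π p.a (π p.a) rfl).surjective b
    rw [skip_removePerm]; simp
  have key2 : ∀ q : Fin Γ.v ⊕ Fin Γ.s,
      Sum.map (merge (σ p.x) (σ p.y) (σ.injective.ne p.ne)) id (Sum.map σ ρ q) =
      Sum.map (removePerm σ p.y (σ p.y) rfl) ρ (Sum.map (merge p.x p.y p.ne) id q) := by
    rintro (w | j)
    · exact congrArg Sum.inl (merge_perm σ p.x p.y p.ne _ w)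
    · rfl
  apply mk_congr
  · intro b
    exact (congrArg (fun c => Sum.map (merge (σ p.x) (σ p.y) (σ.injective.ne p.ne)) id
      (Sum.map σ ρ (Γ.src c))) (key b)).trans (key2 _)
  · intro b
    exact (congrArg (fun c => Sum.map (merge (σ p.x) (σ p.y) (σ.injective.ne p.ne)) id
      (Sum.map σ ρ (Γ.tgt c))) (key b)).trans (key2 _)

theorem contractSign_relabel (N : ℤ) {Γ : Gr} (p : Γ.Inner) (σ : Equiv.Perm (Fin Γ.v))
    (ρ : Equiv.Perm (Fin Γ.s)) (π : Equiv.Perm (Fin Γ.e)) :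
    contractSign N (p.relabel σ ρ π) *
        relSign N (removePerm σ p.y (σ p.y) rfl) ρ (removePerm π p.a (π p.a) rfl) =
      relSign N σ ρ π * contractSign N p := by
  have e : ∀ (a b s : ℤˣ), a * (s * (b * a)) = s * b := by decide
  have e' : ∀ (a b s r : ℤˣ), a * (s * (b * a) * r) = s * r * b := by decide
  unfold contractSign relSign
  simp only [sign_removePerm]
  split_ifs
  · exact e _ _ _
  · exact e' _ _ _ _

/-- The contractible edge of the graph with one edge reversed. -/
def Inner.flip {Γ : Gr} (p : Γ.Inner) (c : Fin Γ.e) : (Γ.flip c).Inner :=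
  if h : p.a = c then
    ⟨(p.a, p.y, p.x), by simp [Gr.flip, h, ← p.tgt_eq], by simp [Gr.flip, h, ← p.src_eq],
      p.ne.symm⟩
  else
    ⟨(p.a, p.x, p.y), by simp [Gr.flip, h, p.src_eq], by simp [Gr.flip, h, p.tgt_eq], p.ne⟩

theorem Inner.flip_a {Γ : Gr} (p : Γ.Inner) (c : Fin Γ.e) : (p.flip c).a = p.a := by
  by_cases h : p.a = c
  · exact (congrArg Inner.a (dif_pos h)).trans rfl
  · exact (congrArg Inner.a (dif_neg h)).trans rfl

theorem contract_flip_of_ne {Γ : Gr} (p : Γ.Inner) (c : Fin Γ.e) (h : p.a ≠ c) :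
    (Γ.flip c).contract (p.flip c) = (Γ.contract p).flip (unskip p.a c (Ne.symm h)) := by
  have hp : p.flip c = ⟨(p.a, p.x, p.y), by simp [Gr.flip, h, p.src_eq],
    by simp [Gr.flip, h, p.tgt_eq], p.ne⟩ := dif_neg h
  rw [hp]
  have key : ∀ b : Fin (Γ.e - 1), (skip p.a b = c) ↔ b = unskip p.a c (Ne.symm h) := by
    intro b; constructor
    · rintro rfl; exact (unskip_skip _ _ _).symm
    · rintro rfl; exact skip_unskip _ _ _
  apply mk_congr
  · intro b
    by_cases hb : skip p.a b = c
    · exact (congrArg (Sum.map (merge p.x p.y p.ne) id) (if_pos hb)).trans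
        (if_pos ((key b).1 hb)).symm
    · exact (congrArg (Sum.map (merge p.x p.y p.ne) id) (if_neg hb)).trans
        (if_neg (fun h' => hb ((key b).2 h'))).symm
  · intro b
    by_cases hb : skip p.a b = c
    · exact (congrArg (Sum.map (merge p.x p.y p.ne) id) (if_pos hb)).trans
        (if_pos ((key b).1 hb)).symm
    · exact (congrArg (Sum.map (merge p.x p.y p.ne) id) (if_neg hb)).trans
        (if_neg (fun h' => hb ((key b).2 h'))).symm

theorem contract_flip_self {Γ : Gr} (p : Γ.Inner) :
    (Γ.flip p.a).contract (p.flip p.a) =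
      (Γ.contract p).relabel
        (removePerm (Equiv.swap p.x p.y) p.y p.x (Equiv.swap_apply_right _ _)) 1 1 := by
  have hp : p.flip p.a = ⟨(p.a, p.y, p.x), by simp [Gr.flip, ← p.tgt_eq],
    by simp [Gr.flip, ← p.src_eq], p.ne.symm⟩ := dif_pos rfl
  rw [hp]
  have key2 : ∀ q : Fin Γ.v ⊕ Fin Γ.s,
      Sum.map (merge p.y p.x p.ne.symm) id q =
      Sum.map (removePerm (Equiv.swap p.x p.y) p.y p.x (Equiv.swap_apply_right _ _)) (1 : Equiv.Perm (Fin Γ.s))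
        (Sum.map (merge p.x p.y p.ne) id q) := by
    rintro (w | j)
    · exact congrArg Sum.inl (merge_comm p.x p.y p.ne w)
    · rfl
  apply mk_congr
  · intro b
    exact (congrArg (Sum.map (merge p.y p.x p.ne.symm) id) (if_neg (skip_ne _ _))).trans (key2 _)
  · intro b
    exact (congrArg (Sum.map (merge p.y p.x p.ne.symm) id) (if_neg (skip_ne _ _))).trans (key2 _)

theorem contractSign_flip_of_ne (N : ℤ) {Γ : Gr} (p : Γ.Inner) (c : Fin Γ.e) (h : p.a ≠ c) :
    contractSign N (p.flip c) = contractSign N p := by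
  have hp : p.flip c = ⟨(p.a, p.x, p.y), by simp [Gr.flip, h, p.src_eq],
    by simp [Gr.flip, h, p.tgt_eq], p.ne⟩ := dif_neg h
  rw [hp]; rfl

theorem contractSign_flip_self (N : ℤ) {Γ : Gr} (p : Γ.Inner) :
    contractSign N (p.flip p.a) * relSign N
        (removePerm (Equiv.swap p.x p.y) p.y p.x (Equiv.swap_apply_right _ _))
        (1 : Equiv.Perm (Fin Γ.s)) (1 : Equiv.Perm (Fin (Γ.e - 1))) =
      flipSign N * contractSign N p := by
  have hp : p.flip p.a = ⟨(p.a, p.y, p.x), by simp [Gr.flip, ← p.tgt_eq],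
    by simp [Gr.flip, ← p.src_eq], p.ne.symm⟩ := dif_pos rfl
  rw [hp]
  have e : ∀ (a b : ℤˣ), a * (-1 * (b * a) * 1) = -1 * b := by decide
  unfold contractSign relSign flipSign
  simp only [sign_removePerm, Equiv.Perm.sign_swap p.ne, Equiv.Perm.sign_one]
  split_ifs
  · simp [Inner.a]
  · exact e _ _

/-! ### Two successive contractions -/

theorem skip_skip {k : ℕ} (a : Fin k) (b : Fin (k - 1)) (h : a ≠ skip a b) (i : Fin (k - 1 - 1)) :
    skip (skip a b) (skip (unskip (skip a b) a h) i) = skip a (skip b i) := by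
  have := i.2; have := b.2; have := a.2
  ext; simp only [skip, unskip]; split_ifs <;> omega

theorem sign_skip {k : ℕ} (a : Fin k) (b : Fin (k - 1)) (h : a ≠ skip a b) :
    (-1 : ℤˣ) ^ (skip a b).1 * (-1) ^ (unskip (skip a b) a h).1 = -((-1) ^ a.1 * (-1) ^ b.1) := by
  have h1 : ((skip a b).1 = b.1 ∧ (unskip (skip a b) a h).1 + 1 = a.1) ∨
      ((skip a b).1 = b.1 + 1 ∧ (unskip (skip a b) a h).1 = a.1) := by
    have := b.2; have := a.2
    simp only [skip, unskip]; split_ifs <;> omega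
  rcases h1 with ⟨h1, h2⟩ | ⟨h1, h2⟩
  · rw [h1, ← h2, pow_succ, mul_comm]; simp
  · rw [h1, h2, pow_succ, mul_comm]; simp

/-- Contracting `x → y` and `z → w`, with `y ≠ w`, in the two possible orders. -/
theorem merge_merge_of_ne {k : ℕ} {x y z w : Fin k} (h : x ≠ y) (h' : z ≠ w) (hw : w ≠ y)
    (h1 : merge x y h z ≠ merge x y h w) (h2 : merge z w h' x ≠ merge z w h' y) (u : Fin k) :
    merge (merge z w h' x) (merge z w h' y) h2 (merge z w h' u) =
      merge (merge x y h z) (merge x y h w) h1 (merge x y h u) := by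
  have e1 : merge x y h w = unskip y w hw := by unfold merge; congr 1; simp [hw]
  have e2 : merge z w h' y = unskip w y hw.symm := by unfold merge; congr 1; simp [hw.symm]
  have hs : w = skip y (unskip y w hw) := (skip_unskip _ _ _).symm
  have key : ∀ i, skip w (skip (merge z w h' y) i) = skip y (skip (merge x y h w) i) := by
    intro i
    rw [e1, e2]
    have := skip_skip y (unskip y w hw) (by rw [← hs]; exact hw.symm) i
    simpa only [skip_unskip] using this
  have hne : ¬ (x = w ∧ z = y) := by
    rintro ⟨rfl, rfl⟩
    apply h1; apply skip_inj (y := z); simp [skip_merge]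
  have m1 : ∀ u, (merge x y h u = merge x y h w) ↔ ((if u = y then x else u) = w) := by
    intro u
    have a1 := skip_merge x y h u
    have a2 := skip_merge x y h w
    rw [if_neg hw] at a2
    constructor
    · intro e; rw [← a1, e, a2]
    · intro e; apply skip_inj (y := y); rw [a1, a2, e]
  have m2 : ∀ u, (merge z w h' u = merge z w h' y) ↔ ((if u = w then z else u) = y) := by
    intro u
    have a1 := skip_merge z w h' u
    have a2 := skip_merge z w h' y
    rw [if_neg hw.symm] at a2
    constructor
    · intro e; rw [← a1, e, a2]
    · intro e; apply skip_inj (y := w); rw [a1, a2, e]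
  apply skip_inj (y := merge z w h' y)
  apply skip_inj (y := w)
  have L : skip w (skip (merge z w h' y) (merge (merge z w h' x) (merge z w h' y) h2
      (merge z w h' u))) = if (if u = w then z else u) = y then (if x = w then z else x)
        else (if u = w then z else u) := by
    rw [skip_merge, apply_ite (skip w)]; simp only [skip_merge, m2]
  have R : skip y (skip (merge x y h w) (merge (merge x y h z) (merge x y h w) h1
      (merge x y h u))) = if (if u = y then x else u) = w then (if z = y then x else z)
        else (if u = y then x else u) := by
    rw [skip_merge, apply_ite (skip y)]; simp only [skip_merge, m1]
  rw [L, key, R]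
  clear L R key m1 m2 h1 h2 e1 e2 hs
  grind

/-- Contracting `x → y` and `z → y` in the two possible orders. -/
theorem merge_merge_of_eq {k : ℕ} {x y z : Fin k} (h : x ≠ y) (h' : z ≠ y)
    (h1 : merge x y h z ≠ merge x y h y) (h2 : merge z y h' x ≠ merge z y h' y) (u : Fin k) :
    merge (merge z y h' x) (merge z y h' y) h2 (merge z y h' u) =
      removePerm (Equiv.swap (merge x y h z) (merge x y h y)) (merge x y h y) (merge x y h z)
        (Equiv.swap_apply_right _ _)
        (merge (merge x y h z) (merge x y h y) h1 (merge x y h u)) := by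
  have e1 : merge z y h' x = merge x y h y := by
    apply skip_inj (y := y); simp [skip_merge, h]
  have e2 : merge z y h' y = merge x y h z := by
    apply skip_inj (y := y); simp [skip_merge, h']
  have hsk : ∀ t : Fin k, t ≠ y → merge z y h' t = merge x y h t := by
    intro t ht; apply skip_inj (y := y); simp [skip_merge, ht]
  rw [← merge_comm]
  by_cases hu : u = y
  · subst hu
    apply skip_inj (y := merge x u h z)
    simp only [e1, e2, skip_merge]
    simp
  · simp only [e1, e2, hsk u hu]

theorem exists_inl_of_map {α β γ : Type} {f : α → γ} {q : α ⊕ β} {c : γ}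
    (h : Sum.map f (id : β → β) q = Sum.inl c) : ∃ t, q = Sum.inl t ∧ f t = c := by
  rcases q with t | j
  · exact ⟨t, rfl, Sum.inl_injective h⟩
  · simp at h

/-- Two contractions in the opposite order give the same graph, up to renumbering, with the opposite
sign. -/
theorem exists_swap {Γ : Gr} (p : Γ.Inner) (q : (Γ.contract p).Inner) :
    ∃ (p' : Γ.Inner) (q' : (Γ.contract p').Inner) (θ : Equiv.Perm (Fin (Γ.v - 1 - 1))),
      p'.a = skip p.a q.a ∧ skip p'.a q'.a = p.a ∧
      (Γ.contract p').contract q' = ((Γ.contract p).contract q).relabel θ 1 1 ∧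
      ∀ N : ℤ, contractSign N p' * contractSign N q' *
        relSign N θ (1 : Equiv.Perm (Fin Γ.s)) (1 : Equiv.Perm (Fin (Γ.e - 1 - 1))) =
        - (contractSign N p * contractSign N q) := by
  obtain ⟨⟨a, x, y⟩, hx, hy, hxy⟩ := p
  obtain ⟨⟨b, X, Y⟩, hX, hY, hXY⟩ := q
  obtain ⟨z, hz, rfl⟩ := exists_inl_of_map hX
  obtain ⟨w, hw, rfl⟩ := exists_inl_of_map hY
  dsimp only at hx hy hxy
  change merge x y hxy z ≠ merge x y hxy w at hXY
  change Γ.src (skip a b) = _ at hz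
  change Γ.tgt (skip a b) = _ at hw
  have hzw : z ≠ w := fun h => hXY (by rw [h])
  have hab : a ≠ skip a b := (skip_ne a b).symm
  have h2 : merge z w hzw x ≠ merge z w hzw y := by
    intro h3
    have h4 := congrArg (skip w) h3
    rw [skip_merge, skip_merge] at h4
    apply hXY
    apply skip_inj (y := y)
    rw [skip_merge, skip_merge]
    clear hXY h3
    have aux : ∀ {k : ℕ} (x y z w : Fin k), x ≠ y → z ≠ w →
        ((if x = w then z else x) = if y = w then z else y) →
        (if z = y then x else z) = if w = y then x else w := by
      intro k x y z w h1 h2 h3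
      grind
    exact aux x y z w hxy hzw h4
  let p' : Γ.Inner := ⟨(skip a b, z, w), hz, hw, hzw⟩
  have hsa : skip (skip a b) (unskip (skip a b) a hab) = a := skip_unskip _ _ _
  have hq1 : (Γ.contract p').src (unskip (skip a b) a hab) = Sum.inl (merge z w hzw x) :=
    (congrArg (fun c => Sum.map (merge z w hzw) id (Γ.src c)) hsa).trans
      (congrArg (Sum.map (merge z w hzw) id) hx)
  have hq2 : (Γ.contract p').tgt (unskip (skip a b) a hab) = Sum.inl (merge z w hzw y) :=
    (congrArg (fun c => Sum.map (merge z w hzw) id (Γ.tgt c)) hsa).trans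
      (congrArg (Sum.map (merge z w hzw) id) hy)
  let q' : (Γ.contract p').Inner :=
    ⟨(unskip (skip a b) a hab, merge z w hzw x, merge z w hzw y), hq1, hq2, h2⟩
  by_cases hwy : w = y
  · subst hwy
    refine ⟨p', q', removePerm (Equiv.swap (merge x w hxy z) (merge x w hxy w)) (merge x w hxy w)
      (merge x w hxy z) (Equiv.swap_apply_right _ _), rfl, hsa, ?_, ?_⟩
    · have key : ∀ t : Fin Γ.v ⊕ Fin Γ.s,
          Sum.map (merge (merge z w hzw x) (merge z w hzw w) h2) id
            (Sum.map (merge z w hzw) id t) =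
          Sum.map (removePerm (Equiv.swap (merge x w hxy z) (merge x w hxy w)) (merge x w hxy w)
            (merge x w hxy z) (Equiv.swap_apply_right _ _)) (1 : Equiv.Perm (Fin Γ.s))
            (Sum.map (merge (merge x w hxy z) (merge x w hxy w) hXY) id
              (Sum.map (merge x w hxy) id t)) := by
        rintro (u | j)
        · exact congrArg Sum.inl (merge_merge_of_eq hxy hzw hXY h2 u)
        · rfl
      apply mk_congr
      · intro i
        exact (congrArg (fun c => Sum.map (merge (merge z w hzw x) (merge z w hzw w) h2) id
          (Sum.map (merge z w hzw) id (Γ.src c))) (skip_skip a b hab i)).trans (key _)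
      · intro i
        exact (congrArg (fun c => Sum.map (merge (merge z w hzw x) (merge z w hzw w) h2) id
          (Sum.map (merge z w hzw) id (Γ.tgt c))) (skip_skip a b hab i)).trans (key _)
    · intro N
      unfold contractSign relSign
      rw [sign_removePerm, Equiv.Perm.sign_swap hXY]
      split_ifs
      · have := sign_skip a b hab
        simpa [Inner.a, p', q'] using this
      · have e2 : merge z w hzw w = merge x w hxy z := by
          apply skip_inj (y := w); simp [skip_merge, hzw]
        have e : ∀ (r s t : ℤˣ), r * s * (-1 * (t * s) * 1) = -(r * t) := by decide
        have := e ((-1) ^ w.1) ((-1) ^ (merge x w hxy z).1) ((-1) ^ (merge x w hxy w).1)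
        change (-1) ^ w.1 * (-1) ^ (merge z w hzw w).1 * _ =
          -((-1) ^ w.1 * (-1) ^ (merge x w hxy w).1)
        rw [e2, Equiv.Perm.sign_one]
        exact this
  · refine ⟨p', q', 1, rfl, hsa, ?_, ?_⟩
    · have key : ∀ t : Fin Γ.v ⊕ Fin Γ.s,
          Sum.map (merge (merge z w hzw x) (merge z w hzw y) h2) id
            (Sum.map (merge z w hzw) id t) =
          Sum.map (1 : Equiv.Perm (Fin (Γ.v - 1 - 1))) (1 : Equiv.Perm (Fin Γ.s))
            (Sum.map (merge (merge x y hxy z) (merge x y hxy w) hXY) id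
              (Sum.map (merge x y hxy) id t)) := by
        rintro (u | j)
        · exact congrArg Sum.inl (merge_merge_of_ne hxy hzw hwy hXY h2 u)
        · rfl
      apply mk_congr
      · intro i
        exact (congrArg (fun c => Sum.map (merge (merge z w hzw x) (merge z w hzw y) h2) id
          (Sum.map (merge z w hzw) id (Γ.src c))) (skip_skip a b hab i)).trans (key _)
      · intro i
        exact (congrArg (fun c => Sum.map (merge (merge z w hzw x) (merge z w hzw y) h2) id
          (Sum.map (merge z w hzw) id (Γ.tgt c))) (skip_skip a b hab i)).trans (key _)
    · intro N
      unfold contractSign relSign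
      split_ifs
      · have := sign_skip a b hab
        simpa [Inner.a, p', q'] using this
      · have hyw : y ≠ skip y (unskip y w hwy) := (skip_ne _ _).symm
        have := sign_skip y (unskip y w hwy) hyw
        have e1 : merge x y hxy w = unskip y w hwy := by unfold merge; congr 1; simp [hwy]
        have e2 : merge z w hzw y = unskip w y (Ne.symm hwy) := by
          unfold merge; congr 1; simp [Ne.symm hwy]
        simp only [skip_unskip] at this
        change (-1) ^ w.1 * (-1) ^ (merge z w hzw y).1 * _ =
          -((-1) ^ y.1 * (-1) ^ (merge x y hxy w).1)
        rw [e1, e2, Equiv.Perm.sign_one, Equiv.Perm.sign_one, mul_one, mul_one]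
        exact this

end Gr

/-! ### Graph complexes

The hairy graph complex and the fixed target oriented graph complex are built by the same
procedure. The data are the parity parameter `N`, whether the directions of edges are forgotten up
to sign, the admissible graphs, and a number `targets` that the differential is required to
preserve. -/

/-- A class of graphs for which the contraction of edges defines a complex. -/
structure GraphKind where
  /-- the parameter that determines degrees and signs -/
  N : ℤ
  /-- whether edge directions are identified up to sign -/
  flips : Prop
  /-- the admissible graphs -/
  adm : Gr → Prop
  /-- the number preserved by the differential -/
  targets : Gr → ℕ
  adm_relabel : ∀ (Γ : Gr) (σ : Equiv.Perm (Fin Γ.v)) (ρ : Equiv.Perm (Fin Γ.s))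
    (π : Equiv.Perm (Fin Γ.e)), adm Γ → adm (Γ.relabel σ ρ π)
  targets_relabel : ∀ (Γ : Gr) (σ : Equiv.Perm (Fin Γ.v)) (ρ : Equiv.Perm (Fin Γ.s))
    (π : Equiv.Perm (Fin Γ.e)), targets (Γ.relabel σ ρ π) = targets Γ
  adm_flip : ∀ (Γ : Gr) (c : Fin Γ.e), flips → adm Γ → adm (Γ.flip c)
  targets_flip : ∀ (Γ : Gr) (c : Fin Γ.e), flips → targets (Γ.flip c) = targets Γ
  contract_mid : ∀ (Γ : Gr) (p : Γ.Inner) (q : (Γ.contract p).Inner), adm Γ →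
    adm ((Γ.contract p).contract q) → targets ((Γ.contract p).contract q) = targets Γ →
    adm (Γ.contract p) ∧ targets (Γ.contract p) = targets Γ

namespace GraphKind

variable (𝒢 : GraphKind) (K : Type*) [Field K]

/-- `𝒢.Rel Γ Γ' ε`: the numbered graph `Γ'` arises from `Γ` by a renumbering or, where this is
allowed, by reversing an edge, and is identified with `ε` times `Γ`. -/
inductive Rel : Gr → Gr → ℤˣ → Prop
  | relabel (Γ : Gr) (σ : Equiv.Perm (Fin Γ.v)) (ρ : Equiv.Perm (Fin Γ.s))
      (π : Equiv.Perm (Fin Γ.e)) : Rel Γ (Γ.relabel σ ρ π) (Gr.relSign 𝒢.N σ ρ π)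
  | flip (Γ : Gr) (c : Fin Γ.e) (h : 𝒢.flips) : Rel Γ (Γ.flip c) (Gr.flipSign 𝒢.N)

/-- The admissible numbered graphs of degree `D`. -/
abbrev Gens (D : ℤ) : Type := {Γ : Gr // 𝒢.adm Γ ∧ Γ.degree 𝒢.N = D}

/-- The relations between numbered graphs that define the coinvariants. -/
noncomputable def relations (D : ℤ) : Submodule K (𝒢.Gens D →₀ K) :=
  Submodule.span K {z | ∃ (Γ Γ' : 𝒢.Gens D) (ε : ℤˣ), 𝒢.Rel Γ.1 Γ'.1 ε ∧
    z = Finsupp.single Γ' 1 - Finsupp.single Γ (((ε : ℤ) : K))}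

/-- The degree `D` part of the graph complex: linear combinations of admissible numbered graphs,
modulo the (signed) action of the renumbering group. -/
abbrev Space (D : ℤ) : Type _ := (𝒢.Gens D →₀ K) ⧸ 𝒢.relations K D

open Classical in
/-- The class of a graph in degree `D`; zero if the graph is not admissible of degree `D`. -/
noncomputable def cls (D : ℤ) (Γ : Gr) : 𝒢.Space K D :=
  if h : 𝒢.adm Γ ∧ Γ.degree 𝒢.N = D then
    (𝒢.relations K D).mkQ (Finsupp.single (⟨Γ, h⟩ : 𝒢.Gens D) 1)
  else 0

/-- The signed sum of all contractions `Γ/a` which do not change the number `targets`.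
Contractions that are not admissible are considered to be zero. -/
noncomputable def contractions (D : ℤ) (Γ : Gr) : 𝒢.Space K (D + 1) :=
  ∑ p : Γ.Inner, if 𝒢.targets (Γ.contract p) = 𝒢.targets Γ then
    Gr.contractSign 𝒢.N p • 𝒢.cls K (D + 1) (Γ.contract p) else 0

variable {𝒢}

theorem adm_relabel_iff (Γ : Gr) (σ : Equiv.Perm (Fin Γ.v)) (ρ : Equiv.Perm (Fin Γ.s))
    (π : Equiv.Perm (Fin Γ.e)) : 𝒢.adm (Γ.relabel σ ρ π) ↔ 𝒢.adm Γ := by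
  refine ⟨fun h => ?_, 𝒢.adm_relabel Γ σ ρ π⟩
  have := 𝒢.adm_relabel (Γ.relabel σ ρ π) σ.symm ρ.symm π.symm h
  convert this using 1
  apply Gr.mk_congr <;> intro b
  · change _ = Sum.map σ.symm ρ.symm (Sum.map σ ρ (Γ.src (π.symm (π.symm.symm b))))
    simp [Sum.map_map]
  · change _ = Sum.map σ.symm ρ.symm (Sum.map σ ρ (Γ.tgt (π.symm (π.symm.symm b))))
    simp [Sum.map_map]

theorem adm_flip_iff (Γ : Gr) (c : Fin Γ.e) (hf : 𝒢.flips) : 𝒢.adm (Γ.flip c) ↔ 𝒢.adm Γ := by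
  refine ⟨fun h => ?_, 𝒢.adm_flip Γ c hf⟩
  have := 𝒢.adm_flip (Γ.flip c) c hf h
  convert this using 1
  apply Gr.mk_congr <;> intro b
  · change Γ.src b = if b = c then (if b = c then Γ.src b else Γ.tgt b) else
      (if b = c then Γ.tgt b else Γ.src b)
    split_ifs <;> rfl
  · change Γ.tgt b = if b = c then (if b = c then Γ.tgt b else Γ.src b) else
      (if b = c then Γ.src b else Γ.tgt b)
    split_ifs <;> rfl

theorem cls_of_rel (D : ℤ) {Γ Γ' : Gr} {ε : ℤˣ} (h : 𝒢.Rel Γ Γ' ε) :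
    𝒢.cls K D Γ' = ε • 𝒢.cls K D Γ := by
  have h1 : (𝒢.adm Γ' ∧ Γ'.degree 𝒢.N = D) ↔ (𝒢.adm Γ ∧ Γ.degree 𝒢.N = D) := by
    cases h with
    | relabel σ ρ π => exact and_congr (adm_relabel_iff Γ σ ρ π) Iff.rfl
    | flip c hf => exact and_congr (adm_flip_iff Γ c hf) Iff.rfl
  unfold cls
  by_cases h2 : 𝒢.adm Γ ∧ Γ.degree 𝒢.N = D
  · rw [dif_pos h2, dif_pos (h1.2 h2), Units.smul_def, ← map_zsmul, ← sub_eq_zero, ← map_sub,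
      Submodule.mkQ_apply, Submodule.Quotient.mk_eq_zero]
    refine Submodule.subset_span ⟨⟨Γ, h2⟩, ⟨Γ', h1.2 h2⟩, ε, h, ?_⟩
    rw [Finsupp.smul_single, zsmul_eq_mul, mul_one]
  · rw [dif_neg h2, dif_neg (mt h1.1 h2), smul_zero]

theorem targets_of_rel {Γ Γ' : Gr} {ε : ℤˣ} (h : 𝒢.Rel Γ Γ' ε) : 𝒢.targets Γ' = 𝒢.targets Γ := by
  cases h with
  | relabel σ ρ π => exact 𝒢.targets_relabel Γ σ ρ π
  | flip c hf => exact 𝒢.targets_flip Γ c hf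

theorem term_of_rel (D : ℤ) {Γ Γ' : Gr} {ε' s s' ε : ℤˣ} (h : 𝒢.Rel Γ Γ' ε') (hs : s' * ε' = ε * s)
    {t t' : ℕ} (ht : t' = t) :
    (ε • if 𝒢.targets Γ = t then s • 𝒢.cls K D Γ else 0) =
      if 𝒢.targets Γ' = t' then s' • 𝒢.cls K D Γ' else 0 := by
  rw [targets_of_rel h, cls_of_rel K D h, ht, smul_ite, smul_zero, smul_smul, smul_smul, hs]

theorem contractions_of_rel (D : ℤ) {Γ Γ' : Gr} {ε : ℤˣ} (h : 𝒢.Rel Γ Γ' ε) :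
    𝒢.contractions K D Γ' = ε • 𝒢.contractions K D Γ := by
  unfold contractions
  rw [Finset.smul_sum]
  symm
  cases h with
  | relabel σ ρ π =>
    refine Fintype.sum_bijective (fun p => p.relabel σ ρ π) ⟨?_, ?_⟩ _ _ ?_
    · intro p q hpq
      exact Gr.Inner.ext (π.injective (congrArg Gr.Inner.a hpq))
    · rintro ⟨⟨a, x, y⟩, hx, hy, hxy⟩
      obtain ⟨x', hx', rfl⟩ : ∃ t, Γ.src (π.symm a) = Sum.inl t ∧ σ t = x := by
        change Sum.map σ ρ (Γ.src (π.symm a)) = Sum.inl x at hx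
        rcases h : Γ.src (π.symm a) with t | t <;> rw [h] at hx
        · exact ⟨t, rfl, Sum.inl_injective hx⟩
        · simp at hx
      obtain ⟨y', hy', rfl⟩ : ∃ t, Γ.tgt (π.symm a) = Sum.inl t ∧ σ t = y := by
        change Sum.map σ ρ (Γ.tgt (π.symm a)) = Sum.inl y at hy
        rcases h : Γ.tgt (π.symm a) with t | t <;> rw [h] at hy
        · exact ⟨t, rfl, Sum.inl_injective hy⟩
        · simp at hy
      refine ⟨⟨(π.symm a, x', y'), hx', hy', fun h => hxy (congrArg σ h)⟩, Gr.Inner.ext ?_⟩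
      exact π.apply_symm_apply a
    · intro p
      refine term_of_rel K (D + 1) ?_ (Gr.contractSign_relabel 𝒢.N p σ ρ π)
        (𝒢.targets_relabel Γ σ ρ π)
      rw [Gr.contract_relabel]
      exact Rel.relabel (Γ.contract p) _ ρ _
  | flip c hf =>
    refine Fintype.sum_bijective (fun p => p.flip c) ⟨?_, ?_⟩ _ _ ?_
    · intro p q hpq
      have := congrArg Gr.Inner.a hpq
      simp only [Gr.Inner.flip_a] at this
      exact Gr.Inner.ext this
    · rintro ⟨⟨a, x, y⟩, hx, hy, hxy⟩
      by_cases hac : a = c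
      · have hx' : Γ.tgt a = Sum.inl x := (if_pos hac).symm.trans hx
        have hy' : Γ.src a = Sum.inl y := (if_pos hac).symm.trans hy
        exact ⟨⟨(a, y, x), hy', hx', hxy.symm⟩, Gr.Inner.ext (Gr.Inner.flip_a _ _)⟩
      · have hx' : Γ.src a = Sum.inl x := (if_neg hac).symm.trans hx
        have hy' : Γ.tgt a = Sum.inl y := (if_neg hac).symm.trans hy
        exact ⟨⟨(a, x, y), hx', hy', hxy⟩, Gr.Inner.ext (Gr.Inner.flip_a _ _)⟩
    · intro p
      by_cases hpc : p.a = c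
      · subst hpc
        refine term_of_rel K (D + 1) ?_ (Gr.contractSign_flip_self 𝒢.N p) (𝒢.targets_flip Γ _ hf)
        rw [Gr.contract_flip_self]
        exact Rel.relabel (Γ.contract p) _ 1 1
      · refine term_of_rel K (D + 1) (ε' := Gr.flipSign 𝒢.N) ?_ ?_ (𝒢.targets_flip Γ _ hf)
        · rw [Gr.contract_flip_of_ne p c hpc]
          exact Rel.flip (Γ.contract p) _ hf
        · rw [Gr.contractSign_flip_of_ne 𝒢.N p c hpc, mul_comm]

theorem relations_le (D : ℤ) : 𝒢.relations K D ≤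
    LinearMap.ker (Finsupp.linearCombination K fun Γ : 𝒢.Gens D => 𝒢.contractions K D Γ.1) := by
  refine Submodule.span_le.2 ?_
  rintro _ ⟨Γ, Γ', ε, h, rfl⟩
  simp only [SetLike.mem_coe, LinearMap.mem_ker, map_sub, Finsupp.linearCombination_single,
    one_smul]
  rw [contractions_of_rel K D h, Units.smul_def, Int.cast_smul_eq_zsmul, sub_self]

variable (𝒢)

/-- The differential `d Γ = ∑ ± Γ/a`. -/
noncomputable def d (D : ℤ) : 𝒢.Space K D →ₗ[K] 𝒢.Space K (D + 1) :=
  (𝒢.relations K D).liftQ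
    (Finsupp.linearCombination K fun Γ : 𝒢.Gens D => 𝒢.contractions K D Γ.1) (relations_le K D)

variable {𝒢}

theorem d_cls {D : ℤ} {Γ : Gr} (h : 𝒢.adm Γ) (hD : Γ.degree 𝒢.N = D) :
    𝒢.d K D (𝒢.cls K D Γ) = 𝒢.contractions K D Γ := by
  unfold cls d
  rw [dif_pos ⟨h, hD⟩, Submodule.mkQ_apply, Submodule.liftQ_apply,
    Finsupp.linearCombination_single, one_smul]

theorem cls_of_not {D : ℤ} {Γ : Gr} (h : ¬ 𝒢.adm Γ) : 𝒢.cls K D Γ = 0 :=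
  dif_neg fun h' => h h'.1

theorem d_d_cls {D : ℤ} {Γ : Gr} (h : 𝒢.adm Γ) (hD : Γ.degree 𝒢.N = D) :
    𝒢.d K (D + 1) (𝒢.d K D (𝒢.cls K D Γ)) = 0 := by
  classical
  rw [d_cls K h hD]
  unfold contractions
  rw [map_sum]
  have step : ∀ p : Γ.Inner, 𝒢.d K (D + 1) (if 𝒢.targets (Γ.contract p) = 𝒢.targets Γ then
      Gr.contractSign 𝒢.N p • 𝒢.cls K (D + 1) (Γ.contract p) else 0) =
      ∑ q : (Γ.contract p).Inner,
        if 𝒢.targets ((Γ.contract p).contract q) = 𝒢.targets Γ then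
          (Gr.contractSign 𝒢.N p * Gr.contractSign 𝒢.N q) •
            𝒢.cls K (D + 1 + 1) ((Γ.contract p).contract q) else 0 := by
    intro p
    by_cases hp : 𝒢.adm (Γ.contract p) ∧ 𝒢.targets (Γ.contract p) = 𝒢.targets Γ
    · rw [if_pos hp.2, Units.smul_def, map_zsmul, ← Units.smul_def,
        d_cls K hp.1 (by rw [Gr.degree_contract, hD])]
      unfold contractions
      rw [Finset.smul_sum]
      refine Finset.sum_congr rfl fun q _ => ?_
      rw [hp.2, smul_ite, smul_zero, smul_smul]
    · have h0 : (if 𝒢.targets (Γ.contract p) = 𝒢.targets Γ then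
          Gr.contractSign 𝒢.N p • 𝒢.cls K (D + 1) (Γ.contract p) else 0) = 0 := by
        split_ifs with h1
        · rw [cls_of_not K (fun h2 => hp ⟨h2, h1⟩), smul_zero]
        · rfl
      rw [h0, map_zero]
      symm
      refine Finset.sum_eq_zero fun q _ => ?_
      split_ifs with h1
      · rw [cls_of_not K (fun h2 => hp (𝒢.contract_mid Γ p q h h2 h1)), smul_zero]
      · rfl
  rw [Finset.sum_congr rfl fun p _ => step p, Finset.sum_sigma']
  choose P Q θ h1 h2 h3 h4 using fun (p : Γ.Inner) (q : (Γ.contract p).Inner) =>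
    Gr.exists_swap p q
  have hne : ∀ (p : Γ.Inner) (q : (Γ.contract p).Inner), P p q ≠ p := by
    intro p q hpq
    have := h1 p q
    rw [hpq] at this
    exact Gr.skip_ne _ _ this.symm
  refine Finset.sum_involution (fun x _ => ⟨P x.1 x.2, Q x.1 x.2⟩) ?_ ?_ ?_ ?_
  · rintro ⟨p, q⟩ -
    have hrel : 𝒢.Rel ((Γ.contract p).contract q) ((Γ.contract (P p q)).contract (Q p q))
        (Gr.relSign 𝒢.N (θ p q) (1 : Equiv.Perm (Fin Γ.s))
          (1 : Equiv.Perm (Fin (Γ.e - 1 - 1)))) := by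
      rw [h3]
      exact Rel.relabel ((Γ.contract p).contract q) (θ p q) 1 1
    have := term_of_rel K (D + 1 + 1) hrel (ε := -1) ((h4 p q 𝒢.N).trans (neg_one_mul _).symm)
      (rfl : 𝒢.targets Γ = _)
    dsimp only
    rw [← this]
    have e : ∀ z : 𝒢.Space K (D + 1 + 1), z + (-1 : ℤˣ) • z = 0 := by
      intro z; rw [Units.smul_def]; simp
    exact e _
  · rintro ⟨p, q⟩ - - hpq
    exact hne p q (congrArg Sigma.fst hpq)
  · intro _ _; exact Finset.mem_univ _
  · rintro ⟨p, q⟩ -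
    have e1 : P (P p q) (Q p q) = p := Gr.Inner.ext ((h1 _ _).trans (h2 p q))
    have aux : ∀ (p' : Γ.Inner) (q' : (Γ.contract p').Inner), p' = p →
        Gr.skip p'.a q'.a = Gr.skip p.a q.a →
        (⟨p', q'⟩ : Σ p : Γ.Inner, (Γ.contract p).Inner) = ⟨p, q⟩ := by
      rintro p' q' rfl h
      rw [Gr.Inner.ext (Gr.skip_inj h)]
    exact aux _ _ e1 ((h2 _ _).trans (h1 p q))

theorem d_comp_d (D : ℤ) : 𝒢.d K (D + 1) ∘ₗ 𝒢.d K D = 0 := by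
  refine Submodule.linearMap_qext _ (Finsupp.lhom_ext' fun Γ => LinearMap.ext_ring ?_)
  have := d_d_cls K Γ.2.1 Γ.2.2
  unfold cls at this
  rw [dif_pos Γ.2] at this
  exact this

variable (𝒢)

/-- The graph complex. -/
noncomputable def complex : CochainComplex (ModuleCat K) ℤ :=
  CochainComplex.of (fun D => ModuleCat.of K (𝒢.Space K D)) (fun D => ModuleCat.ofHom (𝒢.d K D))
    (fun D => by rw [← ModuleCat.ofHom_comp, d_comp_d]; rfl)

end GraphKind

/-! ### Admissible graphs -/

namespace Gr

/-- There is an edge from `p` to `q`. -/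
def Arrow (Γ : Gr) (p q : Fin Γ.v ⊕ Fin Γ.s) : Prop := ∃ b, Γ.src b = p ∧ Γ.tgt b = q

/-- The number of edges with source `q`. -/
def outDeg (Γ : Gr) (q : Fin Γ.v ⊕ Fin Γ.s) : ℕ := (Finset.univ.filter fun b => Γ.src b = q).card

/-- The number of edges with target `q`. -/
def inDeg (Γ : Gr) (q : Fin Γ.v ⊕ Fin Γ.s) : ℕ := (Finset.univ.filter fun b => Γ.tgt b = q).card

/-- Any two (internal or external) vertices are joined by an undirected path. -/
def Connected (Γ : Gr) : Prop := ∀ p q, Relation.EqvGen Γ.Arrow p q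

/-- There is no directed cycle. -/
def Acyclic (Γ : Gr) : Prop := ∀ p, ¬ Relation.TransGen Γ.Arrow p p

/-- The number of targets (sinks), i.e. of internal vertices without outgoing edges. -/
def sinks (Γ : Gr) : ℕ := (Finset.univ.filter fun w : Fin Γ.v => Γ.outDeg (Sum.inl w) = 0).card

/-- The graphs that span the hairy graph complex: connected graphs with at least one internal and at
least one external vertex, internal vertices being at least 3-valent and external ones 1-valent. -/
structure IsHairy (Γ : Gr) : Prop where
  v_pos : 0 < Γ.v
  s_pos : 0 < Γ.s
  connected : Γ.Connected
  internal : ∀ w : Fin Γ.v, 3 ≤ Γ.outDeg (Sum.inl w) + Γ.inDeg (Sum.inl w)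
  external : ∀ j : Fin Γ.s, Γ.outDeg (Sum.inr j) + Γ.inDeg (Sum.inr j) = 1

/-- The graphs that span the oriented graph complex: connected non-empty directed acyclic graphs
without external vertices, all vertices being at least 2-valent, and without passing vertices
(vertices with exactly one incoming and exactly one outgoing edge). -/
structure IsOriented (Γ : Gr) : Prop where
  no_ext : Γ.s = 0
  v_pos : 0 < Γ.v
  connected : Γ.Connected
  two_le : ∀ w : Fin Γ.v, 2 ≤ Γ.outDeg (Sum.inl w) + Γ.inDeg (Sum.inl w)
  no_passing : ∀ w : Fin Γ.v, ¬ (Γ.inDeg (Sum.inl w) = 1 ∧ Γ.outDeg (Sum.inl w) = 1)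
  acyclic : Γ.Acyclic

theorem Connected.of_map {Γ Γ' : Gr} (f : Fin Γ.v ⊕ Fin Γ.s → Fin Γ'.v ⊕ Fin Γ'.s)
    (hf : Function.Surjective f)
    (h : ∀ p q, Γ.Arrow p q → Relation.EqvGen Γ'.Arrow (f p) (f q)) (hc : Γ.Connected) :
    Γ'.Connected := by
  intro p q
  obtain ⟨p, rfl⟩ := hf p
  obtain ⟨q, rfl⟩ := hf q
  induction hc p q with
  | rel _ _ h' => exact h _ _ h'
  | refl _ => exact .refl _
  | symm _ _ _ ih => exact .symm _ _ ih
  | trans _ _ _ _ _ ih1 ih2 => exact .trans _ _ _ ih1 ih2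

theorem outDeg_eq (Γ : Gr) (q : Fin Γ.v ⊕ Fin Γ.s) :
    Γ.outDeg q = ∑ b, if Γ.src b = q then 1 else 0 := Finset.card_filter _ _

theorem inDeg_eq (Γ : Gr) (q : Fin Γ.v ⊕ Fin Γ.s) :
    Γ.inDeg q = ∑ b, if Γ.tgt b = q then 1 else 0 := Finset.card_filter _ _

theorem sinks_eq (Γ : Gr) :
    Γ.sinks = ∑ w : Fin Γ.v, if Γ.outDeg (Sum.inl w) = 0 then 1 else 0 := Finset.card_filter _ _

/-! Renumbering and reversal of edges. -/

section

variable (Γ : Gr) (σ : Equiv.Perm (Fin Γ.v)) (ρ : Equiv.Perm (Fin Γ.s)) (π : Equiv.Perm (Fin Γ.e))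

theorem map_perm_inj {p q : Fin Γ.v ⊕ Fin Γ.s} : Sum.map σ ρ p = Sum.map σ ρ q ↔ p = q :=
  ((σ.injective.sumMap ρ.injective).eq_iff)

theorem outDeg_relabel (q : Fin Γ.v ⊕ Fin Γ.s) :
    (Γ.relabel σ ρ π).outDeg (Sum.map σ ρ q) = Γ.outDeg q := by
  rw [outDeg_eq, outDeg_eq]
  exact Fintype.sum_equiv π.symm _ _ fun b => if_congr (map_perm_inj Γ σ ρ) rfl rfl

theorem inDeg_relabel (q : Fin Γ.v ⊕ Fin Γ.s) :
    (Γ.relabel σ ρ π).inDeg (Sum.map σ ρ q) = Γ.inDeg q := by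
  rw [inDeg_eq, inDeg_eq]
  exact Fintype.sum_equiv π.symm _ _ fun b => if_congr (map_perm_inj Γ σ ρ) rfl rfl

theorem sinks_relabel : (Γ.relabel σ ρ π).sinks = Γ.sinks := by
  rw [sinks_eq, sinks_eq]
  symm
  refine Fintype.sum_equiv σ _ _ fun w => ?_
  rw [← outDeg_relabel Γ σ ρ π]
  rfl

theorem arrow_relabel {p q : Fin Γ.v ⊕ Fin Γ.s} (h : Γ.Arrow p q) :
    (Γ.relabel σ ρ π).Arrow (Sum.map σ ρ p) (Sum.map σ ρ q) := by
  obtain ⟨b, rfl, rfl⟩ := h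
  refine ⟨π b, ?_, ?_⟩
  · exact congrArg (fun c => Sum.map σ ρ (Γ.src c)) (π.symm_apply_apply b)
  · exact congrArg (fun c => Sum.map σ ρ (Γ.tgt c)) (π.symm_apply_apply b)

theorem Connected.relabel (h : Γ.Connected) : (Γ.relabel σ ρ π).Connected :=
  h.of_map (Γ' := Γ.relabel σ ρ π) (Sum.map σ ρ) (σ.surjective.sumMap ρ.surjective)
    fun _ _ h' => .rel _ _ (arrow_relabel Γ σ ρ π h')

theorem Acyclic.relabel (h : Γ.Acyclic) : (Γ.relabel σ ρ π).Acyclic := by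
  intro p hp
  refine h (Sum.map σ.symm ρ.symm p) (Relation.TransGen.lift
    (p := Γ.Arrow) (Sum.map σ.symm ρ.symm) ?_ p p hp)
  rintro _ _ ⟨b, rfl, rfl⟩
  refine ⟨π.symm b, ?_, ?_⟩
  · change _ = Sum.map σ.symm ρ.symm (Sum.map σ ρ (Γ.src (π.symm b)))
    simp [Sum.map_map]
  · change _ = Sum.map σ.symm ρ.symm (Sum.map σ ρ (Γ.tgt (π.symm b)))
    simp [Sum.map_map]

theorem IsHairy.relabel (h : Γ.IsHairy) : (Γ.relabel σ ρ π).IsHairy where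
  v_pos := h.v_pos
  s_pos := h.s_pos
  connected := Connected.relabel Γ σ ρ π h.connected
  internal w := by
    obtain ⟨w, rfl⟩ := σ.surjective w
    have h1 := outDeg_relabel Γ σ ρ π (Sum.inl w)
    have h2 := inDeg_relabel Γ σ ρ π (Sum.inl w)
    exact (h.internal w).trans (congrArg₂ (· + ·) h1 h2).ge
  external j := by
    obtain ⟨j, rfl⟩ := ρ.surjective j
    have h1 := outDeg_relabel Γ σ ρ π (Sum.inr j)
    have h2 := inDeg_relabel Γ σ ρ π (Sum.inr j)
    exact (congrArg₂ (· + ·) h1 h2).trans (h.external j)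

theorem IsOriented.relabel (h : Γ.IsOriented) : (Γ.relabel σ ρ π).IsOriented where
  no_ext := h.no_ext
  v_pos := h.v_pos
  connected := Connected.relabel Γ σ ρ π h.connected
  two_le w := by
    obtain ⟨w, rfl⟩ := σ.surjective w
    have h1 := outDeg_relabel Γ σ ρ π (Sum.inl w)
    have h2 := inDeg_relabel Γ σ ρ π (Sum.inl w)
    exact (h.two_le w).trans (congrArg₂ (· + ·) h1 h2).ge
  no_passing w := by
    obtain ⟨w, rfl⟩ := σ.surjective w
    have h1 := outDeg_relabel Γ σ ρ π (Sum.inl w)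
    have h2 := inDeg_relabel Γ σ ρ π (Sum.inl w)
    exact fun h' => h.no_passing w ⟨h2.symm.trans h'.1, h1.symm.trans h'.2⟩
  acyclic := Acyclic.relabel Γ σ ρ π h.acyclic

theorem deg_flip (c : Fin Γ.e) (q : Fin Γ.v ⊕ Fin Γ.s) :
    (Γ.flip c).outDeg q + (Γ.flip c).inDeg q = Γ.outDeg q + Γ.inDeg q := by
  rw [outDeg_eq Γ, inDeg_eq Γ]
  refine (congrArg₂ (· + ·) (outDeg_eq (Γ.flip c) q) (inDeg_eq (Γ.flip c) q)).trans ?_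
  refine Finset.sum_add_distrib.symm.trans (Eq.trans ?_ Finset.sum_add_distrib)
  refine Finset.sum_congr rfl fun b _ => ?_
  by_cases h : b = c
  · have h1 : (Γ.flip c).src b = Γ.tgt b := if_pos h
    have h2 : (Γ.flip c).tgt b = Γ.src b := if_pos h
    exact (congrArg₂ (fun t u : Fin Γ.v ⊕ Fin Γ.s => (if t = q then 1 else 0) + if u = q then 1 else 0)
      h1 h2).trans (add_comm _ _)
  · have h1 : (Γ.flip c).src b = Γ.src b := if_neg h
    have h2 : (Γ.flip c).tgt b = Γ.tgt b := if_neg h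
    exact congrArg₂ (fun t u : Fin Γ.v ⊕ Fin Γ.s => (if t = q then 1 else 0) + if u = q then 1 else 0)
      h1 h2

theorem IsHairy.flip (c : Fin Γ.e) (h : Γ.IsHairy) : (Γ.flip c).IsHairy where
  v_pos := h.v_pos
  s_pos := h.s_pos
  connected := by
    refine Connected.of_map (Γ := Γ) (Γ' := Γ.flip c) id Function.surjective_id ?_ h.connected
    rintro _ _ ⟨b, rfl, rfl⟩
    by_cases hb : b = c
    · have h1 : (Γ.flip c).src b = Γ.tgt b := if_pos hb
      have h2 : (Γ.flip c).tgt b = Γ.src b := if_pos hb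
      exact .symm _ _ (.rel _ _ ⟨b, h1, h2⟩)
    · have h1 : (Γ.flip c).src b = Γ.src b := if_neg hb
      have h2 : (Γ.flip c).tgt b = Γ.tgt b := if_neg hb
      exact .rel _ _ ⟨b, h1, h2⟩
  internal w := (h.internal w).trans (deg_flip Γ c _).ge
  external j := (deg_flip Γ c _).trans (h.external j)

end

/-! Contraction of edges. -/

theorem sum_skip {k : ℕ} (a : Fin k) (g : Fin k → ℕ) :
    ∑ b, g b = g a + ∑ i : Fin (k - 1), g (skip a i) := by
  obtain _ | m := k
  · exact a.elim0
  rw [Fin.sum_univ_succAbove g a]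
  congr 1
  refine Finset.sum_congr rfl fun i _ => ?_
  congr 1
  ext; simp only [skip, Fin.succAbove, Fin.lt_def, Fin.val_castSucc]
  split_ifs <;> simp

section

variable {Γ : Gr} (p : Γ.Inner)

/-- The vertex obtained by merging the ends of `p`. -/
def Inner.z : Fin (Γ.v - 1) := merge p.x p.y p.ne p.x

theorem Inner.skip_z : skip p.y p.z = p.x := by
  unfold Inner.z; rw [skip_merge, if_neg p.ne]

theorem map_merge_eq_inl (q : Fin Γ.v ⊕ Fin Γ.s) (u : Fin (Γ.v - 1)) :
    Sum.map (merge p.x p.y p.ne) id q = Sum.inl u ↔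
      q = Sum.inl (skip p.y u) ∨ (q = Sum.inl p.y ∧ u = p.z) := by
  rcases q with w | j
  · have h1 : merge p.x p.y p.ne w = u ↔ (if w = p.y then p.x else w) = skip p.y u := by
      rw [← skip_merge p.x p.y p.ne w]
      exact ⟨fun h => by rw [h], fun h => skip_inj h⟩
    simp only [Sum.map_inl, Sum.inl.injEq, h1]
    by_cases hw : w = p.y
    · rw [if_pos hw, ← p.skip_z]
      constructor
      · intro h; exact Or.inr ⟨hw, (skip_inj h).symm⟩
      · rintro (h | ⟨-, h⟩)
        · exact absurd (h.symm.trans hw) (skip_ne _ _)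
        · rw [h]
    · rw [if_neg hw]
      exact ⟨Or.inl, fun h => h.resolve_right fun h' => hw h'.1⟩
  · simp

theorem ite_merge (q : Fin Γ.v ⊕ Fin Γ.s) (u : Fin (Γ.v - 1)) :
    (if Sum.map (merge p.x p.y p.ne) id q = Sum.inl u then 1 else 0 : ℕ) =
      (if q = Sum.inl (skip p.y u) then 1 else 0) +
        (if u = p.z then (if q = Sum.inl p.y then 1 else 0) else 0) := by
  have hne : skip p.y u ≠ p.y := skip_ne _ _
  rw [if_congr (map_merge_eq_inl p q u) rfl rfl]
  have h13 : ¬ (q = Sum.inl (skip p.y u) ∧ q = Sum.inl p.y) := fun h =>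
    hne (Sum.inl_injective (h.1.symm.trans h.2))
  by_cases h1 : q = Sum.inl (skip p.y u)
  · have h2 : ¬ q = Sum.inl p.y := fun h2 => h13 ⟨h1, h2⟩
    rw [if_pos (Or.inl h1), if_pos h1, if_neg h2, ite_self]
  · rw [if_neg h1, zero_add]
    by_cases h3 : u = p.z
    · rw [if_pos h3]
      exact if_congr ⟨fun h => (h.resolve_left h1).1, fun h => Or.inr ⟨h, h3⟩⟩ rfl rfl
    · rw [if_neg h3, if_neg (fun h => h3 (h.resolve_left h1).2)]

theorem outDeg_contract (u : Fin (Γ.v - 1)) :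
    (Γ.contract p).outDeg (Sum.inl u) + (if u = p.z then 1 else 0) =
      Γ.outDeg (Sum.inl (skip p.y u)) + (if u = p.z then Γ.outDeg (Sum.inl p.y) else 0) := by
  have h0 : (Γ.contract p).outDeg (Sum.inl u) =
      ∑ i : Fin (Γ.e - 1), ((if Γ.src (skip p.a i) = Sum.inl (skip p.y u) then 1 else 0) +
        (if u = p.z then (if Γ.src (skip p.a i) = Sum.inl p.y then 1 else 0) else 0)) := by
    rw [outDeg_eq]
    exact Finset.sum_congr rfl fun i _ => ite_merge p _ u
  have h1 := sum_skip p.a fun b => if Γ.src b = Sum.inl (skip p.y u) then 1 else 0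
  have h2 := sum_skip p.a fun b => if Γ.src b = Sum.inl p.y then 1 else 0
  rw [← outDeg_eq] at h1 h2
  rw [p.src_eq] at h1 h2
  rw [if_neg (fun h => p.ne (Sum.inl_injective h))] at h2
  rw [h0, Finset.sum_add_distrib]
  by_cases hu : u = p.z
  · rw [hu, p.skip_z, if_pos rfl] at h1
    simp only [hu, if_true, p.skip_z]
    omega
  · rw [if_neg (fun h => hu (skip_inj ((Sum.inl_injective h).symm.trans p.skip_z.symm)))] at h1
    simp only [hu, if_false, Finset.sum_const_zero]
    omega

theorem inDeg_contract (u : Fin (Γ.v - 1)) :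
    (Γ.contract p).inDeg (Sum.inl u) + (if u = p.z then 1 else 0) =
      Γ.inDeg (Sum.inl (skip p.y u)) + (if u = p.z then Γ.inDeg (Sum.inl p.y) else 0) := by
  have h0 : (Γ.contract p).inDeg (Sum.inl u) =
      ∑ i : Fin (Γ.e - 1), ((if Γ.tgt (skip p.a i) = Sum.inl (skip p.y u) then 1 else 0) +
        (if u = p.z then (if Γ.tgt (skip p.a i) = Sum.inl p.y then 1 else 0) else 0)) := by
    rw [inDeg_eq]
    exact Finset.sum_congr rfl fun i _ => ite_merge p _ u
  have h1 := sum_skip p.a fun b => if Γ.tgt b = Sum.inl (skip p.y u) then 1 else 0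
  have h2 := sum_skip p.a fun b => if Γ.tgt b = Sum.inl p.y then 1 else 0
  rw [← inDeg_eq] at h1 h2
  rw [p.tgt_eq] at h1 h2
  rw [if_pos rfl] at h2
  rw [if_neg (fun h => skip_ne _ _ (Sum.inl_injective h).symm)] at h1
  rw [h0, Finset.sum_add_distrib]
  by_cases hu : u = p.z
  · simp only [hu, if_true] at h1 ⊢
    omega
  · simp only [hu, if_false, Finset.sum_const_zero]
    omega

theorem outDeg_contract_of_ne {u : Fin (Γ.v - 1)} (hu : u ≠ p.z) :
    (Γ.contract p).outDeg (Sum.inl u) = Γ.outDeg (Sum.inl (skip p.y u)) := by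
  have := outDeg_contract p u
  rwa [if_neg hu, if_neg hu] at this

theorem inDeg_contract_of_ne {u : Fin (Γ.v - 1)} (hu : u ≠ p.z) :
    (Γ.contract p).inDeg (Sum.inl u) = Γ.inDeg (Sum.inl (skip p.y u)) := by
  have := inDeg_contract p u
  rwa [if_neg hu, if_neg hu] at this

theorem deg_contract_inr (j : Fin Γ.s) :
    (Γ.contract p).outDeg (Sum.inr j) + (Γ.contract p).inDeg (Sum.inr j) =
      Γ.outDeg (Sum.inr j) + Γ.inDeg (Sum.inr j) := by
  have key : ∀ q : Fin Γ.v ⊕ Fin Γ.s,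
      Sum.map (merge p.x p.y p.ne) id q = Sum.inr j ↔ q = Sum.inr j := by
    rintro (w | i) <;> simp
  have h1 := sum_skip p.a fun b => if Γ.src b = Sum.inr j then 1 else 0
  have h2 := sum_skip p.a fun b => if Γ.tgt b = Sum.inr j then 1 else 0
  rw [← outDeg_eq, p.src_eq, if_neg Sum.inl_ne_inr, zero_add] at h1
  rw [← inDeg_eq, p.tgt_eq, if_neg Sum.inl_ne_inr, zero_add] at h2
  rw [h1, h2, outDeg_eq, inDeg_eq]
  exact congrArg₂ (· + ·) (Finset.sum_congr rfl fun i _ => if_congr (key _) rfl rfl)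
    (Finset.sum_congr rfl fun i _ => if_congr (key _) rfl rfl)

theorem outDeg_x_pos : 1 ≤ Γ.outDeg (Sum.inl p.x) :=
  Finset.card_pos.2 ⟨p.a, by simp [p.src_eq]⟩

theorem inDeg_y_pos : 1 ≤ Γ.inDeg (Sum.inl p.y) :=
  Finset.card_pos.2 ⟨p.a, by simp [p.tgt_eq]⟩

theorem sinks_contract :
    (Γ.contract p).sinks + (if Γ.outDeg (Sum.inl p.y) = 0 then 1 else 0) =
      Γ.sinks + (if Γ.outDeg (Sum.inl p.x) + Γ.outDeg (Sum.inl p.y) = 1 then 1 else 0) := by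
  have hx := outDeg_x_pos p
  have h1 := sum_skip p.y fun w => if Γ.outDeg (Sum.inl w) = 0 then 1 else 0
  rw [← sinks_eq] at h1
  have h2 : (Γ.contract p).sinks = ∑ u : Fin (Γ.v - 1),
      ((if Γ.outDeg (Sum.inl (skip p.y u)) = 0 then 1 else 0) +
        if u = p.z then (if Γ.outDeg (Sum.inl p.x) + Γ.outDeg (Sum.inl p.y) = 1 then 1 else 0)
          else 0) := by
    rw [sinks_eq]
    refine Finset.sum_congr rfl fun u _ => ?_
    have h3 := outDeg_contract p u
    by_cases hu : u = p.z
    · subst hu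
      rw [if_pos rfl, if_pos rfl, p.skip_z] at h3
      rw [if_pos rfl, p.skip_z]
      split_ifs <;> omega
    · have h4 := outDeg_contract_of_ne p hu
      refine Eq.trans ?_ (congrArg (_ + ·) (if_neg hu).symm)
      exact if_congr (h4 ▸ Iff.rfl) rfl rfl
  rw [h2, Finset.sum_add_distrib, h1, Finset.sum_ite_eq' Finset.univ p.z, if_pos (Finset.mem_univ _)]
  omega

theorem sinks_contract_le : (Γ.contract p).sinks ≤ Γ.sinks := by
  have := sinks_contract p
  have hx := outDeg_x_pos p
  split_ifs at this <;> omega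

theorem Connected.contract (h : Γ.Connected) : (Γ.contract p).Connected := by
  refine h.of_map (Γ' := Γ.contract p) (Sum.map (merge p.x p.y p.ne) id) ?_ ?_
  · exact Function.Surjective.sumMap (fun u => ⟨skip p.y u, merge_skip _ _ _ _⟩)
      Function.surjective_id
  · rintro _ _ ⟨b, rfl, rfl⟩
    by_cases hb : b = p.a
    · subst hb
      have : merge p.x p.y p.ne p.x = merge p.x p.y p.ne p.y := by
        apply skip_inj (y := p.y); simp [skip_merge, p.ne]
      have e : Sum.map (merge p.x p.y p.ne) id (Γ.src p.a) =
          Sum.map (merge p.x p.y p.ne) id (Γ.tgt p.a) := by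
        rw [p.src_eq, p.tgt_eq]; exact congrArg Sum.inl this
      exact e ▸ .refl _
    · refine .rel _ _ ⟨unskip p.a b hb, ?_, ?_⟩
      · exact congrArg (fun c => Sum.map _ id (Γ.src c)) (skip_unskip p.a b hb)
      · exact congrArg (fun c => Sum.map _ id (Γ.tgt c)) (skip_unskip p.a b hb)

theorem Acyclic.of_contract (h : (Γ.contract p).Acyclic) : Γ.Acyclic := by
  have hm : Sum.map (merge p.x p.y p.ne) id (Sum.inl p.x : Fin Γ.v ⊕ Fin Γ.s) =
      Sum.map (merge p.x p.y p.ne) id (Sum.inl p.y) := by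
    refine congrArg Sum.inl ?_
    apply skip_inj (y := p.y); simp [skip_merge, p.ne]
  have arrow : ∀ b, b ≠ p.a → (Γ.contract p).Arrow
      (Sum.map (merge p.x p.y p.ne) id (Γ.src b)) (Sum.map (merge p.x p.y p.ne) id (Γ.tgt b)) := by
    intro b hb
    refine ⟨unskip p.a b hb, ?_, ?_⟩
    · exact congrArg (fun c => Sum.map _ id (Γ.src c)) (skip_unskip p.a b hb)
    · exact congrArg (fun c => Sum.map _ id (Γ.tgt c)) (skip_unskip p.a b hb)
  obtain ⟨f, hf⟩ : ∃ f : Fin Γ.v ⊕ Fin Γ.s → Fin (Γ.v - 1) ⊕ Fin Γ.s,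
    f = Sum.map (merge p.x p.y p.ne) id := ⟨_, rfl⟩
  rw [← hf] at hm
  replace arrow : ∀ b, b ≠ p.a → (Γ.contract p).Arrow (f (Γ.src b)) (f (Γ.tgt b)) := by
    rw [hf]; exact arrow
  have key : ∀ s t, Relation.TransGen Γ.Arrow s t →
      Relation.TransGen (Γ.contract p).Arrow (f s) (f t) ∨ (s = Sum.inl p.x ∧ t = Sum.inl p.y) := by
    intro s t hst
    induction hst with
    | single hb =>
      obtain ⟨b, rfl, rfl⟩ := hb
      by_cases hb : b = p.a
      · subst hb; exact Or.inr ⟨p.src_eq, p.tgt_eq⟩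
      · exact Or.inl (.single (arrow b hb))
    | tail _ hb ih =>
      obtain ⟨b, rfl, rfl⟩ := hb
      rcases ih with ih | ⟨rfl, ih⟩
      · by_cases hb : b = p.a
        · subst hb
          have e : f (Γ.src p.a) = f (Γ.tgt p.a) := by rw [p.src_eq, p.tgt_eq, hm]
          exact Or.inl (e ▸ ih)
        · exact Or.inl (ih.tail (arrow b hb))
      · by_cases hb : b = p.a
        · subst hb
          exact absurd (Sum.inl_injective (p.src_eq.symm.trans ih)) p.ne
        · left
          have e : f (Γ.src b) = f (Sum.inl p.x) := by rw [ih, hm]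
          exact e ▸ .single (arrow b hb)
  intro s hs
  rcases key s s hs with h1 | ⟨h1, h2⟩
  · exact h _ h1
  · exact p.ne (Sum.inl_injective (h1.symm.trans h2))

theorem IsHairy.contract (h : Γ.IsHairy) : (Γ.contract p).IsHairy where
  v_pos := by have := p.v_pos; change 0 < Γ.v - 1; omega
  s_pos := h.s_pos
  connected := h.connected.contract p
  internal u := by
    have h1 := outDeg_contract p u
    have h2 := inDeg_contract p u
    have h3 := h.internal (skip p.y u)
    have h4 := h.internal p.y
    split_ifs at h1 h2 <;> omega
  external j := (deg_contract_inr p j).trans (h.external j)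

theorem IsOriented.contract_of_sinks (h : Γ.IsOriented) (ha : (Γ.contract p).Acyclic)
    (hs : (Γ.contract p).sinks = Γ.sinks) : (Γ.contract p).IsOriented where
  no_ext := h.no_ext
  v_pos := by have := p.v_pos; change 0 < Γ.v - 1; omega
  connected := h.connected.contract p
  two_le u := by
    have h1 := outDeg_contract p u
    have h2 := inDeg_contract p u
    have h3 := h.two_le (skip p.y u)
    have h4 := h.two_le p.y
    split_ifs at h1 h2 <;> omega
  no_passing u := by
    have h1 := outDeg_contract p u
    have h2 := inDeg_contract p u
    have h3 := h.two_le (skip p.y u)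
    have h4 := h.two_le p.y
    have h5 := h.no_passing (skip p.y u)
    have h6 := h.no_passing p.y
    have h7 := sinks_contract p
    have h8 := outDeg_x_pos p
    have h9 := inDeg_y_pos p
    by_cases hu : u = p.z
    · subst hu
      rw [if_pos rfl, if_pos rfl, p.skip_z] at h1 h2
      rw [p.skip_z] at h3 h5
      rintro ⟨h10, h11⟩
      split_ifs at h7 <;> omega
    · have h12 := outDeg_contract_of_ne p hu
      have h13 := inDeg_contract_of_ne p hu
      rintro ⟨h10, h11⟩
      exact h5 ⟨h13.symm.trans h10, h12.symm.trans h11⟩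
  acyclic := ha

end

end Gr

/-! ### The two complexes -/

/-- Hairy graphs with the signs and degrees of `HG_{n,n}`. -/
def hairyKind (n : ℤ) : GraphKind where
  N := n
  flips := True
  adm := Gr.IsHairy
  targets _ := 0
  adm_relabel Γ σ ρ π h := Gr.IsHairy.relabel Γ σ ρ π h
  targets_relabel _ _ _ _ := rfl
  adm_flip Γ c _ h := Gr.IsHairy.flip Γ c h
  targets_flip _ _ _ := rfl
  contract_mid _ p _ h _ _ := ⟨h.contract p, rfl⟩

/-- Oriented graphs with the signs and degrees of `OG_N`, and with the differential that preserves
the number of targets. -/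
def orientedKind (N : ℤ) : GraphKind where
  N := N
  flips := False
  adm := Gr.IsOriented
  targets := Gr.sinks
  adm_relabel Γ σ ρ π h := Gr.IsOriented.relabel Γ σ ρ π h
  targets_relabel Γ σ ρ π := Gr.sinks_relabel Γ σ ρ π
  adm_flip _ _ h := h.elim
  targets_flip _ _ h := h.elim
  contract_mid Γ p q h h1 h2 := by
    have hs : (Γ.contract p).sinks = Γ.sinks :=
      le_antisymm (Gr.sinks_contract_le p) (h2.symm.le.trans (Gr.sinks_contract_le q))
    exact ⟨h.contract_of_sinks p (h1.acyclic.of_contract q) hs, hs⟩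

/-- The hairy graph complex `(HG_{n,n}, d)`. -/
noncomputable def HG (K : Type*) [Field K] (n : ℤ) : CochainComplex (ModuleCat K) ℤ :=
  (hairyKind n).complex K

/-- The fixed target oriented graph complex `(OG_N, d₀)`. -/
noncomputable def OG₀ (K : Type*) [Field K] (N : ℤ) : CochainComplex (ModuleCat K) ℤ :=
  (orientedKind N).complex K

/-! ### The explicit map -/

namespace Gr

/-- The end of the edge `τ x` other than `x`. -/
def parent (Γ : Gr) (τ : Fin Γ.v → Fin Γ.e) (x : Fin Γ.v) : Fin Γ.v ⊕ Fin Γ.s :=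
  if Γ.src (τ x) = Sum.inl x then Γ.tgt (τ x) else Γ.src (τ x)

/-- A spanning forest each of whose components contains exactly one external vertex is recorded by
the function `τ` that sends an internal vertex `x` to the first edge of the path in the forest from
`x` to an external vertex; the set of edges of the forest is the range of `τ`.  A hair forest is
such a forest that contains all hairs, i.e. none of the external vertices is isolated in it. -/
structure IsHairForest (Γ : Gr) (τ : Fin Γ.v → Fin Γ.e) : Prop where
  incident : ∀ x, Γ.src (τ x) = Sum.inl x ∨ Γ.tgt (τ x) = Sum.inl x
  reaches : ∀ x, ∃ j, Relation.TransGen (fun p q => ∃ y, p = Sum.inl y ∧ q = Γ.parent τ y)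
    (Sum.inl x) (Sum.inr j)
  hairs : ∀ j, ∃ x, Γ.parent τ x = Sum.inr j

/-- Numbers of the edges of the oriented graph associated to a hair forest: first the forest edges
`τ x` that are not hairs, ordered by `x`; then for each edge `b` outside of the forest the two edges
`(b, false)` and `(b, true)`. -/
abbrev ForestEdge (Γ : Gr) (τ : Fin Γ.v → Fin Γ.e) : Type :=
  {x : Fin Γ.v // ∃ y, Γ.parent τ x = Sum.inl y} ⊕ₗ
    ({b : Fin Γ.e // ∀ x, τ x ≠ b} ×ₗ Bool)

noncomputable instance (Γ : Gr) (τ : Fin Γ.v → Fin Γ.e) : Fintype (Γ.ForestEdge τ) := by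
  classical
  exact Fintype.ofEquiv ({x : Fin Γ.v // ∃ y, Γ.parent τ x = Sum.inl y} ⊕
    ({b : Fin Γ.e // ∀ x, τ x ≠ b} × Bool)) ((Equiv.refl _).sumCongr toLex |>.trans toLex)

/-- The vertex of the oriented graph that corresponds to a vertex of `Γ`: the internal vertex `x`
becomes the vertex with the number `τ x`.  The value on external vertices is irrelevant. -/
def forestVertex (Γ : Gr) (τ : Fin Γ.v → Fin Γ.e) (b : Fin Γ.e) (q : Fin Γ.v ⊕ Fin Γ.s) : Fin Γ.e :=
  Sum.elim τ (fun _ => b) q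

/-- The source of an edge of the oriented graph. -/
def forestSrc (Γ : Gr) (τ : Fin Γ.v → Fin Γ.e) (k : Γ.ForestEdge τ) : Fin Γ.e :=
  Sum.elim (fun x => τ x.1) (fun c => (ofLex c).1.1) (ofLex k)

/-- The target of an edge of the oriented graph. -/
def forestTgt (Γ : Gr) (τ : Fin Γ.v → Fin Γ.e) (k : Γ.ForestEdge τ) : Fin Γ.e :=
  Sum.elim (fun x => Γ.forestVertex τ (τ x.1) (Γ.parent τ x.1))
    (fun c => Γ.forestVertex τ (ofLex c).1.1
      (if (ofLex c).2 then Γ.tgt (ofLex c).1.1 else Γ.src (ofLex c).1.1)) (ofLex k)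

/-- The oriented graph associated to a hair forest: the forest edges are directed towards the
external vertices, every edge `p → q` outside of the forest is replaced by a zigzag `p ← • → q`
with a new source `•`, and then the external vertices are deleted together with the hairs.
The new source of the zigzag of the edge `b` gets the number `b`, and the internal vertex `x` gets
the number `τ x`. -/
noncomputable def forestGraph (Γ : Gr) (τ : Fin Γ.v → Fin Γ.e) : Gr where
  v := Γ.e
  s := 0
  e := Fintype.card (Γ.ForestEdge τ)
  src i := Sum.inl (Γ.forestSrc τ (monoEquivOfFin (Γ.ForestEdge τ) rfl i))
  tgt i := Sum.inl (Γ.forestTgt τ (monoEquivOfFin (Γ.ForestEdge τ) rfl i))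

open Classical in
/-- The sign of a hair forest.  It is trivial for even `n`.  For odd `n` it is the sign of the
renumbering of the internal vertices for which the vertices without hair in the forest come first
(in their order), followed by those with a hair in the forest in the order of the hairs, times a
factor `-1` for every forest edge that points away from the external vertices. -/
noncomputable def forestSign (n : ℤ) (Γ : Gr) (τ : Fin Γ.v → Fin Γ.e) : ℤˣ :=
  if Even n then 1 else
    (-1) ^ ((Finset.univ.filter fun p : Fin Γ.v × Fin Γ.v => p.1 < p.2 ∧
        ∃ j, Γ.parent τ p.1 = Sum.inr j ∧ ∀ i, Γ.parent τ p.2 = Sum.inr i → i < j).card +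
      (Finset.univ.filter fun x => Γ.src (τ x) ≠ Sum.inl x).card)

end Gr

open Classical in
/-- The signed sum over all hair forests of the associated oriented graphs, in degree `D` of the
oriented graph complex. -/
noncomputable def forestSum (K : Type*) [Field K] (n D : ℤ) (Γ : Gr) :
    (orientedKind (n + 1)).Space K D :=
  ∑ τ : Fin Γ.v → Fin Γ.e, if Γ.IsHairForest τ then
    Gr.forestSign n Γ τ • (orientedKind (n + 1)).cls K D (Γ.forestGraph τ) else 0

/-!
# The hair forest map is a quasi-isomorphism

*Encoding of oriented graphs.* A hairy graph is a map `p` from half-edges to vertices. A set `D` of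
half-edges that is admissible (`Adm`) directs some of the edges, and gives an oriented graph `og p D`
in which the directed edges are arcs, the others become zigzags with a new bivalent source in the
middle, and the hairs are deleted. Every oriented graph arises in this way
(`exists_og_of_isOriented`), and isomorphisms between such graphs are renumberings of the hairy
graphs (`exists_ren_of_iso`): the internal vertices are recovered as the vertices other than bivalent
sources, the external ones as the targets. An ordering `l` of `D` removes the sign ambiguity, and
defines an element `phi p l` of the oriented complex that is alternating in `l`. Signs that depend
on the numbers of vertices and edges alone are never computed: they enter as constants, and a sign
is the sign of a bijection between two types relative to a chosen one (`esign`).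

*The map.* A hair forest is the same as an admissible set with exactly one outgoing half-edge at
every internal vertex, that is, an admissible section `t` of the half-edges over the internal
vertices. The sign of the forest is precisely what relates the numbering of its oriented graph to
the ordering of the section by the vertices (`fr_forest`), so that `f(Γ)` is, up to a constant sign,
the sum of `phi p t` over all sections (`forestSum_eq`).

*The differential.* The differential of `phi p l` has two parts: the contraction of one half of a
zigzag adds a half-edge to the list (`exists_ct_zig`), the contraction of an arc is a contraction of
the hairy graph. Dually, the first part is the simplicial coboundary `delta` on alternating functions
of lists. The sum over all sections corresponds to the function `omega`, a determinant, and since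
every half-edge has one source, `delta omega = 0` (`delta_omega`). Hence in the differential of
`f(Γ)` only the contractions of arcs remain (`d_secSum`), and for each inner edge they add up to `f`
of its contraction: the path from the merged vertex starts at one of the two ends of the edge
(`arcSum_inner`). Thus `f` is a morphism of complexes (`d_forestMap`).

*The quasi-isomorphism.* The contraction of an arc lowers the number of internal vertices, so the
size of the hairy graph filters both complexes, and the leading part of the differential of the
oriented complex is `delta` for a fixed hairy graph. If the graph has a forest `T`, this complex is
exact except for the class of `omega` (`exists_eq_delta_of_ne`, `exists_eq_omega_add_delta`): a
cocycle that vanishes at `T`, and hence on all lists that follow `T` at every vertex, is changed by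
coboundaries, namely by contraction with the arcs of `T`, so as to vanish on the lists that follow
`T` at fewer and fewer vertices, and finally on all lists (`exists_step`). If the graph has no
forest, there are no lists, and the graph has two hairs at one vertex, so that it vanishes in the
hairy complex (`cls_eq_zero_of_no_forest`). In characteristic zero the passage to the coinvariants
under renumberings does no harm: the functionals `psi` given by the orbit functions `theta` detect
the leading part of an element, and averaging recovers it. So a cycle of the cone of `f` can be
changed by a boundary to have smaller size (`exists_reduction`), and an induction over the
well-ordered set of sizes shows that the cone is acyclic (`exists_boundary`).
-/



namespace HairForest

/-! ### Signs of bijections -/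

section Signs

variable {α β γ : Type*} [Fintype α] [DecidableEq α]

/-- The sign of a bijection relative to an arbitrarily chosen bijection between the same two types.
Only ratios of such signs have a meaning; all signs that depend on the two types alone are thus
never computed. -/
noncomputable def esign (q : α ≃ β) : ℤˣ :=
  Equiv.Perm.sign (q.trans (Classical.choice (⟨q⟩ : Nonempty (α ≃ β))).symm)

theorem esign_perm_trans (π : Equiv.Perm α) (q : α ≃ β) :
    esign (π.trans q) = Equiv.Perm.sign π * esign q := by
  unfold esign
  rw [Equiv.trans_assoc, mul_comm]
  exact Equiv.Perm.sign_mul (q.trans (Classical.choice (⟨q⟩ : Nonempty (α ≃ β))).symm) π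

theorem esign_eq_sign_mul (q q' : α ≃ β) :
    esign q = Equiv.Perm.sign (q.trans q'.symm) * esign q' := by
  rw [← esign_perm_trans]
  congr 1
  ext x; simp

theorem esign_trans_perm [Fintype β] [DecidableEq β] (q : α ≃ β) (π : Equiv.Perm β) :
    esign (q.trans π) = Equiv.Perm.sign π * esign q := by
  rw [esign_eq_sign_mul (q.trans π) q]
  congr 1
  rw [Equiv.trans_assoc]
  exact Equiv.Perm.sign_trans_trans_symm π q

theorem exists_esign_trans_left [Fintype γ] [DecidableEq γ] (E : γ ≃ α) :
    ∃ c : ℤˣ, ∀ q : α ≃ β, esign (E.trans q) = c * esign q := by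
  by_cases h : Nonempty (α ≃ β)
  · obtain ⟨q0⟩ := h
    refine ⟨esign (E.trans q0) * esign q0, fun q => ?_⟩
    rw [esign_eq_sign_mul q q0, esign_eq_sign_mul (E.trans q) (E.trans q0)]
    have h1 : (E.trans q).trans (E.trans q0).symm = (E.trans (q.trans q0.symm)).trans E.symm := by
      ext x; simp
    rw [h1, Equiv.Perm.sign_trans_trans_symm, mul_assoc, mul_left_comm (esign q0),
      Int.units_mul_self, mul_one, mul_comm]
  · exact ⟨1, fun q => (h ⟨q⟩).elim⟩

end Signs

/-! ### Graphs on arbitrary types of vertices and edges -/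

/-- A directed graph without external vertices on arbitrary types of vertices and edges. -/
structure TG (V E : Type) where
  s : E → V
  t : E → V

namespace TG

variable {V E V' E' : Type} {w r : ℕ}

/-- The numbered graph obtained from numberings of the vertices and of the edges. -/
abbrev gr (T : TG V E) (nV : V ≃ Fin w) (nE : E ≃ Fin r) : Gr where
  v := w
  s := 0
  e := r
  src k := Sum.inl (nV (T.s (nE.symm k)))
  tgt k := Sum.inl (nV (T.t (nE.symm k)))

theorem gr_iso (T : TG V E) (T' : TG V' E') (eV : V ≃ V') (eE : E ≃ E')
    (hs : ∀ k, T'.s (eE k) = eV (T.s k)) (ht : ∀ k, T'.t (eE k) = eV (T.t k))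
    (nV : V' ≃ Fin w) (nE : E' ≃ Fin r) :
    T.gr (eV.trans nV) (eE.trans nE) = T'.gr nV nE := by
  apply Gr.mk_congr
  · intro k
    simp only [Equiv.trans_apply, Equiv.symm_trans_apply, ← hs, Equiv.apply_symm_apply]
  · intro k
    simp only [Equiv.trans_apply, Equiv.symm_trans_apply, ← ht, Equiv.apply_symm_apply]

/-- Every numbered graph without external vertices arises from a graph on types. -/
theorem exists_of_gr (Γ : Gr) (h : Γ.s = 0) : ∃ T : TG (Fin Γ.v) (Fin Γ.e),
    Γ = T.gr (Equiv.refl _) (Equiv.refl _) := by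
  obtain ⟨v, s, e, src, tgt⟩ := Γ
  obtain rfl : s = 0 := h
  refine ⟨⟨fun k => (src k).elim id Fin.elim0, fun k => (tgt k).elim id Fin.elim0⟩, ?_⟩
  apply Gr.mk_congr
  · intro k
    rcases h : src k with x | x
    · simp [h]
    · exact x.elim0
  · intro k
    rcases h : tgt k with x | x
    · simp [h]
    · exact x.elim0

/-! Degrees, connectedness and acyclicity. -/

theorem outDeg_gr [Fintype E] [DecidableEq V] (T : TG V E) (nV : V ≃ Fin w) (nE : E ≃ Fin r)
    (x : V) :
    (T.gr nV nE).outDeg (Sum.inl (nV x)) = (Finset.univ.filter fun k => T.s k = x).card := by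
  rw [Finset.card_filter]
  refine (Gr.outDeg_eq (T.gr nV nE) (Sum.inl (nV x))).trans ?_
  refine Fintype.sum_equiv nE.symm _ _ fun k => if_congr ?_ rfl rfl
  exact ⟨fun h => nV.injective (Sum.inl_injective h), fun h => congrArg (fun y => Sum.inl (nV y)) h⟩

theorem inDeg_gr [Fintype E] [DecidableEq V] (T : TG V E) (nV : V ≃ Fin w) (nE : E ≃ Fin r)
    (x : V) :
    (T.gr nV nE).inDeg (Sum.inl (nV x)) = (Finset.univ.filter fun k => T.t k = x).card := by
  rw [Finset.card_filter]
  refine (Gr.inDeg_eq (T.gr nV nE) (Sum.inl (nV x))).trans ?_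
  refine Fintype.sum_equiv nE.symm _ _ fun k => if_congr ?_ rfl rfl
  exact ⟨fun h => nV.injective (Sum.inl_injective h), fun h => congrArg (fun y => Sum.inl (nV y)) h⟩

theorem sinks_gr [Fintype E] [Fintype V] [DecidableEq V] (T : TG V E) (nV : V ≃ Fin w)
    (nE : E ≃ Fin r) :
    (T.gr nV nE).sinks = (Finset.univ.filter fun x => ∀ k, T.s k ≠ x).card := by
  rw [Finset.card_filter]
  refine (Gr.sinks_eq (T.gr nV nE)).trans ?_
  refine (Fintype.sum_equiv nV (fun x => if ∀ k, T.s k ≠ x then 1 else 0)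
    (fun u => if (T.gr nV nE).outDeg (Sum.inl u) = 0 then 1 else 0) fun x => ?_).symm
  refine if_congr ?_ rfl rfl
  rw [outDeg_gr, Finset.card_eq_zero, Finset.filter_eq_empty_iff]
  simp

/-- There is an edge from `x` to `y`. -/
def Arrow (T : TG V E) (x y : V) : Prop := ∃ k, T.s k = x ∧ T.t k = y

theorem arrow_gr (T : TG V E) (nV : V ≃ Fin w) (nE : E ≃ Fin r) {x y : V} :
    (T.gr nV nE).Arrow (Sum.inl (nV x)) (Sum.inl (nV y)) ↔ T.Arrow x y := by
  constructor
  · rintro ⟨b, h1, h2⟩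
    exact ⟨nE.symm b, nV.injective (Sum.inl_injective h1), nV.injective (Sum.inl_injective h2)⟩
  · rintro ⟨k, rfl, rfl⟩
    refine ⟨nE k, ?_, ?_⟩
    · exact congrArg (fun c => Sum.inl (nV (T.s c))) (nE.symm_apply_apply k)
    · exact congrArg (fun c => Sum.inl (nV (T.t c))) (nE.symm_apply_apply k)

/-- A vertex of the numbered graph, as an element of the type of vertices. -/
def back (nV : V ≃ Fin w) (q : Fin w ⊕ Fin 0) : V := nV.symm (q.elim id Fin.elim0)

theorem inl_back (nV : V ≃ Fin w) (q : Fin w ⊕ Fin 0) : Sum.inl (nV (back nV q)) = q := by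
  rcases q with x | x
  · simp [back]
  · exact x.elim0

theorem back_inl (nV : V ≃ Fin w) (x : V) : back nV (Sum.inl (nV x)) = x := by simp [back]

theorem arrow_back (T : TG V E) (nV : V ≃ Fin w) (nE : E ≃ Fin r) {q q' : Fin w ⊕ Fin 0} :
    (T.gr nV nE).Arrow q q' ↔ T.Arrow (back nV q) (back nV q') := by
  rw [← arrow_gr T nV nE, inl_back, inl_back]

end TG

/-- An irreflexive transitive relation on a finite type admits a height function. -/
theorem exists_height {α : Type*} [Finite α] {R : α → α → Prop}
    (h : ∀ x, ¬ Relation.TransGen R x x) : ∃ ht : α → ℕ, ∀ x y, R x y → ht y < ht x := by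
  classical
  have := Fintype.ofFinite α
  refine ⟨fun x => (Finset.univ.filter fun y => Relation.TransGen R x y).card, fun x y hxy => ?_⟩
  refine Finset.card_lt_card ⟨?_, ?_⟩
  · intro z hz
    simp only [Finset.mem_filter, Finset.mem_univ, true_and] at hz ⊢
    exact .head hxy hz
  · intro hsub
    have h1 : y ∈ Finset.univ.filter fun z => Relation.TransGen R x z := by
      simpa using Relation.TransGen.single hxy
    have h2 := hsub h1
    simp only [Finset.mem_filter, Finset.mem_univ, true_and] at h2
    exact h y h2

theorem not_transGen_of_height {α : Type*} {R : α → α → Prop} (ht : α → ℕ)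
    (h : ∀ x y, R x y → ht y < ht x) (x : α) : ¬ Relation.TransGen R x x := by
  have key : ∀ x y, Relation.TransGen R x y → ht y < ht x := by
    intro x y hxy
    induction hxy with
    | single h1 => exact h _ _ h1
    | tail _ h1 ih => exact (h _ _ h1).trans ih
  exact fun hx => lt_irrefl _ (key x x hx)

namespace TG

variable {V E : Type} {w r : ℕ}

theorem eqvGen_map {α β : Type*} {R : α → α → Prop} {S : β → β → Prop} (f : α → β)
    (h : ∀ x y, R x y → Relation.EqvGen S (f x) (f y)) {x y : α} (hxy : Relation.EqvGen R x y) :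
    Relation.EqvGen S (f x) (f y) := by
  induction hxy with
  | rel _ _ h' => exact h _ _ h'
  | refl _ => exact .refl _
  | symm _ _ _ ih => exact .symm _ _ ih
  | trans _ _ _ _ _ ih1 ih2 => exact .trans _ _ _ ih1 ih2

theorem acyclic_iff (T : TG V E) (nV : V ≃ Fin w) (nE : E ≃ Fin r) :
    (T.gr nV nE).Acyclic ↔ ∃ ht : V → ℕ, ∀ k, ht (T.t k) < ht (T.s k) := by
  constructor
  · intro h
    obtain ⟨ht, hht⟩ := exists_height (R := (T.gr nV nE).Arrow) h
    exact ⟨fun x => ht (Sum.inl (nV x)), fun k => hht _ _ ((arrow_gr T nV nE).2 ⟨k, rfl, rfl⟩)⟩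
  · rintro ⟨ht, hht⟩
    refine not_transGen_of_height (fun q => ht (back nV q)) ?_
    intro x y hxy
    obtain ⟨k, h1, h2⟩ := (arrow_back T nV nE).1 hxy
    rw [← h1, ← h2]
    exact hht k

variable [Fintype E] [DecidableEq V]

/-- The conditions that define the generators of the oriented graph complex, with acyclicity
expressed by a height function. -/
structure Oriented (T : TG V E) : Prop where
  nonempty : Nonempty V
  connected : ∀ x y, Relation.EqvGen T.Arrow x y
  two_le : ∀ x, 2 ≤ (Finset.univ.filter fun k => T.s k = x).card +
    (Finset.univ.filter fun k => T.t k = x).card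
  no_passing : ∀ x, ¬ ((Finset.univ.filter fun k => T.t k = x).card = 1 ∧
    (Finset.univ.filter fun k => T.s k = x).card = 1)
  acyclic : ∃ ht : V → ℕ, ∀ k, ht (T.t k) < ht (T.s k)

theorem isOriented_iff (T : TG V E) (nV : V ≃ Fin w) (nE : E ≃ Fin r) :
    (T.gr nV nE).IsOriented ↔ T.Oriented := by
  constructor
  · intro h
    refine ⟨⟨nV.symm ⟨0, h.v_pos⟩⟩, fun x y => ?_, fun x => ?_, fun x => ?_,
      (acyclic_iff T nV nE).1 h.acyclic⟩
    · have h1 := h.connected (Sum.inl (nV x)) (Sum.inl (nV y))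
      have h2 := eqvGen_map (S := T.Arrow) (back nV)
        (fun q q' hq => .rel _ _ ((arrow_back T nV nE).1 hq)) h1
      rwa [back_inl, back_inl] at h2
    · rw [← outDeg_gr T nV nE, ← inDeg_gr T nV nE]
      exact h.two_le (nV x)
    · rw [← outDeg_gr T nV nE, ← inDeg_gr T nV nE]
      exact h.no_passing (nV x)
  · intro h
    refine ⟨rfl, ?_, fun q q' => ?_, fun u => ?_, fun u => ?_, (acyclic_iff T nV nE).2 h.acyclic⟩
    · exact Fin.pos (nV h.nonempty.some)
    · have h2 := eqvGen_map (S := (T.gr nV nE).Arrow) (fun x => Sum.inl (nV x))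
        (fun x y hxy => .rel _ _ ((arrow_gr T nV nE).2 hxy)) (h.connected (back nV q) (back nV q'))
      rwa [inl_back, inl_back] at h2
    · obtain ⟨x, rfl⟩ := nV.surjective u
      exact (h.two_le x).trans (congrArg₂ (· + ·) (outDeg_gr T nV nE x) (inDeg_gr T nV nE x)).ge
    · obtain ⟨x, rfl⟩ := nV.surjective u
      exact fun h' => h.no_passing x ⟨(inDeg_gr T nV nE x).symm.trans h'.1,
        (outDeg_gr T nV nE x).symm.trans h'.2⟩

end TG

end HairForest


namespace HairForest

/-! ### Contraction of edges in graphs on arbitrary types -/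

namespace TG

variable (K : Type*) [Field K] (N D : ℤ) {V E V' E' : Type} {w r : ℕ}

/-- The class in the oriented graph complex of a graph with numbered vertices and edges. -/
noncomputable def cl (T : TG V E) (nV : V ≃ Fin w) (nE : E ≃ Fin r) : (orientedKind N).Space K D :=
  (orientedKind N).cls K D (T.gr nV nE)

theorem cl_relabel (T : TG V E) (nV : V ≃ Fin w) (nE : E ≃ Fin r) (σ : Equiv.Perm (Fin w))
    (π : Equiv.Perm (Fin r)) :
    T.cl K N D (nV.trans σ) (nE.trans π) =
      Gr.relSign N σ (1 : Equiv.Perm (Fin 0)) π • T.cl K N D nV nE :=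
  GraphKind.cls_of_rel K D
    (GraphKind.Rel.relabel (𝒢 := orientedKind N) (T.gr nV nE) σ (1 : Equiv.Perm (Fin 0)) π)

theorem cl_iso (T : TG V E) (T' : TG V' E') (eV : V ≃ V') (eE : E ≃ E')
    (hs : ∀ k, T'.s (eE k) = eV (T.s k)) (ht : ∀ k, T'.t (eE k) = eV (T.t k))
    (nV : V' ≃ Fin w) (nE : E' ≃ Fin r) :
    T.cl K N D (eV.trans nV) (eE.trans nE) = T'.cl K N D nV nE := by
  unfold cl
  rw [gr_iso T T' eV eE hs ht]

/-- An edge between different vertices, as a contractible edge of the numbered graph. -/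
def inner (T : TG V E) (nV : V ≃ Fin w) (nE : E ≃ Fin r) (a : E) (h : T.s a ≠ T.t a) :
    (T.gr nV nE).Inner :=
  ⟨(nE a, nV (T.s a), nV (T.t a)), by simp, by simp, nV.injective.ne h⟩

/-- The contribution of the contraction of the edge `a` to the differential. -/
noncomputable def ct (T : TG V E) (nV : V ≃ Fin w) (nE : E ≃ Fin r) (a : E) (h : T.s a ≠ T.t a) :
    (orientedKind N).Space K (D + 1) :=
  if ((T.gr nV nE).contract (T.inner nV nE a h)).sinks = (T.gr nV nE).sinks then
    Gr.contractSign N (T.inner nV nE a h) •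
      (orientedKind N).cls K (D + 1) ((T.gr nV nE).contract (T.inner nV nE a h)) else 0

theorem contractions_eq [Fintype E] (T : TG V E) (nV : V ≃ Fin w) (nE : E ≃ Fin r)
    (hl : ∀ a, T.s a ≠ T.t a) :
    (orientedKind N).contractions K D (T.gr nV nE) = ∑ a : E, T.ct K N D nV nE a (hl a) := by
  symm
  refine Fintype.sum_bijective (fun a => T.inner nV nE a (hl a)) ⟨?_, ?_⟩ _ _ fun a => rfl
  · intro a b hab
    exact nE.injective (congrArg Gr.Inner.a hab)
  · intro p
    refine ⟨nE.symm p.a, Gr.Inner.ext ?_⟩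
    exact nE.apply_symm_apply p.a

theorem ct_relabel (T : TG V E) (nV : V ≃ Fin w) (nE : E ≃ Fin r) (a : E) (h : T.s a ≠ T.t a)
    (σ : Equiv.Perm (Fin w)) (π : Equiv.Perm (Fin r)) :
    T.ct K N D (nV.trans σ) (nE.trans π) a h =
      Gr.relSign N σ (1 : Equiv.Perm (Fin 0)) π • T.ct K N D nV nE a h := by
  symm
  refine GraphKind.term_of_rel (𝒢 := orientedKind N) K (D + 1) ?_
    (Gr.contractSign_relabel N (T.inner nV nE a h) σ (1 : Equiv.Perm (Fin 0)) π)
    ((orientedKind N).targets_relabel (T.gr nV nE) σ (1 : Equiv.Perm (Fin 0)) π)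
  have := GraphKind.Rel.relabel (𝒢 := orientedKind N) ((T.gr nV nE).contract (T.inner nV nE a h))
    (Gr.removePerm σ (T.inner nV nE a h).y (σ (T.inner nV nE a h).y) rfl)
    (1 : Equiv.Perm (Fin 0)) (Gr.removePerm π (T.inner nV nE a h).a (π (T.inner nV nE a h).a) rfl)
  rw [← Gr.contract_relabel (T.inner nV nE a h) σ (1 : Equiv.Perm (Fin 0)) π] at this
  exact this

theorem ct_iso (T : TG V E) (T' : TG V' E') (eV : V ≃ V') (eE : E ≃ E')
    (hs : ∀ k, T'.s (eE k) = eV (T.s k)) (ht : ∀ k, T'.t (eE k) = eV (T.t k))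
    (nV : V' ≃ Fin w) (nE : E' ≃ Fin r) (a : E) (h : T.s a ≠ T.t a)
    (h' : T'.s (eE a) ≠ T'.t (eE a)) :
    T.ct K N D (eV.trans nV) (eE.trans nE) a h = T'.ct K N D nV nE (eE a) h' := by
  have key : ∀ (Γ Γ' : Gr) (p : Γ.Inner) (p' : Γ'.Inner), Γ = Γ' → p.a.1 = p'.a.1 →
      ((if (Γ.contract p).sinks = Γ.sinks then
        Gr.contractSign N p • (orientedKind N).cls K (D + 1) (Γ.contract p) else 0) =
      if (Γ'.contract p').sinks = Γ'.sinks then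
        Gr.contractSign N p' • (orientedKind N).cls K (D + 1) (Γ'.contract p') else 0) := by
    rintro Γ _ p p' rfl hp
    obtain rfl : p = p' := Gr.Inner.ext (Fin.ext hp)
    rfl
  exact key _ _ _ _ (gr_iso T T' eV eE hs ht nV nE) rfl

/-- The numbering for which a chosen element gets the number `0` and the remaining elements, which
are identified with the elements of `V'`, have been numbered before. -/
def optNum (j : V ≃ Option V') (n : V' ≃ Fin w) : V ≃ Fin (w + 1) :=
  (j.trans (Equiv.optionCongr n)).trans (finSuccEquiv w).symm

theorem optNum_none (j : V ≃ Option V') (n : V' ≃ Fin w) {a : V} (h : j a = none) :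
    optNum j n a = 0 := by
  simp [optNum, h]

theorem optNum_some (j : V ≃ Option V') (n : V' ≃ Fin w) {a : V} {b : V'} (h : j a = some b) :
    optNum j n a = (n b).succ := by
  simp [optNum, h]

theorem optNum_symm_succ (j : V ≃ Option V') (n : V' ≃ Fin w) (i : Fin w) :
    (optNum j n).symm i.succ = j.symm (some (n.symm i)) := by
  rw [Equiv.symm_apply_eq, optNum_some j n (Equiv.apply_symm_apply j _), Equiv.apply_symm_apply]

theorem skip_zero {k : ℕ} (i : Fin k) : Gr.skip (0 : Fin (k + 1)) i = i.succ := by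
  ext; simp [Gr.skip]

/-- Contraction of an edge `a` for a numbering in which `a` and its source have the number `0`.  The
merged vertex takes the place of the target, and not of the source as in the definition of the
differential; this is the reason for the sign `-1` for odd `N`. -/
theorem ct_optNum (T : TG V E) (T' : TG V' E') (a : E) (h : T.s a ≠ T.t a)
    (jV : V ≃ Option V') (jE : E ≃ Option E') (hV : jV (T.s a) = none) (hE : jE a = none)
    (x' : V') (hx : jV (T.t a) = some x')
    (hs : ∀ k, T'.s k = (jV (T.s (jE.symm (some k)))).getD x')
    (ht : ∀ k, T'.t k = (jV (T.t (jE.symm (some k)))).getD x')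
    (nV : V' ≃ Fin w) (nE : E' ≃ Fin r) :
    T.ct K N D (optNum jV nV) (optNum jE nE) a h =
      if (T'.gr nV nE).sinks = (T.gr (optNum jV nV) (optNum jE nE)).sinks then
        (if Even N then 1 else -1 : ℤˣ) • T'.cl K N (D + 1) nV nE else 0 := by
  obtain ⟨p, hp⟩ : ∃ p, p = T.inner (optNum jV nV) (optNum jE nE) a h := ⟨_, rfl⟩
  have hpa : p.a = 0 := by rw [hp]; exact optNum_none jE nE hE
  have hpx : p.x = 0 := by rw [hp]; exact optNum_none jV nV hV
  have hpy : p.y = (nV x').succ := by rw [hp]; exact optNum_some jV nV hx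
  have hcol : ∀ u : V, Gr.merge p.y p.x p.ne.symm (optNum jV nV u) = nV ((jV u).getD x') := by
    intro u
    apply Gr.skip_inj (y := p.x)
    rw [Gr.skip_merge]
    rcases hu : jV u with _ | u'
    · rw [optNum_none jV nV hu, if_pos hpx.symm, hpy, hpx]
      exact (skip_zero _).symm
    · rw [optNum_some jV nV hu, if_neg (by rw [hpx]; exact Fin.succ_ne_zero _), hpx]
      exact (skip_zero _).symm
  have hflip : p.flip p.a = ⟨(p.a, p.y, p.x), by simp [Gr.flip, ← p.tgt_eq],
    by simp [Gr.flip, ← p.src_eq], p.ne.symm⟩ := dif_pos rfl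
  have hgr : ((T.gr (optNum jV nV) (optNum jE nE)).flip p.a).contract (p.flip p.a) =
      T'.gr nV nE := by
    rw [hflip]
    have hne : ∀ b : Fin r, Gr.skip p.a b ≠ p.a := fun b => Gr.skip_ne _ _
    have hsk : ∀ b : Fin r, (optNum jE nE).symm (Gr.skip p.a b) = jE.symm (some (nE.symm b)) := by
      intro b
      rw [hpa]
      exact (congrArg _ (skip_zero b)).trans (optNum_symm_succ jE nE b)
    apply Gr.mk_congr
    · intro b
      refine (congrArg (Sum.map (Gr.merge p.y p.x p.ne.symm) id) (if_neg (hne b))).trans ?_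
      exact congrArg Sum.inl ((hcol _).trans ((congrArg (fun c => nV ((jV (T.s c)).getD x'))
        (hsk b)).trans (congrArg nV (hs _).symm)))
    · intro b
      refine (congrArg (Sum.map (Gr.merge p.y p.x p.ne.symm) id) (if_neg (hne b))).trans ?_
      exact congrArg Sum.inl ((hcol _).trans ((congrArg (fun c => nV ((jV (T.t c)).getD x'))
        (hsk b)).trans (congrArg nV (ht _).symm)))
  have hsign : Gr.contractSign N (p.flip p.a) = 1 := by
    rw [hflip]
    unfold Gr.contractSign
    change (if Even N then (-1 : ℤˣ) ^ p.a.1 else (-1) ^ p.x.1) = 1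
    rw [hpa, hpx]
    simp
  have hrel := GraphKind.Rel.relabel (𝒢 := orientedKind N)
    ((T.gr (optNum jV nV) (optNum jE nE)).contract p)
    (Gr.removePerm (Equiv.swap p.x p.y) p.y p.x (Equiv.swap_apply_right _ _))
    (1 : Equiv.Perm (Fin 0)) (1 : Equiv.Perm (Fin r))
  have hcs := Gr.contractSign_flip_self N p
  rw [hsign, one_mul] at hcs
  have hflipSign : Gr.flipSign N = (if Even N then 1 else -1 : ℤˣ) := rfl
  have hrel2 : (orientedKind N).Rel ((T.gr (optNum jV nV) (optNum jE nE)).contract p)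
      (T'.gr nV nE) ((if Even N then 1 else -1 : ℤˣ) * Gr.contractSign N p) := by
    rw [← hgr, Gr.contract_flip_self, ← hflipSign, ← hcs]
    exact hrel
  have hfin := GraphKind.term_of_rel (𝒢 := orientedKind N) K (D + 1) hrel2 (s := Gr.contractSign N p)
    (s' := (if Even N then 1 else -1 : ℤˣ)) (ε := 1)
    (by rw [← mul_assoc, Int.units_mul_self]) (rfl : (T.gr (optNum jV nV) (optNum jE nE)).sinks = _)
  rw [one_smul] at hfin
  unfold ct
  rw [← hp]
  exact hfin

end TG

end HairForest


namespace HairForest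

/-! ### Half-edges and the oriented graphs of a hairy graph -/

/-- Half-edges of a graph with `e` edges; `(b, false)` is the half-edge of `b` at its source and
`(b, true)` the half-edge at its target. -/
abbrev Hf (e : ℕ) : Type := Fin e × Bool

/-- The other half of the same edge. -/
def bar {e : ℕ} (h : Hf e) : Hf e := (h.1, !h.2)

@[simp] theorem bar_bar {e : ℕ} (h : Hf e) : bar (bar h) = h := by simp [bar]

theorem bar_ne {e : ℕ} (h : Hf e) : bar h ≠ h := by
  intro h'; have := congrArg Prod.snd h'; simp [bar] at this

@[simp] theorem bar_fst {e : ℕ} (h : Hf e) : (bar h).1 = h.1 := rfl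

theorem bar_inj {e : ℕ} {h h' : Hf e} (hh : bar h = bar h') : h = h' := by
  have := congrArg bar hh; simpa using this

theorem eq_or_eq_bar {e : ℕ} {h h' : Hf e} (hh : h.1 = h'.1) : h = h' ∨ h = bar h' := by
  obtain ⟨b, i⟩ := h
  obtain ⟨b', i'⟩ := h'
  obtain rfl : b = b' := hh
  cases i <;> cases i' <;> simp [bar]

variable {v s e : ℕ}

/-- The numbered graph whose half-edge `h` ends at the vertex `p h`. -/
abbrev grOf (p : Hf e → Fin v ⊕ Fin s) : Gr := ⟨v, s, e, fun b => p (b, false), fun b => p (b, true)⟩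

/-- The end of a half-edge of a numbered graph. -/
def en (Γ : Gr) (h : Hf Γ.e) : Fin Γ.v ⊕ Fin Γ.s := cond h.2 (Γ.tgt h.1) (Γ.src h.1)

/-- The conditions of the generators of the hairy graph complex in terms of half-edges. -/
structure Hairy (p : Hf e → Fin v ⊕ Fin s) : Prop where
  v_pos : 0 < v
  s_pos : 0 < s
  connected : ∀ q q', Relation.EqvGen (fun q q' => ∃ h, p h = q ∧ p (bar h) = q') q q'
  internal : ∀ x, 3 ≤ (Finset.univ.filter fun h => p h = Sum.inl x).card
  external : ∀ j, ∃! h, p h = Sum.inr j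

theorem deg_grOf (p : Hf e → Fin v ⊕ Fin s) (q : Fin v ⊕ Fin s) :
    (grOf p).outDeg q + (grOf p).inDeg q = (Finset.univ.filter fun h => p h = q).card := by
  rw [Gr.outDeg_eq, Gr.inDeg_eq, Finset.card_filter, Fintype.sum_prod_type,
    ← Finset.sum_add_distrib]
  refine Finset.sum_congr rfl fun b _ => ?_
  rw [Fintype.sum_bool, add_comm]

theorem isHairy_iff (p : Hf e → Fin v ⊕ Fin s) : (grOf p).IsHairy ↔ Hairy p := by
  have h1 : ∀ j, (Finset.univ.filter fun h => p h = Sum.inr j).card = 1 ↔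
      ∃! h, p h = Sum.inr j := by
    intro j
    rw [Finset.card_eq_one]
    constructor
    · rintro ⟨h, hh⟩
      have h2 := fun k => Finset.ext_iff.1 hh k
      simp only [Finset.mem_filter, Finset.mem_univ, true_and, Finset.mem_singleton] at h2
      exact ⟨h, (h2 h).2 rfl, fun k hk => (h2 k).1 hk⟩
    · rintro ⟨h, h2, h3⟩
      refine ⟨h, Finset.ext fun k => ?_⟩
      simp only [Finset.mem_filter, Finset.mem_univ, true_and, Finset.mem_singleton]
      exact ⟨h3 k, fun hk => hk ▸ h2⟩
  constructor
  · intro h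
    refine ⟨h.v_pos, h.s_pos, fun q q' => ?_, fun x => ?_, fun j => ?_⟩
    · refine TG.eqvGen_map id (fun x y hxy => ?_) (h.connected q q')
      obtain ⟨b, h2, h3⟩ := hxy
      exact .rel _ _ ⟨(b, false), h2, h3⟩
    · rw [← deg_grOf]; exact h.internal x
    · rw [← h1, ← deg_grOf]; exact h.external j
  · intro h
    refine ⟨h.v_pos, h.s_pos, fun q q' => ?_, fun x => ?_, fun j => ?_⟩
    · refine TG.eqvGen_map id (fun x y hxy => ?_) (h.connected q q')
      obtain ⟨⟨b, i⟩, h2, h3⟩ := hxy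
      cases i
      · exact .rel _ _ ⟨b, h2, h3⟩
      · exact .symm _ _ (.rel _ _ ⟨b, h3, h2⟩)
    · rw [deg_grOf]; exact h.internal x
    · rw [deg_grOf, h1]; exact h.external j

/-- The half-edge at an external vertex. -/
noncomputable def outer {p : Hf e → Fin v ⊕ Fin s} (hp : Hairy p) (j : Fin s) : Hf e :=
  (hp.external j).choose

theorem p_outer {p : Hf e → Fin v ⊕ Fin s} (hp : Hairy p) (j : Fin s) :
    p (outer hp j) = Sum.inr j := (hp.external j).choose_spec.1

theorem eq_outer {p : Hf e → Fin v ⊕ Fin s} (hp : Hairy p) {j : Fin s} {h : Hf e}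
    (hh : p h = Sum.inr j) : h = outer hp j := (hp.external j).choose_spec.2 h hh

/-- A set `D` of half-edges records which edges of a hairy graph are directed: an edge `b` with
`(b, i) ∈ D` is an arc from the end of `(b, i)` to the other end of `b`, and an edge without
half-edge in `D` stands for a zigzag with a bivalent source in its middle.  The set is admissible if
the arcs form no cycle, every hair is an arc to the external vertex, every internal vertex has an
outgoing arc, and a vertex with a hair has no other outgoing arc. -/
structure Adm (p : Hf e → Fin v ⊕ Fin s) (D : Set (Hf e)) : Prop where
  opp : ∀ h ∈ D, bar h ∉ D
  src_int : ∀ h ∈ D, ∃ x, p h = Sum.inl x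
  hair : ∀ h j, p h = Sum.inr j → bar h ∈ D
  out : ∀ x, ∃ h ∈ D, p h = Sum.inl x
  sink : ∀ h ∈ D, ∀ j, p (bar h) = Sum.inr j → ∀ h' ∈ D, p h' = p h → h' = h
  acyc : ∃ ht : Fin v → ℕ, ∀ h ∈ D, ∀ x y, p h = Sum.inl x → p (bar h) = Sum.inl y → ht y < ht x

/-- The edges that stand for zigzags. -/
def Zig (D : Set (Hf e)) : Type := {b : Fin e // ∀ i, (b, i) ∉ D}

noncomputable instance (D : Set (Hf e)) : Fintype (Zig D) := by
  classical exact inferInstanceAs (Fintype (Subtype _))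

instance (D : Set (Hf e)) : DecidableEq (Zig D) := inferInstanceAs (DecidableEq (Subtype _))

/-- The edges of the oriented graph: the half-edges outside of `D` at internal vertices. -/
def Edge (p : Hf e → Fin v ⊕ Fin s) (D : Set (Hf e)) : Type :=
  {h : Hf e // h ∉ D ∧ ∃ x, p h = Sum.inl x}

noncomputable instance (p : Hf e → Fin v ⊕ Fin s) (D : Set (Hf e)) : Fintype (Edge p D) := by
  classical exact inferInstanceAs (Fintype (Subtype _))

instance (p : Hf e → Fin v ⊕ Fin s) (D : Set (Hf e)) : DecidableEq (Edge p D) :=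
  inferInstanceAs (DecidableEq (Subtype _))

section

variable {p : Hf e → Fin v ⊕ Fin s} {D : Set (Hf e)}

/-- The vertex at the end of an edge. -/
noncomputable def Edge.x (k : Edge p D) : Fin v := k.2.2.choose

theorem Edge.p_eq (k : Edge p D) : p k.1 = Sum.inl k.x := k.2.2.choose_spec

theorem Edge.x_eq (k : Edge p D) {x : Fin v} (h : p k.1 = Sum.inl x) : k.x = x :=
  Sum.inl_injective (k.p_eq.symm.trans h)

theorem Edge.zig (k : Edge p D) (h : bar k.1 ∉ D) : ∀ i, (k.1.1, i) ∉ D := by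
  intro i
  rcases eq_or_eq_bar (h := (k.1.1, i)) (h' := k.1) rfl with h1 | h1
  · rw [h1]; exact k.2.1
  · rw [h1]; exact h

end

open Classical in
/-- The oriented graph of a hairy graph with a set `D` of half-edges: arcs remain edges, every other
edge `b` is replaced by a zigzag with the new source `b`, and the hairs are removed. -/
noncomputable def og (p : Hf e → Fin v ⊕ Fin s) (D : Set (Hf e)) :
    TG (Fin v ⊕ Zig D) (Edge p D) where
  s k := if h : bar k.1 ∈ D then Sum.inl ((p (bar k.1)).elim id fun _ => k.x)
    else Sum.inr ⟨k.1.1, k.zig h⟩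
  t k := Sum.inl k.x

section

variable {p : Hf e → Fin v ⊕ Fin s} {D : Set (Hf e)}

theorem og_s_arc (k : Edge p D) (h : bar k.1 ∈ D) {x : Fin v} (hx : p (bar k.1) = Sum.inl x) :
    (og p D).s k = Sum.inl x := by
  refine (dif_pos h).trans ?_
  rw [hx]; rfl

theorem og_s_zig (k : Edge p D) (h : bar k.1 ∉ D) : (og p D).s k = Sum.inr ⟨k.1.1, k.zig h⟩ :=
  dif_neg h

theorem og_t (k : Edge p D) : (og p D).t k = Sum.inl k.x := rfl

theorem og_t_eq (k : Edge p D) {x : Fin v} (hx : p k.1 = Sum.inl x) :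
    (og p D).t k = Sum.inl x := congrArg Sum.inl (k.x_eq hx)

namespace Adm

variable (hD : Adm p D)
include hD

theorem og_s_eq_inl (k : Edge p D) {x : Fin v} :
    (og p D).s k = Sum.inl x ↔ bar k.1 ∈ D ∧ p (bar k.1) = Sum.inl x := by
  by_cases h : bar k.1 ∈ D
  · obtain ⟨y, hy⟩ := hD.src_int _ h
    rw [og_s_arc k h hy, hy]
    simp [h]
  · rw [og_s_zig k h]
    simp [h]

theorem og_s_eq_inr (k : Edge p D) {b : Zig D} :
    (og p D).s k = Sum.inr b ↔ k.1.1 = b.1 := by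
  by_cases h : bar k.1 ∈ D
  · obtain ⟨y, hy⟩ := hD.src_int _ h
    rw [og_s_arc k h hy]
    simp only [reduceCtorEq, false_iff]
    intro hb
    exact b.2 (!k.1.2) (hb ▸ (show (k.1.1, !k.1.2) ∈ D from h))
  · rw [og_s_zig k h]
    exact ⟨fun h' => congrArg Subtype.val (Sum.inr_injective h'),
      fun h' => congrArg Sum.inr (Subtype.ext h')⟩

/-- All half-edges of a zigzag end at internal vertices. -/
theorem zig_int (b : Zig D) (i : Bool) : ∃ x, p (b.1, i) = Sum.inl x := by
  rcases h : p (b.1, i) with x | j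
  · exact ⟨x, rfl⟩
  · exact (b.2 _ (hD.hair _ j h)).elim

/-- A half of a zigzag, as an edge. -/
def zigEdge (b : Zig D) (i : Bool) : Edge p D := ⟨(b.1, i), b.2 i, hD.zig_int b i⟩

theorem s_zigEdge (b : Zig D) (i : Bool) : (og p D).s (hD.zigEdge b i) = Sum.inr b :=
  (hD.og_s_eq_inr _).2 rfl

theorem card_out_inr (b : Zig D) :
    (Finset.univ.filter fun k => (og p D).s k = Sum.inr b).card = 2 := by
  have : (Finset.univ.filter fun k => (og p D).s k = Sum.inr b) =
      {hD.zigEdge b false, hD.zigEdge b true} := by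
    ext k
    simp only [Finset.mem_filter, Finset.mem_univ, true_and, Finset.mem_insert,
      Finset.mem_singleton, hD.og_s_eq_inr]
    constructor
    · intro h
      rcases hi : k.1.2 with _ | _
      · exact Or.inl (Subtype.ext (Prod.ext h hi))
      · exact Or.inr (Subtype.ext (Prod.ext h hi))
    · rintro (rfl | rfl) <;> rfl
  rw [this, Finset.card_pair]
  intro h
  have := congrArg (fun k : Edge p D => k.1.2) h
  simp [zigEdge] at this

omit hD in
theorem card_in_inr (b : Zig D) :
    (Finset.univ.filter fun k => (og p D).t k = Sum.inr b).card = 0 := by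
  rw [Finset.card_eq_zero, Finset.filter_eq_empty_iff]
  intro k _
  simp [og]

end Adm

end

end HairForest


namespace HairForest

/-! ### The oriented graphs of admissible sets -/

variable {v s e : ℕ} {p : Hf e → Fin v ⊕ Fin s} {D : Set (Hf e)}

section

open Classical

theorem card_in_inl (x : Fin v) :
    (Finset.univ.filter fun k => (og p D).t k = Sum.inl x).card =
      (Finset.univ.filter fun h => p h = Sum.inl x ∧ h ∉ D).card := by
  refine Finset.card_bij (fun k _ => k.1) ?_ ?_ ?_
  · intro k hk
    simp only [Finset.mem_filter, Finset.mem_univ, true_and, og_t, Sum.inl.injEq] at hk ⊢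
    exact ⟨by rw [k.p_eq, hk], k.2.1⟩
  · intro k _ k' _ hkk
    exact Subtype.ext hkk
  · intro h hh
    simp only [Finset.mem_filter, Finset.mem_univ, true_and] at hh
    refine ⟨⟨h, hh.2, x, hh.1⟩, ?_, rfl⟩
    exact Finset.mem_filter.2 ⟨Finset.mem_univ _, og_t_eq (p := p) (D := D) ⟨h, hh.2, x, hh.1⟩ hh.1⟩

namespace Adm

variable (hD : Adm p D)
include hD

/-- An arc between internal vertices, as an edge of the oriented graph. -/
def arcEdge {h : Hf e} (hh : h ∈ D) {y : Fin v} (hy : p (bar h) = Sum.inl y) : Edge p D :=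
  ⟨bar h, hD.opp h hh, y, hy⟩

theorem s_arcEdge {h : Hf e} (hh : h ∈ D) {x y : Fin v} (hy : p (bar h) = Sum.inl y)
    (hx : p h = Sum.inl x) : (og p D).s (hD.arcEdge hh hy) = Sum.inl x :=
  (hD.og_s_eq_inl _).2 (by simpa [arcEdge] using ⟨hh, hx⟩)

theorem card_out_inl (x : Fin v) :
    (Finset.univ.filter fun k => (og p D).s k = Sum.inl x).card =
      (Finset.univ.filter fun h => p h = Sum.inl x ∧ h ∈ D ∧ ∃ y, p (bar h) = Sum.inl y).card := by
  refine Finset.card_bij (fun k _ => bar k.1) ?_ ?_ ?_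
  · intro k hk
    simp only [Finset.mem_filter, Finset.mem_univ, true_and, hD.og_s_eq_inl, bar_bar] at hk ⊢
    exact ⟨hk.2, hk.1, k.2.2⟩
  · intro k _ k' _ hkk
    exact Subtype.ext (bar_inj hkk)
  · intro h hh
    simp only [Finset.mem_filter, Finset.mem_univ, true_and] at hh
    obtain ⟨hx, hh, y, hy⟩ := hh
    refine ⟨hD.arcEdge hh hy, ?_, by simp [arcEdge]⟩
    exact Finset.mem_filter.2 ⟨Finset.mem_univ _, hD.s_arcEdge hh hy hx⟩

omit hD in
theorem card_in_add (hp : Hairy p) (x : Fin v) :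
    3 ≤ (Finset.univ.filter fun k => (og p D).t k = Sum.inl x).card +
      (Finset.univ.filter fun h => p h = Sum.inl x ∧ h ∈ D).card := by
  have h1 := hp.internal x
  rw [card_in_inl, add_comm, ← Finset.filter_filter, ← Finset.filter_filter,
    Finset.card_filter_add_card_filter_not]
  exact h1

/-- A vertex with a hair has no outgoing edge. -/
theorem card_of_haired {x : Fin v} {h : Hf e} {j : Fin s} (hh : h ∈ D) (hx : p h = Sum.inl x)
    (hj : p (bar h) = Sum.inr j) :
    (Finset.univ.filter fun k => (og p D).s k = Sum.inl x).card = 0 ∧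
      (Finset.univ.filter fun h => p h = Sum.inl x ∧ h ∈ D).card = 1 := by
  constructor
  · rw [hD.card_out_inl, Finset.card_eq_zero, Finset.filter_eq_empty_iff]
    rintro h' - ⟨h1, h2, y, h3⟩
    rw [hD.sink h hh j hj h' h2 (h1.trans hx.symm), hj] at h3
    exact Sum.inr_ne_inl h3
  · rw [Finset.card_eq_one]
    refine ⟨h, ?_⟩
    ext h'
    simp only [Finset.mem_filter, Finset.mem_univ, true_and, Finset.mem_singleton]
    exact ⟨fun h1 => hD.sink h hh j hj h' h1.2 (h1.1.trans hx.symm), fun h1 => h1 ▸ ⟨hx, hh⟩⟩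

theorem card_of_not_haired {x : Fin v}
    (hx : ∀ h ∈ D, p h = Sum.inl x → ∃ y, p (bar h) = Sum.inl y) :
    (Finset.univ.filter fun k => (og p D).s k = Sum.inl x).card =
      (Finset.univ.filter fun h => p h = Sum.inl x ∧ h ∈ D).card := by
  rw [hD.card_out_inl]
  congr 1
  ext h
  simp only [Finset.mem_filter, Finset.mem_univ, true_and]
  exact ⟨fun h1 => ⟨h1.1, h1.2.1⟩, fun h1 => ⟨h1.1, h1.2, hx h h1.2 h1.1⟩⟩

omit hD in
theorem haired_or (x : Fin v) : (∃ h ∈ D, p h = Sum.inl x ∧ ∃ j, p (bar h) = Sum.inr j) ∨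
    ∀ h ∈ D, p h = Sum.inl x → ∃ y, p (bar h) = Sum.inl y := by
  by_cases h : ∃ h ∈ D, p h = Sum.inl x ∧ ∃ j, p (bar h) = Sum.inr j
  · exact Or.inl h
  · refine Or.inr fun k hk hx => ?_
    rcases h1 : p (bar k) with y | j
    · exact ⟨y, rfl⟩
    · exact (h ⟨k, hk, hx, j, h1⟩).elim

theorem card_D_pos (x : Fin v) : 1 ≤ (Finset.univ.filter fun h => p h = Sum.inl x ∧ h ∈ D).card := by
  obtain ⟨h, hh, hx⟩ := hD.out x
  exact Finset.card_pos.2 ⟨h, by simp [hh, hx]⟩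

theorem card_out_eq_zero_iff {x : Fin v} :
    (Finset.univ.filter fun k => (og p D).s k = Sum.inl x).card = 0 ↔
      ∃ h ∈ D, p h = Sum.inl x ∧ ∃ j, p (bar h) = Sum.inr j := by
  constructor
  · intro h0
    rcases haired_or (p := p) (D := D) x with h | h
    · exact h
    · rw [hD.card_of_not_haired h] at h0
      have := hD.card_D_pos x
      omega
  · rintro ⟨h, hh, hx, j, hj⟩
    exact (hD.card_of_haired hh hx hj).1

theorem exists_height : ∃ ht : Fin v ⊕ Zig D → ℕ, ∀ k, ht ((og p D).t k) < ht ((og p D).s k) := by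
  obtain ⟨ht, h1⟩ := hD.acyc
  obtain ⟨M, hM⟩ : ∃ M, ∀ x, ht x < M := by
    refine ⟨(∑ x, ht x) + 1, fun x => Nat.lt_succ_of_le ?_⟩
    exact Finset.single_le_sum (f := ht) (fun _ _ => Nat.zero_le _) (Finset.mem_univ x)
  refine ⟨Sum.elim ht fun _ => M, fun k => ?_⟩
  by_cases h : bar k.1 ∈ D
  · obtain ⟨x, hx⟩ := hD.src_int _ h
    rw [og_s_arc k h hx, og_t]
    exact h1 _ h x k.x hx (by rw [bar_bar]; exact k.p_eq)
  · rw [og_s_zig k h, og_t]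
    exact hM _

/-- The end of a hair. -/
theorem exists_hairEnd (hp : Hairy p) (j : Fin s) :
    ∃ x, bar (outer hp j) ∈ D ∧ p (bar (outer hp j)) = Sum.inl x := by
  have h := hD.hair _ j (p_outer hp j)
  obtain ⟨x, hx⟩ := hD.src_int _ h
  exact ⟨x, h, hx⟩

/-- The internal vertex at a hair. -/
noncomputable def hairEnd (hp : Hairy p) (j : Fin s) : Fin v := (hD.exists_hairEnd hp j).choose

theorem outer_mem (hp : Hairy p) (j : Fin s) : bar (outer hp j) ∈ D :=
  (hD.exists_hairEnd hp j).choose_spec.1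

theorem p_bar_outer (hp : Hairy p) (j : Fin s) :
    p (bar (outer hp j)) = Sum.inl (hD.hairEnd hp j) := (hD.exists_hairEnd hp j).choose_spec.2

theorem hairEnd_injective (hp : Hairy p) : Function.Injective (hD.hairEnd hp) := by
  intro j j' hj
  have h1 := hD.sink _ (hD.outer_mem hp j) j (by rw [bar_bar]; exact p_outer hp j) _ (hD.outer_mem hp j')
    (by rw [hD.p_bar_outer, hD.p_bar_outer, hj])
  have h2 := p_outer hp j
  rw [← bar_inj h1, p_outer hp j'] at h2
  exact (Sum.inr_injective h2).symm

/-- The conditions on an admissible set are exactly what makes its oriented graph admissible: an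
internal vertex with a hair is a target of valence at least two, any other internal vertex has an
outgoing arc and is at least trivalent, and the new vertices are bivalent sources. -/
theorem oriented (hp : Hairy p) : (og p D).Oriented where
  nonempty := ⟨Sum.inl ⟨0, hp.v_pos⟩⟩
  connected := by
    -- external vertices are moved to the internal ends of their hairs
    let f : Fin v ⊕ Fin s → Fin v ⊕ Zig D := Sum.elim Sum.inl fun j => Sum.inl (hD.hairEnd hp j)
    have hf : ∀ h, Relation.EqvGen (og p D).Arrow (f (p h)) (f (p (bar h))) := by
      have key : ∀ h x, p h = Sum.inl x →
          Relation.EqvGen (og p D).Arrow (f (p h)) (f (p (bar h))) := by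
        intro h x hx
        rcases hy : p (bar h) with y | j
        · rw [hx]
          by_cases h1 : h ∈ D
          · exact .rel _ _ ⟨hD.arcEdge h1 hy, hD.s_arcEdge h1 hy hx, og_t_eq (hD.arcEdge h1 hy) hy⟩
          · by_cases h2 : bar h ∈ D
            · refine .symm _ _ (.rel _ _ ⟨⟨h, h1, x, hx⟩, ?_, ?_⟩)
              · exact og_s_arc ⟨h, h1, x, hx⟩ h2 hy
              · exact og_t_eq ⟨h, h1, x, hx⟩ hx
            · have h3 := og_s_zig ⟨h, h1, x, hx⟩ h2
              have h4 := og_s_zig (p := p) (D := D) ⟨bar h, h2, y, hy⟩ (by simpa using h1)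
              refine .trans _ _ _ (.symm _ _ (.rel _ _ ⟨⟨h, h1, x, hx⟩, h3, ?_⟩))
                (.rel _ _ ⟨⟨bar h, h2, y, hy⟩, h4, ?_⟩)
              · exact og_t_eq ⟨h, h1, x, hx⟩ hx
              · exact og_t_eq ⟨bar h, h2, y, hy⟩ hy
        · have h1 : bar h = outer hp j := eq_outer hp hy
          have h2 := hD.p_bar_outer hp j
          rw [← h1, bar_bar] at h2
          rw [h2]
          exact .refl _
      intro h
      rcases hx : p h with x | j
      · rw [← hx]; exact key h x hx
      · have h1 : h = outer hp j := eq_outer hp hx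
        have h2 := hD.p_bar_outer hp j
        rw [← h1] at h2
        rw [h2]
        exact .refl _
    have h1 : ∀ q q', Relation.EqvGen (og p D).Arrow (f q) (f q') := fun q q' =>
      TG.eqvGen_map f (fun x y ⟨h, hx, hy⟩ => hx ▸ hy ▸ hf h) (hp.connected q q')
    have h2 : ∀ z : Fin v ⊕ Zig D, ∃ q, Relation.EqvGen (og p D).Arrow z (f q) := by
      rintro (x | b)
      · exact ⟨Sum.inl x, .refl _⟩
      · refine ⟨Sum.inl (hD.zigEdge b false).x, .rel _ _ ⟨hD.zigEdge b false, ?_, rfl⟩⟩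
        exact hD.s_zigEdge b false
    intro z z'
    obtain ⟨q, hq⟩ := h2 z
    obtain ⟨q', hq'⟩ := h2 z'
    exact .trans _ _ _ hq (.trans _ _ _ (h1 q q') (.symm _ _ hq'))
  two_le := by
    rintro (x | b)
    · have h1 := card_in_add (D := D) hp x
      rcases haired_or (p := p) (D := D) x with ⟨h, hh, hx, j, hj⟩ | h
      · have h2 := hD.card_of_haired hh hx hj
        convert (by omega : 2 ≤ (Finset.univ.filter fun k => (og p D).s k = Sum.inl x).card +
          (Finset.univ.filter fun k => (og p D).t k = Sum.inl x).card)
      · have h2 := hD.card_of_not_haired h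
        convert (by omega : 2 ≤ (Finset.univ.filter fun k => (og p D).s k = Sum.inl x).card +
          (Finset.univ.filter fun k => (og p D).t k = Sum.inl x).card)
    · have h1 := hD.card_out_inr b
      convert (by omega : 2 ≤ (Finset.univ.filter fun k => (og p D).s k = Sum.inr b).card +
          (Finset.univ.filter fun k => (og p D).t k = Sum.inr b).card)
  no_passing := by
    rintro (x | b)
    · have h1 := card_in_add (D := D) hp x
      rcases haired_or (p := p) (D := D) x with ⟨h, hh, hx, j, hj⟩ | h
      · have h2 := hD.card_of_haired hh hx hj
        convert (by omega : ¬ ((Finset.univ.filter fun k => (og p D).t k = Sum.inl x).card = 1 ∧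
          (Finset.univ.filter fun k => (og p D).s k = Sum.inl x).card = 1))
      · have h2 := hD.card_of_not_haired h
        convert (by omega : ¬ ((Finset.univ.filter fun k => (og p D).t k = Sum.inl x).card = 1 ∧
          (Finset.univ.filter fun k => (og p D).s k = Sum.inl x).card = 1))
    · have h1 := hD.card_out_inr b
      convert (by omega : ¬ ((Finset.univ.filter fun k => (og p D).t k = Sum.inr b).card = 1 ∧
          (Finset.univ.filter fun k => (og p D).s k = Sum.inr b).card = 1))
  acyclic := hD.exists_height

/-- Internal vertices are never bivalent sources of the oriented graph. -/
theorem not_biv (hp : Hairy p) (x : Fin v) :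
    ¬ ((Finset.univ.filter fun k => (og p D).t k = Sum.inl x).card = 0 ∧
      (Finset.univ.filter fun k => (og p D).s k = Sum.inl x).card = 2) := by
  have h1 := card_in_add (D := D) hp x
  rcases haired_or (p := p) (D := D) x with ⟨h, hh, hx, j, hj⟩ | h
  · have h2 := hD.card_of_haired hh hx hj
    omega
  · have h2 := hD.card_of_not_haired h
    omega

/-- The targets of the oriented graph are the internal ends of the hairs. -/
theorem sinks_og (hp : Hairy p) {w r : ℕ} (nV : Fin v ⊕ Zig D ≃ Fin w) (nE : Edge p D ≃ Fin r) :
    ((og p D).gr nV nE).sinks = s := by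
  rw [TG.sinks_gr]
  have : (Finset.univ.filter fun z => ∀ k, (og p D).s k ≠ z) =
      Finset.univ.image fun j => Sum.inl (hD.hairEnd hp j) := by
    ext z
    simp only [Finset.mem_filter, Finset.mem_univ, true_and, Finset.mem_image]
    rcases z with x | b
    · have h1 := hD.card_out_eq_zero_iff (x := x)
      rw [Finset.card_eq_zero, Finset.filter_eq_empty_iff] at h1
      have h2 : (∀ k, (og p D).s k ≠ Sum.inl x) ↔
        ∀ ⦃k⦄, k ∈ Finset.univ → ¬ (og p D).s k = Sum.inl x := by simp
      rw [h2, h1]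
      constructor
      · rintro ⟨h, hh, hx, j, hj⟩
        refine ⟨j, congrArg Sum.inl ?_⟩
        have h3 := hD.p_bar_outer hp j
        rw [← eq_outer hp hj, bar_bar, hx] at h3
        exact (Sum.inl_injective h3).symm
      · rintro ⟨j, hj⟩
        refine ⟨_, hD.outer_mem hp j, ?_, j, by rw [bar_bar]; exact p_outer hp j⟩
        rw [hD.p_bar_outer]
        exact congrArg Sum.inl (Sum.inl_injective hj)
    · simp only [reduceCtorEq, exists_false, iff_false, not_forall, not_not]
      exact ⟨_, hD.s_zigEdge b false⟩
  have h2 := Finset.card_image_of_injective (Finset.univ : Finset (Fin s))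
    (f := fun j => (Sum.inl (hD.hairEnd hp j) : Fin v ⊕ Zig D))
    (Sum.inl_injective.comp (hD.hairEnd_injective hp))
  rw [Finset.card_univ, Fintype.card_fin] at h2
  rw [← this] at h2
  exact Eq.trans (by congr!) h2

end Adm

end

/-! ### The number of vertices other than bivalent sources -/

/-- The number of vertices that are not bivalent sources. -/
def core (Γ : Gr) : ℕ :=
  (Finset.univ.filter fun w : Fin Γ.v =>
    ¬ (Γ.inDeg (Sum.inl w) = 0 ∧ Γ.outDeg (Sum.inl w) = 2)).card

theorem core_gr {V E : Type} [Fintype V] [Fintype E] [DecidableEq V] {w r : ℕ} (T : TG V E)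
    (nV : V ≃ Fin w) (nE : E ≃ Fin r) :
    core (T.gr nV nE) = (Finset.univ.filter fun x =>
      ¬ ((Finset.univ.filter fun k => T.t k = x).card = 0 ∧
        (Finset.univ.filter fun k => T.s k = x).card = 2)).card := by
  have h : ∀ x, ((T.gr nV nE).inDeg (Sum.inl (nV x)) = 0 ∧ (T.gr nV nE).outDeg (Sum.inl (nV x)) = 2) =
      ((Finset.univ.filter fun k => T.t k = x).card = 0 ∧
        (Finset.univ.filter fun k => T.s k = x).card = 2) := by
    intro x
    rw [TG.outDeg_gr, TG.inDeg_gr]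
  refine (Finset.card_equiv nV fun x => ?_).symm
  simp only [Finset.mem_filter, Finset.mem_univ, true_and]
  exact (not_congr (h x).to_iff).symm

/-- The vertices of the oriented graph that are not bivalent sources are the internal vertices of
the hairy graph. -/
theorem Adm.core_og (hD : Adm p D) (hp : Hairy p) {w r : ℕ} (nV : Fin v ⊕ Zig D ≃ Fin w)
    (nE : Edge p D ≃ Fin r) : core ((og p D).gr nV nE) = v := by
  classical
  rw [core_gr]
  have : (Finset.univ.filter fun z : Fin v ⊕ Zig D =>
      ¬ ((Finset.univ.filter fun k => (og p D).t k = z).card = 0 ∧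
        (Finset.univ.filter fun k => (og p D).s k = z).card = 2)) =
      Finset.univ.image Sum.inl := by
    ext z
    simp only [Finset.mem_filter, Finset.mem_univ, true_and, Finset.mem_image]
    rcases z with x | b
    · have := hD.not_biv hp x
      simp only [Sum.inl.injEq, exists_eq, iff_true]
      convert this
    · have h1 := hD.card_out_inr b
      have h2 := card_in_inr (p := p) b
      simp only [reduceCtorEq, exists_false, iff_false, not_not]
      constructor
      · convert h2
      · convert h1
  rw [this, Finset.card_image_of_injective _ Sum.inl_injective, Finset.card_univ, Fintype.card_fin]

end HairForest


namespace HairForest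

/-! ### Renumberings in terms of half-edges -/

/-- The permutations of the half-edges that come from a permutation of the edges and reversals. -/
def Sym (e : ℕ) : Subgroup (Equiv.Perm (Hf e)) where
  carrier := {κ | ∀ h, κ (bar h) = bar (κ h)}
  mul_mem' := by
    intro a b ha hb h
    rw [Equiv.Perm.mul_apply, Equiv.Perm.mul_apply, hb, ha]
  one_mem' := fun _ => rfl
  inv_mem' := by
    intro a ha h
    rw [Equiv.Perm.inv_eq_iff_eq, ha]
    exact (congrArg bar (Equiv.apply_symm_apply a h)).symm

namespace Sym

variable {e : ℕ}

theorem map_bar (κ : Sym e) (h : Hf e) : κ.1 (bar h) = bar (κ.1 h) := κ.2 h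

theorem fst_eq (κ : Sym e) (h : Hf e) : (κ.1 h).1 = (κ.1 (h.1, false)).1 := by
  rcases eq_or_eq_bar (h := h) (h' := (h.1, false)) rfl with h1 | h1
  · rw [← h1]
  · exact (congrArg (fun k => (κ.1 k).1) h1).trans (by rw [map_bar, bar_fst])

/-- The underlying permutation of the edges. -/
def edgePerm : Sym e →* Equiv.Perm (Fin e) where
  toFun κ :=
    { toFun := fun b => (κ.1 (b, false)).1
      invFun := fun b => ((κ⁻¹).1 (b, false)).1
      left_inv := fun b => by
        have h1 := (fst_eq (κ⁻¹) (κ.1 (b, false))).symm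
        exact h1.trans (congrArg Prod.fst (Equiv.symm_apply_apply κ.1 (b, false)))
      right_inv := fun b => by
        have h1 := (fst_eq κ ((κ⁻¹).1 (b, false))).symm
        exact h1.trans (congrArg Prod.fst (Equiv.apply_symm_apply κ.1 (b, false))) }
  map_one' := by ext b; rfl
  map_mul' := by
    intro κ κ'
    ext b
    exact congrArg Fin.val (fst_eq κ (κ'.1 (b, false)))

theorem edgePerm_apply (κ : Sym e) (h : Hf e) : edgePerm κ h.1 = (κ.1 h).1 := (fst_eq κ h).symm

end Sym

/-- The group of all renumberings of the internal vertices, the external vertices and the edges,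
together with the reversals of edges. -/
abbrev Ren (v s e : ℕ) : Type := Equiv.Perm (Fin v) × Equiv.Perm (Fin s) × Sym e

variable {v s e m : ℕ}

/-- The action of a renumbering on graphs. -/
def act (g : Ren v s e) (p : Hf e → Fin v ⊕ Fin s) : Hf e → Fin v ⊕ Fin s :=
  fun h => Sum.map g.1 g.2.1 (p (g.2.2.1.symm h))

theorem act_apply (g : Ren v s e) (p : Hf e → Fin v ⊕ Fin s) (h : Hf e) :
    act g p (g.2.2.1 h) = Sum.map g.1 g.2.1 (p h) := by
  simp [act]

theorem act_mul (g g' : Ren v s e) (p : Hf e → Fin v ⊕ Fin s) :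
    act (g * g') p = act g (act g' p) := by
  funext h
  obtain ⟨h, rfl⟩ := (g * g').2.2.1.surjective h
  have h1 : (g * g').2.2.1 h = g.2.2.1 (g'.2.2.1 h) := rfl
  rw [act_apply, h1, act_apply, act_apply, Sum.map_map]
  rfl

theorem act_one (p : Hf e → Fin v ⊕ Fin s) : act 1 p = p := by
  funext h
  have : ∀ q : Fin v ⊕ Fin s, Sum.map (1 : Equiv.Perm (Fin v)) (1 : Equiv.Perm (Fin s)) q = q := by
    rintro (x | x) <;> rfl
  exact this _

/-- The sign by which a renumbering acts on the oriented graphs with an ordering of the set of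
directed edges. -/
def chi (N : ℤ) : Ren v s e →* ℤˣ where
  toFun g := if Even N then Equiv.Perm.sign g.2.1 * Equiv.Perm.sign g.2.2.1 else
    Equiv.Perm.sign g.1 * Equiv.Perm.sign (Sym.edgePerm g.2.2)
  map_one' := by split_ifs <;> simp
  map_mul' g g' := by
    split_ifs
    · simp only [Prod.snd_mul, Prod.fst_mul, Subgroup.coe_mul, map_mul]
      exact mul_mul_mul_comm _ _ _ _
    · simp only [Prod.snd_mul, Prod.fst_mul, map_mul]
      exact mul_mul_mul_comm _ _ _ _

section

variable {p p' : Hf e → Fin v ⊕ Fin s} {D D' : Set (Hf e)} {g : Ren v s e}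

theorem act_eq_inl {h : Hf e} {x : Fin v} :
    act g p (g.2.2.1 h) = Sum.inl (g.1 x) ↔ p h = Sum.inl x := by
  rw [act_apply]
  rcases p h with y | y <;> simp

theorem act_eq_inr {h : Hf e} {x : Fin s} :
    act g p (g.2.2.1 h) = Sum.inr (g.2.1 x) ↔ p h = Sum.inr x := by
  rw [act_apply]
  rcases p h with y | y <;> simp

theorem Hairy.act (hp : Hairy p) (g : Ren v s e) : Hairy (act g p) where
  v_pos := hp.v_pos
  s_pos := hp.s_pos
  connected q q' := by
    obtain ⟨q, rfl⟩ := (g.1.sumCongr g.2.1).surjective q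
    obtain ⟨q', rfl⟩ := (g.1.sumCongr g.2.1).surjective q'
    refine TG.eqvGen_map _ ?_ (hp.connected q q')
    rintro _ _ ⟨h, rfl, rfl⟩
    refine .rel _ _ ⟨g.2.2.1 h, act_apply g p h, ?_⟩
    rw [← Sym.map_bar]
    exact act_apply g p _
  internal x := by
    obtain ⟨x, rfl⟩ := g.1.surjective x
    refine (hp.internal x).trans (Finset.card_equiv g.2.2.1 fun h => ?_).le
    simp only [Finset.mem_filter, Finset.mem_univ, true_and]
    exact act_eq_inl.symm
  external j := by
    obtain ⟨j, rfl⟩ := g.2.1.surjective j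
    refine ⟨g.2.2.1 (outer hp j), act_eq_inr.2 (p_outer hp j), fun h hh => ?_⟩
    obtain ⟨h, rfl⟩ := g.2.2.1.surjective h
    exact congrArg _ (eq_outer hp (act_eq_inr.1 hh))

theorem hairy_act_iff : Hairy (act g p) ↔ Hairy p := by
  refine ⟨fun h => ?_, fun h => h.act g⟩
  have := h.act g⁻¹
  rwa [← act_mul, inv_mul_cancel, act_one] at this

theorem outer_act (hp : Hairy p) (hp' : Hairy (act g p)) (j : Fin s) :
    outer hp' (g.2.1 j) = g.2.2.1 (outer hp j) :=
  (eq_outer hp' (act_eq_inr.2 (p_outer hp j))).symm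

theorem Adm.act (hD : Adm p D) (g : Ren v s e) : Adm (act g p) (g.2.2.1 '' D) where
  opp := by
    rintro _ ⟨h, hh, rfl⟩
    rw [← Sym.map_bar, g.2.2.1.injective.mem_set_image]
    exact hD.opp h hh
  src_int := by
    rintro _ ⟨h, hh, rfl⟩
    obtain ⟨x, hx⟩ := hD.src_int h hh
    exact ⟨g.1 x, act_eq_inl.2 hx⟩
  hair h j hj := by
    obtain ⟨h, rfl⟩ := g.2.2.1.surjective h
    obtain ⟨j, rfl⟩ := g.2.1.surjective j
    rw [← Sym.map_bar, g.2.2.1.injective.mem_set_image]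
    exact hD.hair h j (act_eq_inr.1 hj)
  out x := by
    obtain ⟨x, rfl⟩ := g.1.surjective x
    obtain ⟨h, hh, hx⟩ := hD.out x
    exact ⟨_, ⟨h, hh, rfl⟩, act_eq_inl.2 hx⟩
  sink := by
    rintro _ ⟨h, hh, rfl⟩ j hj _ ⟨h', hh', rfl⟩ hh2
    obtain ⟨j, rfl⟩ := g.2.1.surjective j
    rw [← Sym.map_bar] at hj
    obtain ⟨x, hx⟩ := hD.src_int h hh
    rw [act_eq_inl.2 hx] at hh2
    rw [hD.sink h hh j (act_eq_inr.1 hj) h' hh' ((act_eq_inl.1 hh2).trans hx.symm)]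
  acyc := by
    obtain ⟨ht, hht⟩ := hD.acyc
    refine ⟨fun x => ht (g.1.symm x), ?_⟩
    rintro _ ⟨h, hh, rfl⟩ x y hx hy
    obtain ⟨x, rfl⟩ := g.1.surjective x
    obtain ⟨y, rfl⟩ := g.1.surjective y
    rw [← Sym.map_bar] at hy
    simpa using hht h hh x y (act_eq_inl.1 hx) (act_eq_inl.1 hy)

theorem adm_act_iff : Adm (HairForest.act g p) (g.2.2.1 '' D) ↔ Adm p D := by
  refine ⟨fun h => ?_, fun h => h.act g⟩
  have := h.act g⁻¹
  rw [← act_mul, inv_mul_cancel, act_one, Set.image_image] at this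
  have h2 : (fun x => (g⁻¹).2.2.1 (g.2.2.1 x)) '' D = D := by
    rw [show (fun x => (g⁻¹).2.2.1 (g.2.2.1 x)) = id from
      funext fun x => Equiv.symm_apply_apply g.2.2.1 x, Set.image_id]
  rwa [h2] at this

end

/-! ### Oriented graphs with an ordering of the directed edges -/

/-- `l` is a list without repetition of the elements of the admissible set `D`. -/
structure Lists (p : Hf e → Fin v ⊕ Fin s) (D : Set (Hf e)) (l : Fin m → Hf e) : Prop where
  adm : Adm p D
  inj : Function.Injective l
  range : Set.range l = D

namespace Lists

variable {p p' : Hf e → Fin v ⊕ Fin s} {D D' : Set (Hf e)} {l l' : Fin m → Hf e}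

theorem mem (L : Lists p D l) (i : Fin m) : l i ∈ D := L.range ▸ ⟨i, rfl⟩

theorem fst_inj (L : Lists p D l) {i j : Fin m} (h : (l i).1 = (l j).1) : i = j := by
  rcases eq_or_eq_bar h with h | h
  · exact L.inj h
  · exact (L.adm.opp _ (L.mem j) (h ▸ L.mem i)).elim

/-- Every edge is either a zigzag or occurs in the list. -/
noncomputable def edges (L : Lists p D l) : Zig D ⊕ Fin m ≃ Fin e :=
  Equiv.ofBijective (Sum.elim (fun b => b.1) fun i => (l i).1) (by
    constructor
    · rintro (b | i) (b' | j) h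
      · exact congrArg Sum.inl (Subtype.ext h)
      · exact (b.2 (l j).2 ((show b.1 = (l j).1 from h) ▸ L.mem j)).elim
      · exact (b'.2 (l i).2 ((show (l i).1 = b'.1 from h) ▸ L.mem i)).elim
      · exact congrArg Sum.inr (L.fst_inj h)
    · intro b
      by_cases h : ∀ i, (b, i) ∉ D
      · exact ⟨Sum.inl ⟨b, h⟩, rfl⟩
      · push Not at h
        obtain ⟨i, hi⟩ := h
        rw [← L.range] at hi
        obtain ⟨j, hj⟩ := hi
        exact ⟨Sum.inr j, congrArg Prod.fst hj⟩)

/-- The vertices of the oriented graph and the directed edges together correspond to the vertices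
and edges of the hairy graph. -/
noncomputable def vertEquiv (L : Lists p D l) : (Fin v ⊕ Zig D) ⊕ Fin m ≃ Fin v ⊕ Fin e :=
  (Equiv.sumAssoc _ _ _).trans ((Equiv.refl _).sumCongr L.edges)

/-- The edges of the oriented graph, the directed edges and the hairs together correspond to the
half-edges of the hairy graph. -/
noncomputable def edgeEquiv (L : Lists p D l) (hp : Hairy p) :
    Edge p D ⊕ (Fin m ⊕ Fin s) ≃ Hf e :=
  Equiv.ofBijective (Sum.elim (fun k => k.1) (Sum.elim l (outer hp))) (by
    constructor
    · have h1 : ∀ i j, l i ≠ outer hp j := by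
        intro i j h
        obtain ⟨x, hx⟩ := L.adm.src_int _ (L.mem i)
        rw [h, p_outer hp j] at hx
        exact Sum.inr_ne_inl hx
      rintro (k | i | j) (k' | i' | j') h
      · exact congrArg Sum.inl (Subtype.ext h)
      · exact (k.2.1 ((show k.1 = l i' from h) ▸ L.mem i')).elim
      · have h2 := k.p_eq
        rw [show k.1 = outer hp j' from h, p_outer hp j'] at h2
        exact (Sum.inr_ne_inl h2).elim
      · exact (k'.2.1 ((show l i = k'.1 from h) ▸ L.mem i)).elim
      · exact congrArg (fun i => Sum.inr (Sum.inl i)) (L.inj h)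
      · exact (h1 _ _ h).elim
      · have h2 := k'.p_eq
        rw [← show outer hp j = k'.1 from h, p_outer hp j] at h2
        exact (Sum.inr_ne_inl h2).elim
      · exact (h1 _ _ (Eq.symm h)).elim
      · have h2 := p_outer hp j
        rw [show outer hp j = outer hp j' from h, p_outer hp j'] at h2
        exact congrArg (fun i => Sum.inr (Sum.inr i)) (Sum.inr_injective h2).symm
    · intro h
      by_cases hD : h ∈ D
      · rw [← L.range] at hD
        obtain ⟨i, hi⟩ := hD
        exact ⟨Sum.inr (Sum.inl i), hi⟩
      · rcases hx : p h with x | j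
        · exact ⟨Sum.inl ⟨h, hD, x, hx⟩, rfl⟩
        · exact ⟨Sum.inr (Sum.inr j), (eq_outer hp hx).symm⟩)

variable {w r : ℕ}

/-- The sign that compares numberings of the vertices and edges of the oriented graph with the list
of directed edges. -/
noncomputable def fr (N : ℤ) (L : Lists p D l) (hp : Hairy p) (nV : Fin v ⊕ Zig D ≃ Fin w)
    (nE : Edge p D ≃ Fin r) : ℤˣ :=
  if Even N then esign ((nE.symm.sumCongr (Equiv.refl (Fin m ⊕ Fin s))).trans (L.edgeEquiv hp))
  else esign ((nV.symm.sumCongr (Equiv.refl (Fin m))).trans L.vertEquiv)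

theorem fr_trans (N : ℤ) (L : Lists p D l) (hp : Hairy p) (nV : Fin v ⊕ Zig D ≃ Fin w)
    (nE : Edge p D ≃ Fin r) (σ : Equiv.Perm (Fin w)) (π : Equiv.Perm (Fin r)) :
    L.fr N hp (nV.trans σ) (nE.trans π) =
      Gr.relSign N σ (1 : Equiv.Perm (Fin 0)) π * L.fr N hp nV nE := by
  unfold fr Gr.relSign
  split_ifs
  · rw [← Equiv.Perm.sign_inv π, ← mul_one (Equiv.Perm.sign π⁻¹), ← Equiv.Perm.sign_one
      (α := Fin m ⊕ Fin s), ← Equiv.Perm.sign_sumCongr, ← esign_perm_trans]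
    congr 1
    ext z : 1
    rcases z with z | z <;> rfl
  · rw [Equiv.Perm.sign_one, mul_one, ← Equiv.Perm.sign_inv σ, ← mul_one (Equiv.Perm.sign σ⁻¹),
      ← Equiv.Perm.sign_one (α := Fin m), ← Equiv.Perm.sign_sumCongr, ← esign_perm_trans]
    congr 1
    ext z : 1
    rcases z with z | z <;> rfl

end Lists

end HairForest


namespace HairForest

variable {v s e m : ℕ} {p : Hf e → Fin v ⊕ Fin s} {D D' : Set (Hf e)} {l l' : Fin m → Hf e}

/-! ### The action of renumberings on oriented graphs -/

section

variable (g : Ren v s e) (hκ : ∀ h, h ∈ D ↔ g.2.2.1 h ∈ D')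

/-- The bijection between zigzags induced by a renumbering. -/
def zigIso : Zig D ≃ Zig D' :=
  Equiv.subtypeEquiv (Sym.edgePerm g.2.2) (by
    intro b
    have h1 : ∀ i, ∃ j, g.2.2.1 (b, i) = (Sym.edgePerm g.2.2 b, j) := fun i =>
      ⟨_, Prod.ext (Sym.edgePerm_apply g.2.2 (b, i)).symm rfl⟩
    have h2 : ∀ j, ∃ i, g.2.2.1 (b, i) = (Sym.edgePerm g.2.2 b, j) := by
      intro j
      obtain ⟨⟨c, i⟩, hi⟩ := g.2.2.1.surjective (Sym.edgePerm g.2.2 b, j)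
      have h3 := Sym.edgePerm_apply g.2.2 (c, i)
      rw [hi] at h3
      obtain rfl := (Sym.edgePerm g.2.2).injective h3
      exact ⟨i, hi⟩
    constructor
    · intro h j hj
      obtain ⟨i, hi⟩ := h2 j
      exact h i ((hκ _).2 (hi ▸ hj))
    · intro h i hi
      obtain ⟨j, hj⟩ := h1 i
      exact h j (hj ▸ (hκ _).1 hi))

/-- The bijection between vertices induced by a renumbering. -/
def vIso : Fin v ⊕ Zig D ≃ Fin v ⊕ Zig D' := Equiv.sumCongr g.1 (zigIso g hκ)

/-- The bijection between edges induced by a renumbering. -/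
def eIso (p : Hf e → Fin v ⊕ Fin s) : Edge p D ≃ Edge (act g p) D' :=
  Equiv.subtypeEquiv g.2.2.1 (by
    intro h
    refine and_congr (not_congr (hκ h)) ⟨fun ⟨x, hx⟩ => ⟨g.1 x, act_eq_inl.2 hx⟩, ?_⟩
    rintro ⟨x, hx⟩
    obtain ⟨x, rfl⟩ := g.1.surjective x
    exact ⟨x, act_eq_inl.1 hx⟩)

theorem eIso_x (k : Edge p D) : (eIso g hκ p k).x = g.1 k.x :=
  Edge.x_eq _ (act_eq_inl.2 k.p_eq)

theorem og_t_eIso (k : Edge p D) :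
    (og (act g p) D').t (eIso g hκ p k) = vIso g hκ ((og p D).t k) :=
  congrArg Sum.inl (eIso_x g hκ k)

theorem og_s_eIso (hD : Adm p D) (k : Edge p D) :
    (og (act g p) D').s (eIso g hκ p k) = vIso g hκ ((og p D).s k) := by
  have h1 : bar (eIso g hκ p k).1 = g.2.2.1 (bar k.1) := (Sym.map_bar g.2.2 k.1).symm
  by_cases h : bar k.1 ∈ D
  · obtain ⟨x, hx⟩ := hD.src_int _ h
    rw [og_s_arc k h hx]
    exact og_s_arc _ (h1 ▸ (hκ _).1 h) (h1 ▸ act_eq_inl.2 hx)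
  · have h2 : bar (eIso g hκ p k).1 ∉ D' := h1 ▸ fun h3 => h ((hκ _).2 h3)
    rw [og_s_zig k h, og_s_zig _ h2]
    exact congrArg Sum.inr (Subtype.ext (Sym.edgePerm_apply g.2.2 k.1).symm)

theorem Lists.act (L : Lists p D l) (g : Ren v s e) (π : Equiv.Perm (Fin m)) :
    Lists (act g p) (g.2.2.1 '' D) (fun i => g.2.2.1 (l (π i))) where
  adm := L.adm.act g
  inj := g.2.2.1.injective.comp (L.inj.comp π.injective)
  range := by
    rw [← L.range, ← Set.range_comp, ← π.surjective.range_comp (g.2.2.1 ∘ l)]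
    rfl

/-- A renumbering of the hairy graph changes the frame by its character and by the sign of the
permutation of the list: the bijection that defines the frame is composed with the renumbering of
the half-edges, or of the vertices and edges. -/
theorem Lists.fr_act {N : ℤ} (L : Lists p D l) (hp : Hairy p) (L' : Lists (HairForest.act g p) D' l')
    (hp' : Hairy (HairForest.act g p)) (π : Equiv.Perm (Fin m))
    (hl : ∀ i, l' i = g.2.2.1 (l (π i))) {w r : ℕ} (nV : Fin v ⊕ Zig D' ≃ Fin w)
    (nE : Edge (HairForest.act g p) D' ≃ Fin r) :
    L'.fr N hp' nV nE = chi N g * Equiv.Perm.sign π *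
      L.fr N hp ((vIso g hκ).trans nV) ((eIso g hκ p).trans nE) := by
  unfold fr chi
  simp only [MonoidHom.coe_mk, OneHom.coe_mk]
  split_ifs
  · have h1 : (nE.symm.sumCongr (Equiv.refl (Fin m ⊕ Fin s))).trans (L'.edgeEquiv hp') =
        (Equiv.Perm.sumCongr (1 : Equiv.Perm (Fin r)) (Equiv.Perm.sumCongr π g.2.1⁻¹)).trans
          (((((eIso g hκ p).trans nE).symm.sumCongr (Equiv.refl (Fin m ⊕ Fin s))).trans
            (L.edgeEquiv hp)).trans g.2.2.1) := by
      ext z : 1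
      rcases z with z | z | z
      · have h2 := Equiv.apply_symm_apply (eIso g hκ p) (nE.symm z)
        exact (congrArg Subtype.val h2).symm
      · exact hl z
      · have h2 := outer_act hp hp' (g.2.1.symm z)
        rw [Equiv.apply_symm_apply] at h2
        exact h2
    rw [h1, esign_perm_trans, esign_trans_perm, Equiv.Perm.sign_sumCongr, Equiv.Perm.sign_sumCongr,
      Equiv.Perm.sign_one, Equiv.Perm.sign_inv, one_mul]
    ac_rfl
  · have h1 : (nV.symm.sumCongr (Equiv.refl (Fin m))).trans L'.vertEquiv =
        (Equiv.Perm.sumCongr (1 : Equiv.Perm (Fin w)) π).trans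
          (((((vIso g hκ).trans nV).symm.sumCongr (Equiv.refl (Fin m))).trans L.vertEquiv).trans
            (Equiv.Perm.sumCongr g.1 (Sym.edgePerm g.2.2))) := by
      ext z : 1
      rcases z with z | z
      · obtain ⟨u, rfl⟩ := ((vIso g hκ).trans nV).surjective z
        have h2 : (((vIso g hκ).trans nV).symm.sumCongr (Equiv.refl (Fin m)))
          (Sum.inl (((vIso g hκ).trans nV) u)) = Sum.inl u := by simp
        have h3 : (nV.symm.sumCongr (Equiv.refl (Fin m)))
          (Sum.inl (((vIso g hκ).trans nV) u)) = Sum.inl (vIso g hκ u) := by simp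
        refine (congrArg L'.vertEquiv h3).trans (Eq.trans ?_ (congrArg (fun t =>
          Equiv.Perm.sumCongr g.1 (Sym.edgePerm g.2.2) (L.vertEquiv t)) h2).symm)
        rcases u with u | u <;> rfl
      · refine congrArg Sum.inr ((congrArg Prod.fst (hl z)).trans ?_)
        exact (Sym.edgePerm_apply g.2.2 (l (π z))).symm
    rw [h1, esign_perm_trans, esign_trans_perm, Equiv.Perm.sign_sumCongr, Equiv.Perm.sign_sumCongr,
      Equiv.Perm.sign_one, one_mul]
    ac_rfl

end

/-! ### The elements of the oriented complex attached to lists -/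

section

variable (K : Type*) [Field K] (N Δ : ℤ)

open Classical in
/-- The element of the oriented graph complex given by a hairy graph and a list of directed
half-edges; it is zero if the list is not admissible. -/
noncomputable def phi (p : Hf e → Fin v ⊕ Fin s) (l : Fin m → Hf e) : (orientedKind N).Space K Δ :=
  if h : Hairy p ∧ Lists p (Set.range l) l then
    h.2.fr N h.1 (Fintype.equivFin _) (Fintype.equivFin _) •
      (og p (Set.range l)).cl K N Δ (Fintype.equivFin _) (Fintype.equivFin _)
  else 0

variable {N}

theorem phi_eq (L : Lists p D l) (hp : Hairy p) {w r : ℕ} (nV : Fin v ⊕ Zig D ≃ Fin w)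
    (nE : Edge p D ≃ Fin r) :
    phi K N Δ p l = L.fr N hp nV nE • (og p D).cl K N Δ nV nE := by
  obtain rfl := L.range
  obtain rfl : Fintype.card (Fin v ⊕ Zig (Set.range l)) = w := by
    simpa using Fintype.card_congr nV
  obtain rfl : Fintype.card (Edge p (Set.range l)) = r := by
    simpa using Fintype.card_congr nE
  unfold phi
  rw [dif_pos ⟨hp, L⟩]
  have h1 : nV = (Fintype.equivFin _).trans ((Fintype.equivFin _).symm.trans nV) := by
    ext; simp
  have h2 : nE = (Fintype.equivFin _).trans ((Fintype.equivFin _).symm.trans nE) := by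
    ext; simp
  rw [h1, h2, Lists.fr_trans, TG.cl_relabel, smul_smul, mul_right_comm, Int.units_mul_self, one_mul]

variable (N) in
theorem phi_of_not (h : ¬ (Hairy p ∧ Lists p (Set.range l) l)) : phi K N Δ p l = 0 := dif_neg h

/-- Equivariance under renumberings, with the list carried along and permuted. -/
theorem phi_act (g : Ren v s e) (π : Equiv.Perm (Fin m)) (p : Hf e → Fin v ⊕ Fin s)
    (l : Fin m → Hf e) :
    phi K N Δ (act g p) (fun i => g.2.2.1 (l (π i))) =
      (chi N g * Equiv.Perm.sign π) • phi K N Δ p l := by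
  by_cases h : Hairy p ∧ Lists p (Set.range l) l
  · obtain ⟨hp, L⟩ := h
    have hκ : ∀ h, h ∈ Set.range l ↔ g.2.2.1 h ∈ g.2.2.1 '' Set.range l := fun h =>
      (g.2.2.1.injective.mem_set_image).symm
    have nV := Fintype.equivFin (Fin v ⊕ Zig (g.2.2.1 '' Set.range l))
    have nE := Fintype.equivFin (Edge (act g p) (g.2.2.1 '' Set.range l))
    rw [phi_eq K Δ (L.act g π) (hp.act g) nV nE,
      phi_eq K Δ L hp ((vIso g hκ).trans nV) ((eIso g hκ p).trans nE),
      Lists.fr_act g hκ L hp (L.act g π) (hp.act g) π (fun _ => rfl) nV nE, smul_smul,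
      TG.cl_iso K N Δ (og p (Set.range l)) _ (vIso g hκ) (eIso g hκ p) (og_s_eIso g hκ L.adm)
        (og_t_eIso g hκ) nV nE]
  · rw [phi_of_not K N Δ h, smul_zero]
    refine phi_of_not K N Δ fun h' => h ?_
    have hr : Set.range (fun i => g.2.2.1 (l (π i))) = g.2.2.1 '' Set.range l := by
      rw [← Set.range_comp, ← π.surjective.range_comp (g.2.2.1 ∘ l)]
      rfl
    refine ⟨hairy_act_iff.1 h'.1, adm_act_iff.1 (hr ▸ h'.2.adm), ?_, rfl⟩
    intro i j hij
    obtain ⟨i, rfl⟩ := π.surjective i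
    obtain ⟨j, rfl⟩ := π.surjective j
    exact congrArg π (h'.2.inj (congrArg g.2.2.1 hij))

theorem phi_perm (π : Equiv.Perm (Fin m)) (p : Hf e → Fin v ⊕ Fin s) (l : Fin m → Hf e) :
    phi K N Δ p (l ∘ π) = Equiv.Perm.sign π • phi K N Δ p l := by
  have := phi_act K Δ (N := N) (1 : Ren v s e) π p l
  rw [act_one, map_one, one_mul] at this
  exact this

end

end HairForest


namespace HairForest

variable {v s e m : ℕ} {p : Hf e → Fin v ⊕ Fin s} {D : Set (Hf e)} {l : Fin m → Hf e}

/-! ### Contraction of a half of a zigzag -/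

theorem d_cls_of_adm {𝒢 : GraphKind} (K : Type*) [Field K] (Δ : ℤ) {Γ : Gr} (h : 𝒢.adm Γ) :
    𝒢.d K Δ (𝒢.cls K Δ Γ) = 𝒢.contractions K Δ Γ := by
  by_cases hd : Γ.degree 𝒢.N = Δ
  · exact GraphKind.d_cls K h hd
  · have h0 : 𝒢.cls K Δ Γ = 0 := dif_neg fun h' => hd h'.2
    rw [h0, map_zero]
    symm
    refine Finset.sum_eq_zero fun q _ => ?_
    have h1 : 𝒢.cls K (Δ + 1) (Γ.contract q) = 0 := by
      refine dif_neg fun h' => hd ?_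
      have := h'.2
      rw [Gr.degree_contract] at this
      omega
    rw [h1, smul_zero, ite_self]

theorem Adm.ne (hD : Adm p D) (k : Edge p D) : (og p D).s k ≠ (og p D).t k := by
  obtain ⟨ht, hht⟩ := hD.exists_height
  intro h
  have := hht k
  rw [h] at this
  exact lt_irrefl _ this

/-- Directing a zigzag at an end without hair keeps all conditions except for acyclicity. -/
theorem Adm.insert (hD : Adm p D) (k : Edge p D) (hk : bar k.1 ∉ D)
    (hx : ∀ h ∈ D, p h = Sum.inl k.x → ∃ y, p (bar h) = Sum.inl y)
    (hac : ∃ ht : Fin v → ℕ, ∀ h ∈ Insert.insert k.1 D, ∀ x y, p h = Sum.inl x →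
      p (bar h) = Sum.inl y → ht y < ht x) : Adm p (Insert.insert k.1 D) where
  opp := by
    rintro h (rfl | hh) h'
    · rcases h' with h' | h'
      · exact bar_ne _ h'
      · exact hk h'
    · rcases h' with h' | h'
      · apply hk
        rw [← h', bar_bar]
        exact hh
      · exact hD.opp h hh h'
  src_int := by
    rintro h (rfl | hh)
    · exact k.2.2
    · exact hD.src_int h hh
  hair h j hj := Or.inr (hD.hair h j hj)
  out x := by
    obtain ⟨h, hh, h1⟩ := hD.out x
    exact ⟨h, Or.inr hh, h1⟩
  sink := by
    rintro h (rfl | hh) j hj h' hh' hhh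
    · have := hD.hair (bar k.1) j hj
      rw [bar_bar] at this
      exact (k.2.1 this).elim
    · rcases hh' with rfl | hh'
      · obtain ⟨y, hy⟩ := hx h hh (hhh.symm.trans k.p_eq)
        rw [hj] at hy
        exact (Sum.inr_ne_inl hy).elim
      · exact hD.sink h hh j hj h' hh' hhh
  acyc := hac

/-- An admissible set remains admissible after removing an element if every vertex still has an
outgoing arc. -/
theorem Adm.of_insert {h : Hf e} (hD : Adm p (Insert.insert h D)) (hh : h ∉ D)
    (hout : ∀ x, ∃ h ∈ D, p h = Sum.inl x) : Adm p D where
  opp h' h1 h2 := hD.opp h' (Or.inr h1) (Or.inr h2)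
  src_int h' h1 := hD.src_int h' (Or.inr h1)
  hair h' j hj := by
    rcases hD.hair h' j hj with h1 | h1
    · exfalso
      obtain ⟨x, hx⟩ := hD.src_int h (Or.inl rfl)
      obtain ⟨h2, h3, h4⟩ := hout x
      have := hD.sink h (Or.inl rfl) j (by rw [← h1, bar_bar]; exact hj) h2 (Or.inr h3)
        (h4.trans hx.symm)
      exact hh (this ▸ h3)
    · exact h1
  out := hout
  sink h' h1 j hj h2 h3 := hD.sink h' (Or.inr h1) j hj h2 (Or.inr h3)
  acyc := by
    obtain ⟨ht, hht⟩ := hD.acyc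
    exact ⟨ht, fun h' h1 => hht h' (Or.inr h1)⟩

section

variable (hD : Adm p D) (k : Edge p D) (hk : bar k.1 ∉ D)

/-- The zigzag to which an edge belongs. -/
def Edge.zigOf (k : Edge p D) (hk : bar k.1 ∉ D) : Zig D := ⟨k.1.1, k.zig hk⟩

theorem zig_of_insert {k : Edge p D} {b : Fin e} (hb : ∀ i, (b, i) ∉ Insert.insert k.1 D) :
    b ≠ k.1.1 := by
  rintro rfl
  exact hb k.1.2 (Or.inl rfl)

/-- Directing a zigzag removes its source from the vertices. -/
noncomputable def zigVert : Option (Fin v ⊕ Zig (Insert.insert k.1 D)) ≃ Fin v ⊕ Zig D :=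
  Equiv.ofBijective (fun o => o.elim (Sum.inr (k.zigOf hk))
    (Sum.map id fun b => (⟨b.1, fun i hi => b.2 i (Or.inr hi)⟩ : Zig D))) (by
    constructor
    · rintro (_ | x | b) (_ | x' | b') h
      · rfl
      · exact (Sum.inr_ne_inl h).elim
      · exact (zig_of_insert b'.2 (congrArg Subtype.val (Sum.inr_injective h)).symm).elim
      · exact (Sum.inl_ne_inr h).elim
      · exact congrArg (fun x => some (Sum.inl x)) (Sum.inl_injective h)
      · exact (Sum.inl_ne_inr h).elim
      · exact (zig_of_insert b.2 (congrArg Subtype.val (Sum.inr_injective h))).elim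
      · exact (Sum.inr_ne_inl h).elim
      · exact congrArg (fun x => some (Sum.inr x))
          (Subtype.ext (congrArg (fun b : Zig D => b.1) (Sum.inr_injective h)))
    · rintro (x | b)
      · exact ⟨some (Sum.inl x), rfl⟩
      · by_cases hb : b.1 = k.1.1
        · exact ⟨none, congrArg Sum.inr (Subtype.ext hb.symm)⟩
        · refine ⟨some (Sum.inr ⟨b.1, ?_⟩), rfl⟩
          rintro i (hi | hi)
          · exact hb (congrArg Prod.fst hi)
          · exact b.2 i hi)

/-- Directing a zigzag removes one of its two edges. -/
noncomputable def zigEdges : Option (Edge p (Insert.insert k.1 D)) ≃ Edge p D :=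
  Equiv.ofBijective (fun o => o.elim k
    (fun k' => (⟨k'.1, fun h => k'.2.1 (Or.inr h), k'.2.2⟩ : Edge p D))) (by
    constructor
    · rintro (_ | k') (_ | k'') h
      · rfl
      · exact (k''.2.1 (Or.inl (congrArg Subtype.val h).symm)).elim
      · exact (k'.2.1 (Or.inl (congrArg Subtype.val h))).elim
      · exact congrArg some (Subtype.ext (congrArg (fun k : Edge p D => k.1) h))
    · intro k'
      by_cases h : k'.1 = k.1
      · exact ⟨none, Subtype.ext h.symm⟩
      · exact ⟨some ⟨k'.1, fun h' => h'.elim h k'.2.1, k'.2.2⟩, rfl⟩)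

variable (K : Type*) [Field K] (N Δ : ℤ) {w r : ℕ}

include hD in
/-- The contraction of one half of a zigzag turns the zigzag into an arc. -/
theorem ct_zig (nV : Fin v ⊕ Zig (Insert.insert k.1 D) ≃ Fin w)
    (nE : Edge p (Insert.insert k.1 D) ≃ Fin r) :
    (og p D).ct K N Δ (TG.optNum (zigVert k hk).symm nV) (TG.optNum (zigEdges k).symm nE) k
        (hD.ne k) =
      if ((og p (Insert.insert k.1 D)).gr nV nE).sinks =
        ((og p D).gr (TG.optNum (zigVert k hk).symm nV) (TG.optNum (zigEdges k).symm nE)).sinks then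
        (if Even N then 1 else -1 : ℤˣ) • (og p (Insert.insert k.1 D)).cl K N (Δ + 1) nV nE
      else 0 := by
  have hsome : ∀ (x : Fin v), (zigVert k hk).symm (Sum.inl x) = some (Sum.inl x) := fun x => by
    rw [Equiv.symm_apply_eq]; rfl
  refine TG.ct_optNum K N Δ (og p D) (og p (Insert.insert k.1 D)) k (hD.ne k) (zigVert k hk).symm
    (zigEdges k).symm ?_ ?_ (Sum.inl k.x) ?_ ?_ ?_ nV nE
  · rw [Equiv.symm_apply_eq]; exact og_s_zig k hk
  · rw [Equiv.symm_apply_eq]; rfl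
  · exact hsome k.x
  · intro k'
    obtain ⟨k'', hk''⟩ : ∃ k'' : Edge p D, k'' = (zigEdges k) (some k') := ⟨_, rfl⟩
    have h1 : k''.1 = k'.1 := by rw [hk'']; rfl
    rw [Equiv.symm_symm, ← hk'']
    by_cases h : bar k'.1 ∈ D
    · obtain ⟨x, hx⟩ := hD.src_int _ h
      rw [og_s_arc k' (Or.inr h) hx, og_s_arc k'' (by rwa [h1]) (by rwa [h1]), hsome]
      rfl
    · have h2 := og_s_zig k'' (by rwa [h1])
      rw [h2]
      by_cases h3 : bar k'.1 = k.1
      · rw [og_s_arc k' (Or.inl h3) (by rw [h3]; exact k.p_eq)]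
        have h4 : (zigVert k hk).symm (Sum.inr ⟨k''.1.1, k''.zig (by rwa [h1])⟩) = none := by
          rw [Equiv.symm_apply_eq]
          refine congrArg Sum.inr (Subtype.ext ?_)
          exact (congrArg Prod.fst h1).trans ((bar_fst k'.1).symm.trans (congrArg Prod.fst h3))
        rw [h4]
        rfl
      · have h5 : bar k'.1 ∉ Insert.insert k.1 D := fun h' => h'.elim h3 h
        rw [og_s_zig k' h5]
        have h4 : (zigVert k hk).symm (Sum.inr ⟨k''.1.1, k''.zig (by rwa [h1])⟩) =
            some (Sum.inr ⟨k'.1.1, k'.zig h5⟩) := by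
          rw [Equiv.symm_apply_eq]
          exact congrArg Sum.inr (Subtype.ext (congrArg Prod.fst h1))
        rw [h4]
        rfl
  · intro k'
    have h1 : ((zigEdges k) (some k')).x = k'.x := Edge.x_eq _ k'.p_eq
    rw [Equiv.symm_symm, og_t, og_t, h1, hsome]
    rfl

/-- Moving one element from the first to the second summand. -/
noncomputable def moveOne (w m : ℕ) : Fin w ⊕ Fin (m + 1) ≃ Fin (w + 1) ⊕ Fin m :=
  Equiv.ofBijective (Sum.elim (fun i => Sum.inl i.succ) (Fin.cases (Sum.inl 0) Sum.inr)) (by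
    constructor
    · rintro (i | i) (j | j) h
      · simpa using h
      · obtain rfl | ⟨j, rfl⟩ := Fin.eq_zero_or_eq_succ j
        · exact (Fin.succ_ne_zero _ (Sum.inl_injective h)).elim
        · exact (Sum.inl_ne_inr h).elim
      · obtain rfl | ⟨i, rfl⟩ := Fin.eq_zero_or_eq_succ i
        · exact (Fin.succ_ne_zero _ (Sum.inl_injective h).symm).elim
        · exact (Sum.inr_ne_inl h).elim
      · obtain rfl | ⟨i, rfl⟩ := Fin.eq_zero_or_eq_succ i <;>
          obtain rfl | ⟨j, rfl⟩ := Fin.eq_zero_or_eq_succ j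
        · rfl
        · exact (Sum.inl_ne_inr h).elim
        · exact (Sum.inr_ne_inl h).elim
        · exact congrArg (fun i : Fin m => Sum.inr i.succ) (Sum.inr_injective h)
    · rintro (i | i)
      · obtain rfl | ⟨i, rfl⟩ := Fin.eq_zero_or_eq_succ i
        · exact ⟨Sum.inr 0, rfl⟩
        · exact ⟨Sum.inl i, rfl⟩
      · exact ⟨Sum.inr i.succ, rfl⟩)

/-- The sign of the list obtained by directing a zigzag is, up to a sign that depends on the size of
the graph only, the sign of the original list. -/
theorem exists_fr_cons (N : ℤ) (v s e m w r : ℕ) : ∃ c : ℤˣ, ∀ (p : Hf e → Fin v ⊕ Fin s)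
    (D : Set (Hf e)) (l : Fin m → Hf e) (k : Edge p D) (hk : bar k.1 ∉ D) (L : Lists p D l)
    (L' : Lists p (Insert.insert k.1 D) (Fin.cons k.1 l : Fin (m + 1) → Hf e)) (hp : Hairy p)
    (nV : Fin v ⊕ Zig (Insert.insert k.1 D) ≃ Fin w)
    (nE : Edge p (Insert.insert k.1 D) ≃ Fin r),
    L'.fr N hp nV nE =
      c * L.fr N hp (TG.optNum (zigVert k hk).symm nV) (TG.optNum (zigEdges k).symm nE) := by
  unfold Lists.fr
  by_cases hN : Even N
  · simp only [if_pos hN]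
    obtain ⟨c, hc⟩ := exists_esign_trans_left (β := Hf e)
      ((Equiv.sumAssoc (Fin r) (Fin (m + 1)) (Fin s)).symm.trans
        (((moveOne r m).sumCongr (Equiv.refl (Fin s))).trans
          (Equiv.sumAssoc (Fin (r + 1)) (Fin m) (Fin s))))
    refine ⟨c, fun p D l k hk L L' hp nV nE => ?_⟩
    rw [← hc]
    congr 1
    ext z : 1
    rcases z with z | z | z
    · have h1 : (TG.optNum (zigEdges k).symm nE).symm z.succ = zigEdges k (some (nE.symm z)) :=
        TG.optNum_symm_succ _ _ _
      exact (congrArg Subtype.val h1).symm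
    · obtain rfl | ⟨z, rfl⟩ := Fin.eq_zero_or_eq_succ z
      · have h1 : (TG.optNum (zigEdges k).symm nE).symm 0 = k := by
          rw [Equiv.symm_apply_eq, TG.optNum_none]
          rw [Equiv.symm_apply_eq]
          rfl
        exact (congrArg Subtype.val h1).symm
      · rfl
    · rfl
  · simp only [if_neg hN]
    obtain ⟨c, hc⟩ := exists_esign_trans_left (β := Fin v ⊕ Fin e) (moveOne w m)
    refine ⟨c, fun p D l k hk L L' hp nV nE => ?_⟩
    rw [← hc]
    congr 1
    ext z : 1
    rcases z with z | z
    · have h1 : (TG.optNum (zigVert k hk).symm nV).symm z.succ = zigVert k hk (some (nV.symm z)) :=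
        TG.optNum_symm_succ _ _ _
      have h2 : L.vertEquiv (Sum.inl (zigVert k hk (some (nV.symm z)))) =
          L'.vertEquiv (Sum.inl (nV.symm z)) := by
        rcases nV.symm z with u | u <;> rfl
      exact h2.symm.trans (congrArg (fun t => L.vertEquiv (Sum.inl t)) h1.symm)
    · obtain rfl | ⟨z, rfl⟩ := Fin.eq_zero_or_eq_succ z
      · have h1 : (TG.optNum (zigVert k hk).symm nV).symm 0 = Sum.inr (k.zigOf hk) := by
          rw [Equiv.symm_apply_eq, TG.optNum_none]
          rw [Equiv.symm_apply_eq]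
          rfl
        exact (congrArg (fun t => L.vertEquiv (Sum.inl t)) h1).symm
      · rfl

end

/-! ### The differential of the elements attached to lists -/

theorem Lists.cons {k : Edge p D} (L : Lists p D l) (hD : Adm p (Insert.insert k.1 D)) :
    Lists p (Insert.insert k.1 D) (Fin.cons k.1 l : Fin (m + 1) → Hf e) where
  adm := hD
  inj := by
    rw [Fin.cons_injective_iff]
    exact ⟨by rw [L.range]; exact k.2.1, L.inj⟩
  range := by rw [Fin.range_cons, L.range]

/-- Being an oriented graph, expressed for sets of directed edges: acyclicity. -/
theorem exists_height_of_oriented {D : Set (Hf e)} (hopp : ∀ h ∈ D, bar h ∉ D)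
    (h : (og p D).Oriented) :
    ∃ ht : Fin v → ℕ, ∀ h ∈ D, ∀ x y, p h = Sum.inl x → p (bar h) = Sum.inl y → ht y < ht x := by
  obtain ⟨ht, hht⟩ := h.acyclic
  refine ⟨fun x => ht (Sum.inl x), fun h hh x y hx hy => ?_⟩
  obtain ⟨k, hk⟩ : ∃ k : Edge p D, k.1 = bar h := ⟨⟨bar h, hopp h hh, y, hy⟩, rfl⟩
  have h1 := hht k
  rwa [og_s_arc k (by rwa [hk, bar_bar]) (by rw [hk, bar_bar]; exact hx),
    og_t_eq k (by rw [hk]; exact hy)] at h1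

variable (K : Type*) [Field K] (Δ : ℤ)

/-- The contraction of one half of a zigzag directs the edge, that is, adds a half-edge to the list.
If the end of that half has a hair, the contraction loses a target, so that it does not occur in the
differential, and the longer list is not admissible; if the new arc closes a cycle, both sides
vanish as well. The sign depends on the numbers of vertices, edges and arcs only. -/
theorem exists_ct_zig (N : ℤ) (v s e m : ℕ) : ∃ c : ℤˣ, ∀ (p : Hf e → Fin v ⊕ Fin s)
    (D : Set (Hf e)) (l : Fin m → Hf e) (L : Lists p D l) (hp : Hairy p) (k : Edge p D)
    (_ : bar k.1 ∉ D) {w r : ℕ} (nV : Fin v ⊕ Zig D ≃ Fin w) (nE : Edge p D ≃ Fin r),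
    L.fr N hp nV nE • (og p D).ct K N Δ nV nE k (L.adm.ne k) =
      c • phi K N (Δ + 1) p (Fin.cons k.1 l : Fin (m + 1) → Hf e) := by
  choose c hc using exists_fr_cons N v s e m
  refine ⟨c (v + e - m - 1) (2 * e - m - s - 1) * (if Even N then 1 else -1),
    fun p D l L hp k hk w r nV nE => ?_⟩
  obtain ⟨w', ⟨nV'⟩⟩ : ∃ w', Nonempty (Fin v ⊕ Zig (Insert.insert k.1 D) ≃ Fin w') :=
    ⟨_, ⟨Fintype.equivFin _⟩⟩
  obtain ⟨r', ⟨nE'⟩⟩ : ∃ r', Nonempty (Edge p (Insert.insert k.1 D) ≃ Fin r') :=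
    ⟨_, ⟨Fintype.equivFin _⟩⟩
  obtain rfl : w' + 1 = w := by
    simpa using Fintype.card_congr ((TG.optNum (zigVert k hk).symm nV').symm.trans nV)
  obtain rfl : r' + 1 = r := by
    simpa using Fintype.card_congr ((TG.optNum (zigEdges k).symm nE').symm.trans nE)
  have h1 : nV = (TG.optNum (zigVert k hk).symm nV').trans
    ((TG.optNum (zigVert k hk).symm nV').symm.trans nV) := by ext; simp
  have h2 : nE = (TG.optNum (zigEdges k).symm nE').trans
    ((TG.optNum (zigEdges k).symm nE').symm.trans nE) := by ext; simp
  rw [h1, h2, Lists.fr_trans, TG.ct_relabel, smul_smul, mul_right_comm, Int.units_mul_self, one_mul]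
  have hr : Set.range (Fin.cons k.1 l : Fin (m + 1) → Hf e) = Insert.insert k.1 D := by
    rw [Fin.range_cons, L.range]
  rcases Adm.haired_or (p := p) (D := D) k.x with ⟨h, hh, hx, j, hj⟩ | hx
  -- a target is merged with a bivalent source, and the new vertex has an outgoing edge
  · have hs : ((og p D).gr (TG.optNum (zigVert k hk).symm nV')
        (TG.optNum (zigEdges k).symm nE')).outDeg
        (Sum.inl ((TG.optNum (zigVert k hk).symm nV') (Sum.inl k.x))) = 0 := by
      rw [TG.outDeg_gr]
      convert (L.adm.card_of_haired hh hx hj).1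
    have hs' := Gr.sinks_contract ((og p D).inner (TG.optNum (zigVert k hk).symm nV')
        (TG.optNum (zigEdges k).symm nE') k (L.adm.ne k))
    have ho : ((og p D).gr (TG.optNum (zigVert k hk).symm nV')
        (TG.optNum (zigEdges k).symm nE')).outDeg
        (Sum.inl ((TG.optNum (zigVert k hk).symm nV') ((og p D).s k))) = 2 := by
      rw [TG.outDeg_gr, og_s_zig k hk]
      convert L.adm.card_out_inr ⟨k.1.1, k.zig hk⟩
    have hne : ¬ (((og p D).gr (TG.optNum (zigVert k hk).symm nV')
        (TG.optNum (zigEdges k).symm nE')).contract ((og p D).inner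
          (TG.optNum (zigVert k hk).symm nV') (TG.optNum (zigEdges k).symm nE') k
          (L.adm.ne k))).sinks = ((og p D).gr (TG.optNum (zigVert k hk).symm nV')
        (TG.optNum (zigEdges k).symm nE')).sinks := by
      intro h3
      rw [h3] at hs'
      change _ + (if ((og p D).gr (TG.optNum (zigVert k hk).symm nV')
        (TG.optNum (zigEdges k).symm nE')).outDeg
        (Sum.inl ((TG.optNum (zigVert k hk).symm nV') (Sum.inl k.x))) = 0 then 1 else 0) =
        _ + if ((og p D).gr (TG.optNum (zigVert k hk).symm nV')
        (TG.optNum (zigEdges k).symm nE')).outDeg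
        (Sum.inl ((TG.optNum (zigVert k hk).symm nV') ((og p D).s k))) + ((og p D).gr
        (TG.optNum (zigVert k hk).symm nV') (TG.optNum (zigEdges k).symm nE')).outDeg
        (Sum.inl ((TG.optNum (zigVert k hk).symm nV') (Sum.inl k.x))) = 1 then 1 else 0 at hs'
      rw [hs, ho] at hs'
      simp at hs'
    unfold TG.ct
    rw [if_neg hne, smul_zero, phi_of_not, smul_zero]
    rintro ⟨-, h4⟩
    rw [hr] at h4
    have := h4.adm.sink h (Or.inr hh) j hj k.1 (Or.inl rfl) (k.p_eq.trans hx.symm)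
    exact k.2.1 (this ▸ hh)
  -- no hair at the end: the number of targets is kept, and only acyclicity matters
  · rw [ct_zig L.adm k hk K N Δ nV' nE']
    by_cases hac : ∃ ht : Fin v → ℕ, ∀ h ∈ Insert.insert k.1 D, ∀ x y, p h = Sum.inl x →
      p (bar h) = Sum.inl y → ht y < ht x
    · have hD' := L.adm.insert k hk hx hac
      have L' := L.cons hD'
      rw [if_pos ((hD'.sinks_og hp _ _).trans (L.adm.sinks_og hp _ _).symm),
        phi_eq K (Δ + 1) L' hp nV' nE', smul_smul, smul_smul]
      have hw : w' = v + e - m - 1 := by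
        have := Fintype.card_congr ((nV'.symm.sumCongr (Equiv.refl (Fin (m + 1)))).trans L'.vertEquiv)
        simp only [Fintype.card_sum, Fintype.card_fin] at this
        omega
      have hr' : r' = 2 * e - m - s - 1 := by
        have := Fintype.card_congr ((nE'.symm.sumCongr (Equiv.refl (Fin (m + 1) ⊕ Fin s))).trans
          (L'.edgeEquiv hp))
        simp only [Fintype.card_sum, Fintype.card_fin, Fintype.card_prod, Fintype.card_bool] at this
        omega
      subst hw hr'
      rw [hc _ _ p D l k hk L L' hp nV' nE']
      congr 1
      generalize c _ _ = c0
      generalize L.fr N hp _ _ = f0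
      generalize (if Even N then 1 else -1 : ℤˣ) = i0
      revert c0 f0 i0
      decide
    · have h0 : (og p (Insert.insert k.1 D)).cl K N (Δ + 1) nV' nE' = 0 := by
        refine GraphKind.cls_of_not K fun h3 => hac ?_
        refine exists_height_of_oriented ?_ ((TG.isOriented_iff _ _ _).1 h3)
        rintro h (rfl | hh) h'
        · rcases h' with h' | h'
          · exact bar_ne _ h'
          · exact hk h'
        · rcases h' with h' | h'
          · apply hk
            rw [← h', bar_bar]
            exact hh
          · exact L.adm.opp h hh h'
      rw [h0, smul_zero, ite_self, smul_zero, phi_of_not, smul_zero]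
      rintro ⟨-, h4⟩
      rw [hr] at h4
      exact hac h4.adm.acyc

open Classical in
/-- The contractions of arcs in the differential of an oriented graph. -/
noncomputable def arcs (N : ℤ) (hD : Adm p D) {w r : ℕ} (nV : Fin v ⊕ Zig D ≃ Fin w)
    (nE : Edge p D ≃ Fin r) : (orientedKind N).Space K (Δ + 1) :=
  ∑ k : Edge p D, if bar k.1 ∈ D then (og p D).ct K N Δ nV nE k (hD.ne k) else 0

/-- The differential directs one more zigzag or contracts an arc. -/
theorem exists_d_phi (N : ℤ) (v s e m : ℕ) : ∃ c : ℤˣ, ∀ (p : Hf e → Fin v ⊕ Fin s)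
    (D : Set (Hf e)) (l : Fin m → Hf e) (L : Lists p D l) (hp : Hairy p) {w r : ℕ}
    (nV : Fin v ⊕ Zig D ≃ Fin w) (nE : Edge p D ≃ Fin r),
    (orientedKind N).d K Δ (phi K N Δ p l) =
      c • (∑ h, phi K N (Δ + 1) p (Fin.cons h l : Fin (m + 1) → Hf e)) +
        L.fr N hp nV nE • arcs K Δ N L.adm nV nE := by
  classical
  obtain ⟨c, hc⟩ := exists_ct_zig K Δ N v s e m
  refine ⟨c, fun p D l L hp w r nV nE => ?_⟩
  have h0 : ∑ h, phi K N (Δ + 1) p (Fin.cons h l : Fin (m + 1) → Hf e) =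
      ∑ k : Edge p D, if bar k.1 ∈ D then 0 else
        phi K N (Δ + 1) p (Fin.cons k.1 l : Fin (m + 1) → Hf e) := by
    have h1 : ∀ h, ¬ (h ∉ D ∧ bar h ∉ D ∧ ∃ x, p h = Sum.inl x) →
        phi K N (Δ + 1) p (Fin.cons h l : Fin (m + 1) → Hf e) = 0 := by
      intro h hh
      refine phi_of_not K N (Δ + 1) fun h2 => hh ?_
      have h3 := h2.2.adm
      rw [Fin.range_cons, L.range] at h3
      have h4 := h2.2.inj
      rw [Fin.cons_injective_iff, L.range] at h4
      exact ⟨h4.1, fun h5 => h3.opp h (Or.inl rfl) (Or.inr h5), h3.src_int h (Or.inl rfl)⟩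
    symm
    refine Finset.sum_of_injOn (fun k => k.1) (fun _ _ _ _ h => Subtype.ext h)
      (fun _ _ => Finset.mem_univ _) ?_ ?_
    · intro h _ hh
      refine h1 h fun h2 => hh ⟨⟨h, h2.1, h2.2.2⟩, Finset.mem_coe.2 (Finset.mem_univ _), rfl⟩
    · intro k _
      by_cases hk : bar k.1 ∈ D
      · rw [if_pos hk, h1]
        exact fun h2 => h2.2.1 hk
      · rw [if_neg hk]
  have h2 : (orientedKind N).adm ((og p D).gr nV nE) :=
    (TG.isOriented_iff _ _ _).2 (by convert L.adm.oriented hp)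
  rw [phi_eq K Δ L hp nV nE, Units.smul_def, map_zsmul, ← Units.smul_def]
  unfold TG.cl
  rw [d_cls_of_adm K Δ h2]
  have h3 := TG.contractions_eq K N Δ (og p D) nV nE L.adm.ne
  rw [h3, h0, arcs, Finset.smul_sum, Finset.smul_sum, Finset.smul_sum, ← Finset.sum_add_distrib]
  refine Finset.sum_congr rfl fun k _ => ?_
  by_cases hk : bar k.1 ∈ D
  · rw [if_pos hk, if_pos hk, smul_zero, zero_add]
  · rw [if_neg hk, if_neg hk, smul_zero, add_zero]
    exact hc p D l L hp k hk nV nE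

end HairForest


namespace HairForest

/-! ### Isomorphisms between oriented graphs of hairy graphs -/

section

variable {V E V' E' : Type} [Fintype E] [DecidableEq V] [Fintype E'] [DecidableEq V']

/-- A bivalent source. -/
def TG.Biv (T : TG V E) (z : V) : Prop :=
  (Finset.univ.filter fun k => T.t k = z).card = 0 ∧
    (Finset.univ.filter fun k => T.s k = z).card = 2

theorem TG.biv_iso {T : TG V E} {T' : TG V' E'} {eV : V ≃ V'} {eE : E ≃ E'}
    (hs : ∀ k, T'.s (eE k) = eV (T.s k)) (ht : ∀ k, T'.t (eE k) = eV (T.t k)) (z : V) :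
    T'.Biv (eV z) ↔ T.Biv z := by
  have h1 : (Finset.univ.filter fun k => T.t k = z).card =
      (Finset.univ.filter fun k => T'.t k = eV z).card :=
    Finset.card_equiv eE fun k => by simp [ht]
  have h2 : (Finset.univ.filter fun k => T.s k = z).card =
      (Finset.univ.filter fun k => T'.s k = eV z).card :=
    Finset.card_equiv eE fun k => by simp [hs]
  unfold TG.Biv
  rw [h1, h2]

end

variable {v s e : ℕ} {p p' : Hf e → Fin v ⊕ Fin s} {D D' : Set (Hf e)}

theorem Adm.exists_hairEnd_iff (hD : Adm p D) (hp : Hairy p) {x : Fin v} :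
    (∃ j, hD.hairEnd hp j = x) ↔ ∀ k, (og p D).s k ≠ Sum.inl x := by
  have h1 := hD.card_out_eq_zero_iff (x := x)
  rw [Finset.card_eq_zero, Finset.filter_eq_empty_iff] at h1
  have h2 : (∀ k, (og p D).s k ≠ Sum.inl x) ↔
    ∀ ⦃k⦄, k ∈ Finset.univ → ¬ (og p D).s k = Sum.inl x := by simp
  rw [h2, h1]
  constructor
  · rintro ⟨j, hj⟩
    exact ⟨_, hD.outer_mem hp j, by rw [hD.p_bar_outer, hj], j, by rw [bar_bar]; exact p_outer hp j⟩
  · rintro ⟨h, hh, hx, j, hj⟩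
    refine ⟨j, ?_⟩
    have h3 := hD.p_bar_outer hp j
    rw [← eq_outer hp hj, bar_bar, hx] at h3
    exact (Sum.inl_injective h3).symm

section

open Classical

variable (hp : Hairy p) (hD : Adm p D) (hp' : Hairy p') (hD' : Adm p' D')
  {eV : Fin v ⊕ Zig D ≃ Fin v ⊕ Zig D'} {eE : Edge p D ≃ Edge p' D'}
  (hs : ∀ k, (og p' D').s (eE k) = eV ((og p D).s k))
  (ht : ∀ k, (og p' D').t (eE k) = eV ((og p D).t k))

include hp hD hp' hD' hs ht

omit hp' in
theorem exists_vertPerm : ∃ σ : Equiv.Perm (Fin v), ∀ x, eV (Sum.inl x) = Sum.inl (σ x) := by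
  have h1 : ∀ x, ∃ y, eV (Sum.inl x) = Sum.inl y := by
    intro x
    rcases h : eV (Sum.inl x) with y | b
    · exact ⟨y, rfl⟩
    · have h2 : (og p' D').Biv (Sum.inr b) :=
        ⟨by convert Adm.card_in_inr b, by convert hD'.card_out_inr b⟩
      rw [← h, TG.biv_iso hs ht] at h2
      exact (hD.not_biv hp x (by unfold TG.Biv at h2; convert h2)).elim
  choose σ hσ using h1
  have h2 : Function.Injective σ := by
    intro x y hxy
    have h3 := hσ x
    rw [hxy, ← hσ y] at h3
    exact Sum.inl_injective (eV.injective h3)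
  exact ⟨Equiv.ofBijective σ (Finite.injective_iff_bijective.1 h2), hσ⟩

omit hp in
theorem exists_inr (b : Zig D) : ∃ b', eV (Sum.inr b) = Sum.inr b' := by
  rcases h : eV (Sum.inr b) with y | b'
  · have h2 : (og p D).Biv (Sum.inr b) :=
      ⟨by convert Adm.card_in_inr b, by convert hD.card_out_inr b⟩
    rw [← TG.biv_iso hs ht, h] at h2
    exact (hD'.not_biv hp' y (by unfold TG.Biv at h2; convert h2)).elim
  · exact ⟨b', rfl⟩

omit ht in
theorem exists_hairPerm (σ : Equiv.Perm (Fin v)) (hσ : ∀ x, eV (Sum.inl x) = Sum.inl (σ x)) :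
    ∃ ρ : Equiv.Perm (Fin s), ∀ j, hD'.hairEnd hp' (ρ j) = σ (hD.hairEnd hp j) := by
  have h1 : ∀ j, ∃ j', hD'.hairEnd hp' j' = σ (hD.hairEnd hp j) := by
    intro j
    rw [hD'.exists_hairEnd_iff hp']
    intro k' hk'
    obtain ⟨k, rfl⟩ := eE.surjective k'
    rw [hs, ← hσ] at hk'
    exact (hD.exists_hairEnd_iff hp).1 ⟨j, rfl⟩ k (eV.injective hk')
  choose ρ hρ using h1
  have h2 : Function.Injective ρ := by
    intro x y hxy
    have h3 := hρ x
    rw [hxy, hρ y] at h3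
    exact (hD.hairEnd_injective hp (σ.injective h3)).symm
  exact ⟨Equiv.ofBijective ρ (Finite.injective_iff_bijective.1 h2), hρ⟩

/-- Every isomorphism between the oriented graphs of two hairy graphs with admissible sets comes
from a renumbering of the hairy graphs. -/
theorem exists_ren_of_iso : ∃ g : Ren v s e, p' = act g p ∧ (∀ h, h ∈ D ↔ g.2.2.1 h ∈ D') ∧
    (∀ x, eV (Sum.inl x) = Sum.inl (g.1 x)) ∧
    (∀ b, ∃ b', eV (Sum.inr b) = Sum.inr b' ∧ b'.1 = Sym.edgePerm g.2.2 b.1) ∧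
    ∀ k, (eE k).1 = g.2.2.1 k.1 := by
  obtain ⟨σ, hσ⟩ := exists_vertPerm hp hD hD' hs ht
  obtain ⟨ρ, hρ⟩ := exists_hairPerm hp hD hp' hD' hs σ hσ
  -- the bijection between the half-edges outside of the admissible sets
  have h1 : ∀ h, h ∉ D → ∃ h', h' ∉ D' ∧ p' h' = Sum.map σ ρ (p h) ∧
      (∀ k : Edge p D, k.1 = h → (eE k).1 = h') ∧ (∀ j, h = outer hp j → h' = outer hp' (ρ j)) := by
    intro h hh
    rcases hx : p h with x | j
    · obtain ⟨k, hk⟩ : ∃ k : Edge p D, k.1 = h := ⟨⟨h, hh, x, hx⟩, rfl⟩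
      refine ⟨(eE k).1, (eE k).2.1, ?_, ?_, ?_⟩
      · have h2 := ht k
        rw [og_t, og_t, hσ, k.x_eq (hk ▸ hx)] at h2
        rw [(eE k).p_eq]
        exact congrArg Sum.inl (Sum.inl_injective h2)
      · intro k' hk'
        rw [Subtype.ext (hk'.trans hk.symm)]
      · rintro j rfl
        rw [p_outer hp j] at hx
        exact (Sum.inr_ne_inl hx).elim
    · refine ⟨outer hp' (ρ j), ?_, p_outer hp' _, ?_, ?_⟩
      · intro h2
        obtain ⟨x, hx'⟩ := hD'.src_int _ h2
        rw [p_outer hp' (ρ j)] at hx'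
        exact Sum.inr_ne_inl hx'
      · intro k hk
        have h2 := k.p_eq
        rw [hk, hx] at h2
        exact (Sum.inr_ne_inl h2).elim
      · rintro j' rfl
        rw [p_outer hp j'] at hx
        rw [Sum.inr_injective hx]
  choose κ0 hκ1 hκ2 hκ3 hκ4 using h1
  have hκ5 : ∀ h (hh : h ∉ D), bar h ∈ D → bar (κ0 h hh) ∈ D' ∧
      p' (bar (κ0 h hh)) = Sum.map σ ρ (p (bar h)) := by
    intro h hh hb
    rcases hx : p h with x | j
    · obtain ⟨k, rfl⟩ : ∃ k : Edge p D, k.1 = h := ⟨⟨h, hh, x, hx⟩, rfl⟩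
      obtain ⟨y, hy⟩ := hD.src_int _ hb
      have h2 := hs k
      rw [og_s_arc k hb hy, hσ, hD'.og_s_eq_inl, hκ3 _ hh k rfl] at h2
      rw [hy]
      exact h2
    · obtain rfl := eq_outer hp hx
      rw [hκ4 _ hh j rfl]
      refine ⟨hD'.outer_mem hp' _, ?_⟩
      rw [hD'.p_bar_outer hp', hD.p_bar_outer hp, hρ]
      rfl
  have hκ6 : ∀ h (hh : h ∉ D) (hb : bar h ∉ D), κ0 (bar h) hb = bar (κ0 h hh) := by
    intro h hh hb
    obtain ⟨b, hb'⟩ : ∃ b : Zig D, b.1 = h.1 := by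
      refine ⟨⟨h.1, fun i hi => ?_⟩, rfl⟩
      rcases eq_or_eq_bar (h := (h.1, i)) (h' := h) rfl with h2 | h2
      · exact hh (h2 ▸ hi)
      · exact hb (h2 ▸ hi)
    obtain ⟨k, hk⟩ : ∃ k : Edge p D, k.1 = h :=
      ⟨⟨h, hh, by have := hD.zig_int b h.2; rwa [hb'] at this⟩, rfl⟩
    obtain ⟨k', hk'⟩ : ∃ k : Edge p D, k.1 = bar h :=
      ⟨⟨bar h, hb, by have := hD.zig_int b (!h.2); rwa [hb'] at this⟩, rfl⟩
    rw [← hκ3 h hh k hk, ← hκ3 _ hb k' hk']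
    have h2 : (og p D).s k = Sum.inr b := (hD.og_s_eq_inr k).2 (by rw [hk, hb'])
    have h3 : (og p D).s k' = Sum.inr b := (hD.og_s_eq_inr k').2 (by rw [hk', hb', bar_fst])
    obtain ⟨b', hbb⟩ := exists_inr hD hp' hD' hs ht b
    have h4 := hs k
    have h5 := hs k'
    rw [h2, hbb, hD'.og_s_eq_inr] at h4
    rw [h3, hbb, hD'.og_s_eq_inr] at h5
    rcases eq_or_eq_bar (h5.trans h4.symm) with h6 | h6
    · have h7 := congrArg Subtype.val (eE.injective (Subtype.ext h6))
      rw [hk, hk'] at h7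
      exact (bar_ne _ h7).elim
    · exact h6
  let κf : Hf e → Hf e := fun h => if hh : h ∈ D then bar (κ0 (bar h) (hD.opp h hh)) else κ0 h hh
  have hf1 : ∀ h (hh : h ∈ D), κf h = bar (κ0 (bar h) (hD.opp h hh)) := fun h hh => dif_pos hh
  have hf2 : ∀ h (hh : h ∉ D), κf h = κ0 h hh := fun h hh => dif_neg hh
  have hmem : ∀ h, h ∈ D ↔ κf h ∈ D' := by
    intro h
    by_cases hh : h ∈ D
    · rw [hf1 h hh]
      exact ⟨fun _ => (hκ5 _ _ (by rwa [bar_bar])).1, fun _ => hh⟩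
    · rw [hf2 h hh]
      exact ⟨fun h' => (hh h').elim, fun h' => (hκ1 h hh h').elim⟩
  have hinj0 : ∀ h hh h' hh', κ0 h hh = κ0 h' hh' → h = h' := by
    intro h hh h' hh' hhh
    have h2 := hκ2 h hh
    have h3 := hκ2 h' hh'
    rw [← hhh] at h3
    have h4 := (σ.injective.sumMap ρ.injective) (h2.symm.trans h3)
    rcases hx : p h with x | j
    · obtain ⟨k, rfl⟩ : ∃ k : Edge p D, k.1 = h := ⟨⟨h, hh, x, hx⟩, rfl⟩
      obtain ⟨k', rfl⟩ : ∃ k : Edge p D, k.1 = h' := ⟨⟨h', hh', x, h4 ▸ hx⟩, rfl⟩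
      rw [← hκ3 _ hh k rfl, ← hκ3 _ hh' k' rfl] at hhh
      rw [eE.injective (Subtype.ext hhh)]
    · rw [eq_outer hp hx, ← eq_outer hp (h4 ▸ hx)]
  have hinj : Function.Injective κf := by
    intro h h' hhh
    by_cases hh : h ∈ D
    · have hh' : h' ∈ D := by rwa [hmem, ← hhh, ← hmem]
      rw [hf1 h hh, hf1 h' hh'] at hhh
      exact bar_inj (hinj0 _ _ _ _ (bar_inj hhh))
    · have hh' : h' ∉ D := by rwa [hmem, ← hhh, ← hmem]
      rw [hf2 h hh, hf2 h' hh'] at hhh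
      exact hinj0 _ _ _ _ hhh
  have hbar : ∀ h, κf (bar h) = bar (κf h) := by
    intro h
    by_cases hh : h ∈ D
    · rw [hf1 h hh, hf2 _ (hD.opp h hh), bar_bar]
    · by_cases hb : bar h ∈ D
      · rw [hf1 _ hb, hf2 h hh]
        simp only [bar_bar]
      · rw [hf2 _ hb, hf2 h hh, hκ6 h hh hb]
  have hmap : ∀ h, p' (κf h) = Sum.map σ ρ (p h) := by
    intro h
    by_cases hh : h ∈ D
    · have := (hκ5 (bar h) (hD.opp h hh) (by rwa [bar_bar])).2
      rw [bar_bar] at this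
      rw [hf1 h hh, this]
    · rw [hf2 h hh, hκ2]
  let κ : Sym e := ⟨Equiv.ofBijective κf (Finite.injective_iff_bijective.1 hinj), hbar⟩
  have hE : ∀ k, (eE k).1 = κ.1 k.1 := fun k =>
    (hκ3 k.1 k.2.1 k rfl).trans (hf2 k.1 k.2.1).symm
  refine ⟨(σ, ρ, κ), ?_, hmem, hσ, fun b => ?_, hE⟩
  · funext h
    obtain ⟨h, rfl⟩ := κ.1.surjective h
    exact (hmap h).trans (act_apply (σ, ρ, κ) p h).symm
  · obtain ⟨b', hb'⟩ := exists_inr hD hp' hD' hs ht b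
    refine ⟨b', hb', ?_⟩
    have h2 := hs (hD.zigEdge b false)
    rw [hD.s_zigEdge, hb', hD'.og_s_eq_inr, hE] at h2
    exact h2.symm.trans (Sym.edgePerm_apply κ (b.1, false)).symm

end

end HairForest


namespace HairForest

/-! ### Every oriented graph comes from a hairy graph -/

theorem Adm.exists_lists {v s e : ℕ} {p : Hf e → Fin v ⊕ Fin s} {D : Set (Hf e)} (hD : Adm p D) :
    ∃ (m : ℕ) (l : Fin m → Hf e), Lists p D l := by
  classical
  let q := Fintype.equivFin D
  exact ⟨_, fun i => (q.symm i).1, hD, fun i j h => q.symm.injective (Subtype.ext h), by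
    ext h
    constructor
    · rintro ⟨i, rfl⟩
      exact (q.symm i).2
    · intro h'
      exact ⟨q ⟨h, h'⟩, by simp⟩⟩

namespace TG

variable {V E : Type} [DecidableEq V] [Fintype E] (T : TG V E)

/-- The edges of the hairy graph of an oriented graph: the edges that do not start at a bivalent
source, the bivalent sources, and the sinks, each of which receives a hair. -/
abbrev Ix : Type :=
  {k : E // ¬ T.Biv (T.s k)} ⊕ ({z : V // T.Biv z} ⊕ {z : V // ∀ k, T.s k ≠ z})

variable {T}

theorem not_biv_t (k : E) : ¬ T.Biv (T.t k) := by
  intro h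
  have := Finset.card_eq_zero.1 h.1
  rw [Finset.filter_eq_empty_iff] at this
  exact this (Finset.mem_univ k) rfl

theorem not_biv_of_sink {z : V} (hz : ∀ k, T.s k ≠ z) : ¬ T.Biv z := by
  intro h
  have h1 : (Finset.univ.filter fun k => T.s k = z) = ∅ := by
    rw [Finset.filter_eq_empty_iff]
    exact fun k _ => hz k
  have := h.2
  rw [h1] at this
  simp at this

/-- The half-edges of the hairy graph that are chosen to direct its edges. -/
def ixDir : T.Ix → Bool → Prop
  | Sum.inl _, i => i = false
  | Sum.inr (Sum.inl _), _ => False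
  | Sum.inr (Sum.inr _), i => i = false

/-- The ends of the half-edges of the hairy graph. -/
def ixEnd (half : {z : V // T.Biv z} → Bool → E) :
    T.Ix → Bool → {z : V // ¬ T.Biv z} ⊕ {z : V // ∀ k, T.s k ≠ z}
  | Sum.inl k, false => Sum.inl ⟨T.s k.1, k.2⟩
  | Sum.inl k, true => Sum.inl ⟨T.t k.1, not_biv_t k.1⟩
  | Sum.inr (Sum.inl b), i => Sum.inl ⟨T.t (half b i), not_biv_t _⟩
  | Sum.inr (Sum.inr x), false => Sum.inl ⟨x.1, not_biv_of_sink x.2⟩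
  | Sum.inr (Sum.inr x), true => Sum.inr x

theorem exists_half : ∃ half : {z : V // T.Biv z} → Bool → E, (∀ b i, T.s (half b i) = b.1) ∧
    (∀ b k, T.s k = b.1 → ∃ i, half b i = k) ∧ ∀ b, half b false ≠ half b true := by
  classical
  have h1 : ∀ b : {z : V // T.Biv z}, ∃ f : Bool → E, (∀ i, T.s (f i) = b.1) ∧
      (∀ k, T.s k = b.1 → ∃ i, f i = k) ∧ f false ≠ f true := by
    intro b
    obtain ⟨k, k', hne, hk⟩ := Finset.card_eq_two.1 b.2.2
    have h2 : ∀ c, T.s c = b.1 ↔ c = k ∨ c = k' := fun c => by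
      have := Finset.ext_iff.1 hk c
      simpa using this
    refine ⟨fun i => cond i k' k, ?_, ?_, hne⟩
    · rintro (_ | _)
      · exact (h2 k).2 (Or.inl rfl)
      · exact (h2 k').2 (Or.inr rfl)
    · intro c hc
      rcases (h2 c).1 hc with rfl | rfl
      · exact ⟨false, rfl⟩
      · exact ⟨true, rfl⟩
  choose half h1 h2 h3 using h1
  exact ⟨half, h1, h2, h3⟩

theorem Oriented.exists_sink [Finite V] (hT : T.Oriented) : ∃ z, ∀ k, T.s k ≠ z := by
  obtain ⟨ht, hht⟩ := hT.acyclic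
  have := hT.nonempty
  obtain ⟨z, hz⟩ := Finite.exists_min ht
  refine ⟨z, fun k hk => ?_⟩
  have h1 := hht k
  rw [hk] at h1
  exact absurd h1 (not_lt.2 (hz _))

theorem Oriented.three_le (hT : T.Oriented) {z : V} (hz : ¬ T.Biv z) :
    3 ≤ (Finset.univ.filter fun k => T.s k = z).card + (Finset.univ.filter fun k => T.t k = z).card +
      if (∀ k, T.s k ≠ z) then 1 else 0 := by
  have h1 := hT.two_le z
  have h2 := hT.no_passing z
  unfold Biv at hz
  have h3 : (∀ k, T.s k ≠ z) ↔ (Finset.univ.filter fun k => T.s k = z).card = 0 := by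
    rw [Finset.card_eq_zero, Finset.filter_eq_empty_iff]
    simp
  rw [if_congr h3 rfl rfl]
  split_ifs <;> omega

section

variable {half : {z : V // T.Biv z} → Bool → E} {v s e : ℕ} (nC : {z : V // ¬ T.Biv z} ≃ Fin v)
  (nS : {z : V // ∀ k, T.s k ≠ z} ≃ Fin s) (nI : T.Ix ≃ Fin e)

variable (half) in
/-- The hairy graph of an oriented graph. -/
def hg : Hf e → Fin v ⊕ Fin s := fun h => Sum.map nC nS (ixEnd half (nI.symm h.1) h.2)

/-- The admissible set of the hairy graph of an oriented graph. -/
def hgDir : Set (Hf e) := {h | ixDir (nI.symm h.1) h.2}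

theorem hg_apply (c : T.Ix) (i : Bool) :
    hg half nC nS nI (nI c, i) = Sum.map nC nS (ixEnd half c i) := by simp [hg]

theorem mem_hgDir {c : T.Ix} {i : Bool} : (nI c, i) ∈ hgDir nI ↔ ixDir c i := by simp [hgDir]

open Classical in
variable (half) in
/-- The half-edge of the hairy graph at the target of an edge. -/
noncomputable def inHalf (k : E) : T.Ix × Bool :=
  if h : T.Biv (T.s k) then (Sum.inr (Sum.inl ⟨T.s k, h⟩), decide (half ⟨T.s k, h⟩ true = k))
  else (Sum.inl ⟨k, h⟩, true)

theorem inHalf_of_not {k : E} (h : ¬ T.Biv (T.s k)) : inHalf half k = (Sum.inl ⟨k, h⟩, true) :=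
  dif_neg h

theorem not_ixDir_inHalf (k : E) : ¬ ixDir (inHalf half k).1 (inHalf half k).2 := by
  unfold inHalf
  split_ifs with h
  · exact id
  · exact Bool.noConfusion

variable (h1 : ∀ b i, T.s (half b i) = b.1) (h2 : ∀ b k, T.s k = b.1 → ∃ i, half b i = k)
  (h3 : ∀ b, half b false ≠ half b true)

include h1 h3 in
theorem inHalf_half (b : {z : V // T.Biv z}) (i : Bool) :
    inHalf half (half b i) = (Sum.inr (Sum.inl b), i) := by
  have hb : T.Biv (T.s (half b i)) := by rw [h1]; exact b.2
  have hb' : (⟨T.s (half b i), hb⟩ : {z : V // T.Biv z}) = b := Subtype.ext (h1 b i)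
  refine (dif_pos hb).trans ?_
  rw [hb']
  cases i
  · simp [(h3 b).symm]
  · simp

include h2 in
theorem exists_eq_half {k : E} (h : T.Biv (T.s k)) : ∃ b i, k = half b i := by
  obtain ⟨i, hi⟩ := h2 ⟨T.s k, h⟩ k rfl
  exact ⟨_, i, hi.symm⟩

include h1 h2 h3 in
theorem ixEnd_inHalf (k : E) :
    ixEnd half (inHalf half k).1 (inHalf half k).2 = Sum.inl ⟨T.t k, not_biv_t k⟩ := by
  by_cases h : T.Biv (T.s k)
  · obtain ⟨b, i, rfl⟩ := exists_eq_half h2 h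
    rw [inHalf_half h1 h3]
    rfl
  · rw [inHalf_of_not h]
    rfl

include h1 h2 h3 in
theorem inHalf_injective : Function.Injective (inHalf (T := T) half) := by
  intro k k' hk
  by_cases h : T.Biv (T.s k)
  · obtain ⟨b, i, rfl⟩ := exists_eq_half h2 h
    rw [inHalf_half h1 h3] at hk
    by_cases h' : T.Biv (T.s k')
    · obtain ⟨b', i', rfl⟩ := exists_eq_half h2 h'
      rw [inHalf_half h1 h3] at hk
      simp only [Prod.mk.injEq, Sum.inr.injEq, Sum.inl.injEq] at hk
      rw [hk.1, hk.2]
    · rw [inHalf_of_not h'] at hk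
      simp at hk
  · rw [inHalf_of_not h] at hk
    by_cases h' : T.Biv (T.s k')
    · obtain ⟨b', i', rfl⟩ := exists_eq_half h2 h'
      rw [inHalf_half h1 h3] at hk
      simp at hk
    · rw [inHalf_of_not h'] at hk
      simpa using hk

include h1 h3 in
theorem exists_inHalf {c : T.Ix} {i : Bool} (hc : ¬ ixDir c i) {x : {z : V // ¬ T.Biv z}}
    (hx : ixEnd half c i = Sum.inl x) : ∃ k, inHalf half k = (c, i) := by
  rcases c with k | b | x'
  · cases i
    · exact (hc rfl).elim
    · exact ⟨k.1, inHalf_of_not k.2⟩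
  · exact ⟨half b i, inHalf_half h1 h3 b i⟩
  · cases i
    · exact (hc rfl).elim
    · exact (Sum.inr_ne_inl hx).elim

theorem exists_nI (h : Hf e) : ∃ c i, h = (nI c, i) := ⟨nI.symm h.1, h.2, by simp⟩

/-- The half-edge of the hairy graph at the target of an edge, with its number. -/
noncomputable def inHf (half : {z : V // T.Biv z} → Bool → E) (k : E) : Hf e :=
  (nI (inHalf half k).1, (inHalf half k).2)

include h1 h2 h3 in
theorem hg_inHf (k : E) : hg half nC nS nI (inHf nI half k) = Sum.inl (nC ⟨T.t k, not_biv_t k⟩) := by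
  unfold inHf
  rw [hg_apply, ixEnd_inHalf h1 h2 h3]
  rfl

theorem inHf_notMem (k : E) : inHf nI half k ∉ hgDir nI := by
  unfold inHf
  rw [mem_hgDir]
  exact not_ixDir_inHalf k

include h1 h2 h3 in
theorem inHf_injective : Function.Injective (inHf nI half) := by
  intro k k' hk
  refine inHalf_injective h1 h2 h3 (Prod.ext (nI.injective (congrArg Prod.fst hk))
    (congrArg (fun a : Hf e => a.2) hk))

include h1 h3 in
theorem exists_inHf {h : Hf e} (hh : h ∉ hgDir nI) {x : Fin v} (hx : hg half nC nS nI h = Sum.inl x) :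
    ∃ k, inHf nI half k = h := by
  obtain ⟨c, i, rfl⟩ := exists_nI nI h
  rw [mem_hgDir] at hh
  rw [hg_apply] at hx
  rcases hy : ixEnd half c i with y | y
  · obtain ⟨k, hk⟩ := exists_inHalf h1 h3 hh hy
    refine ⟨k, ?_⟩
    unfold inHf
    rw [hk]
  · rw [hy] at hx
    exact (Sum.inr_ne_inl hx).elim

include h1 h2 h3 in
/-- The hairy graph of an oriented graph has the core vertices as internal vertices, the targets as
external vertices, and as edges the edges between core vertices, the bivalent sources and one hair
for every target. Trivalence holds because a target gains its hair and passing vertices and bivalent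
sources are excluded. -/
theorem hairy_hg [Finite V] (hT : T.Oriented) : Hairy (hg half nC nS nI) where
  v_pos := by
    obtain ⟨z, hz⟩ := hT.exists_sink
    exact Fin.pos (nC ⟨z, not_biv_of_sink hz⟩)
  s_pos := by
    obtain ⟨z, hz⟩ := hT.exists_sink
    exact Fin.pos (nS ⟨z, hz⟩)
  connected := by
    obtain ⟨R, hR⟩ : ∃ R, R = Relation.EqvGen (fun q q' =>
      ∃ h, hg half nC nS nI h = q ∧ hg half nC nS nI (bar h) = q') := ⟨_, rfl⟩
    rw [← hR]
    have hedge : ∀ (c : T.Ix) (i j : Bool),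
        R (Sum.map nC nS (ixEnd half c i)) (Sum.map nC nS (ixEnd half c j)) := by
      have h4 : ∀ c, R (Sum.map nC nS (ixEnd half c false)) (Sum.map nC nS (ixEnd half c true)) := by
        intro c
        rw [hR]
        exact .rel _ _ ⟨(nI c, false), hg_apply nC nS nI c false, hg_apply nC nS nI c true⟩
      rintro c (_ | _) (_ | _)
      · rw [hR]; exact .refl _
      · exact h4 c
      · have := h4 c
        rw [hR] at this ⊢
        exact .symm _ _ this
      · rw [hR]; exact .refl _
    classical
    -- a bivalent source is sent to one of the two ends of its zigzag
    let f : V → Fin v ⊕ Fin s := fun z =>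
      if h : T.Biv z then Sum.map nC nS (ixEnd half (Sum.inr (Sum.inl ⟨z, h⟩)) false)
      else Sum.inl (nC ⟨z, h⟩)
    have hf1 : ∀ z (h : ¬ T.Biv z), f z = Sum.inl (nC ⟨z, h⟩) := fun z h => dif_neg h
    have hf2 : ∀ b : {z : V // T.Biv z}, f b.1 = Sum.map nC nS (ixEnd half (Sum.inr (Sum.inl b)) false) :=
      fun b => dif_pos b.2
    have hf : ∀ k, R (f (T.s k)) (f (T.t k)) := by
      intro k
      rw [hf1 _ (not_biv_t k)]
      by_cases h : T.Biv (T.s k)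
      · obtain ⟨b, i, rfl⟩ := exists_eq_half h2 h
        rw [h1, hf2]
        exact hedge (Sum.inr (Sum.inl b)) false i
      · rw [hf1 _ h]
        exact hedge (Sum.inl ⟨k, h⟩) false true
    have hf' : ∀ z z', R (f z) (f z') := by
      intro z z'
      have := hT.connected z z'
      rw [hR]
      refine TG.eqvGen_map f ?_ this
      rintro _ _ ⟨k, rfl, rfl⟩
      rw [← hR]
      exact hf k
    have hq : ∀ q, ∃ z, R q (f z) := by
      rintro (x | j)
      · obtain ⟨⟨z, hz⟩, rfl⟩ := nC.surjective x
        refine ⟨z, ?_⟩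
        rw [hf1 z hz, hR]
        exact .refl _
      · obtain ⟨⟨z, hz⟩, rfl⟩ := nS.surjective j
        refine ⟨z, ?_⟩
        rw [hf1 z (not_biv_of_sink hz)]
        exact hedge (Sum.inr (Sum.inr ⟨z, hz⟩)) true false
    intro q q'
    obtain ⟨z, hz⟩ := hq q
    obtain ⟨z', hz'⟩ := hq q'
    have := hf' z z'
    rw [hR] at hz hz' this ⊢
    exact .trans _ _ _ hz (.trans _ _ _ this (.symm _ _ hz'))
  internal x := by
    classical
    obtain ⟨⟨z, hz⟩, rfl⟩ := nC.surjective x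
    refine (hT.three_le hz).trans ?_
    have h4 : (if ∀ k, T.s k ≠ z then 1 else 0) = Fintype.card (PLift (∀ k, T.s k ≠ z)) := by
      split_ifs with h
      · exact ((Fintype.card_eq_one_iff).2 ⟨⟨h⟩, fun _ => rfl⟩).symm
      · exact ((Fintype.card_eq_zero_iff).2 ⟨fun h' => h h'.1⟩).symm
    rw [h4, ← Fintype.card_subtype, ← Fintype.card_subtype, ← Fintype.card_subtype,
      ← Fintype.card_sum, ← Fintype.card_sum]
    -- outgoing edges, incoming edges and, for a target, its hair give different half-edges
    let F : ({k // T.s k = z} ⊕ {k // T.t k = z}) ⊕ PLift (∀ k, T.s k ≠ z) →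
        {h // hg half nC nS nI h = Sum.inl (nC ⟨z, hz⟩)} := fun a => match a with
      | Sum.inl (Sum.inl k) => ⟨(nI (Sum.inl ⟨k.1, by rw [k.2]; exact hz⟩), false), by
          rw [hg_apply]
          exact congrArg (fun z => Sum.inl (nC z)) (Subtype.ext k.2)⟩
      | Sum.inl (Sum.inr k) => ⟨inHf nI half k.1, by
          rw [hg_inHf nC nS nI h1 h2 h3]
          exact congrArg (fun z => Sum.inl (nC z)) (Subtype.ext k.2)⟩
      | Sum.inr h => ⟨(nI (Sum.inr (Sum.inr ⟨z, h.1⟩)), false), by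
          rw [hg_apply]
          rfl⟩
    have hd1 : ∀ k, (nI (Sum.inl k), false) ∈ hgDir nI := fun _ => (mem_hgDir nI).2 rfl
    have hd2 : ∀ x, (nI (Sum.inr (Sum.inr x)), false) ∈ hgDir nI := fun _ => (mem_hgDir nI).2 rfl
    have hN : ∀ a b, F a = F b → (F a).1 ∈ hgDir nI → (F b).1 ∈ hgDir nI := fun a b h h' => h ▸ h'
    refine Fintype.card_le_of_injective F ?_
    rintro ((k | k) | h) ((k' | k') | h') hF
    · have := nI.injective (congrArg (fun a => a.1.1) hF)
      exact congrArg (fun k => Sum.inl (Sum.inl k))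
        (Subtype.ext (congrArg (fun k : {k // ¬ T.Biv (T.s k)} => k.1) (Sum.inl_injective this)))
    · exact (inHf_notMem nI k'.1 (hN (Sum.inl (Sum.inl k)) (Sum.inl (Sum.inr k')) hF (hd1 _))).elim
    · exact (h'.1 k.1 k.2).elim
    · exact (inHf_notMem nI k.1 (hN (Sum.inl (Sum.inl k')) (Sum.inl (Sum.inr k)) hF.symm (hd1 _))).elim
    · exact congrArg (fun k => Sum.inl (Sum.inr k))
        (Subtype.ext (inHf_injective nI h1 h2 h3 (congrArg Subtype.val hF)))
    · exact (inHf_notMem nI k.1 (hN (Sum.inr h') (Sum.inl (Sum.inr k)) hF.symm (hd2 _))).elim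
    · exact (h.1 k'.1 k'.2).elim
    · exact (inHf_notMem nI k'.1 (hN (Sum.inr h) (Sum.inl (Sum.inr k')) hF (hd2 _))).elim
    · cases h
      cases h'
      rfl
  external j := by
    obtain ⟨x, rfl⟩ := nS.surjective j
    refine ⟨(nI (Sum.inr (Sum.inr x)), true), hg_apply nC nS nI _ _, fun h hh => ?_⟩
    obtain ⟨c, i, rfl⟩ := exists_nI nI h
    rw [hg_apply] at hh
    rcases c with k | b | x' <;> cases i <;>
      simp only [ixEnd, Sum.map_inl, Sum.map_inr, reduceCtorEq, Sum.inr.injEq] at hh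
    rw [nS.injective hh]

/-- The edges between core vertices and the hairs, with their directions, form an admissible set. -/
theorem adm_hg (hT : T.Oriented) : Adm (hg half nC nS nI) (hgDir nI) where
  opp h hh hb := by
    obtain ⟨c, i, rfl⟩ := exists_nI nI h
    have hb' : (nI c, !i) ∈ hgDir nI := hb
    rw [mem_hgDir] at hh hb'
    rcases c with k | b | x
    · rw [show i = false from hh] at hb'
      exact Bool.noConfusion (show (!false) = false from hb')
    · exact hh
    · rw [show i = false from hh] at hb'
      exact Bool.noConfusion (show (!false) = false from hb')
  src_int h hh := by
    obtain ⟨c, i, rfl⟩ := exists_nI nI h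
    rw [mem_hgDir] at hh
    rw [hg_apply]
    rcases c with k | b | x
    · obtain rfl : i = false := hh
      exact ⟨_, rfl⟩
    · exact hh.elim
    · obtain rfl : i = false := hh
      exact ⟨_, rfl⟩
  hair h j hj := by
    obtain ⟨c, i, rfl⟩ := exists_nI nI h
    rw [hg_apply] at hj
    change (nI c, !i) ∈ hgDir nI
    rw [mem_hgDir]
    rcases c with k | b | x <;> cases i
    · exact (Sum.inl_ne_inr hj).elim
    · rfl
    · exact (Sum.inl_ne_inr hj).elim
    · exact (Sum.inl_ne_inr hj).elim
    · exact (Sum.inl_ne_inr hj).elim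
    · rfl
  out x := by
    obtain ⟨⟨z, hz⟩, rfl⟩ := nC.surjective x
    by_cases h : ∀ k, T.s k ≠ z
    · exact ⟨(nI (Sum.inr (Sum.inr ⟨z, h⟩)), false), (mem_hgDir nI).2 rfl, hg_apply nC nS nI _ _⟩
    · push Not at h
      obtain ⟨k, rfl⟩ := h
      exact ⟨(nI (Sum.inl ⟨k, hz⟩), false), (mem_hgDir nI).2 rfl, hg_apply nC nS nI _ _⟩
  sink h hh j hj h' hh' hhh := by
    obtain ⟨c, i, rfl⟩ := exists_nI nI h
    obtain ⟨c', i', rfl⟩ := exists_nI nI h'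
    change hg half nC nS nI (nI c, !i) = _ at hj
    rw [mem_hgDir] at hh hh'
    rw [hg_apply] at hj
    rw [hg_apply, hg_apply] at hhh
    rcases c with k | b | x
    · obtain rfl : i = false := hh
      exact (Sum.inl_ne_inr hj).elim
    · exact hh.elim
    · obtain rfl : i = false := hh
      rcases c' with k' | b' | x'
      · obtain rfl : i' = false := hh'
        exact (x.2 k'.1 (congrArg Subtype.val (nC.injective (Sum.inl_injective hhh)))).elim
      · exact hh'.elim
      · obtain rfl : i' = false := hh'
        have : x' = x := Subtype.ext (congrArg (fun z : {z // ¬ T.Biv z} => z.1)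
          (nC.injective (Sum.inl_injective hhh)))
        rw [this]
  acyc := by
    obtain ⟨ht, hht⟩ := hT.acyclic
    refine ⟨fun x => ht (nC.symm x).1, fun h hh x y hx hy => ?_⟩
    obtain ⟨c, i, rfl⟩ := exists_nI nI h
    change hg half nC nS nI (nI c, !i) = _ at hy
    rw [mem_hgDir] at hh
    rw [hg_apply] at hx hy
    rcases c with k | b | z
    · obtain rfl : i = false := hh
      obtain rfl := Sum.inl_injective hx
      obtain rfl := Sum.inl_injective hy
      simpa only [Equiv.symm_apply_apply] using hht k.1
    · exact hh.elim
    · obtain rfl : i = false := hh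
      exact (Sum.inr_ne_inl hy).elim

include h1 h2 h3 in
/-- An oriented graph is isomorphic to the oriented graph of its hairy graph. -/
theorem exists_iso_hg (hD : Adm (hg half nC nS nI) (hgDir nI)) :
    ∃ (eV : V ≃ Fin v ⊕ Zig (hgDir nI)) (eE : E ≃ Edge (hg half nC nS nI) (hgDir nI)),
      (∀ k, (og (hg half nC nS nI) (hgDir nI)).s (eE k) = eV (T.s k)) ∧
      ∀ k, (og (hg half nC nS nI) (hgDir nI)).t (eE k) = eV (T.t k) := by
  classical
  have hzig : ∀ b : {z : V // T.Biv z}, ∀ i, (nI (Sum.inr (Sum.inl b)), i) ∉ hgDir nI :=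
    fun b i h => (mem_hgDir nI).1 h
  let f : V → Fin v ⊕ Zig (hgDir nI) := fun z =>
    if h : T.Biv z then Sum.inr ⟨nI (Sum.inr (Sum.inl ⟨z, h⟩)), hzig ⟨z, h⟩⟩
    else Sum.inl (nC ⟨z, h⟩)
  have hf1 : ∀ z (h : ¬ T.Biv z), f z = Sum.inl (nC ⟨z, h⟩) := fun z h => dif_neg h
  have hf2 : ∀ b : {z : V // T.Biv z}, f b.1 = Sum.inr ⟨nI (Sum.inr (Sum.inl b)), hzig b⟩ :=
    fun b => dif_pos b.2
  have hf : Function.Bijective f := by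
    constructor
    · intro z z' hz
      by_cases h : T.Biv z <;> by_cases h' : T.Biv z'
      · rw [hf2 ⟨z, h⟩, hf2 ⟨z', h'⟩] at hz
        have := nI.injective (congrArg Subtype.val (Sum.inr_injective hz))
        exact congrArg Subtype.val (Sum.inl_injective (Sum.inr_injective this))
      · rw [hf2 ⟨z, h⟩, hf1 z' h'] at hz
        exact (Sum.inr_ne_inl hz).elim
      · rw [hf1 z h, hf2 ⟨z', h'⟩] at hz
        exact (Sum.inl_ne_inr hz).elim
      · rw [hf1 z h, hf1 z' h'] at hz
        exact congrArg Subtype.val (nC.injective (Sum.inl_injective hz))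
    · rintro (x | ⟨b, hb⟩)
      · obtain ⟨⟨z, hz⟩, rfl⟩ := nC.surjective x
        exact ⟨z, hf1 z hz⟩
      · obtain ⟨c, rfl⟩ := nI.surjective b
        rcases c with k | b | x
        · exact (hb false ((mem_hgDir nI).2 rfl)).elim
        · exact ⟨b.1, hf2 b⟩
        · exact (hb false ((mem_hgDir nI).2 rfl)).elim
  let q : E → Edge (hg half nC nS nI) (hgDir nI) := fun k =>
    ⟨inHf nI half k, inHf_notMem nI k, _, hg_inHf nC nS nI h1 h2 h3 k⟩
  have hq : Function.Bijective q := by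
    constructor
    · intro k k' hk
      exact inHf_injective nI h1 h2 h3 (congrArg Subtype.val hk)
    · rintro ⟨h, hh, x, hx⟩
      obtain ⟨k, hk⟩ := exists_inHf nC nS nI h1 h3 hh hx
      exact ⟨k, Subtype.ext hk⟩
  refine ⟨Equiv.ofBijective f hf, Equiv.ofBijective q hq, fun k => ?_, fun k => ?_⟩
  · change (og _ _).s (q k) = f (T.s k)
    by_cases h : T.Biv (T.s k)
    · obtain ⟨b, i, rfl⟩ := exists_eq_half h2 h
      rw [h1, hf2]
      refine (hD.og_s_eq_inr _).2 ?_
      change nI (inHalf half (half b i)).1 = _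
      rw [inHalf_half h1 h3]
    · rw [hf1 _ h, hD.og_s_eq_inl]
      have h4 : (q k).1 = (nI (Sum.inl ⟨k, h⟩), true) := by
        change (nI (inHalf half k).1, (inHalf half k).2) = _
        rw [inHalf_of_not h]
      rw [h4]
      exact ⟨(mem_hgDir nI).2 rfl, hg_apply nC nS nI (Sum.inl ⟨k, h⟩) false⟩
  · change (og _ _).t (q k) = f (T.t k)
    rw [hf1 _ (not_biv_t k)]
    exact og_t_eq _ (hg_inHf nC nS nI h1 h2 h3 k)

end

end TG

/-- Every generator of the oriented graph complex comes from a hairy graph. -/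
theorem exists_og_of_isOriented {Γ : Gr} (h : Γ.IsOriented) : ∃ (v s e m : ℕ)
    (p : Hf e → Fin v ⊕ Fin s) (D : Set (Hf e)) (l : Fin m → Hf e)
    (nV : Fin v ⊕ Zig D ≃ Fin Γ.v) (nE : Edge p D ≃ Fin Γ.e),
    Hairy p ∧ Lists p D l ∧ Γ = (og p D).gr nV nE := by
  classical
  obtain ⟨T, hT⟩ := TG.exists_of_gr Γ h.no_ext
  have hO : T.Oriented := (TG.isOriented_iff T (Equiv.refl _) (Equiv.refl _)).1 (hT ▸ h)
  obtain ⟨half, h1, h2, h3⟩ := TG.exists_half (T := T)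
  have nC := Fintype.equivFin {z // ¬ T.Biv z}
  have nS := Fintype.equivFin {z // ∀ k, T.s k ≠ z}
  have nI := Fintype.equivFin T.Ix
  have hp := TG.hairy_hg nC nS nI h1 h2 h3 hO
  have hD := TG.adm_hg (half := half) nC nS nI hO
  obtain ⟨m, l, L⟩ := hD.exists_lists
  obtain ⟨eV, eE, hs, ht⟩ := TG.exists_iso_hg nC nS nI h1 h2 h3 hD
  refine ⟨_, _, _, m, _, _, l, eV.symm, eE.symm, hp, L, ?_⟩
  rw [← TG.gr_iso T _ eV eE hs ht eV.symm eE.symm]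
  refine hT.trans ?_
  congr 1 <;> simp

end HairForest


namespace HairForest

/-! ### Functionals on the oriented complex -/

section

variable {𝒢 : GraphKind} (K : Type*) [Field K] {M : Type*} [AddCommGroup M] [Module K M] (Δ : ℤ)
  (F : Gr → M) (hF : ∀ Γ Γ' ε, 𝒢.Rel Γ Γ' ε → F Γ' = ε • F Γ)

include hF in
theorem relations_le_ker : 𝒢.relations K Δ ≤
    LinearMap.ker (Finsupp.linearCombination K fun Γ : 𝒢.Gens Δ => F Γ.1) := by
  refine Submodule.span_le.2 ?_
  rintro _ ⟨Γ, Γ', ε, h, rfl⟩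
  simp only [SetLike.mem_coe, LinearMap.mem_ker, map_sub, Finsupp.linearCombination_single,
    one_smul]
  rw [hF _ _ _ h, Units.smul_def, Int.cast_smul_eq_zsmul, sub_self]

/-- The linear map on a graph complex given by a function of numbered graphs that respects the
relations. -/
noncomputable def lift : 𝒢.Space K Δ →ₗ[K] M :=
  (𝒢.relations K Δ).liftQ (Finsupp.linearCombination K fun Γ : 𝒢.Gens Δ => F Γ.1)
    (relations_le_ker K Δ F hF)

theorem lift_cls {Γ : Gr} (hΓ : 𝒢.adm Γ) (hd : Γ.degree 𝒢.N = Δ) :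
    lift K Δ F hF (𝒢.cls K Δ Γ) = F Γ := by
  unfold GraphKind.cls lift
  rw [dif_pos ⟨hΓ, hd⟩, Submodule.mkQ_apply, Submodule.liftQ_apply,
    Finsupp.linearCombination_single, one_smul]

/-- A graph complex is spanned by the classes of the admissible graphs. -/
theorem span_cls : Submodule.span K {z | ∃ Γ, 𝒢.adm Γ ∧ Γ.degree 𝒢.N = Δ ∧ z = 𝒢.cls K Δ Γ} = ⊤ := by
  refine (Submodule.eq_top_iff'.2 fun z => ?_)
  obtain ⟨z, rfl⟩ := Submodule.mkQ_surjective _ z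
  induction z using Finsupp.induction_linear with
  | zero => rw [map_zero]; exact Submodule.zero_mem _
  | add f g hf hg => rw [map_add]; exact Submodule.add_mem _ hf hg
  | single Γ c =>
    have h1 : (𝒢.relations K Δ).mkQ (Finsupp.single Γ c) = c • 𝒢.cls K Δ Γ.1 := by
      unfold GraphKind.cls
      rw [dif_pos Γ.2, ← map_smul, Finsupp.smul_single, smul_eq_mul, mul_one]
    rw [h1]
    exact Submodule.smul_mem _ _ (Submodule.subset_span ⟨Γ.1, Γ.2.1, Γ.2.2, rfl⟩)

end

/-- A presentation of a numbered graph as the oriented graph of a hairy graph, together with a list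
of the directed half-edges. -/
structure Pres (v s e m : ℕ) (Γ : Gr) where
  p : Hf e → Fin v ⊕ Fin s
  D : Set (Hf e)
  l : Fin m → Hf e
  hp : Hairy p
  L : Lists p D l
  nV : Fin v ⊕ Zig D ≃ Fin Γ.v
  nE : Edge p D ≃ Fin Γ.e
  s_eq : Γ.s = 0
  src_eq : ∀ k, Γ.src (nE k) = Sum.inl (nV ((og p D).s k))
  tgt_eq : ∀ k, Γ.tgt (nE k) = Sum.inl (nV ((og p D).t k))

namespace Pres

variable {v s e m : ℕ} {Γ : Gr}

/-- The presentation of a renumbered graph. -/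
def relabel (x : Pres v s e m Γ) (σ : Equiv.Perm (Fin Γ.v)) (ρ : Equiv.Perm (Fin Γ.s))
    (π : Equiv.Perm (Fin Γ.e)) : Pres v s e m (Γ.relabel σ ρ π) where
  p := x.p
  D := x.D
  l := x.l
  hp := x.hp
  L := x.L
  nV := x.nV.trans σ
  nE := x.nE.trans π
  s_eq := x.s_eq
  src_eq k := by
    have h1 : (Γ.relabel σ ρ π).src (π (x.nE k)) = Sum.map σ ρ (Γ.src (π.symm (π (x.nE k)))) := rfl
    rw [Equiv.symm_apply_apply, x.src_eq] at h1
    exact h1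
  tgt_eq k := by
    have h1 : (Γ.relabel σ ρ π).tgt (π (x.nE k)) = Sum.map σ ρ (Γ.tgt (π.symm (π (x.nE k)))) := rfl
    rw [Equiv.symm_apply_apply, x.tgt_eq] at h1
    exact h1

/-- The presentation of a graph obtained from a presentation of a renumbered graph. -/
def ofRelabel (σ : Equiv.Perm (Fin Γ.v)) (ρ : Equiv.Perm (Fin Γ.s))
    (π : Equiv.Perm (Fin Γ.e)) (x : Pres v s e m (Γ.relabel σ ρ π)) : Pres v s e m Γ where
  p := x.p
  D := x.D
  l := x.l
  hp := x.hp
  L := x.L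
  nV := x.nV.trans σ.symm
  nE := x.nE.trans π.symm
  s_eq := x.s_eq
  src_eq k := by
    have h1 := x.src_eq k
    change Sum.map σ ρ (Γ.src (π.symm (x.nE k))) = _ at h1
    rcases h2 : Γ.src (π.symm (x.nE k)) with y | y <;> rw [h2] at h1
    · exact h2.trans (congrArg Sum.inl ((Equiv.eq_symm_apply σ).2 (Sum.inl_injective h1)))
    · exact (Sum.inr_ne_inl h1).elim
  tgt_eq k := by
    have h1 := x.tgt_eq k
    change Sum.map σ ρ (Γ.tgt (π.symm (x.nE k))) = _ at h1
    rcases h2 : Γ.tgt (π.symm (x.nE k)) with y | y <;> rw [h2] at h1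
    · exact h2.trans (congrArg Sum.inl ((Equiv.eq_symm_apply σ).2 (Sum.inl_injective h1)))
    · exact (Sum.inr_ne_inl h1).elim

/-- The sign of a presentation. -/
noncomputable def fr (N : ℤ) (x : Pres v s e m Γ) : ℤˣ := x.L.fr N x.hp x.nV x.nE

theorem gr_eq (x : Pres v s e m Γ) : Γ = (og x.p x.D).gr x.nV x.nE := by
  obtain ⟨p, D, l, hp, L, nV, nE, hs, h1, h2⟩ := x
  obtain ⟨v', s', e', src, tgt⟩ := Γ
  obtain rfl : s' = 0 := hs
  apply Gr.mk_congr
  · intro k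
    have := h1 (nE.symm k)
    rwa [Equiv.apply_symm_apply] at this
  · intro k
    have := h2 (nE.symm k)
    rwa [Equiv.apply_symm_apply] at this

theorem sinks_eq (x : Pres v s e m Γ) : Γ.sinks = s :=
  (congrArg Gr.sinks x.gr_eq).trans (x.L.adm.sinks_og x.hp x.nV x.nE)

theorem core_eq (x : Pres v s e m Γ) : core Γ = v :=
  (congrArg core x.gr_eq).trans (x.L.adm.core_og x.hp x.nV x.nE)

theorem card_v (x : Pres v s e m Γ) : Γ.v + m = v + e := by
  have := Fintype.card_congr ((x.nV.symm.sumCongr (Equiv.refl (Fin m))).trans x.L.vertEquiv)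
  simpa only [Fintype.card_sum, Fintype.card_fin] using this

theorem card_e (x : Pres v s e m Γ) : Γ.e + (m + s) = e * 2 := by
  have := Fintype.card_congr ((x.nE.symm.sumCongr (Equiv.refl (Fin m ⊕ Fin s))).trans
    (x.L.edgeEquiv x.hp))
  simpa only [Fintype.card_sum, Fintype.card_fin, Fintype.card_prod, Fintype.card_bool] using this

end Pres

section

variable {K : Type*} [Field K] {v s e m : ℕ}

/-- Functions of hairy graphs and lists of half-edges that are compatible with renumberings, up to
the sign of the renumbering and of the permutation of the list. -/
structure Equi (N : ℤ) (θ : (Hf e → Fin v ⊕ Fin s) → (Fin m → Hf e) → K) : Prop where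
  act : ∀ (g : Ren v s e) (π : Equiv.Perm (Fin m)) p l,
    θ (act g p) (fun i => g.2.2.1 (l (π i))) = (chi N g * Equiv.Perm.sign π) • θ p l
  supp : ∀ p l, ¬ (Hairy p ∧ Lists p (Set.range l) l) → θ p l = 0

variable {N : ℤ} {θ : (Hf e → Fin v ⊕ Fin s) → (Fin m → Hf e) → K}

/-- The value of an equivariant function, multiplied by the frame, depends only on the numbered
oriented graph, up to the sign of its renumberings: two presentations of isomorphic oriented graphs
differ by a renumbering of the hairy graph. -/
theorem Equi.fr_eq (hθ : Equi N θ) {Γ : Gr} {σ : Equiv.Perm (Fin Γ.v)} {ρ : Equiv.Perm (Fin Γ.s)}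
    {π : Equiv.Perm (Fin Γ.e)} (x : Pres v s e m Γ) (p' : Hf e → Fin v ⊕ Fin s) (D' : Set (Hf e))
    (l' : Fin m → Hf e) (hp' : Hairy p') (L' : Lists p' D' l') (nV' : Fin v ⊕ Zig D' ≃ Fin Γ.v)
    (nE' : Edge p' D' ≃ Fin Γ.e)
    (hsrc : ∀ k, Sum.map σ ρ (Γ.src (π.symm (nE' k))) = Sum.inl (nV' ((og p' D').s k)))
    (htgt : ∀ k, Sum.map σ ρ (Γ.tgt (π.symm (nE' k))) = Sum.inl (nV' ((og p' D').t k))) :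
    L'.fr N hp' nV' nE' • θ p' l' = Gr.relSign N σ ρ π • x.fr N • θ x.p x.l := by
  have hs : ∀ k, (og p' D').s (((x.nE.trans π).trans nE'.symm) k) =
      ((x.nV.trans σ).trans nV'.symm) ((og x.p x.D).s k) := by
    intro k
    have h1 := hsrc (((x.nE.trans π).trans nE'.symm) k)
    simp only [Equiv.trans_apply, Equiv.apply_symm_apply, Equiv.symm_apply_apply, x.src_eq] at h1
    exact (Equiv.eq_symm_apply nV').2 (Sum.inl_injective h1).symm
  have ht : ∀ k, (og p' D').t (((x.nE.trans π).trans nE'.symm) k) =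
      ((x.nV.trans σ).trans nV'.symm) ((og x.p x.D).t k) := by
    intro k
    have h1 := htgt (((x.nE.trans π).trans nE'.symm) k)
    simp only [Equiv.trans_apply, Equiv.apply_symm_apply, Equiv.symm_apply_apply, x.tgt_eq] at h1
    exact (Equiv.eq_symm_apply nV').2 (Sum.inl_injective h1).symm
  obtain ⟨g, hg, hmem, hv, hz, hE⟩ := exists_ren_of_iso x.hp x.L.adm hp' L'.adm hs ht
  have hρ : Gr.relSign N σ ρ π = Gr.relSign N σ (1 : Equiv.Perm (Fin 0)) π := by
    unfold Gr.relSign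
    have : Subsingleton (Fin Γ.s) := by rw [x.s_eq]; infer_instance
    rw [Subsingleton.elim ρ 1, Equiv.Perm.sign_one, Equiv.Perm.sign_one]
  rw [hρ]
  clear hs ht hρ hsrc htgt
  unfold Pres.fr
  subst hg
  -- the two lists enumerate corresponding sets
  have hl : ∀ i, ∃ j, g.2.2.1 (x.l j) = l' i := by
    intro i
    obtain ⟨h, hh⟩ := g.2.2.1.surjective (l' i)
    have h1 : h ∈ x.D := (hmem h).2 (hh ▸ L'.mem i)
    rw [← x.L.range] at h1
    obtain ⟨j, rfl⟩ := h1
    exact ⟨j, hh⟩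
  choose q hq using hl
  have hqi : Function.Injective q := by
    intro i j hij
    have h1 := hq i
    rw [hij, hq j] at h1
    exact (L'.inj h1).symm
  let q' : Equiv.Perm (Fin m) := Equiv.ofBijective q (Finite.injective_iff_bijective.1 hqi)
  have hl' : l' = fun i => g.2.2.1 (x.l (q' i)) := funext fun i => (hq i).symm
  have hV : (vIso g hmem).trans nV' = x.nV.trans σ := by
    ext z : 1
    rw [Equiv.trans_apply, ← Equiv.eq_symm_apply]
    rcases z with z | b
    · exact (hv z).symm
    · obtain ⟨b', hb, hb'⟩ := hz b
      refine Eq.trans (congrArg Sum.inr (Subtype.ext ?_)) hb.symm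
      exact hb'.symm
  have hE' : (eIso g hmem x.p).trans nE' = x.nE.trans π := by
    ext k : 1
    rw [Equiv.trans_apply, ← Equiv.eq_symm_apply]
    exact (Subtype.ext (hE k)).symm
  rw [Lists.fr_act g hmem x.L x.hp L' hp' q' (fun i => (hq i).symm) nV' nE', hV, hE', hl', hθ.act,
    Lists.fr_trans, smul_smul, smul_smul]
  congr 1
  generalize chi N g * Equiv.Perm.sign q' = a
  generalize Gr.relSign N σ (1 : Equiv.Perm (Fin 0)) π = b
  generalize x.L.fr N x.hp x.nV x.nE = c
  revert a b c
  decide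

theorem Equi.pres_eq (hθ : Equi N θ) {Γ : Gr} {σ : Equiv.Perm (Fin Γ.v)} {ρ : Equiv.Perm (Fin Γ.s)}
    {π : Equiv.Perm (Fin Γ.e)} (x : Pres v s e m Γ) (x' : Pres v s e m (Γ.relabel σ ρ π)) :
    x'.fr N • θ x'.p x'.l = Gr.relSign N σ ρ π • x.fr N • θ x.p x.l :=
  hθ.fr_eq x x'.p x'.D x'.l x'.hp x'.L x'.nV x'.nE x'.src_eq x'.tgt_eq

open Classical in
/-- The value on a graph of the functional given by an equivariant function. -/
noncomputable def gval (N : ℤ) (θ : (Hf e → Fin v ⊕ Fin s) → (Fin m → Hf e) → K) (Γ : Gr) : K :=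
  if h : Nonempty (Pres v s e m Γ) then h.some.fr N • θ h.some.p h.some.l else 0

theorem gval_relabel (hθ : Equi N θ) (Γ : Gr) (σ : Equiv.Perm (Fin Γ.v)) (ρ : Equiv.Perm (Fin Γ.s))
    (π : Equiv.Perm (Fin Γ.e)) :
    gval N θ (Γ.relabel σ ρ π) = Gr.relSign N σ ρ π • gval N θ Γ := by
  unfold gval
  by_cases h : Nonempty (Pres v s e m Γ)
  · have h' : Nonempty (Pres v s e m (Γ.relabel σ ρ π)) := ⟨h.some.relabel σ ρ π⟩
    rw [dif_pos h, dif_pos h', hθ.pres_eq h.some h'.some]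
  · have h' : ¬ Nonempty (Pres v s e m (Γ.relabel σ ρ π)) := fun ⟨x⟩ => h ⟨x.ofRelabel σ ρ π⟩
    rw [dif_neg h, dif_neg h', smul_zero]

theorem gval_eq (hθ : Equi N θ) {Γ : Gr} (x : Pres v s e m Γ) :
    gval N θ Γ = x.fr N • θ x.p x.l := by
  have h : Nonempty (Pres v s e m Γ) := ⟨x⟩
  have h1 : (h.some.relabel 1 1 1).fr N • θ (h.some.relabel 1 1 1).p (h.some.relabel 1 1 1).l =
      h.some.fr N • θ h.some.p h.some.l := rfl
  have h2 := hθ.pres_eq x (h.some.relabel 1 1 1)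
  rw [h1] at h2
  unfold gval
  rw [dif_pos h, h2]
  unfold Gr.relSign
  simp

variable (N) in
/-- The functional on the oriented graph complex given by an equivariant function. -/
noncomputable def psi (Δ : ℤ) (hθ : Equi N θ) : (orientedKind N).Space K Δ →ₗ[K] K :=
  lift K Δ (gval N θ) fun Γ Γ' ε h => by
    cases h with
    | relabel σ ρ π => exact gval_relabel hθ Γ σ ρ π
    | flip c hc => exact hc.elim

theorem psi_cls {Δ : ℤ} (hθ : Equi N θ) {Γ : Gr} (hΓ : Γ.IsOriented) (hd : Γ.degree N = Δ) :
    psi N Δ hθ ((orientedKind N).cls K Δ Γ) = gval N θ Γ :=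
  lift_cls K Δ _ _ hΓ hd

/-- The degree of the oriented graphs of hairy graphs with `v` internal vertices, `s` external
vertices, `e` edges and `m` directed edges. -/
def dg (N : ℤ) (v s e m : ℕ) : ℤ := (N - 1) * (2 * e - m - s) - N * (v + e - m) + N

theorem Pres.degree_eq {Γ : Gr} (x : Pres v s e m Γ) (N : ℤ) : Γ.degree N = dg N v s e m := by
  have h1 : (Γ.v : ℤ) + m = v + e := by exact_mod_cast x.card_v
  have h2 : (Γ.e : ℤ) + (m + s) = e * 2 := by exact_mod_cast x.card_e
  unfold Gr.degree dg
  have h3 : (Γ.e : ℤ) = 2 * e - m - s := by linarith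
  have h4 : (Γ.v : ℤ) = v + e - m := by linarith
  rw [x.s_eq, h3, h4]
  simp

/-- The presentation of the oriented graph of a hairy graph. -/
def presOg {p : Hf e → Fin v ⊕ Fin s} {D : Set (Hf e)} {l : Fin m → Hf e} (hp : Hairy p)
    (L : Lists p D l) {w r : ℕ} (nV : Fin v ⊕ Zig D ≃ Fin w) (nE : Edge p D ≃ Fin r) :
    Pres v s e m ((og p D).gr nV nE) where
  p := p
  D := D
  l := l
  hp := hp
  L := L
  nV := nV
  nE := nE
  s_eq := rfl
  src_eq k := by simp
  tgt_eq k := by simp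

theorem Lists.isOriented {p : Hf e → Fin v ⊕ Fin s} {D : Set (Hf e)} {l : Fin m → Hf e}
    (L : Lists p D l) (hp : Hairy p) {w r : ℕ} (nV : Fin v ⊕ Zig D ≃ Fin w)
    (nE : Edge p D ≃ Fin r) : ((og p D).gr nV nE).IsOriented := by
  classical
  exact (TG.isOriented_iff _ _ _).2 (by convert L.adm.oriented hp)

theorem psi_phi {Δ : ℤ} (hθ : Equi N θ) (hd : dg N v s e m = Δ) (p : Hf e → Fin v ⊕ Fin s)
    (l : Fin m → Hf e) : psi N Δ hθ (phi K N Δ p l) = θ p l := by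
  by_cases h : Hairy p ∧ Lists p (Set.range l) l
  · obtain ⟨hp, L⟩ := h
    have nV := Fintype.equivFin (Fin v ⊕ Zig (Set.range l))
    have nE := Fintype.equivFin (Edge p (Set.range l))
    have x := presOg hp L nV nE
    rw [phi_eq K Δ L hp nV nE, Units.smul_def, map_zsmul, ← Units.smul_def, TG.cl,
      psi_cls hθ (L.isOriented hp nV nE) (((presOg hp L nV nE).degree_eq N).trans hd),
      gval_eq hθ (presOg hp L nV nE), smul_smul]
    change (L.fr N hp nV nE * L.fr N hp nV nE) • θ p l = _
    rw [Int.units_mul_self, one_smul]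
  · rw [phi_of_not K N Δ h, map_zero, hθ.supp p l h]

theorem psi_cls_of_isEmpty {Δ : ℤ} (hθ : Equi N θ) {Γ : Gr} (h : IsEmpty (Pres v s e m Γ)) :
    psi N Δ hθ ((orientedKind N).cls K Δ Γ) = 0 := by
  by_cases h1 : (orientedKind N).adm Γ ∧ Γ.degree (orientedKind N).N = Δ
  · rw [psi_cls hθ h1.1 h1.2]
    exact dif_neg (not_nonempty_iff.2 h)
  · rw [show (orientedKind N).cls K Δ Γ = 0 from dif_neg h1, map_zero]

end

end HairForest


namespace HairForest

/-! ### Alternating functions of lists of half-edges -/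

section

open Classical

variable {K : Type*} [Field K] {v s e m : ℕ} {p : Hf e → Fin v ⊕ Fin s}

variable (p) in
/-- Alternating functions of the lists of the admissible sets of half-edges. -/
structure AltF (x : (Fin m → Hf e) → K) : Prop where
  perm : ∀ (π : Equiv.Perm (Fin m)) l, x (l ∘ π) = Equiv.Perm.sign π • x l
  supp : ∀ l, ¬ Lists p (Set.range l) l → x l = 0

variable (p) in
/-- The operator dual to directing one more edge. -/
noncomputable def delta (x : (Fin m → Hf e) → K) : (Fin (m + 1) → Hf e) → K := fun l =>
  if Lists p (Set.range l) l then ∑ i : Fin (m + 1), (-1) ^ i.1 * x (l ∘ i.succAbove) else 0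

theorem AltF.eq_cons {x : (Fin (m + 1) → Hf e) → K} (hx : AltF p x) (l : Fin (m + 1) → Hf e)
    (i : Fin (m + 1)) : x l = (-1) ^ i.1 * x (Fin.cons (l i) (l ∘ i.succAbove)) := by
  have h1 : (Fin.cons (l i) (l ∘ i.succAbove) : Fin (m + 1) → Hf e) ∘ i.cycleRange = l := by
    rw [Fin.cons_comp_cycleRange]
    exact Fin.insertNth_self_removeNth i l
  conv_lhs => rw [← h1]
  rw [hx.perm, Fin.sign_cycleRange, Units.smul_def, zsmul_eq_mul]
  simp

theorem AltF.sub {x y : (Fin m → Hf e) → K} (hx : AltF p x) (hy : AltF p y) : AltF p (x - y) where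
  perm π l := by rw [Pi.sub_apply, hx.perm, hy.perm, Pi.sub_apply, smul_sub]
  supp l hl := by rw [Pi.sub_apply, hx.supp l hl, hy.supp l hl, sub_zero]

theorem AltF.add {x y : (Fin m → Hf e) → K} (hx : AltF p x) (hy : AltF p y) : AltF p (x + y) where
  perm π l := by rw [Pi.add_apply, hx.perm, hy.perm, Pi.add_apply, smul_add]
  supp l hl := by rw [Pi.add_apply, hx.supp l hl, hy.supp l hl, add_zero]

theorem AltF.smul {x : (Fin m → Hf e) → K} (hx : AltF p x) (c : K) : AltF p (c • x) where
  perm π l := by rw [Pi.smul_apply, hx.perm, Pi.smul_apply, smul_comm]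
  supp l hl := by rw [Pi.smul_apply, hx.supp l hl, smul_zero]

theorem AltF.zero : AltF p (0 : (Fin m → Hf e) → K) where
  perm π l := by simp
  supp l hl := rfl

theorem Lists.comp_perm {l : Fin m → Hf e} (π : Equiv.Perm (Fin m)) :
    Lists p (Set.range (l ∘ π)) (l ∘ π) ↔ Lists p (Set.range l) l := by
  rw [π.surjective.range_comp l]
  refine ⟨fun h => ⟨h.adm, ?_, rfl⟩, fun h => ⟨h.adm, h.inj.comp π.injective, π.surjective.range_comp l⟩⟩
  intro i j hij
  obtain ⟨i, rfl⟩ := π.surjective i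
  obtain ⟨j, rfl⟩ := π.surjective j
  exact congrArg π (h.inj hij)

theorem range_eq_insert (l : Fin (m + 1) → Hf e) (i : Fin (m + 1)) :
    Set.range l = insert (l i) (Set.range (l ∘ i.succAbove)) := by
  rw [Set.range_comp, Fin.range_succAbove]
  ext h
  constructor
  · rintro ⟨j, rfl⟩
    by_cases hj : j = i
    · exact Or.inl (congrArg l hj)
    · exact Or.inr ⟨j, hj, rfl⟩
  · rintro (rfl | ⟨j, -, rfl⟩)
    · exact ⟨i, rfl⟩
    · exact ⟨j, rfl⟩

theorem Lists.removeNth {l : Fin (m + 1) → Hf e} (L : Lists p (Set.range l) l) (i : Fin (m + 1))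
    (hout : ∀ x, ∃ j, p (l (i.succAbove j)) = Sum.inl x) :
    Lists p (Set.range (l ∘ i.succAbove)) (l ∘ i.succAbove) where
  adm := by
    have h1 := L.adm
    rw [range_eq_insert l i] at h1
    refine h1.of_insert ?_ fun x => ?_
    · rintro ⟨j, hj⟩
      exact Fin.succAbove_ne i j (L.inj hj)
    · obtain ⟨j, hj⟩ := hout x
      exact ⟨_, ⟨j, rfl⟩, hj⟩
  inj := L.inj.comp Fin.succAbove_right_injective
  range := rfl

/-- The permutation of the remaining indices after removing one of them. -/
theorem exists_succAbove_perm (π : Equiv.Perm (Fin (m + 1))) (i : Fin (m + 1)) :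
    ∃ ρ : Equiv.Perm (Fin m), (∀ j, π (i.succAbove j) = (π i).succAbove (ρ j)) ∧
      Equiv.Perm.sign ρ = Equiv.Perm.sign π * ((-1) ^ i.1 * (-1) ^ (π i).1) := by
  have hs : ∀ (z : Fin (m + 1)) (i : Fin m), Gr.skip z i = z.succAbove i := by
    intro z i; ext; simp only [Gr.skip, Fin.succAbove, Fin.lt_def, Fin.val_castSucc]
    split_ifs <;> simp
  refine ⟨Gr.removePerm π i (π i) rfl, fun j => ?_, Gr.sign_removePerm π i (π i) rfl⟩
  rw [← hs, ← hs]
  exact (Gr.skip_removePerm π i (π i) rfl j).symm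

theorem AltF.delta {x : (Fin m → Hf e) → K} (hx : AltF p x) : AltF p (delta p x) where
  perm π l := by
    unfold HairForest.delta
    by_cases hl : Lists p (Set.range l) l
    · rw [if_pos hl, if_pos ((Lists.comp_perm π).2 hl), Finset.smul_sum]
      refine Fintype.sum_equiv π _ _ fun i => ?_
      obtain ⟨ρ, h1, h2⟩ := exists_succAbove_perm π i
      have h3 : (l ∘ π) ∘ i.succAbove = (l ∘ (π i).succAbove) ∘ ρ :=
        funext fun j => congrArg l (h1 j)
      have h4 : ∀ k : ℕ, ((-1 : K) ^ k) = (((-1) ^ k : ℤˣ) : ℤ) := fun k => by simp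
      have h5 : ∀ a b c : ℤˣ, a * (c * (a * b)) = c * b := by decide
      have h6 := congrArg (fun u : ℤˣ => ((u : ℤ) : K))
        (h5 ((-1) ^ i.1) ((-1) ^ (π i).1) (Equiv.Perm.sign π))
      simp only [Units.val_mul, Int.cast_mul] at h6
      rw [h3, hx.perm, h2, h4, h4, Units.smul_def, Units.smul_def, zsmul_eq_mul, zsmul_eq_mul]
      simp only [Units.val_mul, Int.cast_mul]
      linear_combination x (l ∘ (π i).succAbove) * h6
    · rw [if_neg hl, if_neg (mt (Lists.comp_perm π).1 hl), smul_zero]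
  supp l hl := if_neg hl

theorem delta_sub (x y : (Fin m → Hf e) → K) : delta p (x - y) = delta p x - delta p y := by
  funext l
  unfold delta
  rw [Pi.sub_apply]
  split_ifs
  · rw [← Finset.sum_sub_distrib]
    exact Finset.sum_congr rfl fun i _ => mul_sub _ _ _
  · rw [sub_zero]

theorem delta_add (x y : (Fin m → Hf e) → K) : delta p (x + y) = delta p x + delta p y := by
  funext l
  unfold delta
  rw [Pi.add_apply]
  split_ifs
  · rw [← Finset.sum_add_distrib]
    exact Finset.sum_congr rfl fun i _ => mul_add _ _ _
  · rw [add_zero]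

theorem delta_smul (c : K) (x : (Fin m → Hf e) → K) : delta p (c • x) = c • delta p x := by
  funext l
  unfold delta
  rw [Pi.smul_apply]
  split_ifs
  · rw [Finset.smul_sum]
    exact Finset.sum_congr rfl fun i _ => by
      rw [Pi.smul_apply, smul_eq_mul, smul_eq_mul]; ring
  · rw [smul_zero]

/-- The terms that remove the same two entries in the two possible orders cancel. -/
theorem delta_delta {x : (Fin m → Hf e) → K} (hx : AltF p x) : delta p (delta p x) = 0 := by
  funext l
  by_cases L : Lists p (Set.range l) l
  swap
  · exact if_neg L
  have h1 : ∀ i : Fin (m + 2), delta p x (l ∘ i.succAbove) =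
      ∑ j : Fin (m + 1), (-1) ^ j.1 * x ((l ∘ i.succAbove) ∘ j.succAbove) := by
    intro i
    by_cases h2 : Lists p (Set.range (l ∘ i.succAbove)) (l ∘ i.succAbove)
    · exact if_pos h2
    · refine (if_neg h2).trans (Finset.sum_eq_zero fun j _ => ?_).symm
      rw [hx.supp, mul_zero]
      intro h3
      refine h2 (L.removeNth i fun y => ?_)
      obtain ⟨_, ⟨k, rfl⟩, hk⟩ := h3.adm.out y
      exact ⟨_, hk⟩
  refine (if_pos L).trans ?_
  rw [Finset.sum_congr rfl fun i _ => congrArg _ (h1 i)]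
  simp only [Finset.mul_sum]
  rw [Finset.sum_sigma']
  refine Finset.sum_involution (fun a _ => ⟨a.1.succAbove a.2, a.2.predAbove a.1⟩) ?_ ?_ ?_ ?_
  · rintro ⟨i, j⟩ -
    dsimp only
    have h2 : (l ∘ (i.succAbove j).succAbove) ∘ (j.predAbove i).succAbove =
        (l ∘ i.succAbove) ∘ j.succAbove :=
      funext fun k => congrArg l (Fin.succAbove_succAbove_succAbove_predAbove i j k)
    rw [h2, ← mul_assoc, ← mul_assoc, ← add_mul, ← pow_add, ← pow_add,
      Fin.neg_one_pow_succAbove_add_predAbove, add_neg_cancel, zero_mul]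
  · rintro ⟨i, j⟩ - - h2
    exact Fin.succAbove_ne i j (congrArg Sigma.fst h2)
  · intro _ _; exact Finset.mem_sigma.2 ⟨Finset.mem_univ _, Finset.mem_univ _⟩
  · rintro ⟨i, j⟩ -
    dsimp only
    rw [Fin.succAbove_succAbove_predAbove, Fin.predAbove_predAbove_succAbove]

/-! ### Exactness -/

variable (p) in
/-- The function that, up to the support, gives the sign of the bijection between the list and the
internal vertices. -/
noncomputable def omega (l : Fin v → Hf e) : K :=
  if Lists p (Set.range l) l then
    (Matrix.of fun i j => if p (l i) = Sum.inl j then (1 : K) else 0).det else 0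

theorem altF_omega : AltF p (omega (K := K) p) where
  perm π l := by
    unfold omega
    by_cases hl : Lists p (Set.range l) l
    · rw [if_pos hl, if_pos ((Lists.comp_perm π).2 hl)]
      have := Matrix.det_permute π
        (Matrix.of fun i j => if p (l i) = Sum.inl j then (1 : K) else 0)
      rw [Units.smul_def, zsmul_eq_mul]
      exact this
    · rw [if_neg hl, if_neg (mt (Lists.comp_perm π).1 hl), smul_zero]
  supp l hl := if_neg hl

/-- The function `omega` is a cocycle, because every half-edge of a list starts at exactly one
internal vertex. -/
theorem delta_omega : delta p (omega (K := K) p) = 0 := by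
  funext l
  by_cases L : Lists p (Set.range l) l
  swap
  · exact if_neg L
  have h1 : ∀ i : Fin (v + 1), omega (K := K) p (l ∘ i.succAbove) =
      (Matrix.of fun k j => if p (l (i.succAbove k)) = Sum.inl j then (1 : K) else 0).det := by
    intro i
    by_cases h2 : Lists p (Set.range (l ∘ i.succAbove)) (l ∘ i.succAbove)
    · exact if_pos h2
    · refine (if_neg h2).trans ?_
      have h3 : ∃ x, ∀ j, p (l (i.succAbove j)) ≠ Sum.inl x := by
        by_contra h3
        push Not at h3
        exact h2 (L.removeNth i h3)
      obtain ⟨x, hx⟩ := h3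
      symm
      exact Matrix.det_eq_zero_of_column_eq_zero x fun k => if_neg (hx k)
  refine (if_pos L).trans ?_
  -- the sum is the expansion of a determinant whose first column is the sum of the others
  let A : Matrix (Fin (v + 1)) (Fin (v + 1)) K := Matrix.of fun k =>
    Fin.cons 1 fun j => if p (l k) = Sum.inl j then (1 : K) else 0
  have h2 : A.det = ∑ i : Fin (v + 1), (-1) ^ i.1 * omega (K := K) p (l ∘ i.succAbove) := by
    rw [Matrix.det_succ_column_zero]
    refine Finset.sum_congr rfl fun i _ => ?_
    rw [h1]
    have h3 : A i 0 = 1 := rfl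
    rw [h3, mul_one]
    rfl
  rw [← h2]
  refine Matrix.exists_mulVec_eq_zero_iff.1 ⟨Fin.cons 1 fun _ => -1, ?_, ?_⟩
  · intro h3
    exact one_ne_zero (congrFun h3 0)
  · funext k
    obtain ⟨x, hx⟩ := L.adm.src_int _ ⟨k, rfl⟩
    rw [Matrix.mulVec, dotProduct, Fin.sum_univ_succ]
    simp only [A, Matrix.of_apply, Fin.cons_zero, Fin.cons_succ, hx, Sum.inl.injEq]
    simp

variable {T : Fin v → Hf e}

/-- A set of internal vertices that contains with a vertex also its successor in the forest. -/
def Closed (p : Hf e → Fin v ⊕ Fin s) (T : Fin v → Hf e) (R : Finset (Fin v)) : Prop :=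
  ∀ x ∈ R, ∀ y, p (bar (T x)) = Sum.inl y → y ∈ R

/-- At the vertices in `R` the list contains no other half-edges than those of the forest. -/
def Follows (p : Hf e → Fin v ⊕ Fin s) (T : Fin v → Hf e) (R : Finset (Fin v)) (l : Fin m → Hf e) :
    Prop := ∀ x ∈ R, ∀ i, p (l i) = Sum.inl x → l i = T x

/-- A forest arc can be added at a vertex outside of a closed set on which the list follows the
forest, if the other end of the arc belongs to the closed set. -/
theorem adm_insert_forest (hT : ∀ x, p (T x) = Sum.inl x) (hA : Adm p (Set.range T))
    {R : Finset (Fin v)} (hR : Closed p T R) {x0 : Fin v} (hx0 : x0 ∉ R)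
    (hpar : ∀ y, p (bar (T x0)) = Sum.inl y → y ∈ R) {l : Fin m → Hf e}
    (L : Lists p (Set.range l) l) (hl : Follows p T R l) (hTl : T x0 ∉ Set.range l) :
    Adm p (insert (T x0) (Set.range l)) where
  opp := by
    have key : bar (T x0) ∉ Set.range l := by
      rintro ⟨i, hi⟩
      obtain ⟨y, hy⟩ := L.adm.src_int _ ⟨i, rfl⟩
      have h1 := hl y (hpar y (hi ▸ hy)) i hy
      exact hA.opp (T x0) ⟨x0, rfl⟩ ⟨y, h1.symm.trans hi⟩
    rintro h (rfl | hh) (h' | h')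
    · exact bar_ne _ h'
    · exact key h'
    · apply key
      rw [← h', bar_bar]
      exact hh
    · exact L.adm.opp h hh h'
  src_int := by
    rintro h (rfl | hh)
    · exact ⟨x0, hT x0⟩
    · exact L.adm.src_int h hh
  hair h j hj := Or.inr (L.adm.hair h j hj)
  out x := by
    obtain ⟨h, hh, h1⟩ := L.adm.out x
    exact ⟨h, Or.inr hh, h1⟩
  sink := by
    rintro h (rfl | hh) j hj h' hh' hhh
    · have := L.adm.hair _ j hj
      rw [bar_bar] at this
      exact (hTl this).elim
    · rcases hh' with rfl | hh'
      · obtain ⟨x, hx⟩ := hA.hair _ j hj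
        rw [bar_bar] at hx
        rw [hT, ← hx, hT] at hhh
        rw [Sum.inl_injective hhh, hx]
      · exact L.adm.sink h hh j hj h' hh' hhh
  acyc := by
    obtain ⟨ht, hht⟩ := L.adm.acyc
    obtain ⟨M, hM⟩ : ∃ M, ∀ x, ht x < M := by
      refine ⟨(∑ x, ht x) + 1, fun x => Nat.lt_succ_of_le ?_⟩
      exact Finset.single_le_sum (f := ht) (fun _ _ => Nat.zero_le _) (Finset.mem_univ x)
    refine ⟨fun x => if x ∈ R then ht x else ht x + M, ?_⟩
    rintro h (rfl | ⟨i, rfl⟩) x y hx hy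
    · rw [hT] at hx
      obtain rfl := Sum.inl_injective hx
      have := hM y
      simp only [if_neg hx0, if_pos (hpar y hy)]
      omega
    · have h1 := hht _ ⟨i, rfl⟩ x y hx hy
      have h2 := hM y
      by_cases hxR : x ∈ R
      · have h3 := hl x hxR i hx
        rw [h3] at hy
        simp only [if_pos hxR, if_pos (hR x hxR y hy)]
        exact h1
      · simp only [if_neg hxR]
        split_ifs <;> omega

/-- The inductive step of the proof of exactness: a cocycle that vanishes on the lists which follow
the forest on `R` can be changed by a coboundary so that it vanishes on the lists which follow the
forest on `R` minus one vertex. -/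
theorem exists_step (hT : ∀ x, p (T x) = Sum.inl x) (hA : Adm p (Set.range T))
    {R : Finset (Fin v)} {x0 : Fin v} (hR : Closed p T (R.erase x0))
    (hpar : ∀ y, p (bar (T x0)) = Sum.inl y → y ∈ R.erase x0)
    {x : (Fin (m + 1) → Hf e) → K} (hx : AltF p x) (hd : delta p x = 0)
    (hv : ∀ l, Follows p T R l → x l = 0) :
    ∃ y : (Fin m → Hf e) → K, AltF p y ∧ ∀ l, Follows p T (R.erase x0) l → x l = delta p y l := by
  -- the homotopy: contraction with the forest arc at `x0`
  obtain ⟨y, hy⟩ : ∃ y : (Fin m → Hf e) → K, y = fun l => if Lists p (Set.range l) l ∧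
      Follows p T (R.erase x0) l ∧ T x0 ∉ Set.range l then x (Fin.cons (T x0) l) else 0 := ⟨_, rfl⟩
  have hy1 : ∀ l, Lists p (Set.range l) l → Follows p T (R.erase x0) l → T x0 ∉ Set.range l →
      y l = x (Fin.cons (T x0) l) := fun l h1 h2 h3 => by rw [hy]; exact if_pos ⟨h1, h2, h3⟩
  have hy2 : ∀ l, ¬ (Lists p (Set.range l) l ∧ Follows p T (R.erase x0) l ∧ T x0 ∉ Set.range l) →
      y l = 0 := fun l h1 => by rw [hy]; exact if_neg h1
  -- removing the forest arc at `x0` is only possible if `x0` has another outgoing arc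
  have hrem : ∀ (l : Fin (m + 1) → Hf e) (i : Fin (m + 1)), Lists p (Set.range l) l → l i = T x0 →
      Follows p T (R.erase x0) (l ∘ i.succAbove) →
      ¬ Lists p (Set.range (l ∘ i.succAbove)) (l ∘ i.succAbove) → x l = 0 := by
    intro l i L hi hf hn
    refine hv l fun z hz k hk => ?_
    by_cases hki : k = i
    · rw [hki, hi, hT] at hk
      rw [hki, hi, Sum.inl_injective hk]
    · obtain ⟨k, rfl⟩ := Fin.exists_succAbove_eq hki
      by_cases hz0 : z = x0
      · exfalso
        refine hn (L.removeNth i fun w => ?_)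
        obtain ⟨_, ⟨j, rfl⟩, hj⟩ := L.adm.out w
        by_cases hji : j = i
        · rw [hji, hi, hT] at hj
          exact ⟨k, hk.trans (congrArg Sum.inl (hz0.trans (Sum.inl_injective hj)))⟩
        · obtain ⟨j, rfl⟩ := Fin.exists_succAbove_eq hji
          exact ⟨j, hj⟩
      · exact hf z (Finset.mem_erase.2 ⟨hz0, hz⟩) k hk
  refine ⟨y, ⟨fun π l => ?_, fun l hl => hy2 l fun h => hl h.1⟩, fun l hl => ?_⟩
  · by_cases h : Lists p (Set.range l) l ∧ Follows p T (R.erase x0) l ∧ T x0 ∉ Set.range l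
    · rw [hy1 l h.1 h.2.1 h.2.2, hy1 (l ∘ π) ((Lists.comp_perm π).2 h.1)
        (fun z hz i => h.2.1 z hz (π i)) (by rw [π.surjective.range_comp]; exact h.2.2)]
      have h1 : (Fin.cons (T x0) (l ∘ π) : Fin (m + 1) → Hf e) =
          Fin.cons (T x0) l ∘ Equiv.Perm.decomposeFin.symm (0, π) := by
        funext i
        refine Fin.cases ?_ (fun j => ?_) i
        · simp
        · simp
      rw [h1, hx.perm, Equiv.Perm.decomposeFin.symm_sign, if_pos rfl, one_mul]
    · rw [hy2 l h, smul_zero]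
      refine hy2 _ fun h' => h ⟨(Lists.comp_perm π).1 h'.1, fun z hz i => ?_, ?_⟩
      · obtain ⟨i, rfl⟩ := π.surjective i
        exact h'.2.1 z hz i
      · have := h'.2.2
        rwa [π.surjective.range_comp] at this
  · by_cases L : Lists p (Set.range l) l
    swap
    · rw [hx.supp l L]
      exact (if_neg L).symm
    refine Eq.trans ?_ (if_pos L).symm
    by_cases hTl : T x0 ∈ Set.range l
    · obtain ⟨i0, hi0⟩ := hTl
      rw [Finset.sum_eq_single i0]
      · rw [hx.eq_cons l i0]
        have hf : Follows p T (R.erase x0) (l ∘ i0.succAbove) := fun z hz i => hl z hz _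
        by_cases L' : Lists p (Set.range (l ∘ i0.succAbove)) (l ∘ i0.succAbove)
        · rw [hy1 _ L' hf, hi0]
          rintro ⟨j, hj⟩
          exact Fin.succAbove_ne i0 j (L.inj (hj.trans hi0.symm))
        · rw [hy2 _ fun h => L' h.1, ← hx.eq_cons l i0, mul_zero]
          exact hrem l i0 L hi0 hf L'
      · intro i _ hi
        rw [hy2, mul_zero]
        intro h
        obtain ⟨j, hj⟩ := Fin.exists_succAbove_eq (Ne.symm hi)
        exact h.2.2 ⟨j, by rw [← hi0, ← hj]; rfl⟩
      · exact fun h => (h (Finset.mem_univ _)).elim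
    · have hA' := adm_insert_forest hT hA hR (Finset.notMem_erase x0 R) hpar L hl hTl
      have L' : Lists p (Set.range (Fin.cons (T x0) l : Fin (m + 2) → Hf e)) (Fin.cons (T x0) l) :=
        ⟨by rw [Fin.range_cons]; exact hA', Fin.cons_injective_iff.2 ⟨hTl, L.inj⟩, rfl⟩
      have h1 := congrFun hd (Fin.cons (T x0) l)
      have h2 := (if_pos L').symm.trans h1
      rw [Fin.sum_univ_succ] at h2
      have h3 : (Fin.cons (T x0) l : Fin (m + 2) → Hf e) ∘ (0 : Fin (m + 2)).succAbove = l := by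
        funext i
        simp
      have h4 : ∀ i : Fin (m + 1), (Fin.cons (T x0) l : Fin (m + 2) → Hf e) ∘ i.succ.succAbove =
          Fin.cons (T x0) (l ∘ i.succAbove) := by
        intro i
        funext j
        refine Fin.cases ?_ (fun j => ?_) j
        · simp
        · simp
      rw [h3] at h2
      have h5 : ∀ i : Fin (m + 1), x (Fin.cons (T x0) (l ∘ i.succAbove)) = y (l ∘ i.succAbove) := by
        intro i
        have hf : Follows p T (R.erase x0) (l ∘ i.succAbove) := fun z hz i => hl z hz _
        have hn : T x0 ∉ Set.range (l ∘ i.succAbove) := fun ⟨j, hj⟩ => hTl ⟨_, hj⟩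
        by_cases L1 : Lists p (Set.range (l ∘ i.succAbove)) (l ∘ i.succAbove)
        · rw [hy1 _ L1 hf hn]
        · rw [hy2 _ fun h => L1 h.1]
          by_cases L2 : Lists p (Set.range (Fin.cons (T x0) (l ∘ i.succAbove) : Fin (m + 1) → Hf e))
              (Fin.cons (T x0) (l ∘ i.succAbove))
          · have h6 : (Fin.cons (T x0) (l ∘ i.succAbove) : Fin (m + 1) → Hf e) ∘
                (0 : Fin (m + 1)).succAbove = l ∘ i.succAbove := by
              funext j
              simp
            exact hrem _ 0 L2 rfl (by rw [h6]; exact hf) (by rw [h6]; exact L1)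
          · exact hx.supp _ L2
      simp only [h4, h5] at h2
      have h7 : ∑ i : Fin (m + 1), (-1 : K) ^ i.succ.1 * y (l ∘ i.succAbove) =
          - ∑ i : Fin (m + 1), (-1 : K) ^ i.1 * y (l ∘ i.succAbove) := by
        rw [← Finset.sum_neg_distrib]
        refine Finset.sum_congr rfl fun i _ => ?_
        rw [Fin.val_succ, pow_succ]
        ring
      rw [h7] at h2
      simpa [sub_eq_zero, ← sub_eq_add_neg] using h2

/-- Exactness: a cocycle that vanishes on the lists of a forest is a coboundary. -/
theorem exists_eq_delta (hT : ∀ x, p (T x) = Sum.inl x) (hA : Adm p (Set.range T))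
    (R : Finset (Fin v)) : ∀ (_ : Closed p T R) (x : (Fin (m + 1) → Hf e) → K) (_ : AltF p x)
    (_ : delta p x = 0) (_ : ∀ l, Follows p T R l → x l = 0),
    ∃ y : (Fin m → Hf e) → K, AltF p y ∧ x = delta p y := by
  induction hn : R.card generalizing R with
  | zero =>
    intro _ x _ _ hv
    rw [Finset.card_eq_zero] at hn
    refine ⟨0, AltF.zero, funext fun l => ?_⟩
    rw [hv l (by rw [hn]; exact fun z hz => (Finset.notMem_empty z hz).elim)]
    symm
    unfold delta
    split_ifs <;> simp
  | succ n ih =>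
    intro hR x hx hd hv
    obtain ⟨ht, hht⟩ := hA.acyc
    obtain ⟨x0, hx0, hmax⟩ := Finset.exists_max_image R ht (Finset.card_pos.1 (by omega))
    have hpar : ∀ z ∈ R, ∀ y, p (bar (T z)) = Sum.inl y → y ∈ R.erase x0 := by
      intro z hz y hy
      refine Finset.mem_erase.2 ⟨?_, hR z hz y hy⟩
      rintro rfl
      have h1 := hht _ ⟨z, rfl⟩ z y (hT z) hy
      exact absurd (hmax z hz) (not_le.2 h1)
    have hR' : Closed p T (R.erase x0) := fun z hz y hy => hpar z (Finset.mem_of_mem_erase hz) y hy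
    obtain ⟨y0, hy0, h0⟩ := exists_step hT hA hR' (hpar x0 hx0) hx hd hv
    obtain ⟨y1, hy1, h1⟩ := ih (R.erase x0) (by rw [Finset.card_erase_of_mem hx0]; omega) hR'
      (x - delta p y0) (hx.sub hy0.delta) (by rw [delta_sub, hd, delta_delta hy0, sub_zero])
      (fun l hl => by rw [Pi.sub_apply, h0 l hl, sub_self])
    refine ⟨y0 + y1, hy0.add hy1, ?_⟩
    rw [delta_add, ← h1]
    abel

theorem range_eq_of_follows {l : Fin m → Hf e}
    (L : Lists p (Set.range l) l) (hl : Follows p T Finset.univ l) :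
    Set.range l = Set.range T := by
  ext h
  constructor
  · rintro ⟨i, rfl⟩
    obtain ⟨x, hx⟩ := L.adm.src_int _ ⟨i, rfl⟩
    exact ⟨x, (hl x (Finset.mem_univ _) i hx).symm⟩
  · rintro ⟨x, rfl⟩
    obtain ⟨_, ⟨i, rfl⟩, hi⟩ := L.adm.out x
    exact ⟨i, hl x (Finset.mem_univ _) i hi⟩

/-- If there is a forest, the complex of alternating functions is exact at lists whose length is not
the number of internal vertices. -/
theorem exists_eq_delta_of_ne (hT : ∀ x, p (T x) = Sum.inl x) (hA : Adm p (Set.range T))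
    (hm : m + 1 ≠ v) {x : (Fin (m + 1) → Hf e) → K} (hx : AltF p x) (hd : delta p x = 0) :
    ∃ y : (Fin m → Hf e) → K, AltF p y ∧ x = delta p y := by
  refine exists_eq_delta hT hA Finset.univ (fun _ _ _ _ => Finset.mem_univ _) x hx hd fun l hl => ?_
  refine hx.supp l fun L => hm ?_
  have h1 := range_eq_of_follows L hl
  have hTi : Function.Injective T := fun z w h => by
    have := hT z
    rw [h, hT] at this
    exact (Sum.inl_injective this).symm
  have h2 := Nat.card_congr ((Equiv.ofInjective l L.inj).trans ((Equiv.setCongr h1).trans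
    (Equiv.ofInjective T hTi).symm))
  simpa using h2

/-- If there is a forest, the cohomology at the lists whose length is the number of internal
vertices is spanned by `omega`, the coefficient of a cocycle being its value at the forest. -/
theorem exists_eq_omega_add_delta {p : Hf e → Fin (m + 1) ⊕ Fin s} {T : Fin (m + 1) → Hf e}
    (hT : ∀ x, p (T x) = Sum.inl x) (hA : Adm p (Set.range T))
    {x : (Fin (m + 1) → Hf e) → K} (hx : AltF p x) (hd : delta p x = 0) :
    ∃ (c : K) (y : (Fin m → Hf e) → K), AltF p y ∧ x = c • omega p + delta p y := by
  have hTi : Function.Injective T := fun z w h => by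
    have := hT z
    rw [h, hT] at this
    exact (Sum.inl_injective this).symm
  -- the matrix of the forest itself is the identity
  have hω : omega (K := K) p T = 1 := by
    refine (if_pos ⟨hA, hTi, rfl⟩).trans ?_
    have : (Matrix.of fun i j => if p (T i) = Sum.inl j then (1 : K) else 0) = 1 := by
      ext i j
      simp [hT, Matrix.one_apply]
    rw [this, Matrix.det_one]
  obtain ⟨y, hy, h1⟩ := exists_eq_delta hT hA Finset.univ (fun _ _ _ _ => Finset.mem_univ _)
    (x - x T • omega p) (hx.sub (altF_omega.smul _))
    (by rw [delta_sub, delta_smul, hd, delta_omega, smul_zero, sub_zero]) (fun l hl => by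
      by_cases L : Lists p (Set.range l) l
      · have h1 := range_eq_of_follows L hl
        have h2 : ∃ π : Equiv.Perm (Fin (m + 1)), l = T ∘ π := by
          choose q hq using fun i => (h1 ▸ Set.mem_range_self i : l i ∈ Set.range T)
          refine ⟨Equiv.ofBijective q (Finite.injective_iff_bijective.1 fun i j hij => ?_),
            funext fun i => (hq i).symm⟩
          exact L.inj ((hq i).symm.trans ((congrArg T hij).trans (hq j)))
        obtain ⟨π, rfl⟩ := h2
        rw [Pi.sub_apply, Pi.smul_apply, hx.perm, altF_omega.perm, hω, smul_eq_mul, mul_smul_comm,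
          mul_one, sub_self]
      · exact (hx.sub (altF_omega.smul _)).supp l L)
  exact ⟨x T, y, hy, by rw [← h1]; abel⟩

end

end HairForest


namespace HairForest

/-! ### Orbit functions -/

section

open Classical

variable {K : Type*} [Field K] {v s e m : ℕ} {p q : Hf e → Fin v ⊕ Fin s}

noncomputable instance : Fintype (Ren v s e) := Fintype.ofFinite _

/-- The alternating equivariant function supported on the orbit of the graph `q` with the list
`k`. -/
noncomputable def theta (N : ℤ) (q : Hf e → Fin v ⊕ Fin s) (k : Fin m → Hf e)
    (p : Hf e → Fin v ⊕ Fin s) (l : Fin m → Hf e) : K :=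
  if Hairy q ∧ Lists q (Set.range k) k then
    ∑ g : Ren v s e, if act g p = q then
      (((chi N g : ℤˣ) : ℤ) : K) *
        (Matrix.of fun i j => if g.2.2.1 (l i) = k j then (1 : K) else 0).det else 0
  else 0

/-- A nonzero determinant of incidences forces the lists to be equal up to order. -/
theorem exists_perm_of_det_ne {α : Type*} [DecidableEq α] {l k : Fin m → α}
    (h : (Matrix.of fun i j => if l i = k j then (1 : K) else 0).det ≠ 0) :
    ∃ π : Equiv.Perm (Fin m), k = l ∘ π := by
  rw [Matrix.det_apply] at h
  obtain ⟨π, -, hπ⟩ := Finset.exists_ne_zero_of_sum_ne_zero h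
  refine ⟨π, funext fun i => ?_⟩
  by_contra hi
  refine hπ ?_
  rw [Finset.prod_eq_zero (Finset.mem_univ i), smul_zero]
  exact if_neg fun h' => hi h'.symm

theorem lists_act_iff {g : Ren v s e} {l : Fin m → Hf e} :
    Lists (act g p) (Set.range fun i => g.2.2.1 (l i)) (fun i => g.2.2.1 (l i)) ↔
      Lists p (Set.range l) l := by
  have hr : ∀ (g : Ren v s e) (l : Fin m → Hf e),
      Set.range (fun i => g.2.2.1 (l i)) = g.2.2.1 '' Set.range l := fun g l => by
    rw [← Set.range_comp]; rfl
  constructor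
  · intro h
    rw [hr] at h
    exact ⟨adm_act_iff.1 h.adm, fun i j hij => h.inj (congrArg g.2.2.1 hij), rfl⟩
  · intro h
    rw [hr]
    exact h.act g 1

theorem theta_det_eq_zero {g : Ren v s e} {k l : Fin m → Hf e} (hq : act g p = q)
    (h : ¬ (Lists p (Set.range l) l ∧ Lists q (Set.range k) k))
    (h' : Lists p (Set.range l) l ∨ Lists q (Set.range k) k) :
    (Matrix.of fun i j => if g.2.2.1 (l i) = k j then (1 : K) else 0).det = 0 := by
  by_contra h0
  obtain ⟨π, rfl⟩ := exists_perm_of_det_ne (l := fun i => g.2.2.1 (l i)) h0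
  subst hq
  have h1 : Lists (act g p) (Set.range ((fun i => g.2.2.1 (l i)) ∘ π)) ((fun i => g.2.2.1 (l i)) ∘ π) ↔
      Lists p (Set.range l) l := (Lists.comp_perm π).trans lists_act_iff
  rw [h1] at h h'
  simp_all

theorem theta_of_not (N : ℤ) {k l : Fin m → Hf e} (h : ¬ (Hairy p ∧ Lists p (Set.range l) l)) :
    theta (K := K) N q k p l = 0 := by
  unfold theta
  split_ifs with hk
  · refine Finset.sum_eq_zero fun g _ => ?_
    split_ifs with hg
    · rw [theta_det_eq_zero hg _ (Or.inr hk.2), mul_zero]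
      exact fun h1 => h ⟨hairy_act_iff.1 (hg ▸ hk.1), h1.1⟩
    · rfl
  · rfl

/-- An orbit sum with the character of the group as weight is equivariant. -/
theorem equi_theta (N : ℤ) (q : Hf e → Fin v ⊕ Fin s) (k : Fin m → Hf e) :
    Equi N (theta (K := K) N q k) where
  act g π p l := by
    unfold theta
    split_ifs with hk
    · rw [Finset.smul_sum]
      refine Fintype.sum_equiv (Equiv.mulRight g) _ _ fun g' => ?_
      rw [Equiv.coe_mulRight, act_mul]
      split_ifs
      · have h1 := Matrix.det_permute π
          (Matrix.of fun i j => if (g' * g).2.2.1 (l i) = k j then (1 : K) else 0)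
        have h2 : (Matrix.of fun i j => if g'.2.2.1 (g.2.2.1 (l (π i))) = k j then (1 : K) else 0) =
          (Matrix.of fun i j => if (g' * g).2.2.1 (l i) = k j then (1 : K) else 0).submatrix π id :=
          rfl
        have h3 : ∀ a b c : ℤˣ, a * c = (b * c) * (a * b) := by decide
        have h4 := congrArg (fun u : ℤˣ => ((u : ℤ) : K))
          (h3 (chi N g') (chi N g) (Equiv.Perm.sign π))
        rw [h2, h1, map_mul, Units.smul_def, zsmul_eq_mul, ← mul_assoc, ← mul_assoc]
        congr 1
        simp only [Units.val_mul, Int.cast_mul] at h4 ⊢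
        rw [h4]
      · rw [smul_zero]
    · rw [smul_zero]
  supp p l h := theta_of_not N h

theorem altF_theta (N : ℤ) (l : Fin m → Hf e) :
    AltF q fun k => theta (K := K) N q k p l where
  perm π k := by
    unfold theta
    rw [Lists.comp_perm π]
    split_ifs with hk
    · rw [Finset.smul_sum]
      refine Finset.sum_congr rfl fun g _ => ?_
      split_ifs
      · have h1 := Matrix.det_permute' π
          (Matrix.of fun i j => if g.2.2.1 (l i) = k j then (1 : K) else 0)
        have h2 : (Matrix.of fun i j => if g.2.2.1 (l i) = (k ∘ π) j then (1 : K) else 0) =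
          (Matrix.of fun i j => if g.2.2.1 (l i) = k j then (1 : K) else 0).submatrix id π := rfl
        rw [h2, h1, Units.smul_def, zsmul_eq_mul]
        ring
      · rw [smul_zero]
    · rw [smul_zero]
  supp k hk := if_neg fun h => hk h.2

/-- Directing one more edge is dual to the operator `delta`. -/
theorem sum_theta_cons (N : ℤ) {l : Fin m → Hf e} (L : Lists p (Set.range l) l)
    (k : Fin (m + 1) → Hf e) :
    ∑ h, theta (K := K) N q k p (Fin.cons h l : Fin (m + 1) → Hf e) =
      delta q (fun k => theta N q k p l) k := by
  unfold delta
  by_cases hk : Lists q (Set.range k) k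
  swap
  · rw [if_neg hk]
    exact Finset.sum_eq_zero fun h _ => if_neg fun h' => hk h'.2
  rw [if_pos hk]
  by_cases hq : Hairy q
  swap
  · have h0 : ∀ h, theta (K := K) N q k p (Fin.cons h l : Fin (m + 1) → Hf e) = 0 := fun h =>
      if_neg fun h' => hq h'.1
    rw [Finset.sum_eq_zero fun h _ => h0 h]
    refine (Finset.sum_eq_zero fun i _ => ?_).symm
    exact mul_eq_zero_of_right _ (if_neg fun h' => hq h'.1)
  have h1 : ∀ i : Fin (m + 1), theta (K := K) N q (k ∘ i.succAbove) p l =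
      ∑ g : Ren v s e, if act g p = q then (((chi N g : ℤˣ) : ℤ) : K) *
        (Matrix.of fun a j => if g.2.2.1 (l a) = (k ∘ i.succAbove) j then (1 : K) else 0).det
        else 0 := by
    intro i
    by_cases h2 : Lists q (Set.range (k ∘ i.succAbove)) (k ∘ i.succAbove)
    · exact if_pos ⟨hq, h2⟩
    · refine (if_neg fun h' => h2 h'.2).trans (Finset.sum_eq_zero fun g _ => ?_).symm
      split_ifs with hg
      · rw [theta_det_eq_zero hg (fun h' => h2 h'.2) (Or.inl L), mul_zero]
      · rfl
  simp only [h1]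
  unfold theta
  simp only [if_pos (And.intro hq hk), Finset.mul_sum]
  rw [Finset.sum_comm, Finset.sum_comm (s := (Finset.univ : Finset (Fin (m + 1))))]
  refine Finset.sum_congr rfl fun g _ => ?_
  by_cases hg : act g p = q
  swap
  · simp [hg]
  simp only [if_pos hg]
  simp only [Matrix.det_succ_row_zero (n := m)]
  simp only [Finset.mul_sum]
  rw [Finset.sum_comm]
  refine Finset.sum_congr rfl fun j _ => ?_
  have h2 : ∀ h, (Matrix.of fun i j => if g.2.2.1 ((Fin.cons h l : Fin (m + 1) → Hf e) i) = k j
      then (1 : K) else 0) 0 j = if h = g.2.2.1.symm (k j) then (1 : K) else 0 := by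
    intro h
    simp only [Matrix.of_apply, Fin.cons_zero, Equiv.eq_symm_apply]
  have h3 : ∀ h, ((Matrix.of fun i j => if g.2.2.1 ((Fin.cons h l : Fin (m + 1) → Hf e) i) = k j
      then (1 : K) else 0).submatrix Fin.succ j.succAbove) =
      Matrix.of fun a i => if g.2.2.1 (l a) = (k ∘ j.succAbove) i then (1 : K) else 0 := fun h => rfl
  simp only [h2, h3]
  rw [Finset.sum_eq_single (g.2.2.1.symm (k j))]
  · rw [if_pos rfl]; ring
  · intro h _ hh
    rw [if_neg hh]; ring
  · intro h; exact (h (Finset.mem_univ _)).elim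

/-- The expansion of an incidence determinant against an alternating function. -/
theorem sum_det_smul {α M : Type*} [Fintype α] [DecidableEq α] [AddCommGroup M] [Module K M]
    (F : (Fin m → α) → M) (hF : ∀ (π : Equiv.Perm (Fin m)) l, F (l ∘ π) = Equiv.Perm.sign π • F l)
    (A : Fin m → α → K) :
    ∑ k : Fin m → α, (Matrix.of fun i j => A i (k j)).det • F k =
      (m.factorial : K) • ∑ k : Fin m → α, (∏ i, A i (k i)) • F k := by
  have h1 : ∀ k : Fin m → α, (Matrix.of fun i j => A i (k j)).det • F k =
      ∑ π : Equiv.Perm (Fin m), (∏ i, A i ((k ∘ π) i)) • F (k ∘ π) := by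
    intro k
    rw [← Matrix.det_transpose, Matrix.det_apply, Finset.sum_smul]
    refine Finset.sum_congr rfl fun π _ => ?_
    rw [hF, smul_comm (∏ i, A i ((k ∘ π) i)), smul_assoc]
    rfl
  rw [Finset.sum_congr rfl fun k _ => h1 k, Finset.sum_comm]
  have h2 : ∀ π : Equiv.Perm (Fin m), ∑ k : Fin m → α, (∏ i, A i ((k ∘ π) i)) • F (k ∘ π) =
      ∑ k : Fin m → α, (∏ i, A i (k i)) • F k := fun π =>
    Fintype.sum_equiv (Equiv.arrowCongr π.symm (Equiv.refl α)) _ _ fun k => rfl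
  rw [Finset.sum_congr rfl fun π _ => h2 π, Finset.sum_const, Finset.card_univ, Fintype.card_perm,
    Fintype.card_fin, Nat.cast_smul_eq_nsmul]

theorem prod_ite_eq {α : Type*} [DecidableEq α] (l k : Fin m → α) :
    (∏ i, if l i = k i then (1 : K) else 0) = if l = k then 1 else 0 := by
  rw [Finset.prod_ite_zero, Finset.prod_const_one]
  simp only [Finset.mem_univ, true_implies, funext_iff]

/-- The orbit functions separate: their sum against all graphs with lists is the sum over the group
of all renumberings and permutations, which multiplies by the order of the group. -/
theorem sum_theta_phi (N Δ : ℤ) (p : Hf e → Fin v ⊕ Fin s) (l : Fin m → Hf e) :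
    ∑ q : Hf e → Fin v ⊕ Fin s, ∑ k : Fin m → Hf e, theta (K := K) N q k p l • phi K N Δ q k =
      ((Fintype.card (Ren v s e) * m.factorial : ℕ) : K) • phi K N Δ p l := by
  have h1 : ∀ q k, theta (K := K) N q k p l • phi K N Δ q k = ∑ g : Ren v s e,
      if q = act g p then ((((chi N g : ℤˣ) : ℤ) : K) *
        (Matrix.of fun i j => if g.2.2.1 (l i) = k j then (1 : K) else 0).det) • phi K N Δ q k
        else 0 := by
    intro q k
    unfold theta
    split_ifs with hk
    · rw [Finset.sum_smul]
      refine Finset.sum_congr rfl fun g _ => ?_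
      rw [ite_smul, zero_smul]
      exact if_congr eq_comm rfl rfl
    · rw [phi_of_not K N Δ hk]
      simp
  simp only [h1]
  rw [Finset.sum_congr rfl fun q _ => Finset.sum_comm, Finset.sum_comm]
  have h2 : ∀ g : Ren v s e, ∑ q : Hf e → Fin v ⊕ Fin s, ∑ k : Fin m → Hf e,
      (if q = act g p then ((((chi N g : ℤˣ) : ℤ) : K) *
        (Matrix.of fun i j => if g.2.2.1 (l i) = k j then (1 : K) else 0).det) • phi K N Δ q k
        else 0) = (m.factorial : K) • phi K N Δ p l := by
    intro g
    rw [Finset.sum_comm]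
    simp only [Finset.sum_ite_eq', Finset.mem_univ, if_true, mul_smul]
    rw [← Finset.smul_sum, sum_det_smul (fun k => phi K N Δ (act g p) k)
      (fun π k => phi_perm K Δ π _ k) (fun i h => if g.2.2.1 (l i) = h then (1 : K) else 0)]
    have h3 : ∀ k : Fin m → Hf e, (∏ i, if g.2.2.1 (l i) = k i then (1 : K) else 0) =
        if k = (fun i => g.2.2.1 (l i)) then 1 else 0 := fun k =>
      (prod_ite_eq (fun i => g.2.2.1 (l i)) k).trans (if_congr eq_comm rfl rfl)
    simp only [h3, ite_smul, one_smul, zero_smul, Finset.sum_ite_eq', Finset.mem_univ, if_true]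
    have h4 := phi_act K Δ (N := N) g 1 p l
    rw [Equiv.Perm.sign_one, mul_one] at h4
    have h5 : phi K N Δ (act g p) (fun i => g.2.2.1 (l i)) = chi N g • phi K N Δ p l := h4
    rw [h5, smul_comm, Units.smul_def, ← Int.cast_smul_eq_zsmul K, smul_smul, smul_smul, mul_assoc,
      ← Int.cast_mul, ← Units.val_mul, Int.units_mul_self, Units.val_one, Int.cast_one, mul_one]
  rw [Finset.sum_congr rfl fun g _ => h2 g, Finset.sum_const, Finset.card_univ, Nat.cast_mul,
    mul_smul, ← Nat.cast_smul_eq_nsmul K]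

/-- Pairing with a coboundary is the same as directing one more edge. -/
theorem sum_delta_phi (N Δ : ℤ) (p : Hf e → Fin v ⊕ Fin s) (y : (Fin m → Hf e) → K) :
    ∑ l : Fin (m + 1) → Hf e, delta p y l • phi K N Δ p l =
      ((m + 1 : ℕ) : K) • ∑ l : Fin m → Hf e, y l •
        ∑ h, phi K N Δ p (Fin.cons h l : Fin (m + 1) → Hf e) := by
  have h1 : ∀ l : Fin (m + 1) → Hf e, delta p y l • phi K N Δ p l =
      ∑ i : Fin (m + 1), ((-1) ^ i.1 * y (l ∘ i.succAbove)) • phi K N Δ p l := by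
    intro l
    rw [← Finset.sum_smul]
    unfold delta
    split_ifs with hl
    · rfl
    · rw [phi_of_not K N Δ fun h => hl h.2, smul_zero, smul_zero]
  have h2 : ∀ i : Fin (m + 1), ∑ l : Fin (m + 1) → Hf e,
      ((-1) ^ i.1 * y (l ∘ i.succAbove)) • phi K N Δ p l =
      ∑ l : Fin m → Hf e, y l • ∑ h, phi K N Δ p (Fin.cons h l : Fin (m + 1) → Hf e) := by
    intro i
    rw [← (Fin.insertNthEquiv (fun _ => Hf e) i).sum_comp, Fintype.sum_prod_type, Finset.sum_comm]
    refine Finset.sum_congr rfl fun l _ => ?_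
    rw [Finset.smul_sum]
    refine Finset.sum_congr rfl fun h _ => ?_
    have h3 : (Fin.insertNthEquiv (fun _ => Hf e) i) (h, l) =
        (Fin.cons h l : Fin (m + 1) → Hf e) ∘ i.cycleRange := by
      rw [Fin.cons_comp_cycleRange]; rfl
    have h4 : ((Fin.insertNthEquiv (fun _ => Hf e) i) (h, l) : Fin (m + 1) → Hf e) ∘ i.succAbove = l := by
      funext j
      exact Fin.insertNth_apply_succAbove (α := fun _ => Hf e) i h l j
    rw [h4, h3, phi_perm, Fin.sign_cycleRange, Units.smul_def, ← Int.cast_smul_eq_zsmul K, smul_smul]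
    congr 1
    have : ((-1 : K) ^ i.1) * (-1) ^ i.1 = 1 := by
      rw [← mul_pow]; simp
    push_cast
    linear_combination y l * this
  simp only [h1]
  rw [Finset.sum_comm, Finset.sum_congr rfl fun i _ => h2 i, Finset.sum_const, Finset.card_univ,
    Fintype.card_fin, Nat.cast_smul_eq_nsmul]

/-- The functions that select a half-edge at every internal vertex. -/
def Section (p : Hf e → Fin v ⊕ Fin s) (t : Fin v → Hf e) : Prop := ∀ x, p (t x) = Sum.inl x

variable (K) in
/-- The sum over all choices of an outgoing half-edge at every internal vertex. -/
noncomputable def secSum (N Δ : ℤ) (p : Hf e → Fin v ⊕ Fin s) : (orientedKind N).Space K Δ :=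
  ∑ t : Fin v → Hf e, if Section p t then phi K N Δ p t else 0

/-- The determinant in `omega` antisymmetrizes, so that a sum against it is a sum over the lists
whose `i`-th entry starts at the `i`-th vertex. -/
theorem sum_omega_smul {M : Type*} [AddCommGroup M] [Module K M] (p : Hf e → Fin v ⊕ Fin s)
    (F : (Fin v → Hf e) → M) (hF : ∀ (π : Equiv.Perm (Fin v)) k, F (k ∘ π) = Equiv.Perm.sign π • F k)
    (h0 : ∀ k, Section p k → ¬ Lists p (Set.range k) k → F k = 0) :
    ∑ k : Fin v → Hf e, omega (K := K) p k • F k =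
      (v.factorial : K) • ∑ t : Fin v → Hf e, if Section p t then F t else 0 := by
  have h1 : ∀ k : Fin v → Hf e, omega (K := K) p k • F k =
      (Matrix.of fun j i => if p (k i) = Sum.inl j then (1 : K) else 0).det •
        if Lists p (Set.range k) k then F k else 0 := by
    intro k
    unfold omega
    split_ifs with hk
    · rw [← Matrix.det_transpose]
      rfl
    · rw [zero_smul, smul_zero]
  rw [Finset.sum_congr rfl fun k _ => h1 k,
    sum_det_smul (fun k => if Lists p (Set.range k) k then F k else 0) (fun π k => by
      rw [hF, smul_ite, smul_zero]
      exact if_congr (Lists.comp_perm π) rfl rfl)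
      (fun j h => if p h = Sum.inl j then (1 : K) else 0)]
  congr 1
  refine Finset.sum_congr rfl fun k _ => ?_
  by_cases hk : Section p k
  · rw [if_pos hk, Finset.prod_eq_one fun x _ => if_pos (hk x), one_smul]
    split_ifs with hL
    · rfl
    · exact (h0 k hk hL).symm
  · rw [if_neg hk]
    unfold Section at hk
    push Not at hk
    obtain ⟨x, hx⟩ := hk
    rw [Finset.prod_eq_zero (Finset.mem_univ x) (if_neg hx), zero_smul]

theorem sum_omega_phi (N Δ : ℤ) (p : Hf e → Fin v ⊕ Fin s) :
    ∑ k : Fin v → Hf e, omega (K := K) p k • phi K N Δ p k =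
      (v.factorial : K) • secSum K N Δ p :=
  sum_omega_smul p (fun k => phi K N Δ p k) (fun π k => phi_perm K Δ π _ k)
    fun _ _ hL => phi_of_not K N Δ fun h => hL h.2

/-- The value of an orbit function of a forest on the sum over sections does not depend on the
forest, since a renumbering carries exactly one section to a reordering of it. -/
theorem sum_section_theta (N : ℤ) {T : Fin v → Hf e} (hq : Hairy q) (hT : Section q T)
    (hA : Adm q (Set.range T)) (p : Hf e → Fin v ⊕ Fin s) :
    (∑ t : Fin v → Hf e, if Section p t then theta (K := K) N q T p t else 0) =
      ∑ g : Ren v s e, if act g p = q then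
        (((chi N g * Equiv.Perm.sign g.1 : ℤˣ) : ℤ) : K) else 0 := by
  have hTi : Function.Injective T := fun z w h => by
    have := hT z
    rw [h, hT] at this
    exact (Sum.inl_injective this).symm
  unfold theta
  simp only [if_pos (And.intro hq (show Lists q (Set.range T) T from ⟨hA, hTi, rfl⟩))]
  have h0 : ∀ t : Fin v → Hf e, (if Section p t then ∑ g : Ren v s e, (if act g p = q then
      (((chi N g : ℤˣ) : ℤ) : K) *
        (Matrix.of fun i j => if g.2.2.1 (t i) = T j then (1 : K) else 0).det else 0) else 0) =
      ∑ g : Ren v s e, if act g p = q then (((chi N g : ℤˣ) : ℤ) : K) * (if Section p t then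
        (Matrix.of fun i j => if g.2.2.1 (t i) = T j then (1 : K) else 0).det else 0) else 0 := by
    intro t
    split_ifs with ht
    · rfl
    · simp
  rw [Finset.sum_congr rfl fun t _ => h0 t, Finset.sum_comm]
  refine Finset.sum_congr rfl fun g _ => ?_
  by_cases hg : act g p = q
  swap
  · simp [hg]
  subst hg
  simp only [if_true]
  rw [← Finset.mul_sum, Units.val_mul, Int.cast_mul]
  congr 1
  -- the only section with a nonzero determinant corresponds to `T`
  rw [Finset.sum_eq_single fun x => g.2.2.1.symm (T (g.1 x))]
  · have h1 : Section p fun x => g.2.2.1.symm (T (g.1 x)) := by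
      intro x
      refine act_eq_inl.1 ((congrArg (act g p) (Equiv.apply_symm_apply g.2.2.1 _)).trans (hT _))
    rw [if_pos h1, ← Matrix.det_permutation]
    congr 1
    ext i j
    simp only [Matrix.of_apply, Equiv.apply_symm_apply, hTi.eq_iff, Equiv.toPEquiv_apply,
      PEquiv.toMatrix_apply, Option.mem_def, Option.some_inj]
  · intro t _ ht
    split_ifs with hs
    · by_contra h0
      obtain ⟨π, hπ⟩ := exists_perm_of_det_ne (l := fun i => g.2.2.1 (t i)) h0
      refine ht (funext fun x => (Equiv.eq_symm_apply g.2.2.1).2 ?_)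
      obtain ⟨y, hy⟩ := g.1.surjective (g.1 x)
      have h1 := congrFun hπ (π.symm x)
      simp only [Function.comp_apply, Equiv.apply_symm_apply] at h1
      have h2 := hT (π.symm x)
      rw [h1, act_eq_inl.2 (hs x)] at h2
      rw [← h1, Sum.inl_injective h2]
    · rfl
  · intro h; exact (h (Finset.mem_univ _)).elim

end

end HairForest


namespace HairForest

/-! ### Hair forests -/

section

open Classical

variable {K : Type*} [Field K] {v s e : ℕ} {p : Hf e → Fin v ⊕ Fin s}

/-- The sum over the sections transforms like the hairy graph. -/
theorem secSum_act (N Δ : ℤ) (g : Ren v s e) (p : Hf e → Fin v ⊕ Fin s) :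
    secSum K N Δ (act g p) = (chi N g * Equiv.Perm.sign g.1) • secSum K N Δ p := by
  unfold secSum
  rw [Finset.smul_sum]
  symm
  refine Fintype.sum_equiv (Equiv.arrowCongr g.1 g.2.2.1) _ _ fun t => ?_
  have h1 : Section (act g p) (Equiv.arrowCongr g.1 g.2.2.1 t) ↔ Section p t := by
    unfold Section
    rw [← g.1.forall_congr_right]
    refine forall_congr' fun x => ?_
    have h2 : Equiv.arrowCongr g.1 g.2.2.1 t (g.1 x) = g.2.2.1 (t x) := by
      simp [Equiv.arrowCongr]
    rw [h2]
    exact act_eq_inl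
  by_cases h : Section p t
  · rw [if_pos h, if_pos (h1.2 h)]
    have h3 := phi_act K Δ (N := N) g g.1.symm p t
    have h4 : Equiv.Perm.sign g.1.symm = Equiv.Perm.sign g.1 := Equiv.Perm.sign_symm g.1
    rw [h4] at h3
    exact h3.symm
  · rw [if_neg h, if_neg (mt h1.1 h), smul_zero]

/-- The half-edge at `x` of the first edge of the path from `x` in a forest. -/
noncomputable def half (p : Hf e → Fin v ⊕ Fin s) (τ : Fin v → Fin e) (x : Fin v) : Hf e :=
  (τ x, decide (p (τ x, false) ≠ Sum.inl x))

theorem parent_eq (τ : Fin v → Fin e) (x : Fin v) :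
    (grOf p).parent τ x = p (bar (half p τ x)) := by
  unfold Gr.parent half bar
  by_cases h : p (τ x, false) = Sum.inl x
  · rw [if_pos h]
    simp [h]
  · rw [if_neg h]
    simp [h]

theorem section_half {τ : Fin v → Fin e}
    (h : ∀ x, (grOf p).src (τ x) = Sum.inl x ∨ (grOf p).tgt (τ x) = Sum.inl x) :
    Section p (half p τ) := by
  intro x
  unfold half
  by_cases h1 : p (τ x, false) = Sum.inl x
  · simp [h1]
  · simpa [h1] using (h x).resolve_left h1

theorem Section.injective {t : Fin v → Hf e} (ht : Section p t) : Function.Injective t := by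
  intro x y h
  have := ht x
  rw [h, ht y] at this
  exact (Sum.inl_injective this).symm

/-- The condition that successors in the forest eventually reach an external vertex. -/
theorem exists_height_of_reaches {f : Fin v → Fin v ⊕ Fin s}
    (h : ∀ x, ∃ j, Relation.TransGen (fun q q' => ∃ y, q = Sum.inl y ∧ q' = f y)
      (Sum.inl x) (Sum.inr j)) : ∃ ht : Fin v → ℕ, ∀ x y, f x = Sum.inl y → ht y < ht x := by
  obtain ⟨ht, hht⟩ := exists_height (R := fun x y : Fin v => f x = Sum.inl y) (by
    intro x hx
    obtain ⟨j, hj⟩ := h x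
    -- a path that starts on a cycle never leaves it
    have key : ∀ q, Relation.TransGen (fun q q' : Fin v ⊕ Fin s => ∃ y, q = Sum.inl y ∧ q' = f y)
        (Sum.inl x) q → ∃ y, q = Sum.inl y ∧ Relation.TransGen (fun x y => f x = Sum.inl y) y x := by
      have step : ∀ y, Relation.TransGen (fun x y => f x = Sum.inl y) y x →
          ∃ z, f y = Sum.inl z ∧ Relation.TransGen (fun x y => f x = Sum.inl y) z x := by
        intro y hy
        rcases Relation.TransGen.head'_iff.1 hy with ⟨z, hz, hzx⟩
        rcases Relation.reflTransGen_iff_eq_or_transGen.1 hzx with rfl | h1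
        · exact ⟨_, hz, hx⟩
        · exact ⟨z, hz, h1⟩
      intro q hq
      induction hq with
      | single h1 =>
        obtain ⟨y, h2, rfl⟩ := h1
        obtain rfl := Sum.inl_injective h2
        exact step _ hx
      | tail _ h1 ih =>
        obtain ⟨y, rfl, rfl⟩ := h1
        obtain ⟨z, h2, h3⟩ := ih
        obtain rfl := Sum.inl_injective h2
        exact step _ h3
    obtain ⟨y, hy, -⟩ := key _ hj
    exact Sum.inr_ne_inl hy)
  exact ⟨ht, hht⟩

theorem reaches_of_height {f : Fin v → Fin v ⊕ Fin s} {ht : Fin v → ℕ}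
    (hht : ∀ x y, f x = Sum.inl y → ht y < ht x) (x : Fin v) :
    ∃ j, Relation.TransGen (fun q q' => ∃ y, q = Sum.inl y ∧ q' = f y)
      (Sum.inl x) (Sum.inr j) := by
  induction hn : ht x using Nat.strong_induction_on generalizing x with
  | _ n ih =>
    rcases hx : f x with y | j
    · obtain ⟨j, hj⟩ := ih (ht y) (hn ▸ hht x y hx) y rfl
      exact ⟨j, Relation.TransGen.head ⟨x, rfl, hx.symm⟩ hj⟩
    · exact ⟨j, .single ⟨x, rfl, hx.symm⟩⟩

theorem adm_half (hp : Hairy p) {τ : Fin v → Fin e} (h : (grOf p).IsHairForest τ) :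
    Adm p (Set.range (half p τ)) := by
  have hs := section_half h.incident
  obtain ⟨ht, hht⟩ := exists_height_of_reaches h.reaches
  have hht' : ∀ x y, p (bar (half p τ x)) = Sum.inl y → ht y < ht x := fun x y hxy =>
    hht x y ((parent_eq τ x).trans hxy)
  refine ⟨?_, ?_, ?_, fun x => ⟨_, ⟨x, rfl⟩, hs x⟩, ?_, ht, ?_⟩
  · rintro _ ⟨x, rfl⟩ ⟨y, hy⟩
    have h1 := hht' x y (hy ▸ hs y)
    have h2 := hht' y x (by rw [hy, bar_bar]; exact hs x)
    omega
  · rintro _ ⟨x, rfl⟩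
    exact ⟨x, hs x⟩
  · intro k j hk
    obtain ⟨x, hx⟩ := h.hairs j
    rw [parent_eq] at hx
    exact ⟨x, by rw [eq_outer hp hk, ← eq_outer hp hx, bar_bar]⟩
  · rintro _ ⟨x, rfl⟩ j - _ ⟨y, rfl⟩ hxy
    rw [hs, hs] at hxy
    rw [Sum.inl_injective hxy]
  · rintro _ ⟨x, rfl⟩ x' y hx hy
    rw [hs] at hx
    obtain rfl := Sum.inl_injective hx
    exact hht' x y hy

theorem Section.half_fst {t : Fin v → Hf e} (ht : Section p t) (hA : Adm p (Set.range t)) :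
    half p (fun x => (t x).1) = t := by
  funext x
  unfold half
  rcases hx : t x with ⟨b, _ | _⟩
  · have := ht x
    rw [hx] at this
    simp [hx, this]
  · have h1 : p (b, false) ≠ Sum.inl x := by
      intro h1
      obtain ⟨f, hf⟩ := hA.acyc
      exact lt_irrefl _ (hf _ ⟨x, rfl⟩ x x (ht x) (by rw [hx]; exact h1))
    simp [hx, h1]

theorem Section.isHairForest (hp : Hairy p) {t : Fin v → Hf e} (ht : Section p t)
    (hA : Adm p (Set.range t)) : (grOf p).IsHairForest fun x => (t x).1 := by
  have h1 := ht.half_fst hA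
  have hpar : ∀ x, (grOf p).parent (fun x => (t x).1) x = p (bar (t x)) := by
    intro x
    rw [parent_eq, h1]
  refine ⟨fun x => ?_, ?_, fun j => ?_⟩
  · have h2 := ht x
    rcases hx : t x with ⟨b, _ | _⟩ <;> rw [hx] at h2
    · exact Or.inl h2
    · exact Or.inr h2
  · obtain ⟨f, hf⟩ := hA.acyc
    refine reaches_of_height (ht := f) fun x y hxy => hf _ ⟨x, rfl⟩ x y (ht x) ?_
    rw [← hpar]
    exact hxy
  · obtain ⟨x, hx⟩ := hA.hair _ j (p_outer hp j)
    refine ⟨x, ?_⟩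
    rw [hpar, hx, bar_bar]
    exact p_outer hp j

end

end HairForest


namespace HairForest

/-! ### The oriented graph of a hair forest -/

section

open Classical

variable {v s e : ℕ} {p : Hf e → Fin v ⊕ Fin s} {τ : Fin v → Fin e}

theorem lists_half (hp : Hairy p) (h : (grOf p).IsHairForest τ) :
    Lists p (Set.range (half p τ)) (half p τ) :=
  ⟨adm_half hp h, (section_half h.incident).injective, rfl⟩

/-- The edges outside of the forest are the zigzags. -/
theorem mem_zig {b : Fin e} : (∀ i, (b, i) ∉ Set.range (half p τ)) ↔ ∀ x, τ x ≠ b := by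
  constructor
  · rintro h x rfl
    exact h _ ⟨x, rfl⟩
  · rintro h i ⟨x, hx⟩
    exact h x (congrArg Prod.fst hx)

/-- The half-edge that corresponds to an edge of the oriented graph of a forest. -/
noncomputable def forestHalf (p : Hf e → Fin v ⊕ Fin s) (τ : Fin v → Fin e)
    (k : (grOf p).ForestEdge τ) : Hf e :=
  Sum.elim (fun x => bar (half p τ x.1)) (fun c => ((ofLex c).1.1, (ofLex c).2)) (ofLex k)

/-- The edges of the oriented graph of a forest. -/
noncomputable def forestEdges (hp : Hairy p) (h : (grOf p).IsHairForest τ) :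
    (grOf p).ForestEdge τ ≃ Edge p (Set.range (half p τ)) :=
  Equiv.ofBijective (fun k => ⟨forestHalf p τ k, by
    have hA := adm_half hp h
    rcases hk : ofLex k with ⟨x, y, hy⟩ | ⟨b, i⟩
    · have h1 : forestHalf p τ k = bar (half p τ x) := by unfold forestHalf; rw [hk]; rfl
      rw [h1]
      exact ⟨hA.opp _ ⟨x, rfl⟩, y, (parent_eq τ x).symm.trans hy⟩
    · have h1 : forestHalf p τ k = (b.1, i) := by unfold forestHalf; rw [hk]; rfl
      rw [h1]
      exact ⟨mem_zig.2 b.2 i, hA.zig_int ⟨b.1, mem_zig.2 b.2⟩ i⟩⟩) (by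
    have hA := adm_half hp h
    constructor
    · intro k k' hkk
      have hkk : forestHalf p τ k = forestHalf p τ k' := congrArg Subtype.val hkk
      apply ofLex.injective
      unfold forestHalf at hkk
      rcases hk : ofLex k with x | c <;> rcases hk' : ofLex k' with x' | c' <;>
        rw [hk, hk'] at hkk
      · exact congrArg Sum.inl (Subtype.ext
          ((section_half h.incident).injective (bar_inj hkk)))
      · exact (c'.1.2 x.1 (congrArg Prod.fst hkk)).elim
      · exact (c.1.2 x'.1 (congrArg Prod.fst hkk).symm).elim
      · refine congrArg Sum.inr (ofLex.injective (Prod.ext (Subtype.ext ?_) ?_))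
        · exact congrArg (fun z : Hf e => z.1) hkk
        · exact congrArg (fun z : Hf e => z.2) hkk
    · rintro k
      by_cases hk : ∃ x, τ x = k.1.1
      · obtain ⟨x, hx⟩ := hk
        have h1 : bar (half p τ x) = k.1 := by
          rcases eq_or_eq_bar (h := k.1) (h' := half p τ x) hx.symm with h2 | h2
          · exact (k.2.1 ⟨x, h2.symm⟩).elim
          · exact h2.symm
        refine ⟨toLex (Sum.inl ⟨x, k.x, (parent_eq τ x).trans (h1 ▸ k.p_eq)⟩), Subtype.ext h1⟩
      · push Not at hk
        exact ⟨toLex (Sum.inr (toLex (⟨k.1.1, hk⟩, k.1.2))), rfl⟩)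

theorem forestEdges_val (hp : Hairy p) (h : (grOf p).IsHairForest τ)
    (k : (grOf p).ForestEdge τ) : (forestEdges hp h k).1 = forestHalf p τ k := rfl

/-- The numbering of the vertices of the oriented graph of a forest by the edges. -/
noncomputable def forestVerts {D : Set (Hf e)} {t : Fin v → Hf e} (L : Lists p D t) :
    Fin v ⊕ Zig D ≃ Fin e := (Equiv.sumComm _ _).trans L.edges

/-- The oriented graph of a hair forest is the one of the set of its half-edges; the numbers of the
edges come from the order of the forest edges and the halves of the zigzags. -/
theorem exists_forestGraph_eq (hp : Hairy p) (h : (grOf p).IsHairForest τ) :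
    ∃ o : Fin ((grOf p).forestGraph τ).e ≃o (grOf p).ForestEdge τ,
      (grOf p).forestGraph τ = (og p (Set.range (half p τ))).gr (forestVerts (lists_half hp h))
        ((forestEdges hp h).symm.trans o.symm.toEquiv) := by
  obtain ⟨o, hs, ht⟩ : ∃ o : Fin ((grOf p).forestGraph τ).e ≃o (grOf p).ForestEdge τ,
      (∀ i, ((grOf p).forestGraph τ).src i = Sum.inl ((grOf p).forestSrc τ (o i))) ∧
      ∀ i, ((grOf p).forestGraph τ).tgt i = Sum.inl ((grOf p).forestTgt τ (o i)) :=
    ⟨@monoEquivOfFin _ (Gr.instFintypeForestEdge (grOf p) τ) _ _ rfl, fun i => rfl, fun i => rfl⟩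
  refine ⟨o, ?_⟩
  have hA := adm_half hp h
  have key : ∀ q : Fin v ⊕ Fin s, ∀ b y, q = Sum.inl y → (grOf p).forestVertex τ b q = τ y := by
    rintro _ b y rfl; rfl
  refine Gr.mk_congr (fun i => (hs i).trans ?_) (fun i => (ht i).trans ?_)
  · refine congrArg Sum.inl ?_
    change _ = forestVerts (lists_half hp h) ((og p _).s (forestEdges hp h (o i)))
    generalize o i = k
    have hv := forestEdges_val hp h k
    rcases hk : ofLex k with x | c
    · have h1 : (og p (Set.range (half p τ))).s (forestEdges hp h k) = Sum.inl x.1 := by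
        refine (hA.og_s_eq_inl _).2 ?_
        rw [hv]
        unfold forestHalf
        rw [hk]
        change bar (bar _) ∈ _ ∧ p (bar (bar _)) = _
        rw [bar_bar]
        exact ⟨⟨x.1, rfl⟩, section_half h.incident x.1⟩
      rw [h1]
      unfold Gr.forestSrc
      rw [hk]
      rfl
    · have h1 : (og p (Set.range (half p τ))).s (forestEdges hp h k) =
          Sum.inr ⟨(ofLex c).1.1, mem_zig.2 (ofLex c).1.2⟩ := by
        refine (hA.og_s_eq_inr _).2 ?_
        rw [hv]
        unfold forestHalf
        rw [hk]
        rfl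
      rw [h1]
      unfold Gr.forestSrc
      rw [hk]
      rfl
  · refine congrArg Sum.inl ?_
    change _ = forestVerts (lists_half hp h) (Sum.inl (forestEdges hp h (o i)).x)
    generalize o i = k
    have hv := (forestEdges hp h k).p_eq
    rw [forestEdges_val] at hv
    change _ = τ _
    unfold Gr.forestTgt
    unfold forestHalf at hv
    rcases hk : ofLex k with x | c
    · rw [hk] at hv
      exact key _ _ _ ((parent_eq τ x.1).trans hv)
    · rw [hk] at hv
      refine key _ _ _ (Eq.trans ?_ hv)
      change (if (ofLex c).2 = true then p ((ofLex c).1.1, true) else p ((ofLex c).1.1, false)) =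
        p ((ofLex c).1.1, (ofLex c).2)
      rcases hc : (ofLex c).2 with _ | _ <;> simp

/-! ### Comparison of the signs of different forests -/

theorem neg_one_pow_card {α : Type*} [Fintype α] (P : α → Prop) [DecidablePred P] :
    (-1 : ℤˣ) ^ (Finset.univ.filter P).card = ∏ x, if P x then -1 else 1 := by
  rw [Finset.prod_ite, Finset.prod_const, Finset.prod_const_one, mul_one]

/-- The sign of a permutation is given by its number of inversions. -/
theorem sign_eq_inversions {n : ℕ} (σ : Equiv.Perm (Fin n)) :
    Equiv.Perm.sign σ = (-1) ^ (Finset.univ.filter fun q : Fin n × Fin n =>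
      q.1 < q.2 ∧ σ q.2 < σ q.1).card := by
  rw [Equiv.Perm.sign_eq_prod_prod_Iio, neg_one_pow_card, Fintype.prod_prod_type_right]
  refine Finset.prod_congr rfl fun j _ => ?_
  have h1 : Finset.Iio j = Finset.univ.filter fun i => i < j := by ext; simp
  rw [h1, Finset.prod_filter]
  refine Finset.prod_congr rfl fun i _ => ?_
  by_cases hij : i < j
  · have h2 : σ i ≠ σ j := σ.injective.ne hij.ne
    rcases lt_or_gt_of_ne h2 with h3 | h3
    · simp [hij, h3, h3.not_gt]
    · simp [hij, h3, h3.not_gt]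
  · simp [hij]

/-- Two bijections to linear orders that correspond under an isomorphism of orders differ by a
permutation whose sign is given by the numbers of inversions. -/
theorem sign_eq_inversions_mul {n : ℕ} {A B : Type*} [LinearOrder A] [LinearOrder B]
    (a : Fin n ≃ A) (b : Fin n ≃ B) (w : A ≃o B) :
    Equiv.Perm.sign ((a.trans w.toEquiv).trans b.symm) =
      (-1) ^ (Finset.univ.filter fun q : Fin n × Fin n => q.1 < q.2 ∧ a q.2 < a q.1).card *
      (-1) ^ (Finset.univ.filter fun q : Fin n × Fin n => q.1 < q.2 ∧ b q.2 < b q.1).card := by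
  let _ : Fintype B := Fintype.ofEquiv _ b
  have hc : Fintype.card B = n := by
    rw [← Fintype.card_congr b, Fintype.card_fin]
  let o : Fin n ≃o B := monoEquivOfFin B hc
  have h1 : (a.trans w.toEquiv).trans b.symm = ((b.trans o.symm.toEquiv)⁻¹ : Equiv.Perm (Fin n)) *
      (a.trans (w.toEquiv.trans o.symm.toEquiv)) := by
    ext x : 1
    change b.symm (w (a x)) = b.symm (o (o.symm (w (a x))))
    rw [o.apply_symm_apply]
  have h2 : ∀ x y : Fin n, (b.trans o.symm.toEquiv) x < (b.trans o.symm.toEquiv) y ↔ b x < b y :=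
    fun x y => o.symm.lt_iff_lt
  have h3 : ∀ x y : Fin n, (a.trans (w.toEquiv.trans o.symm.toEquiv)) x <
      (a.trans (w.toEquiv.trans o.symm.toEquiv)) y ↔ a x < a y :=
    fun x y => o.symm.lt_iff_lt.trans w.lt_iff_lt
  rw [h1, map_mul, Equiv.Perm.sign_inv, mul_comm, sign_eq_inversions, sign_eq_inversions]
  simp only [h2, h3]

end

end HairForest


namespace HairForest

section

open Classical

variable {v s e : ℕ} {p p' : Hf e → Fin v ⊕ Fin s} {D D' : Set (Hf e)} {t t' : Fin v → Hf e}

/-- With the vertices of the oriented graphs numbered by the edges, the sign of the frame for odd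
`N` is the same for all forests. -/
theorem fr_forestVerts {N : ℤ} (hN : ¬ Even N) (L : Lists p D t) (L' : Lists p' D' t') (hp : Hairy p)
    (hp' : Hairy p') {r r' : ℕ} (nE : Edge p D ≃ Fin r) (nE' : Edge p' D' ≃ Fin r') :
    L.fr N hp (forestVerts L) nE = L'.fr N hp' (forestVerts L') nE' := by
  obtain ⟨u⟩ : Nonempty (Zig D ≃ Zig D') := by
    have h1 := Fintype.card_congr (L.edges.trans L'.edges.symm)
    rw [Fintype.card_sum, Fintype.card_sum] at h1
    exact Fintype.card_eq.1 (by omega)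
  obtain ⟨P, hP⟩ : ∃ P : Equiv.Perm (Fin e), P = L.edges.symm.trans
    ((u.sumCongr (Equiv.refl (Fin v))).trans L'.edges) := ⟨_, rfl⟩
  have h1 : ((forestVerts L').symm.sumCongr (Equiv.refl (Fin v))).trans L'.vertEquiv =
      (Equiv.Perm.sumCongr P⁻¹ (1 : Equiv.Perm (Fin v))).trans
        ((((forestVerts L).symm.sumCongr (Equiv.refl (Fin v))).trans L.vertEquiv).trans
          (Equiv.Perm.sumCongr (1 : Equiv.Perm (Fin v)) P)) := by
    have hPz : ∀ b : Zig D, P b.1 = (u b).1 := by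
      intro b
      rw [hP]
      change L'.edges (Equiv.sumCongr u (Equiv.refl _) (L.edges.symm (L.edges (Sum.inl b)))) = _
      rw [Equiv.symm_apply_apply]
      rfl
    have hPx : ∀ x, P (t x).1 = (t' x).1 := by
      intro x
      rw [hP]
      change L'.edges (Equiv.sumCongr u (Equiv.refl _) (L.edges.symm (L.edges (Sum.inr x)))) = _
      rw [Equiv.symm_apply_apply]
      rfl
    apply Equiv.ext
    rintro (z | x)
    · obtain ⟨y, rfl⟩ := (forestVerts L').surjective z
      have h2 : P⁻¹ (forestVerts L' y) = forestVerts L (Equiv.sumCongr (Equiv.refl _) u.symm y) := by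
        rw [Equiv.Perm.inv_eq_iff_eq]
        rcases y with x | b
        · exact (hPx x).symm
        · change b.1 = P (u.symm b).1
          rw [hPz, Equiv.apply_symm_apply]
      change L'.vertEquiv (Sum.inl ((forestVerts L').symm (forestVerts L' y))) =
        Equiv.Perm.sumCongr 1 P (L.vertEquiv (Sum.inl ((forestVerts L).symm (P⁻¹ (forestVerts L' y)))))
      rw [Equiv.symm_apply_apply, h2, Equiv.symm_apply_apply]
      rcases y with x | b
      · rfl
      · change Sum.inr b.1 = Sum.inr (P (u.symm b).1)
        rw [hPz, Equiv.apply_symm_apply]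
    · exact congrArg Sum.inr (hPx x).symm
  unfold Lists.fr
  rw [if_neg hN, if_neg hN, h1, esign_perm_trans, esign_trans_perm, Equiv.Perm.sign_sumCongr,
    Equiv.Perm.sign_sumCongr, Equiv.Perm.sign_one, Equiv.Perm.sign_inv, mul_one,
    one_mul, ← mul_assoc, Int.units_mul_self, one_mul]

/-- The reversals of the forest edges that point away from the external vertices. -/
noncomputable def flipPerm (t : Fin v → Hf e) (D : Set (Hf e)) :
    Equiv.Perm ((Fin v ⊕ Zig D) × Bool) :=
  Equiv.prodCongrRight (Sum.elim (fun x => if (t x).2 = true then Equiv.boolNot else 1) fun _ => 1)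

theorem sign_flipPerm : Equiv.Perm.sign (flipPerm t D) =
    (-1) ^ (Finset.univ.filter fun x => (t x).2 = true).card := by
  have h1 : Equiv.Perm.sign Equiv.boolNot = -1 := by decide
  rw [neg_one_pow_card, flipPerm, Equiv.Perm.sign_prodCongrRight, Fintype.prod_sum_type]
  simp only [Sum.elim_inl, Sum.elim_inr, Equiv.Perm.sign_one, Finset.prod_const_one, mul_one]
  refine Finset.prod_congr rfl fun x _ => ?_
  split_ifs
  · exact h1
  · exact Equiv.Perm.sign_one

/-- The half-edges in terms of the forest: `(x, false)` is the half-edge chosen at `x` and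
`(x, true)` its other half. -/
noncomputable def forestHalves (L : Lists p D t) : (Fin v ⊕ Zig D) × Bool ≃ Hf e :=
  (flipPerm t D).trans ((forestVerts L).prodCongr (Equiv.refl Bool))

theorem forestHalves_false (L : Lists p D t) (x : Fin v) : forestHalves L (Sum.inl x, false) = t x := by
  change ((t x).1, (if (t x).2 = true then Equiv.boolNot else 1 : Equiv.Perm Bool) false) = t x
  rcases h : t x with ⟨b, _ | _⟩ <;> simp

theorem forestHalves_true (L : Lists p D t) (x : Fin v) :
    forestHalves L (Sum.inl x, true) = bar (t x) := by
  change ((t x).1, (if (t x).2 = true then Equiv.boolNot else 1 : Equiv.Perm Bool) true) = bar (t x)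
  rcases h : t x with ⟨b, _ | _⟩ <;> simp [bar]

theorem forestHalves_inr (L : Lists p D t) (b : Zig D) (i : Bool) :
    forestHalves L (Sum.inr b, i) = (b.1, i) := rfl

/-- The bijection of the half-edges of two graphs with forests that is given by a bijection of the
edges outside of the forests and, for the second halves of the forest edges, by a permutation of the
internal vertices. -/
noncomputable def compare (L : Lists p D t) (L' : Lists p' D' t') (α : Equiv.Perm (Fin v))
    (u : Zig D ≃ Zig D') : Equiv.Perm (Hf e) :=
  (forestHalves L).symm.trans ((Equiv.prodCongrLeft fun i : Bool =>
    Equiv.sumCongr (if i = true then α else 1) u).trans (forestHalves L'))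

theorem compare_apply (L : Lists p D t) (L' : Lists p' D' t') (α : Equiv.Perm (Fin v))
    (u : Zig D ≃ Zig D') (z : Fin v ⊕ Zig D) (i : Bool) :
    compare L L' α u (forestHalves L (z, i)) =
      forestHalves L' (Equiv.sumCongr (if i = true then α else 1) u z, i) := by
  unfold compare
  rw [Equiv.trans_apply, Equiv.symm_apply_apply]
  rfl

/-- Written with respect to the standard numbering of the half-edges, the comparison is a
permutation that acts equally on both halves of all edges, and hence is even, up to `α` on one half
and the exchanges of the halves of those forest edges that are directed against the forest. -/
theorem sign_compare (L : Lists p D t) (L' : Lists p' D' t') (α : Equiv.Perm (Fin v))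
    (u : Zig D ≃ Zig D') : Equiv.Perm.sign (compare L L' α u) = Equiv.Perm.sign α *
      ((-1) ^ (Finset.univ.filter fun x => (t x).2 = true).card *
        (-1) ^ (Finset.univ.filter fun x => (t' x).2 = true).card) := by
  obtain ⟨W, hW⟩ : ∃ W : (Fin v ⊕ Zig D) × Bool ≃ Hf e,
    W = (forestVerts L).prodCongr (Equiv.refl Bool) := ⟨_, rfl⟩
  obtain ⟨W', hW'⟩ : ∃ W : (Fin v ⊕ Zig D') × Bool ≃ Hf e,
    W = (forestVerts L').prodCongr (Equiv.refl Bool) := ⟨_, rfl⟩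
  obtain ⟨M, hM⟩ : ∃ M : (Fin v ⊕ Zig D) × Bool ≃ (Fin v ⊕ Zig D') × Bool,
    M = (Equiv.sumCongr (Equiv.refl _) u).prodCongr (Equiv.refl Bool) := ⟨_, rfl⟩
  obtain ⟨A, hA⟩ : ∃ A : Equiv.Perm ((Fin v ⊕ Zig D) × Bool),
    A = Equiv.prodCongrLeft fun i : Bool =>
      Equiv.Perm.sumCongr (if i = true then α else 1) (1 : Equiv.Perm (Zig D)) := ⟨_, rfl⟩
  have hsA : Equiv.Perm.sign A = Equiv.Perm.sign α := by
    rw [hA, Equiv.Perm.sign_prodCongrLeft, Fintype.prod_bool]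
    simp
  have hMW : Equiv.Perm.sign (W.symm.trans (M.trans W')) = 1 := by
    have h1 : W.symm.trans (M.trans W') = Equiv.prodCongrLeft fun _ : Bool =>
        (forestVerts L).symm.trans ((Equiv.sumCongr (Equiv.refl _) u).trans (forestVerts L')) := by
      rw [hW, hW', hM]
      rfl
    rw [h1, Equiv.Perm.sign_prodCongrLeft, Fintype.prod_bool, Int.units_mul_self]
  have key : compare L L' α u = (W.symm.trans (M.trans W')) *
      ((W.symm.trans (((M.trans (flipPerm t' D')).trans M.symm * (A * (flipPerm t D)⁻¹)).trans W)) :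
        Equiv.Perm (Hf e)) := by
    apply Equiv.ext
    intro h
    obtain ⟨y, rfl⟩ := (forestHalves L).surjective h
    obtain ⟨z, i⟩ := y
    rw [compare_apply]
    have h1 : forestHalves L (z, i) = W (flipPerm t D (z, i)) := by rw [hW]; rfl
    have h2 : ∀ y, forestHalves L' y = W' (flipPerm t' D' y) := by rw [hW']; intro y; rfl
    have h3 : (Equiv.sumCongr (if i = true then α else 1) u z, i) = M (A (z, i)) := by
      rw [hM, hA]
      rcases z with z | z <;> rfl
    rw [h1, h2, h3]
    have h4 : (flipPerm t D)⁻¹ (flipPerm t D (z, i)) = (z, i) := Equiv.symm_apply_apply _ _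
    simp only [Equiv.Perm.mul_apply, Equiv.trans_apply, Equiv.symm_apply_apply,
      Equiv.apply_symm_apply, h4]
  have h5 : ∀ X : Equiv.Perm ((Fin v ⊕ Zig D) × Bool),
      Equiv.Perm.sign (W.symm.trans (X.trans W)) = Equiv.Perm.sign X := fun X => by
    have h6 := Equiv.Perm.sign_symm_trans_trans X W
    rw [Equiv.trans_assoc] at h6
    convert h6
  rw [key, map_mul, hMW, one_mul, h5, map_mul, map_mul, hsA, Equiv.Perm.sign_inv, sign_flipPerm]
  have h4 : Equiv.Perm.sign ((M.trans (flipPerm t' D')).trans M.symm) =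
      Equiv.Perm.sign (flipPerm t' D') := by
    convert Equiv.Perm.sign_trans_trans_symm (flipPerm t' D') M
  rw [h4, sign_flipPerm]
  ac_rfl

/-- The internal vertices without hair in the forest, followed by the hairs. -/
abbrev HairOrder (p : Hf e → Fin v ⊕ Fin s) (τ : Fin v → Fin e) : Type :=
  {x : Fin v // ∃ y, (grOf p).parent τ x = Sum.inl y} ⊕ₗ Fin s

variable {τ τ' : Fin v → Fin e}

theorem half_hairEnd (hp : Hairy p) (h : (grOf p).IsHairForest τ) (j : Fin s) :
    half p τ ((adm_half hp h).hairEnd hp j) = bar (outer hp j) := by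
  obtain ⟨x, hx⟩ := (adm_half hp h).outer_mem hp j
  have h1 := (adm_half hp h).p_bar_outer hp j
  rw [← hx, section_half h.incident] at h1
  rw [← Sum.inl_injective h1, hx]

theorem parent_hairEnd (hp : Hairy p) (h : (grOf p).IsHairForest τ) (j : Fin s) :
    (grOf p).parent τ ((adm_half hp h).hairEnd hp j) = Sum.inr j := by
  rw [parent_eq, half_hairEnd hp h, bar_bar]
  exact p_outer hp j

/-- Every internal vertex either has no hair in the forest or is the end of a unique hair. -/
noncomputable def hairOrder (hp : Hairy p) (h : (grOf p).IsHairForest τ) :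
    Fin v ≃ HairOrder p τ :=
  (Equiv.ofBijective (fun k : HairOrder p τ => Sum.elim (fun x => x.1)
    (fun j => (adm_half hp h).hairEnd hp j) (ofLex k)) (by
    constructor
    · intro k k' hk
      apply ofLex.injective
      rcases h1 : ofLex k with x | j <;> rcases h2 : ofLex k' with x' | j' <;>
        simp only [h1, h2, Sum.elim_inl, Sum.elim_inr] at hk
      · exact congrArg Sum.inl (Subtype.ext hk)
      · obtain ⟨y, hy⟩ := x.2
        rw [hk, parent_hairEnd hp h] at hy
        exact (Sum.inr_ne_inl hy).elim
      · obtain ⟨y, hy⟩ := x'.2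
        rw [← hk, parent_hairEnd hp h] at hy
        exact (Sum.inr_ne_inl hy).elim
      · exact congrArg Sum.inr ((adm_half hp h).hairEnd_injective hp hk)
    · intro x
      rcases hx : (grOf p).parent τ x with y | j
      · exact ⟨toLex (Sum.inl ⟨x, y, hx⟩), rfl⟩
      · refine ⟨toLex (Sum.inr j), (section_half h.incident).injective ?_⟩
        change half p τ ((adm_half hp h).hairEnd hp j) = _
        rw [parent_eq] at hx
        rw [half_hairEnd hp h, ← eq_outer hp hx, bar_bar])).symm

theorem hairOrder_inl (hp : Hairy p) (h : (grOf p).IsHairForest τ)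
    (x : {x : Fin v // ∃ y, (grOf p).parent τ x = Sum.inl y}) :
    hairOrder hp h x.1 = toLex (Sum.inl x) :=
  (Equiv.symm_apply_eq _).2 rfl

theorem hairOrder_inr (hp : Hairy p) (h : (grOf p).IsHairForest τ) (j : Fin s) :
    hairOrder hp h ((adm_half hp h).hairEnd hp j) = toLex (Sum.inr j) :=
  (Equiv.symm_apply_eq _).2 rfl

theorem eq_hairEnd (hp : Hairy p) (h : (grOf p).IsHairForest τ) {x : Fin v} {j : Fin s}
    (hx : (grOf p).parent τ x = Sum.inr j) : x = (adm_half hp h).hairEnd hp j := by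
  refine (section_half h.incident).injective ?_
  rw [parent_eq] at hx
  rw [half_hairEnd hp h, ← eq_outer hp hx, bar_bar]

/-- The inversions of the order of the internal vertices in which the hairs come last, in the order
of the external vertices. -/
theorem hairOrder_lt_iff (hp : Hairy p) (h : (grOf p).IsHairForest τ) {x y : Fin v} (hxy : x < y) :
    hairOrder hp h y < hairOrder hp h x ↔ ∃ j, (grOf p).parent τ x = Sum.inr j ∧
      ∀ i, (grOf p).parent τ y = Sum.inr i → i < j := by
  rcases hx : (grOf p).parent τ x with x' | j
  · have h1 := hairOrder_inl hp h ⟨x, x', hx⟩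
    simp only at h1
    rw [h1]
    rcases hy : (grOf p).parent τ y with y' | i
    · have h2 := hairOrder_inl hp h ⟨y, y', hy⟩
      simp only at h2
      rw [h2, Sum.Lex.inl_lt_inl_iff]
      simp [hxy.not_gt]
    · obtain rfl := eq_hairEnd hp h hy
      rw [hairOrder_inr]
      simp
  · obtain rfl := eq_hairEnd hp h hx
    rw [hairOrder_inr]
    rcases hy : (grOf p).parent τ y with y' | i
    · have h2 := hairOrder_inl hp h ⟨y, y', hy⟩
      simp only at h2
      rw [h2]
      simp
    · obtain rfl := eq_hairEnd hp h hy
      rw [hairOrder_inr, Sum.Lex.inr_lt_inr_iff]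
      simp

/-- Lexicographic products of isomorphic orders. -/
def prodLexIso {A B : Type} [LinearOrder A] [LinearOrder B] (u : A ≃o B) :
    A ×ₗ Bool ≃o B ×ₗ Bool where
  toEquiv := ofLex.trans ((u.toEquiv.prodCongr (Equiv.refl Bool)).trans toLex)
  map_rel_iff' := by
    intro a b
    simp [Prod.Lex.le_iff]

theorem card_zig_add {L : Lists p D t} : Fintype.card (Zig D) + v = e := by
  have := Fintype.card_congr L.edges
  rwa [Fintype.card_sum, Fintype.card_fin, Fintype.card_fin] at this

/-- The comparison of two forests with the orders of the edges of their oriented graphs. -/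
theorem exists_compare (hp : Hairy p) (h : (grOf p).IsHairForest τ) (hp' : Hairy p')
    (h' : (grOf p').IsHairForest τ') {r : ℕ} (o : Fin r ≃o (grOf p).ForestEdge τ)
    (o' : Fin r ≃o (grOf p').ForestEdge τ') :
    ∃ (α : Equiv.Perm (Fin v)) (u : Zig (Set.range (half p τ)) ≃ Zig (Set.range (half p' τ'))),
      Equiv.Perm.sign α =
        (-1) ^ (Finset.univ.filter fun q : Fin v × Fin v => q.1 < q.2 ∧
          ∃ j, (grOf p).parent τ q.1 = Sum.inr j ∧
            ∀ i, (grOf p).parent τ q.2 = Sum.inr i → i < j).card *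
        (-1) ^ (Finset.univ.filter fun q : Fin v × Fin v => q.1 < q.2 ∧
          ∃ j, (grOf p').parent τ' q.1 = Sum.inr j ∧
            ∀ i, (grOf p').parent τ' q.2 = Sum.inr i → i < j).card ∧
      (∀ i, compare (lists_half hp h) (lists_half hp' h') α u (forestHalf p τ (o i)) =
        forestHalf p' τ' (o' i)) ∧
      (∀ j, compare (lists_half hp h) (lists_half hp' h') α u (outer hp j) = outer hp' j) ∧
      ∀ x, compare (lists_half hp h) (lists_half hp' h') α u (half p τ x) = half p' τ' x := by
  have L := lists_half hp h
  have L' := lists_half hp' h'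
  let zB : {b : Fin e // ∀ x, τ x ≠ b} ≃ Zig (Set.range (half p τ)) :=
    Equiv.subtypeEquivRight fun b => mem_zig.symm
  let zB' : {b : Fin e // ∀ x, τ' x ≠ b} ≃ Zig (Set.range (half p' τ')) :=
    Equiv.subtypeEquivRight fun b => mem_zig.symm
  have hc1 : Fintype.card {x : Fin v // ∃ y, (grOf p).parent τ x = Sum.inl y} =
      Fintype.card {x : Fin v // ∃ y, (grOf p').parent τ' x = Sum.inl y} := by
    have h1 := Fintype.card_congr ((hairOrder hp h).trans ofLex)
    have h2 := Fintype.card_congr ((hairOrder hp' h').trans ofLex)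
    rw [Fintype.card_sum] at h1 h2
    omega
  have hc2 : Fintype.card {b : Fin e // ∀ x, τ x ≠ b} =
      Fintype.card {b : Fin e // ∀ x, τ' x ≠ b} := by
    have h1 := card_zig_add (L := L)
    have h2 := card_zig_add (L := L')
    rw [Fintype.card_congr zB, Fintype.card_congr zB']
    omega
  let uN : {x : Fin v // ∃ y, (grOf p).parent τ x = Sum.inl y} ≃o
      {x : Fin v // ∃ y, (grOf p').parent τ' x = Sum.inl y} :=
    (monoEquivOfFin _ hc1).symm.trans (monoEquivOfFin _ rfl)
  let uB : {b : Fin e // ∀ x, τ x ≠ b} ≃o {b : Fin e // ∀ x, τ' x ≠ b} :=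
    (monoEquivOfFin _ hc2).symm.trans (monoEquivOfFin _ rfl)
  let w : HairOrder p τ ≃o HairOrder p' τ' := OrderIso.sumLexCongr uN (OrderIso.refl _)
  let wE : (grOf p).ForestEdge τ ≃o (grOf p').ForestEdge τ' :=
    OrderIso.sumLexCongr uN (prodLexIso uB)
  have ho : ∀ i, o' i = wE (o i) := fun i => by
    rw [Subsingleton.elim o' (o.trans wE)]; rfl
  let α : Equiv.Perm (Fin v) := ((hairOrder hp h).trans w.toEquiv).trans (hairOrder hp' h').symm
  have hα1 : ∀ x, α x.1 = (uN x).1 := by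
    intro x
    change (hairOrder hp' h').symm (w (hairOrder hp h x.1)) = _
    rw [hairOrder_inl]
    rfl
  have hα2 : ∀ j, α ((adm_half hp h).hairEnd hp j) = (adm_half hp' h').hairEnd hp' j := by
    intro j
    change (hairOrder hp' h').symm (w (hairOrder hp h _)) = _
    rw [hairOrder_inr]
    rfl
  refine ⟨α, (zB.symm.trans uB.toEquiv).trans zB', ?_, ?_, ?_, ?_⟩
  · have h1 := sign_eq_inversions_mul (hairOrder hp h) (hairOrder hp' h') w
    refine h1.trans ?_
    congr 4
    · ext q
      exact and_congr_right fun hq => hairOrder_lt_iff hp h hq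
    · ext q
      exact and_congr_right fun hq => hairOrder_lt_iff hp' h' hq
  · intro i
    rw [ho]
    generalize o i = k
    obtain ⟨k, rfl⟩ := toLex.surjective k
    rcases k with x | c
    · change compare _ _ _ _ (bar (half p τ x.1)) = bar (half p' τ' (uN x).1)
      rw [← forestHalves_true (lists_half hp h), compare_apply, if_pos rfl]
      change forestHalves _ (Sum.inl (α x.1), true) = _
      rw [hα1, forestHalves_true]
    · obtain ⟨c, rfl⟩ := toLex.surjective c
      have h1 := forestHalves_inr (lists_half hp h) (zB c.1) c.2
      change compare _ _ _ _ (c.1.1, c.2) = ((uB c.1).1, c.2)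
      refine (congrArg _ h1.symm).trans ((compare_apply _ _ _ _ _ _).trans ?_)
      rfl
  · intro j
    have h1 : outer hp j = bar (half p τ ((adm_half hp h).hairEnd hp j)) := by
      rw [half_hairEnd hp h, bar_bar]
    have h2 : outer hp' j = bar (half p' τ' ((adm_half hp' h').hairEnd hp' j)) := by
      rw [half_hairEnd hp' h', bar_bar]
    rw [h1, h2, ← forestHalves_true (lists_half hp h), compare_apply, if_pos rfl]
    change forestHalves _ (Sum.inl (α _), true) = _
    rw [hα2, forestHalves_true]
  · intro x
    have h1 := forestHalves_false (lists_half hp h) x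
    have h2 := compare_apply (lists_half hp h) (lists_half hp' h') α
      ((zB.symm.trans uB.toEquiv).trans zB') (Sum.inl x) false
    rw [h1] at h2
    exact h2.trans (forestHalves_false (lists_half hp' h') x)

end

end HairForest


namespace HairForest

/-! ### The sum over the hair forests as a sum over sections -/

section

open Classical

variable {v s e : ℕ} {p p' : Hf e → Fin v ⊕ Fin s} {τ τ' : Fin v → Fin e}

theorem half_snd_iff (x : Fin v) :
    (half p τ x).2 = true ↔ (grOf p).src (τ x) ≠ Sum.inl x := by
  simp [half]

/-- The sign of a forest compensates the dependence of the frames on the forest. -/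
theorem fr_forest (n : ℤ) (hp : Hairy p) (h : (grOf p).IsHairForest τ) (hp' : Hairy p')
    (h' : (grOf p').IsHairForest τ') {r : ℕ} (o : Fin r ≃o (grOf p).ForestEdge τ)
    (o' : Fin r ≃o (grOf p').ForestEdge τ') :
    (lists_half hp' h').fr (n + 1) hp' (forestVerts (lists_half hp' h'))
        ((forestEdges hp' h').symm.trans o'.symm.toEquiv) =
      (lists_half hp h).fr (n + 1) hp (forestVerts (lists_half hp h))
        ((forestEdges hp h).symm.trans o.symm.toEquiv) *
        (Gr.forestSign n (grOf p) τ * Gr.forestSign n (grOf p') τ') := by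
  by_cases hn : Even n
  · have hN : ¬ Even (n + 1) := by
      rw [Int.even_add_one, not_not]
      exact hn
    unfold Gr.forestSign
    rw [if_pos hn, if_pos hn, mul_one, mul_one]
    exact fr_forestVerts hN _ _ hp' hp _ _
  · have hN : Even (n + 1) := Int.even_add_one.2 hn
    obtain ⟨α, u, hα, h1, h2, h3⟩ := exists_compare hp h hp' h' o o'
    have h4 : (((forestEdges hp' h').symm.trans o'.symm.toEquiv).symm.sumCongr
        (Equiv.refl (Fin v ⊕ Fin s))).trans ((lists_half hp' h').edgeEquiv hp') =
        ((((forestEdges hp h).symm.trans o.symm.toEquiv).symm.sumCongr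
        (Equiv.refl (Fin v ⊕ Fin s))).trans ((lists_half hp h).edgeEquiv hp)).trans
        (compare (lists_half hp h) (lists_half hp' h') α u) := by
      apply Equiv.ext
      rintro (i | x | j)
      · exact (h1 i).symm
      · exact (h3 x).symm
      · exact (h2 j).symm
    unfold Lists.fr Gr.forestSign
    rw [if_pos hN, if_pos hN, if_neg hn, if_neg hn, h4, esign_trans_perm, sign_compare, hα]
    simp only [half_snd_iff]
    rw [pow_add, pow_add]
    ac_rfl

theorem card_edge_add {m : ℕ} {D : Set (Hf e)} {l : Fin m → Hf e} (L : Lists p D l) (hp : Hairy p) :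
    Fintype.card (Edge p D) + (m + s) = e * 2 := by
  have := Fintype.card_congr (L.edgeEquiv hp)
  simpa only [Fintype.card_sum, Fintype.card_fin, Fintype.card_prod, Fintype.card_bool] using this

/-- With the numberings of the oriented graph of a forest, the frame and the sign of the forest agree
up to a constant. -/
theorem exists_forest_const (n : ℤ) (v s e : ℕ) : ∃ c : ℤˣ, ∀ (p : Hf e → Fin v ⊕ Fin s)
    (τ : Fin v → Fin e) (hp : Hairy p) (h : (grOf p).IsHairForest τ) (r : ℕ)
    (o : Fin r ≃o (grOf p).ForestEdge τ),
    (lists_half hp h).fr (n + 1) hp (forestVerts (lists_half hp h))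
      ((forestEdges hp h).symm.trans o.symm.toEquiv) = c * Gr.forestSign n (grOf p) τ := by
  by_cases hex : ∃ (p : Hf e → Fin v ⊕ Fin s) (τ : Fin v → Fin e) (_ : Hairy p)
    (_ : (grOf p).IsHairForest τ) (r : ℕ), Nonempty (Fin r ≃o (grOf p).ForestEdge τ)
  · obtain ⟨p0, τ0, hp0, h0, r0, ⟨o0⟩⟩ := hex
    refine ⟨(lists_half hp0 h0).fr (n + 1) hp0 (forestVerts (lists_half hp0 h0))
      ((forestEdges hp0 h0).symm.trans o0.symm.toEquiv) * Gr.forestSign n (grOf p0) τ0,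
      fun p τ hp h r o => ?_⟩
    obtain rfl : r0 = r := by
      have h1 := card_edge_add (lists_half hp h) hp
      have h2 := card_edge_add (lists_half hp0 h0) hp0
      rw [← Fintype.card_congr (o.toEquiv.trans (forestEdges hp h)), Fintype.card_fin] at h1
      rw [← Fintype.card_congr (o0.toEquiv.trans (forestEdges hp0 h0)), Fintype.card_fin] at h2
      omega
    rw [fr_forest n hp0 h0 hp h o0 o, mul_assoc]
  · exact ⟨1, fun p τ hp h r o => (hex ⟨p, τ, hp, h, r, ⟨o⟩⟩).elim⟩

/-- The constant sign by which the frame and the sign of a forest differ. -/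
noncomputable def forestConst (n : ℤ) (v s e : ℕ) : ℤˣ := (exists_forest_const n v s e).choose

theorem fr_eq_forestConst (n : ℤ) (hp : Hairy p) (h : (grOf p).IsHairForest τ) {r : ℕ}
    (o : Fin r ≃o (grOf p).ForestEdge τ) :
    (lists_half hp h).fr (n + 1) hp (forestVerts (lists_half hp h))
      ((forestEdges hp h).symm.trans o.symm.toEquiv) =
        forestConst n v s e * Gr.forestSign n (grOf p) τ :=
  (exists_forest_const n v s e).choose_spec p τ hp h r o

/-- The same for a section and an arbitrary numbering of the edges that is compatible with the order
of the edges of the forest graph. -/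
theorem Section.fr_eq_forestConst (n : ℤ) {D : Set (Hf e)} {t : Fin v → Hf e} (ht : Section p t)
    (L : Lists p D t) (hp : Hairy p) {r : ℕ}
    (o : Fin r ≃o (grOf p).ForestEdge fun x => (t x).1) (nE : Edge p D ≃ Fin r)
    (hE : ∀ i, (nE.symm i).1 = forestHalf p (fun x => (t x).1) (o i)) :
    L.fr (n + 1) hp (forestVerts L) nE =
      forestConst n v s e * Gr.forestSign n (grOf p) fun x => (t x).1 := by
  obtain rfl := L.range
  obtain ⟨τ, rfl⟩ : ∃ τ, t = half p τ := ⟨_, (ht.half_fst L.adm).symm⟩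
  have h : (grOf p).IsHairForest τ := ht.isHairForest hp L.adm
  have h1 : nE = (forestEdges hp h).symm.trans o.symm.toEquiv :=
    Equiv.symm_bijective.injective (Equiv.ext fun i => Subtype.ext (hE i))
  rw [h1]
  exact HairForest.fr_eq_forestConst n hp h o

variable (K : Type*) [Field K] (Δ : ℤ)

/-- The signed sum over the hair forests is, up to a constant sign, the sum over all sections. -/
theorem forestSum_eq (n : ℤ) (hp : Hairy p) :
    forestSum K n Δ (grOf p) = forestConst n v s e • secSum K (n + 1) Δ p := by
  have h1 : ∀ τ, (grOf p).IsHairForest τ → Gr.forestSign n (grOf p) τ •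
      (orientedKind (n + 1)).cls K Δ ((grOf p).forestGraph τ) =
      forestConst n v s e • phi K (n + 1) Δ p (half p τ) := by
    intro τ h
    obtain ⟨o, ho⟩ := exists_forestGraph_eq hp h
    rw [phi_eq K Δ (lists_half hp h) hp (forestVerts (lists_half hp h))
      ((forestEdges hp h).symm.trans o.symm.toEquiv), fr_eq_forestConst n hp h o, smul_smul,
      ← mul_assoc,
      Int.units_mul_self, one_mul, TG.cl, ← ho]
  unfold forestSum secSum
  rw [Finset.smul_sum]
  have h2 : ∀ t : Fin v → Hf e,
      (forestConst n v s e • if Section p t then phi K (n + 1) Δ p t else 0) =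
      if Section p t ∧ Adm p (Set.range t) then forestConst n v s e • phi K (n + 1) Δ p t else 0 := by
    intro t
    by_cases h3 : Section p t
    · by_cases h4 : Adm p (Set.range t)
      · rw [if_pos h3, if_pos ⟨h3, h4⟩]
      · rw [if_pos h3, if_neg (fun h => h4 h.2), phi_of_not, smul_zero]
        exact fun h => h4 h.2.adm
    · rw [if_neg h3, if_neg (fun h => h3 h.1), smul_zero]
  rw [Finset.sum_congr rfl fun t _ => h2 t, ← Finset.sum_filter, ← Finset.sum_filter]
  refine Finset.sum_bij' (fun τ _ => half p τ) (fun t _ x => (t x).1) ?_ ?_ ?_ ?_ ?_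
  · intro τ hτ
    have h := (Finset.mem_filter.1 hτ).2
    exact Finset.mem_filter.2 ⟨Finset.mem_univ _, section_half h.incident, adm_half hp h⟩
  · intro t ht
    have h := (Finset.mem_filter.1 ht).2
    exact Finset.mem_filter.2 ⟨Finset.mem_univ _, h.1.isHairForest hp h.2⟩
  · intro τ _
    rfl
  · intro t ht
    have h := (Finset.mem_filter.1 ht).2
    exact h.1.half_fst h.2
  · intro τ hτ
    exact h1 τ (Finset.mem_filter.1 hτ).2

end

end HairForest


namespace HairForest

/-! ### The contraction of the arcs -/

section

open Classical

variable {v s e m : ℕ} {p : Hf e → Fin v ⊕ Fin s} {D : Set (Hf e)} {l : Fin m → Hf e}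
  (K : Type*) [Field K] (N Δ : ℤ)

/-- The contribution to the differential of the contraction of the arc that ends with the half-edge
`h`; it is zero if there is no such arc. -/
noncomputable def arcTerm (p : Hf e → Fin v ⊕ Fin s) (l : Fin m → Hf e) (h : Hf e) :
    (orientedKind N).Space K (Δ + 1) :=
  if H : (Hairy p ∧ Lists p (Set.range l) l) ∧ bar h ∈ Set.range l ∧
      h ∉ Set.range l ∧ ∃ x, p h = Sum.inl x then
    H.1.2.fr N H.1.1 (Fintype.equivFin _) (Fintype.equivFin _) •
      (og p (Set.range l)).ct K N Δ (Fintype.equivFin _) (Fintype.equivFin _) ⟨h, H.2.2⟩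
        (H.1.2.adm.ne _)
  else 0

theorem arcTerm_of_not {h : Hf e} (H : ¬ ((Hairy p ∧ Lists p (Set.range l) l) ∧
    bar h ∈ Set.range l ∧ h ∉ Set.range l ∧ ∃ x, p h = Sum.inl x)) :
    arcTerm K N Δ p l h = 0 := dif_neg H

theorem arcTerm_eq (L : Lists p D l) (hp : Hairy p) {w r : ℕ} (nV : Fin v ⊕ Zig D ≃ Fin w)
    (nE : Edge p D ≃ Fin r) (k : Edge p D) (hk : bar k.1 ∈ D) :
    arcTerm K N Δ p l k.1 = L.fr N hp nV nE • (og p D).ct K N Δ nV nE k (L.adm.ne k) := by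
  obtain rfl := L.range
  obtain rfl : Fintype.card (Fin v ⊕ Zig (Set.range l)) = w := by
    simpa using Fintype.card_congr nV
  obtain rfl : Fintype.card (Edge p (Set.range l)) = r := by
    simpa using Fintype.card_congr nE
  unfold arcTerm
  rw [dif_pos ⟨⟨hp, L⟩, hk, k.2⟩]
  have h1 : nV = (Fintype.equivFin _).trans ((Fintype.equivFin _).symm.trans nV) := by
    ext; simp
  have h2 : nE = (Fintype.equivFin _).trans ((Fintype.equivFin _).symm.trans nE) := by
    ext; simp
  rw [h1, h2, Lists.fr_trans, TG.ct_relabel, smul_smul, mul_right_comm, Int.units_mul_self, one_mul]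
  rfl

theorem sum_arcTerm (L : Lists p D l) (hp : Hairy p) {w r : ℕ} (nV : Fin v ⊕ Zig D ≃ Fin w)
    (nE : Edge p D ≃ Fin r) :
    ∑ h, arcTerm K N Δ p l h = L.fr N hp nV nE • arcs K Δ N L.adm nV nE := by
  unfold arcs
  rw [Finset.smul_sum]
  symm
  refine Finset.sum_of_injOn (fun k => k.1) (fun _ _ _ _ h => Subtype.ext h)
    (fun _ _ => Finset.mem_univ _) ?_ ?_
  · intro h _ hh
    refine arcTerm_of_not K N Δ fun h2 => hh ?_
    have h3 := h2.2.2
    rw [L.range] at h3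
    exact ⟨⟨h, h3⟩, Finset.mem_coe.2 (Finset.mem_univ _), rfl⟩
  · intro k _
    by_cases hk : bar k.1 ∈ D
    · rw [if_pos hk]
      exact (arcTerm_eq K N Δ L hp nV nE k hk).symm
    · rw [if_neg hk, smul_zero]
      exact (arcTerm_of_not K N Δ fun h => hk ((Set.ext_iff.1 L.range _).1 h.2.1)).symm

theorem range_act (g : Ren v s e) (π : Equiv.Perm (Fin m)) (l : Fin m → Hf e) :
    Set.range (fun i => g.2.2.1 (l (π i))) = g.2.2.1 '' Set.range l := by
  rw [← Set.range_comp, ← π.surjective.range_comp (g.2.2.1 ∘ l)]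
  rfl

/-- Equivariance of the contributions of the arcs to the differential. -/
theorem arcTerm_act (g : Ren v s e) (π : Equiv.Perm (Fin m)) (p : Hf e → Fin v ⊕ Fin s)
    (l : Fin m → Hf e) (h : Hf e) :
    arcTerm K N Δ (act g p) (fun i => g.2.2.1 (l (π i))) (g.2.2.1 h) =
      (chi N g * Equiv.Perm.sign π) • arcTerm K N Δ p l h := by
  by_cases H : (Hairy p ∧ Lists p (Set.range l) l) ∧ bar h ∈ Set.range l ∧
      h ∉ Set.range l ∧ ∃ x, p h = Sum.inl x
  · obtain ⟨⟨hp, L⟩, hb, hk⟩ := H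
    have hκ : ∀ h, h ∈ Set.range l ↔ g.2.2.1 h ∈ g.2.2.1 '' Set.range l := fun h =>
      (g.2.2.1.injective.mem_set_image).symm
    have nV := Fintype.equivFin (Fin v ⊕ Zig (g.2.2.1 '' Set.range l))
    have nE := Fintype.equivFin (Edge (act g p) (g.2.2.1 '' Set.range l))
    obtain ⟨k, rfl⟩ : ∃ k : Edge p (Set.range l), k.1 = h := ⟨⟨h, hk⟩, rfl⟩
    have hb' : bar (eIso g hκ p k).1 ∈ g.2.2.1 '' Set.range l :=
      ⟨bar k.1, hb, Sym.map_bar g.2.2 k.1⟩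
    have h1 := arcTerm_eq K N Δ (L.act g π) (hp.act g) nV nE (eIso g hκ p k) hb'
    have h2 := arcTerm_eq K N Δ L hp ((vIso g hκ).trans nV) ((eIso g hκ p).trans nE) k hb
    have h3 := TG.ct_iso K N Δ (og p (Set.range l)) _ (vIso g hκ) (eIso g hκ p)
      (og_s_eIso g hκ L.adm) (og_t_eIso g hκ) nV nE k (L.adm.ne k) ((L.act g π).adm.ne _)
    rw [h2, h3, smul_smul]
    refine h1.trans ?_
    rw [Lists.fr_act g hκ L hp (L.act g π) (hp.act g) π (fun _ => rfl) nV nE]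
  · rw [arcTerm_of_not K N Δ H, smul_zero]
    refine arcTerm_of_not K N Δ fun h' => H ?_
    obtain ⟨⟨hp, L⟩, hb, hk, y, hy⟩ := h'
    have hr := range_act g π l
    rw [hr] at L hb hk
    rw [← Sym.map_bar g.2.2 h, g.2.2.1.injective.mem_set_image] at hb
    rw [g.2.2.1.injective.mem_set_image] at hk
    obtain ⟨x, rfl⟩ := g.1.surjective y
    refine ⟨⟨hairy_act_iff.1 hp, adm_act_iff.1 L.adm, ?_, rfl⟩, hb, hk, x, act_eq_inl.1 hy⟩
    intro i j hij
    obtain ⟨i, rfl⟩ := π.surjective i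
    obtain ⟨j, rfl⟩ := π.surjective j
    exact congrArg π (L.inj (congrArg g.2.2.1 hij))

/-- The sum of the contractions of the arc that ends with the half-edge `h` over all choices of an
outgoing half-edge at every internal vertex. -/
noncomputable def arcSum (p : Hf e → Fin v ⊕ Fin s) (h : Hf e) :
    (orientedKind N).Space K (Δ + 1) :=
  ∑ t : Fin v → Hf e, if Section p t then arcTerm K N Δ p t h else 0

theorem section_act_iff (g : Ren v s e) {t : Fin v → Hf e} :
    Section (act g p) (Equiv.arrowCongr g.1 g.2.2.1 t) ↔ Section p t := by
  unfold Section
  rw [← g.1.forall_congr_right]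
  refine forall_congr' fun x => ?_
  have h2 : Equiv.arrowCongr g.1 g.2.2.1 t (g.1 x) = g.2.2.1 (t x) := by
    simp [Equiv.arrowCongr]
  rw [h2]
  exact act_eq_inl

theorem arcSum_act (g : Ren v s e) (p : Hf e → Fin v ⊕ Fin s) (h : Hf e) :
    arcSum K N Δ (act g p) (g.2.2.1 h) =
      (chi N g * Equiv.Perm.sign g.1) • arcSum K N Δ p h := by
  unfold arcSum
  rw [Finset.smul_sum]
  symm
  refine Fintype.sum_equiv (Equiv.arrowCongr g.1 g.2.2.1) _ _ fun t => ?_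
  by_cases ht : Section p t
  · rw [if_pos ht, if_pos ((section_act_iff g).2 ht)]
    have h3 := arcTerm_act K N Δ g g.1.symm p t h
    have h4 : Equiv.Perm.sign g.1.symm = Equiv.Perm.sign g.1 := Equiv.Perm.sign_symm g.1
    rw [h4] at h3
    exact h3.symm
  · rw [if_neg ht, if_neg (mt (section_act_iff g).1 ht), smul_zero]

theorem phi_cons_perm (π : Equiv.Perm (Fin m)) (p : Hf e → Fin v ⊕ Fin s) (h : Hf e)
    (l : Fin m → Hf e) : phi K N Δ p (Fin.cons h (l ∘ π) : Fin (m + 1) → Hf e) =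
      Equiv.Perm.sign π • phi K N Δ p (Fin.cons h l : Fin (m + 1) → Hf e) := by
  have h1 : (Fin.cons h (l ∘ π) : Fin (m + 1) → Hf e) =
      (Fin.cons h l : Fin (m + 1) → Hf e) ∘ Equiv.Perm.decomposeFin.symm (0, π) := by
    funext i
    refine Fin.cases ?_ (fun i => ?_) i
    · simp [Equiv.Perm.decomposeFin_symm_apply_zero]
    · simp [Equiv.Perm.decomposeFin_symm_apply_succ]
  rw [h1, phi_perm, Equiv.Perm.decomposeFin.symm_sign, if_pos rfl, one_mul]

variable [CharZero K]

/-- In the differential of the sum over the sections the terms that direct one more zigzag cancel: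
such a term has a vertex with two outgoing half-edges, each of which may be the additional one. -/
theorem sum_section_cons (p : Hf e → Fin v ⊕ Fin s) : (∑ t : Fin v → Hf e, if Section p t then
    ∑ h, phi K N Δ p (Fin.cons h t : Fin (v + 1) → Hf e) else 0) = 0 := by
  have h1 := sum_omega_smul (K := K) p
    (fun t => ∑ h, phi K N Δ p (Fin.cons h t : Fin (v + 1) → Hf e))
    (fun π k => by
      rw [Finset.smul_sum]
      exact Finset.sum_congr rfl fun h _ => phi_cons_perm K N Δ π p h k)
    (fun k hk hL => by
      refine Finset.sum_eq_zero fun h _ => phi_of_not K N Δ fun h' => hL ?_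
      have h2 := h'.2.adm
      have h3 := h'.2.inj
      rw [Fin.range_cons] at h2
      rw [Fin.cons_injective_iff] at h3
      exact ⟨h2.of_insert h3.1 fun x => ⟨k x, ⟨x, rfl⟩, hk x⟩, h3.2, rfl⟩)
  have h2 := sum_delta_phi (K := K) N Δ p (omega p)
  rw [delta_omega] at h2
  simp only [Pi.zero_apply, zero_smul, Finset.sum_const_zero] at h2
  have h3 := (smul_eq_zero.1 h2.symm).resolve_left (Nat.cast_ne_zero.2 (Nat.succ_ne_zero v))
  rw [h3] at h1
  exact (smul_eq_zero.1 h1.symm).resolve_left (Nat.cast_ne_zero.2 v.factorial_ne_zero)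

/-- In the differential of the sum over all sections the terms that direct one more edge cancel, by
the cocycle condition for `omega`, and only the contractions of the arcs remain. -/
theorem d_secSum (hp : Hairy p) :
    (orientedKind N).d K Δ (secSum K N Δ p) = ∑ h, arcSum K N Δ p h := by
  obtain ⟨c, hc⟩ := exists_d_phi K Δ N v s e v
  have h1 : ∀ t : Fin v → Hf e, (orientedKind N).d K Δ (phi K N Δ p t) =
      c • (if Lists p (Set.range t) t then
        (∑ h, phi K N (Δ + 1) p (Fin.cons h t : Fin (v + 1) → Hf e)) else 0) +
      ∑ h, arcTerm K N Δ p t h := by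
    intro t
    by_cases L : Lists p (Set.range t) t
    · have h2 := hc p _ t L hp (Fintype.equivFin _) (Fintype.equivFin _)
      rw [← sum_arcTerm] at h2
      rw [if_pos L]
      exact h2
    · rw [phi_of_not K N Δ fun h => L h.2, if_neg L, map_zero, smul_zero, zero_add,
        Finset.sum_eq_zero fun h _ => arcTerm_of_not K N Δ fun h => L h.1.2]
  have h2 : ∀ t : Fin v → Hf e, (orientedKind N).d K Δ (if Section p t then phi K N Δ p t else 0) =
      c • (if Section p t then
        (∑ h, phi K N (Δ + 1) p (Fin.cons h t : Fin (v + 1) → Hf e)) else 0) +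
      ∑ h, if Section p t then arcTerm K N Δ p t h else 0 := by
    intro t
    by_cases ht : Section p t
    · simp only [if_pos ht]
      rw [h1]
      split_ifs with L
      · rfl
      · congr 2
        refine (Finset.sum_eq_zero fun h _ => phi_of_not K N _ fun h' => L ?_).symm
        have h2 := h'.2.adm
        have h3 := h'.2.inj
        rw [Fin.range_cons] at h2
        rw [Fin.cons_injective_iff] at h3
        exact ⟨h2.of_insert h3.1 fun x => ⟨t x, ⟨x, rfl⟩, ht x⟩, h3.2, rfl⟩
    · simp only [if_neg ht]
      simp
  unfold secSum
  rw [map_sum, Finset.sum_congr rfl fun t _ => h2 t, Finset.sum_add_distrib, ← Finset.smul_sum,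
    sum_section_cons K N _ p, smul_zero, zero_add, Finset.sum_comm]
  rfl

end

end HairForest


namespace HairForest

/-! ### Contraction of the edge and removal of the vertex with the number zero -/

section

variable {v s e : ℕ}

/-- The half-edges of the edges different from the edge with the number `0`. -/
def up (h : Hf e) : Hf (e + 1) := (h.1.succ, h.2)

theorem up_inj {h h' : Hf e} (hh : up h = up h') : h = h' :=
  Prod.ext (Fin.succ_injective _ (congrArg Prod.fst hh)) (congrArg (fun h : Hf (e + 1) => h.2) hh)

theorem up_ne (h : Hf e) (i : Bool) : up h ≠ (0, i) := fun hh =>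
  Fin.succ_ne_zero _ (congrArg Prod.fst hh)

theorem eq_or_eq_up (h : Hf (e + 1)) : (∃ i, h = (0, i)) ∨ ∃ h', h = up h' := by
  obtain ⟨b, i⟩ := h
  obtain rfl | ⟨b, rfl⟩ := Fin.eq_zero_or_eq_succ b
  · exact Or.inl ⟨i, rfl⟩
  · exact Or.inr ⟨(b, i), rfl⟩

/-- The map that identifies the vertex `0` with `X.succ`, with the number `0` removed. -/
def down (X : Fin v) : Fin (v + 1) → Fin v := Fin.cases X id

theorem down_zero (X : Fin v) : down X 0 = X := rfl

theorem down_succ (X w : Fin v) : down X w.succ = w := rfl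

/-- The half-edges of the graph in which the vertex `0` has been identified with `X.succ` and the
edge `0` has been removed. -/
def contr (X : Fin v) (p : Hf (e + 1) → Fin (v + 1) ⊕ Fin s) : Hf e → Fin v ⊕ Fin s :=
  fun h => Sum.map (down X) id (p (up h))

variable {X : Fin v} {p : Hf (e + 1) → Fin (v + 1) ⊕ Fin s}

theorem contr_eq_inr {h : Hf e} {j : Fin s} :
    contr X p h = Sum.inr j ↔ p (up h) = Sum.inr j := by
  unfold contr
  rcases p (up h) with x | i <;> simp

theorem contr_eq_of_zero {h : Hf e} (hh : p (up h) = Sum.inl 0) : contr X p h = Sum.inl X := by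
  unfold contr
  rw [hh]
  rfl

theorem contr_eq_of_succ {h : Hf e} {w : Fin v} (hh : p (up h) = Sum.inl w.succ) :
    contr X p h = Sum.inl w := by
  unfold contr
  rw [hh]
  rfl

theorem contr_eq_inl {h : Hf e} {w : Fin v} (hh : contr X p h = Sum.inl w) :
    p (up h) = Sum.inl w.succ ∨ (p (up h) = Sum.inl 0 ∧ w = X) := by
  rcases hq : p (up h) with x | i
  · obtain rfl | ⟨x, rfl⟩ := Fin.eq_zero_or_eq_succ x
    · exact Or.inr ⟨rfl, Sum.inl_injective (hh.symm.trans (contr_eq_of_zero hq))⟩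
    · exact Or.inl (congrArg _ (congrArg _ (Sum.inl_injective ((contr_eq_of_succ hq).symm.trans hh))))
  · exact (Sum.inl_ne_inr (hh.symm.trans (contr_eq_inr.2 hq))).elim

/-- A section is admissible if it contains the hairs and has no cycles. -/
theorem Section.adm_iff {e v : ℕ} {p : Hf e → Fin v ⊕ Fin s} {t : Fin v → Hf e} (ht : Section p t) :
    Adm p (Set.range t) ↔ (∀ h j, p h = Sum.inr j → ∃ x, bar h = t x) ∧
      ∃ f : Fin v → ℕ, ∀ x y, p (bar (t x)) = Sum.inl y → f y < f x := by
  constructor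
  · intro hA
    refine ⟨fun h j hj => ?_, ?_⟩
    · obtain ⟨x, hx⟩ := hA.hair h j hj
      exact ⟨x, hx.symm⟩
    · obtain ⟨f, hf⟩ := hA.acyc
      exact ⟨f, fun x y hy => hf (t x) ⟨x, rfl⟩ x y (ht x) hy⟩
  · rintro ⟨h1, f, hf⟩
    refine ⟨?_, ?_, ?_, fun x => ⟨t x, ⟨x, rfl⟩, ht x⟩, ?_, f, ?_⟩
    · rintro _ ⟨x, rfl⟩ ⟨y, hy⟩
      have h2 := hf x y (by rw [← hy]; exact ht y)
      have h3 := hf y x (by rw [hy, bar_bar]; exact ht x)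
      omega
    · rintro _ ⟨x, rfl⟩
      exact ⟨x, ht x⟩
    · intro h j hj
      obtain ⟨x, hx⟩ := h1 h j hj
      exact ⟨x, hx.symm⟩
    · rintro _ ⟨x, rfl⟩ j _ _ ⟨y, rfl⟩ hxy
      rw [ht, ht] at hxy
      rw [Sum.inl_injective hxy]
    · rintro _ ⟨x, rfl⟩ x' y hx hy
      obtain rfl := Sum.inl_injective ((ht x).symm.trans hx)
      exact hf _ y hy

/-- The half-edges of a forest before the contraction of its arc with the number `0`. -/
def ext (t : Fin v → Hf e) : Fin (v + 1) → Hf (e + 1) := Fin.cons (0, true) (up ∘ t)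

theorem ext_zero (t : Fin v → Hf e) : ext t 0 = (0, true) := rfl

theorem ext_succ (t : Fin v → Hf e) (w : Fin v) : ext t w.succ = up (t w) := rfl

variable {t : Fin v → Hf e}

theorem up_mem_range {h : Hf e} : up h ∈ Set.range (ext t) ↔ h ∈ Set.range t := by
  constructor
  · rintro ⟨x, hx⟩
    obtain rfl | ⟨x, rfl⟩ := Fin.eq_zero_or_eq_succ x
    · exact (up_ne h true hx.symm).elim
    · exact ⟨x, up_inj hx⟩
  · rintro ⟨x, rfl⟩
    exact ⟨x.succ, rfl⟩

theorem zero_false_notMem : ((0, false) : Hf (e + 1)) ∉ Set.range (ext t) := by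
  rintro ⟨x, hx⟩
  obtain rfl | ⟨x, rfl⟩ := Fin.eq_zero_or_eq_succ x
  · exact Bool.noConfusion (congrArg (fun h : Hf (e + 1) => h.2) hx)
  · exact up_ne _ _ hx

section

variable (h0 : p (0, true) = Sum.inl 0) (hX : p (0, false) = Sum.inl X.succ)
include h0

theorem section_ext_iff :
    Section p (ext t) ↔ Section (contr X p) t ∧ p (up (t X)) = Sum.inl X.succ := by
  constructor
  · exact fun h => ⟨fun w => contr_eq_of_succ (h w.succ), h X.succ⟩
  · rintro ⟨h1, h2⟩ x
    obtain rfl | ⟨w, rfl⟩ := Fin.eq_zero_or_eq_succ x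
    · exact h0
    · rcases contr_eq_inl (h1 w) with h | ⟨h, rfl⟩
      · exact h
      · exact h2

include hX

/-- Acyclicity is inherited in both directions: a height on the contraction is doubled, and the
removed vertex, whose arc ends at the merged vertex, is placed just above it. -/
theorem adm_ext_iff (ht : Section p (ext t)) :
    Adm p (Set.range (ext t)) ↔ Adm (contr X p) (Set.range t) := by
  rw [ht.adm_iff, ((section_ext_iff h0).1 ht).1.adm_iff]
  refine and_congr ⟨fun h k j hj => ?_, fun h k j hj => ?_⟩ ⟨?_, ?_⟩
  · obtain ⟨x, hx⟩ := h (up k) j (contr_eq_inr.1 hj)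
    obtain rfl | ⟨w, rfl⟩ := Fin.eq_zero_or_eq_succ x
    · exact (up_ne (bar k) true hx).elim
    · exact ⟨w, up_inj hx⟩
  · obtain ⟨i, rfl⟩ | ⟨k, rfl⟩ := eq_or_eq_up k
    · cases i
      · exact (Sum.inl_ne_inr (hX.symm.trans hj)).elim
      · exact (Sum.inl_ne_inr (h0.symm.trans hj)).elim
    · obtain ⟨w, hw⟩ := h k j (contr_eq_inr.2 hj)
      exact ⟨w.succ, congrArg up hw⟩
  · rintro ⟨f, hf⟩
    refine ⟨fun w => f w.succ, fun w y hy => ?_⟩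
    rcases contr_eq_inl hy with h | ⟨h, rfl⟩
    · exact hf w.succ y.succ h
    · exact (hf 0 _ hX).trans (hf w.succ 0 h)
  · rintro ⟨f, hf⟩
    refine ⟨Fin.cases (2 * f X + 1) fun w => 2 * f w, fun x y hy => ?_⟩
    obtain rfl | ⟨w, rfl⟩ := Fin.eq_zero_or_eq_succ x
    · obtain rfl := Sum.inl_injective (hX.symm.trans hy)
      exact Nat.lt_succ_self _
    · change p (up (bar (t w))) = _ at hy
      obtain rfl | ⟨y, rfl⟩ := Fin.eq_zero_or_eq_succ y
      · have := hf w X (contr_eq_of_zero hy)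
        change 2 * f X + 1 < 2 * f w
        omega
      · have := hf w y (contr_eq_of_succ hy)
        change 2 * f y < 2 * f w
        omega

end

/-- The vertices of the oriented graph and of its contraction. -/
noncomputable def contrVert (t : Fin v → Hf e) :
    Option (Fin v ⊕ Zig (Set.range t)) ≃ Fin (v + 1) ⊕ Zig (Set.range (ext t)) :=
  Equiv.ofBijective (fun o => o.elim (Sum.inl 0) (Sum.map Fin.succ fun b =>
    (⟨b.1.succ, fun i hi => b.2 i (up_mem_range.1 hi)⟩ : Zig (Set.range (ext t))))) (by
    constructor
    · rintro (_ | x | b) (_ | x' | b') h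
      · rfl
      · exact (Fin.succ_ne_zero _ (Sum.inl_injective h).symm).elim
      · exact (Sum.inl_ne_inr h).elim
      · exact (Fin.succ_ne_zero _ (Sum.inl_injective h)).elim
      · exact congrArg (fun x => some (Sum.inl x)) (Fin.succ_injective _ (Sum.inl_injective h))
      · exact (Sum.inl_ne_inr h).elim
      · exact (Sum.inr_ne_inl h).elim
      · exact (Sum.inr_ne_inl h).elim
      · exact congrArg (fun x => some (Sum.inr x)) (Subtype.ext (Fin.succ_injective _
          (congrArg (fun b : Zig (Set.range (ext t)) => b.1) (Sum.inr_injective h))))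
    · rintro (x | b)
      · obtain rfl | ⟨w, rfl⟩ := Fin.eq_zero_or_eq_succ x
        · exact ⟨none, rfl⟩
        · exact ⟨some (Sum.inl w), rfl⟩
      · obtain ⟨b, hb⟩ := b
        obtain rfl | ⟨b, rfl⟩ := Fin.eq_zero_or_eq_succ b
        · exact (hb true ⟨0, rfl⟩).elim
        · exact ⟨some (Sum.inr ⟨b, fun i hi => hb i (up_mem_range.2 hi)⟩), rfl⟩)

theorem forestVerts_contrVert {L : Lists (contr X p) (Set.range t) t}
    {L' : Lists p (Set.range (ext t)) (ext t)} :
    TG.optNum (contrVert t).symm (forestVerts L) = forestVerts L' := by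
  refine Equiv.ext fun u => ?_
  obtain ⟨o, rfl⟩ := (contrVert t).surjective u
  rcases o with _ | z
  · exact TG.optNum_none _ _ ((contrVert t).symm_apply_apply none)
  · refine (TG.optNum_some _ _ ((contrVert t).symm_apply_apply (some z))).trans ?_
    rcases z with w | b <;> rfl

/-- The edges of the oriented graph and of its contraction. -/
noncomputable def contrEdges (hX : p (0, false) = Sum.inl X.succ) (t : Fin v → Hf e) :
    Option (Edge (contr X p) (Set.range t)) ≃ Edge p (Set.range (ext t)) :=
  Equiv.ofBijective (fun o => o.elim ⟨(0, false), zero_false_notMem, X.succ, hX⟩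
    fun k => ⟨up k.1, fun h => k.2.1 (up_mem_range.1 h), by
      obtain ⟨w, hw⟩ := k.2.2
      rcases contr_eq_inl hw with h | h
      · exact ⟨_, h⟩
      · exact ⟨_, h.1⟩⟩) (by
    constructor
    · rintro (_ | k') (_ | k'') h
      · rfl
      · exact (up_ne _ _ (congrArg Subtype.val h).symm).elim
      · exact (up_ne _ _ (congrArg Subtype.val h)).elim
      · exact congrArg some (Subtype.ext (up_inj
          (congrArg (fun k : Edge p (Set.range (ext t)) => k.1) h)))
    · rintro ⟨k, hk, y, hy⟩
      obtain ⟨i, rfl⟩ | ⟨k, rfl⟩ := eq_or_eq_up k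
      · cases i
        · exact ⟨none, rfl⟩
        · exact (hk ⟨0, rfl⟩).elim
      · refine ⟨some ⟨k, fun h => hk (up_mem_range.2 h), ?_⟩, rfl⟩
        obtain rfl | ⟨y, rfl⟩ := Fin.eq_zero_or_eq_succ y
        · exact ⟨_, contr_eq_of_zero hy⟩
        · exact ⟨_, contr_eq_of_succ hy⟩)

theorem contrEdges_none (hX : p (0, false) = Sum.inl X.succ) (t : Fin v → Hf e) :
    (contrEdges hX t none).1 = (0, false) := rfl

theorem contrEdges_some (hX : p (0, false) = Sum.inl X.succ) (t : Fin v → Hf e)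
    (k : Edge (contr X p) (Set.range t)) : (contrEdges hX t (some k)).1 = up k.1 := rfl

variable (K : Type*) [Field K] (N Δ : ℤ)

/-- The contraction of the first arc in the oriented graph of a section is the oriented graph of the
contracted hairy graph, with a sign that comes from the numbers `0` of the edge and of its source.
-/
theorem ct_contr (h0 : p (0, true) = Sum.inl 0) (hX : p (0, false) = Sum.inl X.succ)
    (hp : Hairy p) (hp' : Hairy (contr X p)) (hA : Adm p (Set.range (ext t)))
    (hA' : Adm (contr X p) (Set.range t)) {w r : ℕ} (nV : Fin v ⊕ Zig (Set.range t) ≃ Fin w)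
    (nE : Edge (contr X p) (Set.range t) ≃ Fin r) :
    (og p (Set.range (ext t))).ct K N Δ (TG.optNum (contrVert t).symm nV)
        (TG.optNum (contrEdges hX t).symm nE) (contrEdges hX t none) (hA.ne _) =
      (if Even N then 1 else -1 : ℤˣ) •
        (og (contr X p) (Set.range t)).cl K N (Δ + 1) nV nE := by
  have hz : (contrVert t).symm (Sum.inl 0) = none := by
    rw [Equiv.symm_apply_eq]; rfl
  have hsome : ∀ w : Fin v, (contrVert t).symm (Sum.inl w.succ) = some (Sum.inl w) := fun w => by
    rw [Equiv.symm_apply_eq]; rfl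
  have hcol : ∀ (h : Hf e) (x : Fin v) (y : Fin (v + 1)), contr X p h = Sum.inl x →
      p (up h) = Sum.inl y →
      Sum.inl x = ((contrVert t).symm (Sum.inl y)).getD (Sum.inl X) := by
    intro h x y hx hy
    rcases contr_eq_inl hx with h1 | ⟨h1, rfl⟩
    · obtain rfl := Sum.inl_injective (h1.symm.trans hy)
      rw [hsome]
      rfl
    · obtain rfl := Sum.inl_injective (h1.symm.trans hy)
      rw [hz]
      rfl
  have hcontract := TG.ct_optNum K N Δ (og p (Set.range (ext t)))
    (og (contr X p) (Set.range t)) (contrEdges hX t none) (hA.ne _) (contrVert t).symm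
    (contrEdges hX t).symm ?_ ?_ (Sum.inl X) ?_ ?_ ?_ nV nE
  · rw [hcontract, if_pos]
    rw [hA.sinks_og hp, hA'.sinks_og hp']
  · rw [og_s_arc (contrEdges hX t none) ⟨0, rfl⟩ h0]
    exact hz
  · rw [Equiv.symm_apply_eq]
  · rw [og_t_eq (contrEdges hX t none) hX]
    exact hsome X
  · intro k
    rw [Equiv.symm_symm]
    have h1 := contrEdges_some hX t k
    by_cases h : bar k.1 ∈ Set.range t
    · obtain ⟨x, hx⟩ := hA'.src_int _ h
      have h2 : up (bar k.1) ∈ Set.range (ext t) := up_mem_range.2 h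
      obtain ⟨y, hy⟩ := hA.src_int _ h2
      rw [og_s_arc k h hx, og_s_arc (contrEdges hX t (some k)) h2 hy]
      exact hcol _ x y hx hy
    · have h2 : up (bar k.1) ∉ Set.range (ext t) := mt up_mem_range.1 h
      rw [og_s_zig k h, og_s_zig (contrEdges hX t (some k)) h2]
      have h4 : (contrVert t).symm (Sum.inr ⟨(contrEdges hX t (some k)).1.1,
          (contrEdges hX t (some k)).zig h2⟩) = some (Sum.inr ⟨k.1.1, k.zig h⟩) := by
        rw [Equiv.symm_apply_eq]
        rfl
      rw [h4]
      rfl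
  · intro k
    rw [Equiv.symm_symm, og_t, og_t]
    exact hcol k.1 _ _ k.p_eq (contrEdges hX t (some k)).p_eq

end

end HairForest


namespace HairForest

/-! ### Signs of forests under contraction -/

section

open Classical

variable {v s e : ℕ} {X : Fin v} {p : Hf (e + 1) → Fin (v + 1) ⊕ Fin s} {t : Fin v → Hf e}

theorem grOf_contr (h0 : p (0, true) = Sum.inl 0) (hX : p (0, false) = Sum.inl X.succ) :
    grOf (contr X p) = (grOf p).contract ⟨(0, X.succ, 0), hX, h0, Fin.succ_ne_zero X⟩ := by
  have h1 : ∀ w : Fin (v + 1), Gr.merge X.succ 0 (Fin.succ_ne_zero X) w = down X w := by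
    intro w
    apply Gr.skip_inj (y := (0 : Fin (v + 1)))
    refine (Gr.skip_merge _ _ _ _).trans (Eq.trans ?_ (TG.skip_zero (down X w)).symm)
    obtain rfl | ⟨w, rfl⟩ := Fin.eq_zero_or_eq_succ w
    · rw [if_pos rfl, down_zero]
    · rw [if_neg (Fin.succ_ne_zero w), down_succ]
  have h2 : ∀ b i, contr X p (b, i) =
      Sum.map (Gr.merge X.succ 0 (Fin.succ_ne_zero X)) id (p (Gr.skip (0 : Fin (e + 1)) b, i)) := by
    intro b i
    have h3 : Gr.skip (0 : Fin (e + 1)) b = b.succ := TG.skip_zero b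
    rw [h3]
    exact congrArg (fun f => Sum.map f id (p (b.succ, i))) (funext h1).symm
  exact Gr.mk_congr (fun b => h2 b false) fun b => h2 b true

theorem Hairy.contr (hp : Hairy p) (h0 : p (0, true) = Sum.inl 0)
    (hX : p (0, false) = Sum.inl X.succ) : Hairy (contr X p) := by
  rw [← isHairy_iff, grOf_contr h0 hX]
  exact ((isHairy_iff p).2 hp).contract _

section

variable (h0 : p (0, true) = Sum.inl 0) (hX : p (0, false) = Sum.inl X.succ)
  (ht : Section p (ext t)) (hA : Adm p (Set.range (ext t)))
include hX ht hA

theorem parent_ext_zero :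
    (grOf p).parent (fun x => (ext t x).1) 0 = Sum.inl X.succ := by
  rw [parent_eq, ht.half_fst hA]
  exact hX

omit hX in
theorem parent_ext_succ (w : Fin v) :
    (grOf p).parent (fun x => (ext t x).1) w.succ = p (up (bar (t w))) := by
  rw [parent_eq, ht.half_fst hA]
  rfl

include h0

theorem parent_contr (w : Fin v) :
    (grOf (contr X p)).parent (fun x => (t x).1) w = contr X p (bar (t w)) := by
  rw [parent_eq, ((section_ext_iff h0).1 ht).1.half_fst ((adm_ext_iff h0 hX ht).1 hA)]

theorem parent_ext_eq_inr (w : Fin v) (j : Fin s) :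
    (grOf p).parent (fun x => (ext t x).1) w.succ = Sum.inr j ↔
      (grOf (contr X p)).parent (fun x => (t x).1) w = Sum.inr j := by
  rw [parent_ext_succ ht hA, parent_contr h0 hX ht hA, contr_eq_inr]

theorem parent_ext_inl (w : Fin v) :
    (∃ y, (grOf p).parent (fun x => (ext t x).1) w.succ = Sum.inl y) ↔
      ∃ y, (grOf (contr X p)).parent (fun x => (t x).1) w = Sum.inl y := by
  have h1 : ∀ {a b : ℕ} (q : Fin a ⊕ Fin b), (∃ y, q = Sum.inl y) ↔ ∀ j, q ≠ Sum.inr j := by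
    intro a b q
    rcases q with x | x <;> simp
  rw [h1, h1]
  exact forall_congr' fun j => not_congr (parent_ext_eq_inr h0 hX ht hA w j)

/-- The order of the edges of the oriented graph of a forest before and after the contraction. -/
theorem exists_forestOrder {r : ℕ}
    (o : Fin r ≃o (grOf (contr X p)).ForestEdge fun x => (t x).1) :
    ∃ o' : Fin (r + 1) ≃o (grOf p).ForestEdge fun x => (ext t x).1,
      forestHalf p (fun x => (ext t x).1) (o' 0) = (0, false) ∧
      ∀ i, forestHalf p (fun x => (ext t x).1) (o' i.succ) =
        up (forestHalf (contr X p) (fun x => (t x).1) (o i)) := by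
  have hout : ∀ b : {b : Fin e // ∀ x, (t x).1 ≠ b}, ∀ x, (ext t x).1 ≠ b.1.succ := by
    intro b x hx
    obtain rfl | ⟨w, rfl⟩ := Fin.eq_zero_or_eq_succ x
    · exact (Fin.succ_ne_zero _ hx.symm).elim
    · exact b.2 w (Fin.succ_injective _ hx)
  let F : (grOf (contr X p)).ForestEdge (fun x => (t x).1) →
      (grOf p).ForestEdge fun x => (ext t x).1 := fun k =>
    Sum.elim (fun x => toLex (Sum.inl ⟨x.1.succ, (parent_ext_inl h0 hX ht hA x.1).2 x.2⟩))
      (fun c => toLex (Sum.inr (toLex (⟨(ofLex c).1.1.succ, hout (ofLex c).1⟩, (ofLex c).2))))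
      (ofLex k)
  have hF : StrictMono F := by
    intro k k' hk
    obtain ⟨k, rfl⟩ := toLex.surjective k
    obtain ⟨k', rfl⟩ := toLex.surjective k'
    rcases k with x | c <;> rcases k' with x' | c'
    · have h1 : x < x' := Sum.Lex.inl_lt_inl_iff.1 hk
      have h2 : x.1 < x'.1 := h1
      refine Sum.Lex.inl_lt_inl_iff.2 ?_
      exact (Fin.succ_lt_succ_iff.2 h2 : x.1.succ < x'.1.succ)
    · exact Sum.Lex.inl_lt_inr _ _
    · exact (Sum.Lex.not_inr_lt_inl hk).elim
    · refine Sum.Lex.inr_lt_inr_iff.2 ?_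
      have h1 := Sum.Lex.inr_lt_inr_iff.1 hk
      rw [Prod.Lex.lt_iff] at h1 ⊢
      rcases h1 with h1 | ⟨h1, h2⟩
      · exact Or.inl (Fin.succ_lt_succ_iff.2 h1)
      · exact Or.inr ⟨Subtype.ext (congrArg
          (fun b : {b : Fin e // ∀ x, (t x).1 ≠ b} => Fin.succ b.1) h1), h2⟩
  let G : Fin (r + 1) → (grOf p).ForestEdge fun x => (ext t x).1 :=
    Fin.cases (toLex (Sum.inl ⟨0, _, parent_ext_zero hX ht hA⟩)) fun i => F (o i)
  have hG : StrictMono G := by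
    intro i j hij
    obtain rfl | ⟨j, rfl⟩ := Fin.eq_zero_or_eq_succ j
    · exact (Fin.not_lt_zero _ hij).elim
    obtain rfl | ⟨i, rfl⟩ := Fin.eq_zero_or_eq_succ i
    · change _ < F (o j)
      obtain ⟨k, hk⟩ := toLex.surjective (o j)
      rw [← hk]
      rcases k with x | c
      · exact Sum.Lex.inl_lt_inl_iff.2 (Fin.succ_pos _)
      · exact Sum.Lex.inl_lt_inr _ _
    · exact hF (o.strictMono (Fin.succ_lt_succ_iff.1 hij))
  have hsurj : Function.Surjective G := by
    intro k
    obtain ⟨k, rfl⟩ := toLex.surjective k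
    rcases k with ⟨x, hx⟩ | c
    · obtain rfl | ⟨w, rfl⟩ := Fin.eq_zero_or_eq_succ x
      · exact ⟨0, rfl⟩
      · obtain ⟨i, hi⟩ := o.surjective
          (toLex (Sum.inl ⟨w, (parent_ext_inl h0 hX ht hA w).1 hx⟩))
        exact ⟨i.succ, congrArg F hi⟩
    · obtain ⟨⟨⟨b, hb⟩, i⟩, rfl⟩ := toLex.surjective c
      obtain rfl | ⟨b, rfl⟩ := Fin.eq_zero_or_eq_succ b
      · exact (hb 0 rfl).elim
      · obtain ⟨j, hj⟩ := o.surjective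
          (toLex (Sum.inr (toLex (⟨b, fun x hx => hb x.succ (congrArg Fin.succ hx)⟩, i))))
        exact ⟨j.succ, congrArg F hj⟩
  refine ⟨hG.orderIsoOfSurjective G hsurj, ?_, fun i => ?_⟩
  · change bar (half p (fun x => (ext t x).1) 0) = _
    rw [ht.half_fst hA]
    rfl
  · change forestHalf p _ (F (o i)) = _
    obtain ⟨k, hk⟩ := toLex.surjective (o i)
    rw [← hk]
    rcases k with x | c
    · change bar (half p (fun x => (ext t x).1) x.1.succ) =
        up (bar (half (contr X p) (fun x => (t x).1) x.1))
      rw [ht.half_fst hA, ((section_ext_iff h0).1 ht).1.half_fst ((adm_ext_iff h0 hX ht).1 hA)]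
      rfl
    · rfl

/-- The removed vertex has the smallest number and is not the internal end of a hair of the forest,
so that no inversion is lost; it is the source of its forest arc, but the target of the edge, which
gives the sign. -/
theorem forestSign_ext {n : ℤ} (hn : ¬ Even n) :
    Gr.forestSign n (grOf p) (fun x => (ext t x).1) =
      -Gr.forestSign n (grOf (contr X p)) fun x => (t x).1 := by
  unfold Gr.forestSign
  rw [if_neg hn, if_neg hn, pow_add, pow_add]
  have h1 : (Finset.univ.filter fun q : Fin v × Fin v => q.1 < q.2 ∧
        ∃ j, (grOf (contr X p)).parent (fun x => (t x).1) q.1 = Sum.inr j ∧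
          ∀ i, (grOf (contr X p)).parent (fun x => (t x).1) q.2 = Sum.inr i → i < j).card =
      (Finset.univ.filter fun q : Fin (v + 1) × Fin (v + 1) => q.1 < q.2 ∧
        ∃ j, (grOf p).parent (fun x => (ext t x).1) q.1 = Sum.inr j ∧
          ∀ i, (grOf p).parent (fun x => (ext t x).1) q.2 = Sum.inr i → i < j).card := by
    refine Finset.card_bij (fun q _ => (q.1.succ, q.2.succ)) ?_ ?_ ?_
    · intro q hq
      simp only [Finset.mem_filter, Finset.mem_univ, true_and] at hq ⊢
      simp only [parent_ext_eq_inr h0 hX ht hA, Fin.succ_lt_succ_iff]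
      exact hq
    · intro q _ q' _ h
      exact Prod.ext (Fin.succ_injective _ (congrArg Prod.fst h))
        (Fin.succ_injective _ (congrArg Prod.snd h))
    · rintro ⟨x, y⟩ hq
      simp only [Finset.mem_filter, Finset.mem_univ, true_and] at hq
      obtain ⟨h2, j, h3, h4⟩ := hq
      obtain rfl | ⟨y, rfl⟩ := Fin.eq_zero_or_eq_succ y
      · exact (Fin.not_lt_zero _ h2).elim
      obtain rfl | ⟨x, rfl⟩ := Fin.eq_zero_or_eq_succ x
      · exact (Sum.inl_ne_inr ((parent_ext_zero hX ht hA).symm.trans h3)).elim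
      refine ⟨(x, y), ?_, rfl⟩
      simp only [Finset.mem_filter, Finset.mem_univ, true_and]
      simp only [parent_ext_eq_inr h0 hX ht hA] at h3 h4
      exact ⟨Fin.succ_lt_succ_iff.1 h2, j, h3, h4⟩
  have h2 : (Finset.univ.filter fun x => (grOf p).src (ext t x).1 ≠ Sum.inl x) =
      insert 0 ((Finset.univ.filter fun x => (grOf (contr X p)).src (t x).1 ≠ Sum.inl x).map
        ⟨Fin.succ, Fin.succ_injective _⟩) := by
    have h3 : ∀ x, (grOf p).src (ext t x).1 ≠ Sum.inl x ↔ (ext t x).2 = true := by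
      intro x
      have h4 := half_snd_iff (p := p) (τ := fun x => (ext t x).1) x
      rw [ht.half_fst hA] at h4
      exact h4.symm
    have h5 : ∀ x, (grOf (contr X p)).src (t x).1 ≠ Sum.inl x ↔ (t x).2 = true := by
      intro x
      have h4 := half_snd_iff (p := contr X p) (τ := fun x => (t x).1) x
      rw [((section_ext_iff h0).1 ht).1.half_fst ((adm_ext_iff h0 hX ht).1 hA)] at h4
      exact h4.symm
    simp only [h3, h5]
    refine Finset.ext fun x => ?_
    obtain rfl | ⟨x, rfl⟩ := Fin.eq_zero_or_eq_succ x
    · simp [ext_zero]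
    · simp [ext_succ, up, Fin.succ_ne_zero]
  rw [← h1, h2, Finset.card_insert_of_notMem (by simp [Fin.succ_ne_zero]), Finset.card_map,
    pow_succ, mul_neg_one, mul_neg]

end

variable (K : Type*) [Field K] (n Δ : ℤ)

/-- The contraction of the first arc of the oriented graph of a forest. -/
theorem arcTerm_ext (h0 : p (0, true) = Sum.inl 0) (hX : p (0, false) = Sum.inl X.succ)
    (hp : Hairy p) (ht : Section p (ext t)) :
    forestConst n (v + 1) s (e + 1) • arcTerm K (n + 1) Δ p (ext t) (0, false) =
      -(forestConst n v s e • phi K (n + 1) (Δ + 1) (contr X p) t) := by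
  by_cases hA : Adm p (Set.range (ext t))
  · have hA' := (adm_ext_iff h0 hX ht).1 hA
    have hp' := hp.contr h0 hX
    have ht' : Section (contr X p) t := ((section_ext_iff h0).1 ht).1
    have L : Lists p (Set.range (ext t)) (ext t) := ⟨hA, ht.injective, rfl⟩
    have L' : Lists (contr X p) (Set.range t) t := ⟨hA', ht'.injective, rfl⟩
    obtain ⟨r, ⟨o⟩⟩ : ∃ r, Nonempty (Fin r ≃o (grOf (contr X p)).ForestEdge fun x => (t x).1) :=
      ⟨_, ⟨(exists_forestGraph_eq hp' (ht'.isHairForest hp' hA')).choose⟩⟩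
    obtain ⟨nE, hE⟩ : ∃ nE : Edge (contr X p) (Set.range t) ≃ Fin r,
        ∀ i, (nE.symm i).1 = forestHalf (contr X p) (fun x => (t x).1) (o i) := by
      have h1 : half (contr X p) (fun x => (t x).1) = t := ht'.half_fst hA'
      refine ⟨((forestEdges hp' (ht'.isHairForest hp' hA')).trans
        (Equiv.subtypeEquivRight fun h => by rw [h1])).symm.trans o.symm.toEquiv, fun i => rfl⟩
    obtain ⟨o', ho1, ho2⟩ := exists_forestOrder h0 hX ht hA o
    have h1 : L.fr (n + 1) hp (forestVerts L) (TG.optNum (contrEdges hX t).symm nE) =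
        forestConst n (v + 1) s (e + 1) * Gr.forestSign n (grOf p) fun x => (ext t x).1 := by
      refine ht.fr_eq_forestConst n L hp o' _ fun i => ?_
      obtain rfl | ⟨i, rfl⟩ := Fin.eq_zero_or_eq_succ i
      · rw [ho1]
        have h2 : TG.optNum (contrEdges hX t).symm nE (contrEdges hX t none) = 0 :=
          TG.optNum_none _ _ (Equiv.symm_apply_apply _ _)
        rw [← h2, Equiv.symm_apply_apply]
        rfl
      · rw [ho2, TG.optNum_symm_succ, Equiv.symm_symm, ← hE]
        rfl
    have h2 : L'.fr (n + 1) hp' (forestVerts L') nE =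
        forestConst n v s e * Gr.forestSign n (grOf (contr X p)) fun x => (t x).1 :=
      ht'.fr_eq_forestConst n L' hp' o _ hE
    have h3 := arcTerm_eq K (n + 1) Δ L hp (forestVerts L)
      (TG.optNum (contrEdges hX t).symm nE) (contrEdges hX t none) ⟨0, rfl⟩
    have h4 := ct_contr K (n + 1) Δ h0 hX hp hp' hA hA' (forestVerts L') nE
    rw [forestVerts_contrVert (L' := L)] at h4
    rw [contrEdges_none, h1] at h3
    rw [h3, h4, phi_eq K (Δ + 1) L' hp' (forestVerts L') nE, h2, smul_smul, smul_smul, smul_smul,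
      ← Units.neg_smul]
    congr 1
    by_cases hn : Even n
    · unfold Gr.forestSign
      rw [if_pos hn, if_pos hn, if_neg (by rw [Int.even_add_one, not_not]; exact hn)]
      generalize forestConst n (v + 1) s (e + 1) = a
      generalize forestConst n v s e = b
      revert a b
      decide
    · rw [forestSign_ext h0 hX ht hA hn, if_pos (Int.even_add_one.2 hn)]
      generalize forestConst n (v + 1) s (e + 1) = a
      generalize forestConst n v s e = b
      generalize Gr.forestSign n _ _ = c
      revert a b c
      decide
  · rw [arcTerm_of_not K _ Δ fun h => hA h.1.2.adm, smul_zero,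
      phi_of_not K _ (Δ + 1) fun h => hA ((adm_ext_iff h0 hX ht).2 h.2.adm), smul_zero, neg_zero]

/-- The sections of a hairy graph that contain the first edge, directed from the removed vertex,
correspond to the sections of the contraction for which the arc at the merged vertex starts at the
end `X` of the edge. -/
theorem arcSum_zero_false (h0 : p (0, true) = Sum.inl 0) (hX : p (0, false) = Sum.inl X.succ)
    (hp : Hairy p) :
    forestConst n (v + 1) s (e + 1) • arcSum K (n + 1) Δ p (0, false) =
      -(forestConst n v s e • ∑ t : Fin v → Hf e,
        if Section (contr X p) t ∧ p (up (t X)) = Sum.inl X.succ then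
          phi K (n + 1) (Δ + 1) (contr X p) t else 0) := by
  unfold arcSum
  rw [Finset.smul_sum, Finset.smul_sum, ← Finset.sum_neg_distrib]
  symm
  refine Finset.sum_of_injOn ext ?_ (fun _ _ => Finset.mem_univ _) ?_ ?_
  · intro t _ t' _ h
    funext w
    exact up_inj (congrFun h w.succ)
  · intro T _ hT
    split_ifs with hs
    -- a section whose arc term does not vanish contains the first edge and no other half of it
    · rw [arcTerm_of_not, smul_zero]
      rintro ⟨⟨-, L⟩, ⟨x, hx⟩, -⟩
      obtain rfl : x = 0 := Sum.inl_injective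
        ((hs x).symm.trans ((congrArg p hx).trans h0))
      have h1 : ∀ w : Fin v, ∃ h, T w.succ = up h := by
        intro w
        obtain ⟨i, hi⟩ | h := eq_or_eq_up (T w.succ)
        · exact (Fin.succ_ne_zero w (L.fst_inj ((congrArg Prod.fst hi).trans
            (congrArg Prod.fst hx).symm))).elim
        · exact h
      choose t ht using h1
      refine hT ⟨t, Finset.mem_coe.2 (Finset.mem_univ _), funext fun x => ?_⟩
      obtain rfl | ⟨w, rfl⟩ := Fin.eq_zero_or_eq_succ x
      · exact hx.symm
      · exact (ht w).symm
    · exact smul_zero _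
  · intro t _
    by_cases h : Section p (ext t)
    · rw [if_pos ((section_ext_iff h0).1 h), if_pos h, arcTerm_ext K n Δ h0 hX hp h]
    · rw [if_neg (mt (section_ext_iff h0).2 h), if_neg h, smul_zero, smul_zero, neg_zero]

end

end HairForest


namespace HairForest

/-! ### The map of complexes -/

section

variable {v s e : ℕ}

/-- A renumbering of the edges, on half-edges. -/
def Sym.ofPerm (π : Equiv.Perm (Fin e)) : Sym e :=
  ⟨Equiv.prodCongrLeft fun _ => π, fun _ => rfl⟩

/-- The exchange of the two halves of an edge. -/
def Sym.flip (c : Fin e) : Sym e :=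
  ⟨Equiv.swap (c, false) (c, true), by
    rintro ⟨b, i⟩
    by_cases hb : b = c
    · subst hb
      cases i <;> simp [bar]
    · rw [Equiv.swap_apply_of_ne_of_ne, Equiv.swap_apply_of_ne_of_ne] <;>
        exact fun h => hb (congrArg Prod.fst h)⟩

theorem Sym.edgePerm_ofPerm (π : Equiv.Perm (Fin e)) : Sym.edgePerm (Sym.ofPerm π) = π :=
  Equiv.ext fun _ => rfl

theorem Sym.sign_ofPerm (π : Equiv.Perm (Fin e)) :
    Equiv.Perm.sign (Sym.ofPerm π).1 = 1 := by
  refine (Equiv.Perm.sign_prodCongrLeft fun _ : Bool => π).trans ?_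
  rw [Fintype.prod_bool, Int.units_mul_self]

theorem Sym.flip_apply_of_ne (c : Fin e) {h : Hf e} (hh : h.1 ≠ c) : (Sym.flip c).1 h = h :=
  Equiv.swap_apply_of_ne_of_ne (fun h' => hh (congrArg Prod.fst h'))
    fun h' => hh (congrArg Prod.fst h')

theorem Sym.flip_apply (c : Fin e) (i : Bool) : (Sym.flip c).1 (c, i) = (c, !i) := by
  cases i
  · exact Equiv.swap_apply_left _ _
  · exact Equiv.swap_apply_right _ _

theorem Sym.edgePerm_flip (c : Fin e) : Sym.edgePerm (Sym.flip c) = 1 := by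
  refine Equiv.ext fun b => ?_
  change ((Sym.flip c).1 (b, false)).1 = b
  by_cases hb : b = c
  · subst hb
    rw [Sym.flip_apply]
  · rw [Sym.flip_apply_of_ne c (h := (b, false)) hb]

theorem Sym.sign_flip (c : Fin e) : Equiv.Perm.sign (Sym.flip c).1 = -1 :=
  Equiv.Perm.sign_swap fun h => Bool.noConfusion (congrArg (fun h : Hf e => h.2) h)

theorem chi_ofPerm (n : ℤ) (σ : Equiv.Perm (Fin v)) (ρ : Equiv.Perm (Fin s))
    (π : Equiv.Perm (Fin e)) :
    chi (n + 1) ((σ, ρ, Sym.ofPerm π) : Ren v s e) * Equiv.Perm.sign σ = Gr.relSign n σ ρ π := by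
  have h1 : ∀ a b : ℤˣ, a * b * a = b := by decide
  have h2 : ∀ a b : ℤˣ, b * 1 * a = a * b := by decide
  unfold Gr.relSign chi
  simp only [MonoidHom.coe_mk, OneHom.coe_mk, Sym.edgePerm_ofPerm, Sym.sign_ofPerm]
  by_cases hn : Even n
  · rw [if_pos hn, if_neg (by rw [Int.even_add_one, not_not]; exact hn)]
    exact h1 _ _
  · rw [if_neg hn, if_pos (Int.even_add_one.2 hn)]
    exact h2 _ _

theorem chi_flip (n : ℤ) (c : Fin e) :
    chi (n + 1) ((1, 1, Sym.flip c) : Ren v s e) = Gr.flipSign n := by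
  unfold Gr.flipSign chi
  simp only [MonoidHom.coe_mk, OneHom.coe_mk, Sym.edgePerm_flip, Sym.sign_flip]
  by_cases hn : Even n
  · rw [if_pos hn, if_neg (by rw [Int.even_add_one, not_not]; exact hn)]
    simp
  · rw [if_neg hn, if_pos (Int.even_add_one.2 hn)]
    simp

theorem grOf_act_ofPerm (p : Hf e → Fin v ⊕ Fin s) (σ : Equiv.Perm (Fin v))
    (ρ : Equiv.Perm (Fin s)) (π : Equiv.Perm (Fin e)) :
    grOf (act (σ, ρ, Sym.ofPerm π) p) = (grOf p).relabel σ ρ π := rfl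

theorem act_flip (p : Hf e → Fin v ⊕ Fin s) (c : Fin e) (h : Hf e) :
    act (1, 1, Sym.flip c) p h = p ((Sym.flip c).1 h) := by
  obtain ⟨h, rfl⟩ := (Sym.flip c).1.surjective h
  have h1 := act_apply ((1, 1, Sym.flip c) : Ren v s e) p h
  have h2 : (Sym.flip c).1 ((Sym.flip c).1 h) = h := Equiv.swap_apply_self _ _ _
  rw [h2]
  refine h1.trans ?_
  rcases p h with x | x <;> rfl

theorem grOf_act_flip (p : Hf e → Fin v ⊕ Fin s) (c : Fin e) :
    grOf (act (1, 1, Sym.flip c) p) = (grOf p).flip c := by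
  refine Gr.mk_congr (fun b => (act_flip p c (b, false)).trans ?_)
    (fun b => (act_flip p c (b, true)).trans ?_) <;>
  · by_cases hb : b = c
    · subst hb
      rw [Sym.flip_apply, if_pos rfl]
      rfl
    · rw [Sym.flip_apply_of_ne c (h := (b, _)) hb, if_neg hb]

variable (K : Type*) [Field K] (n Δ : ℤ)

theorem forestSum_act {p : Hf e → Fin v ⊕ Fin s} (hp : Hairy p) (g : Ren v s e) :
    forestSum K n Δ (grOf (act g p)) =
      (chi (n + 1) g * Equiv.Perm.sign g.1) • forestSum K n Δ (grOf p) := by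
  rw [forestSum_eq K Δ n (hp.act g), forestSum_eq K Δ n hp, secSum_act, smul_comm]

open Classical in
/-- The signed sum over the hair forests, extended by zero to all graphs. -/
noncomputable def hairySum (Γ : Gr) : (orientedKind (n + 1)).Space K Δ :=
  if Γ.IsHairy then forestSum K n Δ Γ else 0

/-- The sum over the hair forests respects the defining relations of the hairy complex. -/
theorem hairySum_of_rel (Γ Γ' : Gr) (ε : ℤˣ) (h : (hairyKind n).Rel Γ Γ' ε) :
    hairySum K n Δ Γ' = ε • hairySum K n Δ Γ := by
  have h1 : Γ'.IsHairy ↔ Γ.IsHairy := by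
    cases h with
    | relabel σ ρ π => exact GraphKind.adm_relabel_iff (𝒢 := hairyKind n) Γ σ ρ π
    | flip c hf => exact GraphKind.adm_flip_iff (𝒢 := hairyKind n) Γ c hf
  unfold hairySum
  by_cases hΓ : Γ.IsHairy
  · rw [if_pos hΓ, if_pos (h1.2 hΓ)]
    have hp : Hairy (en Γ) := (isHairy_iff (en Γ)).1 hΓ
    cases h with
    | relabel σ ρ π =>
      have h2 := forestSum_act K n Δ hp (σ, ρ, Sym.ofPerm π)
      have h3 := chi_ofPerm n σ ρ π
      exact h2.trans (congrArg (fun u : ℤˣ => u • forestSum K n Δ Γ) h3)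
    | flip c hf =>
      have h2 := forestSum_act K n Δ hp ((1, 1, Sym.flip c) : Ren Γ.v Γ.s Γ.e)
      have h3 := chi_flip (v := Γ.v) (s := Γ.s) n c
      rw [grOf_act_flip, h3] at h2
      refine h2.trans ?_
      rw [Equiv.Perm.sign_one, mul_one]
      rfl
  · rw [if_neg hΓ, if_neg (mt h1.1 hΓ), smul_zero]

/-- The map on the hairy graph complex, in a fixed degree. -/
noncomputable def forestMap (D : ℤ) :
    (hairyKind n).Space K D →ₗ[K] (orientedKind (n + 1)).Space K (D + 1) :=
  lift K D (hairySum K n (D + 1)) (hairySum_of_rel K n (D + 1))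

theorem forestMap_cls {D : ℤ} {Γ : Gr} (hΓ : Γ.IsHairy) (hD : Γ.degree n = D) :
    forestMap K n D ((hairyKind n).cls K D Γ) = forestSum K n (D + 1) Γ :=
  (lift_cls K D _ (hairySum_of_rel K n (D + 1)) (𝒢 := hairyKind n) hΓ hD).trans (if_pos hΓ)

section

variable {X : Fin v} {p : Hf (e + 1) → Fin (v + 1) ⊕ Fin s}

/-- The contractions of the arcs that come from the edge with the number `0`: in a forest of the
contracted graph the path from the merged vertex starts at one of the two ends of the edge. -/
theorem arcSum_zero (h0 : p (0, true) = Sum.inl 0) (hX : p (0, false) = Sum.inl X.succ)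
    (hp : Hairy p) :
    forestConst n (v + 1) s (e + 1) •
      (arcSum K (n + 1) Δ p (0, false) + arcSum K (n + 1) Δ p (0, true)) =
      -forestSum K n (Δ + 1) (grOf (contr X p)) := by
  classical
  -- the second sum is reduced to the first one by reversing the edge and exchanging its ends
  obtain ⟨g, hg⟩ : ∃ g : Ren (v + 1) s (e + 1), g = (Equiv.swap 0 X.succ, 1, Sym.flip 0) := ⟨_, rfl⟩
  have hg1 : ∀ i, g.2.2.1 (0, i) = (0, !i) := fun i => by rw [hg]; exact Sym.flip_apply 0 i
  have hg2 : ∀ h : Hf e, g.2.2.1 (up h) = up h := fun h => by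
    rw [hg]; exact Sym.flip_apply_of_ne 0 (Fin.succ_ne_zero _)
  have hg3 : g.1 0 = X.succ := by rw [hg]; exact Equiv.swap_apply_left _ _
  have hg4 : g.1 X.succ = 0 := by rw [hg]; exact Equiv.swap_apply_right _ _
  have hg5 : ∀ w : Fin v, w ≠ X → g.1 w.succ = w.succ := fun w hw => by
    rw [hg]
    exact Equiv.swap_apply_of_ne_of_ne (Fin.succ_ne_zero w) fun h => hw (Fin.succ_injective _ h)
  have hg6 : ∀ j, g.2.1 j = j := fun j => by rw [hg]; rfl
  have hsign : chi (n + 1) g * Equiv.Perm.sign g.1 = 1 := by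
    have h1 : Equiv.Perm.sign g.1 = -1 := by
      rw [hg]; exact Equiv.Perm.sign_swap (Fin.succ_ne_zero X).symm
    rw [h1, hg]
    unfold chi
    simp only [MonoidHom.coe_mk, OneHom.coe_mk, Sym.edgePerm_flip, Sym.sign_flip,
      Equiv.Perm.sign_swap (Fin.succ_ne_zero X).symm, Equiv.Perm.sign_one]
    split_ifs <;> decide
  have h0' : act g p (0, true) = Sum.inl 0 := by
    have h1 := act_eq_inl (g := g) (p := p) (h := (0, false)) (x := X.succ)
    rw [hg1, hg4] at h1
    exact h1.2 hX
  have hX' : act g p (0, false) = Sum.inl X.succ := by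
    have h1 := act_eq_inl (g := g) (p := p) (h := (0, true)) (x := 0)
    rw [hg1, hg3] at h1
    exact h1.2 h0
  have hup : ∀ h : Hf e, act g p (up h) = Sum.map g.1 g.2.1 (p (up h)) := fun h => by
    have h1 := act_apply g p (up h)
    rwa [hg2] at h1
  have hcontr : contr X (act g p) = contr X p := by
    funext h
    rcases hq : p (up h) with x | j
    · obtain rfl | ⟨x, rfl⟩ := Fin.eq_zero_or_eq_succ x
      · rw [contr_eq_of_zero hq, contr_eq_of_succ]
        rw [hup, hq]
        exact congrArg Sum.inl hg3
      · rw [contr_eq_of_succ hq]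
        by_cases hx : x = X
        · subst hx
          rw [contr_eq_of_zero]
          rw [hup, hq]
          exact congrArg Sum.inl hg4
        · rw [contr_eq_of_succ]
          rw [hup, hq]
          exact congrArg Sum.inl (hg5 x hx)
    · rw [contr_eq_inr.2 hq, contr_eq_inr, hup, hq]
      exact congrArg Sum.inr (hg6 j)
  have h1 := arcSum_zero_false K n Δ h0 hX hp
  have h2 := arcSum_zero_false K n Δ h0' hX' (hp.act g)
  have h3 := arcSum_act K (n + 1) Δ g p (0, true)
  rw [hsign, one_smul, hg1] at h3
  rw [hcontr] at h2
  have h4 : ∀ t : Fin v → Hf e, act g p (up (t X)) = Sum.inl X.succ ↔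
      p (up (t X)) = Sum.inl 0 := by
    intro t
    have h5 := act_eq_inl (g := g) (p := p) (h := up (t X)) (x := 0)
    rwa [hg2, hg3] at h5
  simp only [h4] at h2
  rw [smul_add, h1, ← h3]
  refine (congrArg _ h2).trans ?_
  rw [forestSum_eq K (Δ + 1) n (hp.contr h0 hX), ← neg_add, ← smul_add, ← Finset.sum_add_distrib]
  congr 2
  refine Finset.sum_congr rfl fun t _ => ?_
  by_cases ht : Section (contr X p) t
  · rw [if_pos ht]
    rcases contr_eq_inl (ht X) with h | ⟨h, -⟩
    · rw [if_pos ⟨ht, h⟩, if_neg, add_zero]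
      exact fun h' => Fin.succ_ne_zero _ (Sum.inl_injective (h.symm.trans h'.2))
    · rw [if_neg, if_pos ⟨ht, h⟩, zero_add]
      exact fun h' => Fin.succ_ne_zero _ (Sum.inl_injective (h'.2.symm.trans h))
  · rw [if_neg ht, if_neg fun h => ht h.1, if_neg fun h => ht h.1, add_zero]

end

/-- The signed contraction of an edge does not depend on the numbering, up to the sign of the
renumbering. -/
theorem contractSign_hairySum_relabel {Γ : Gr} (q : Γ.Inner) (σ : Equiv.Perm (Fin Γ.v))
    (ρ : Equiv.Perm (Fin Γ.s)) (π : Equiv.Perm (Fin Γ.e)) :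
    Gr.contractSign n (q.relabel σ ρ π) •
        hairySum K n Δ ((Γ.relabel σ ρ π).contract (q.relabel σ ρ π)) =
      Gr.relSign n σ ρ π • Gr.contractSign n q • hairySum K n Δ (Γ.contract q) := by
  have h1 : (hairyKind n).Rel (Γ.contract q) ((Γ.relabel σ ρ π).contract (q.relabel σ ρ π))
      (Gr.relSign n (Gr.removePerm σ q.y (σ q.y) rfl) ρ (Gr.removePerm π q.a (π q.a) rfl)) := by
    rw [Gr.contract_relabel]
    exact GraphKind.Rel.relabel (Γ.contract q) _ ρ _
  rw [hairySum_of_rel K n Δ _ _ _ h1, smul_smul, smul_smul, Gr.contractSign_relabel]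

/-- The contractions of the arcs that come from a given inner edge: after a renumbering the edge and
its target have the number `0`. -/
theorem arcSum_inner {p : Hf e → Fin v ⊕ Fin s} (hp : Hairy p) (q : (grOf p).Inner) :
    forestConst n v s e •
      (arcSum K (n + 1) Δ p (q.a, false) + arcSum K (n + 1) Δ p (q.a, true)) =
      -(Gr.contractSign n q • hairySum K n (Δ + 1) ((grOf p).contract q)) := by
  obtain _ | e := e
  · exact q.a.elim0
  obtain _ | v := v
  · exact q.x.elim0
  obtain ⟨σ, hσ⟩ : ∃ σ : Equiv.Perm (Fin (v + 1)), σ q.y = 0 := ⟨_, Equiv.swap_apply_left q.y 0⟩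
  obtain ⟨π, hπ⟩ : ∃ π : Equiv.Perm (Fin (e + 1)), π q.a = 0 := ⟨_, Equiv.swap_apply_left q.a 0⟩
  obtain ⟨X, hX⟩ : ∃ X : Fin v, σ q.x = X.succ := by
    obtain h | h := Fin.eq_zero_or_eq_succ (σ q.x)
    · exact (q.ne (σ.injective (h.trans hσ.symm))).elim
    · exact h
  obtain ⟨g, hg⟩ : ∃ g : Ren (v + 1) s (e + 1), g = (σ, 1, Sym.ofPerm π) := ⟨_, rfl⟩
  have hga : ∀ i, g.2.2.1 (q.a, i) = (0, i) := fun i => by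
    rw [hg]; exact Prod.ext hπ rfl
  have h0 : act g p (0, true) = Sum.inl 0 := by
    have h1 := act_eq_inl (g := g) (p := p) (h := (q.a, true)) (x := q.y)
    have h2 : g.1 q.y = 0 := by rw [hg]; exact hσ
    rw [hga, h2] at h1
    exact h1.2 q.tgt_eq
  have h1 : act g p (0, false) = Sum.inl X.succ := by
    have h1 := act_eq_inl (g := g) (p := p) (h := (q.a, false)) (x := q.x)
    have h2 : g.1 q.x = X.succ := by rw [hg]; exact hX
    rw [hga, h2] at h1
    exact h1.2 q.src_eq
  have hsign : chi (n + 1) g * Equiv.Perm.sign g.1 =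
      Gr.relSign n σ (1 : Equiv.Perm (Fin s)) π := by
    rw [hg]; exact chi_ofPerm n σ 1 π
  have h2 := arcSum_zero K n Δ h0 h1 (hp.act g)
  have h3 : ∀ i, arcSum K (n + 1) Δ (act g p) (0, i) =
      Gr.relSign n σ (1 : Equiv.Perm (Fin s)) π • arcSum K (n + 1) Δ p (q.a, i) := by
    intro i
    rw [← hga, arcSum_act, hsign]
  have h4 : forestSum K n (Δ + 1) (grOf (contr X (act g p))) =
      Gr.contractSign n (q.relabel σ (1 : Equiv.Perm (Fin s)) π) • hairySum K n (Δ + 1)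
        (((grOf p).relabel σ (1 : Equiv.Perm (Fin s)) π).contract
          (q.relabel σ (1 : Equiv.Perm (Fin s)) π)) := by
    have h5 : Gr.contractSign n (q.relabel σ (1 : Equiv.Perm (Fin s)) π) = 1 := by
      have h6 : (q.relabel σ (1 : Equiv.Perm (Fin s)) π).a.1 = 0 := congrArg Fin.val hπ
      have h7 : (q.relabel σ (1 : Equiv.Perm (Fin s)) π).y.1 = 0 := congrArg Fin.val hσ
      unfold Gr.contractSign
      rw [h6, h7]
      split_ifs <;> exact pow_zero _
    have h6 : grOf (contr X (act g p)) = ((grOf p).relabel σ (1 : Equiv.Perm (Fin s)) π).contract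
        (q.relabel σ (1 : Equiv.Perm (Fin s)) π) := by
      rw [grOf_contr h0 h1]
      subst hg
      exact congrArg (fun q' => ((grOf p).relabel σ (1 : Equiv.Perm (Fin s)) π).contract q')
        (Gr.Inner.ext hπ.symm)
    rw [h5, one_smul, ← h6]
    exact (if_pos ((isHairy_iff _).2 ((hp.act g).contr h0 h1))).symm
  rw [h3, h3, ← smul_add, h4, contractSign_hairySum_relabel, ← smul_neg, smul_comm] at h2
  have h5 := congrArg (fun z => Gr.relSign n σ (1 : Equiv.Perm (Fin s)) π • z) h2
  simp only [smul_smul, Int.units_mul_self, one_smul] at h5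
  rw [← mul_assoc, Int.units_mul_self, one_mul] at h5
  simpa only [smul_smul, smul_neg] using h5

variable [CharZero K]

/-- The sums over the hair forests commute with the differentials, with the sign of the shifted
complex. -/
theorem d_forestMap (D : ℤ) (z : (hairyKind n).Space K D) :
    (orientedKind (n + 1)).d K (D + 1) (forestMap K n D z) =
      -forestMap K n (D + 1) ((hairyKind n).d K D z) := by
  classical
  have hz : z ∈ Submodule.span K {z | ∃ Γ, (hairyKind n).adm Γ ∧ Γ.degree (hairyKind n).N = D ∧
      z = (hairyKind n).cls K D Γ} := by
    rw [span_cls]; trivial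
  induction hz using Submodule.span_induction with
  | zero => simp only [map_zero, neg_zero]
  | add x y _ _ hx hy => rw [map_add, map_add, hx, hy, map_add, map_add, neg_add]
  | smul c x _ hx => rw [map_smul, map_smul, hx, map_smul, map_smul, smul_neg]
  | mem z hz =>
    obtain ⟨Γ, hΓ, hD, rfl⟩ := hz
    obtain ⟨v, s, e, p, rfl⟩ : ∃ (v s e : ℕ) (p : Hf e → Fin v ⊕ Fin s), Γ = grOf p :=
      ⟨Γ.v, Γ.s, Γ.e, en Γ, rfl⟩
    have hp : Hairy p := (isHairy_iff p).1 hΓ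
    rw [forestMap_cls K n hΓ hD, GraphKind.d_cls K hΓ hD, forestSum_eq K (D + 1) n hp,
      Units.smul_def, map_zsmul, ← Units.smul_def, d_secSum K (n + 1) (D + 1) hp]
    have h1 : ∑ h, arcSum K (n + 1) (D + 1) p h = ∑ b, (arcSum K (n + 1) (D + 1) p (b, false) +
        arcSum K (n + 1) (D + 1) p (b, true)) := by
      rw [Fintype.sum_prod_type]
      refine Finset.sum_congr rfl fun b _ => ?_
      rw [Fintype.sum_bool]
      exact add_comm _ _
    -- hairs and tadpoles have no arc terms: a tadpole as an arc would be a cycle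
    have h2 : ∀ h : Hf e, (¬ ∃ q : (grOf p).Inner, q.a = h.1) →
        arcSum K (n + 1) (D + 1) p h = 0 := by
      intro h hh
      refine Finset.sum_eq_zero fun t _ => ?_
      split_ifs with ht
      · refine arcTerm_of_not K _ _ ?_
        rintro ⟨⟨-, L⟩, ⟨x, hx⟩, -, y, hy⟩
        have hxy : x ≠ y := by
          rintro rfl
          obtain ⟨f, hf⟩ := L.adm.acyc
          have := hf (t x) ⟨x, rfl⟩ x x (ht x) (by rw [hx, bar_bar]; exact hy)
          omega
        have hx' : p (bar h) = Sum.inl x := by rw [← hx]; exact ht x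
        obtain ⟨b, i⟩ := h
        cases i
        · exact hh ⟨⟨(b, y, x), hy, hx', hxy.symm⟩, rfl⟩
        · exact hh ⟨⟨(b, x, y), hx', hy, hxy⟩, rfl⟩
      · rfl
    have h3 : ∀ q : (grOf p).Inner, forestMap K n (D + 1) (if (hairyKind n).targets
        ((grOf p).contract q) = (hairyKind n).targets (grOf p) then
          Gr.contractSign (hairyKind n).N q • (hairyKind n).cls K (D + 1) ((grOf p).contract q)
          else 0) = Gr.contractSign n q • hairySum K n (D + 1 + 1) ((grOf p).contract q) := by
      intro q
      have h4 : ((grOf p).contract q).IsHairy := Gr.IsHairy.contract q hΓ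
      have h5 : (hairyKind n).targets ((grOf p).contract q) = (hairyKind n).targets (grOf p) := rfl
      rw [if_pos h5, Units.smul_def, map_zsmul, ← Units.smul_def,
        forestMap_cls K n h4 ((Gr.degree_contract n q).trans (congrArg (· + 1) hD))]
      exact congrArg _ (if_pos h4).symm
    unfold GraphKind.contractions
    rw [map_sum, Finset.sum_congr rfl fun q _ => h3 q, h1, Finset.smul_sum,
      ← Finset.sum_neg_distrib]
    symm
    refine Finset.sum_of_injOn (fun q : (grOf p).Inner => q.a) (fun _ _ _ _ h => Gr.Inner.ext h)
      (fun _ _ => Finset.mem_univ _) ?_ ?_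
    · intro b _ hb
      have hb' : ¬ ∃ q : (grOf p).Inner, q.a = b := fun ⟨q, hq⟩ =>
        hb ⟨q, Finset.mem_coe.2 (Finset.mem_univ _), hq⟩
      rw [h2 (b, false) hb', h2 (b, true) hb', add_zero, smul_zero]
    · intro q _
      exact (arcSum_inner K n (D + 1) hp q).symm

end

end HairForest


namespace HairForest

/-! ### The filtration by the size of the hairy graph -/

/-- The number of vertices that are not bivalent sources drops under the contraction of an edge
between two such vertices. -/
theorem core_contract_lt {Γ : Gr} (q : Γ.Inner)
    (hx : ¬ (Γ.inDeg (Sum.inl q.x) = 0 ∧ Γ.outDeg (Sum.inl q.x) = 2)) :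
    core (Γ.contract q) < core Γ := by
  unfold core
  refine lt_of_eq_of_lt (Finset.card_map ⟨Gr.skip q.y, fun _ _ h => Gr.skip_inj h⟩).symm
    (Finset.card_lt_card ?_)
  refine (Finset.ssubset_iff_of_subset ?_).2 ⟨q.y, ?_, ?_⟩
  · intro w hw
    obtain ⟨u, hu, rfl⟩ := Finset.mem_map.1 hw
    refine Finset.mem_filter.2 ⟨Finset.mem_univ _, fun h => ?_⟩
    have hu' := (Finset.mem_filter.1 hu).2
    by_cases huz : u = q.z
    · have h1 : Gr.skip q.y u = q.x := by rw [huz]; exact q.skip_z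
      exact hx (by rw [← h1]; exact h)
    · rw [Gr.inDeg_contract_of_ne q huz, Gr.outDeg_contract_of_ne q huz] at hu'
      exact hu' h
  · refine Finset.mem_filter.2 ⟨Finset.mem_univ _, fun h => ?_⟩
    have := Gr.inDeg_y_pos q
    omega
  · intro h
    obtain ⟨u, -, hu⟩ := Finset.mem_map.1 h
    exact Gr.skip_ne _ _ hu

section

variable {v s e m : ℕ}

/-- The size of a hairy graph; graphs are compared first by the number of internal vertices. -/
def rank (v s e : ℕ) : ℕ ×ₗ ℕ ×ₗ ℕ := toLex (v, toLex (s, e))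

theorem rank_inj {v' s' e' : ℕ} (h : rank v s e = rank v' s' e') : v = v' ∧ s = s' ∧ e = e' := by
  have h1 := congrArg ofLex h
  have h2 := congrArg ofLex (congrArg Prod.snd h1)
  exact ⟨congrArg Prod.fst h1, congrArg Prod.fst h2, congrArg Prod.snd h2⟩

theorem rank_lt {v' s' e' : ℕ} (h : v' < v) : rank v' s' e' < rank v s e :=
  Prod.Lex.lt_iff.2 (Or.inl h)

variable (K : Type*) [Field K] (N Δ : ℤ)

/-- The span of the oriented graphs of hairy graphs whose size belongs to `S`. -/
noncomputable def BF (S : Set (ℕ ×ₗ ℕ ×ₗ ℕ)) : Submodule K ((orientedKind N).Space K Δ) :=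
  Submodule.span K {z | ∃ (v s e m : ℕ) (p : Hf e → Fin v ⊕ Fin s) (l : Fin m → Hf e),
    rank v s e ∈ S ∧ z = phi K N Δ p l}

theorem phi_mem_BF {S : Set (ℕ ×ₗ ℕ ×ₗ ℕ)} (h : rank v s e ∈ S) (p : Hf e → Fin v ⊕ Fin s)
    (l : Fin m → Hf e) : phi K N Δ p l ∈ BF K N Δ S :=
  Submodule.subset_span ⟨v, s, e, m, p, l, h, rfl⟩

/-- The span of the hairy graphs whose size belongs to `S`. -/
noncomputable def AF (S : Set (ℕ ×ₗ ℕ ×ₗ ℕ)) : Submodule K ((hairyKind N).Space K Δ) :=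
  Submodule.span K {z | ∃ (v s e : ℕ) (p : Hf e → Fin v ⊕ Fin s),
    rank v s e ∈ S ∧ z = (hairyKind N).cls K Δ (grOf p)}

theorem BF_mono {S T : Set (ℕ ×ₗ ℕ ×ₗ ℕ)} (h : S ⊆ T) : BF K N Δ S ≤ BF K N Δ T :=
  Submodule.span_mono fun _ ⟨v, s, e, m, p, l, h1, h2⟩ => ⟨v, s, e, m, p, l, h h1, h2⟩

theorem AF_mono {S T : Set (ℕ ×ₗ ℕ ×ₗ ℕ)} (h : S ⊆ T) : AF K N Δ S ≤ AF K N Δ T :=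
  Submodule.span_mono fun _ ⟨v, s, e, p, h1, h2⟩ => ⟨v, s, e, p, h h1, h2⟩

theorem units_smul_mem {M : Type*} [AddCommGroup M] [Module K M] (W : Submodule K M) (c : ℤˣ)
    {z : M} (h : z ∈ W) : c • z ∈ W := by
  rw [Units.smul_def]
  exact zsmul_mem h _

/-- An oriented graph belongs to the part of the filtration given by its core. -/
theorem cls_mem_BF {Γ : Gr} {v : ℕ} (h : core Γ < v) (s e : ℕ) :
    (orientedKind N).cls K Δ Γ ∈ BF K N Δ (Set.Iio (rank v s e)) := by
  by_cases hΓ : Γ.IsOriented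
  · obtain ⟨v', s', e', m, p, D, l, nV, nE, hp, L, hg⟩ := exists_og_of_isOriented hΓ
    have hv : v' < v := lt_of_eq_of_lt ((congrArg core hg).trans (L.adm.core_og hp nV nE)).symm h
    have h1 : phi K N Δ p l = L.fr N hp nV nE • (orientedKind N).cls K Δ Γ :=
      (phi_eq K Δ (N := N) L hp nV nE).trans
        (congrArg (fun Γ => L.fr N hp nV nE • (orientedKind N).cls K Δ Γ) hg.symm)
    have h2 : (orientedKind N).cls K Δ Γ = L.fr N hp nV nE • phi K N Δ p l := by
      rw [h1, smul_smul, Int.units_mul_self, one_smul]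
    have h3 : phi K N Δ p l ∈ BF K N Δ (Set.Iio (rank v s e)) :=
      phi_mem_BF K N Δ (Set.mem_Iio.2 (rank_lt hv)) p l
    rw [h2]
    exact units_smul_mem K _ _ h3
  · rw [GraphKind.cls_of_not K hΓ]
    exact Submodule.zero_mem _

theorem BF_univ : BF K N Δ Set.univ = ⊤ := by
  refine top_le_iff.1 ?_
  rw [← span_cls]
  refine Submodule.span_le.2 ?_
  rintro _ ⟨Γ, -, -, rfl⟩
  exact BF_mono K N Δ (Set.subset_univ _) (cls_mem_BF K N Δ (Nat.lt_succ_self _) 0 0)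

theorem AF_univ : AF K N Δ Set.univ = ⊤ := by
  refine top_le_iff.1 ?_
  rw [← span_cls]
  refine Submodule.span_le.2 ?_
  rintro _ ⟨Γ, -, -, rfl⟩
  exact Submodule.subset_span ⟨Γ.v, Γ.s, Γ.e, en Γ, trivial, rfl⟩

variable {p : Hf e → Fin v ⊕ Fin s} {l : Fin m → Hf e}

/-- The contraction of an arc lowers the number of internal vertices of the hairy graph. -/
theorem arcTerm_mem_BF (p : Hf e → Fin v ⊕ Fin s) (l : Fin m → Hf e) (h : Hf e) :
    arcTerm K N Δ p l h ∈ BF K N (Δ + 1) (Set.Iio (rank v s e)) := by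
  classical
  by_cases H : (Hairy p ∧ Lists p (Set.range l) l) ∧ bar h ∈ Set.range l ∧
      h ∉ Set.range l ∧ ∃ x, p h = Sum.inl x
  · obtain ⟨⟨hp, L⟩, hb, hk⟩ := H
    obtain ⟨k, rfl⟩ : ∃ k : Edge p (Set.range l), k.1 = h := ⟨⟨h, hk⟩, rfl⟩
    have nV := Fintype.equivFin (Fin v ⊕ Zig (Set.range l))
    have nE := Fintype.equivFin (Edge p (Set.range l))
    rw [arcTerm_eq K N Δ L hp nV nE k hb]
    refine units_smul_mem K _ _ ?_
    unfold TG.ct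
    split_ifs
    · refine units_smul_mem K _ _ (cls_mem_BF K N (Δ + 1) ?_ s e)
      refine lt_of_lt_of_eq (core_contract_lt _ ?_) (L.adm.core_og hp nV nE)
      obtain ⟨x, hx⟩ := L.adm.src_int _ hb
      have h1 : ((og p (Set.range l)).inner nV nE k (L.adm.ne k)).x = nV (Sum.inl x) :=
        congrArg nV (og_s_arc k hb hx)
      rw [h1, TG.inDeg_gr, TG.outDeg_gr]
      convert L.adm.not_biv hp x
    · exact Submodule.zero_mem _
  · rw [arcTerm_of_not K N Δ H]
    exact Submodule.zero_mem _

/-- The differential directs one more zigzag, up to terms with fewer internal vertices. -/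
theorem exists_d_phi_mod (v s e m : ℕ) : ∃ c : ℤˣ, ∀ (p : Hf e → Fin v ⊕ Fin s)
    (l : Fin m → Hf e), Hairy p → Lists p (Set.range l) l →
    (orientedKind N).d K Δ (phi K N Δ p l) -
      c • (∑ h, phi K N (Δ + 1) p (Fin.cons h l : Fin (m + 1) → Hf e)) ∈
        BF K N (Δ + 1) (Set.Iio (rank v s e)) := by
  obtain ⟨c, hc⟩ := exists_d_phi K Δ N v s e m
  refine ⟨c, fun p l hp L => ?_⟩
  rw [hc p _ l L hp (Fintype.equivFin _) (Fintype.equivFin _), add_sub_cancel_left, ← sum_arcTerm]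
  exact Submodule.sum_mem _ fun h _ => arcTerm_mem_BF K N Δ p l h

/-- The differential of the oriented complex does not increase the size. -/
theorem d_mem_BF {S : Set (ℕ ×ₗ ℕ ×ₗ ℕ)} (hS : ∀ r ∈ S, Set.Iic r ⊆ S)
    {z : (orientedKind N).Space K Δ} (hz : z ∈ BF K N Δ S) :
    (orientedKind N).d K Δ z ∈ BF K N (Δ + 1) S := by
  induction hz using Submodule.span_induction with
  | zero => rw [map_zero]; exact Submodule.zero_mem _
  | add x y _ _ hx hy => rw [map_add]; exact Submodule.add_mem _ hx hy
  | smul c x _ hx => rw [map_smul]; exact Submodule.smul_mem _ c hx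
  | mem z hz =>
    obtain ⟨v, s, e, m, p, l, hr, rfl⟩ := hz
    by_cases h : Hairy p ∧ Lists p (Set.range l) l
    · obtain ⟨c, hc⟩ := exists_d_phi_mod K N Δ v s e m
      have h1 := BF_mono K N (Δ + 1) ((Set.Iio_subset_Iic_self).trans (hS _ hr)) (hc p l h.1 h.2)
      have h2 : c • (∑ h, phi K N (Δ + 1) p (Fin.cons h l : Fin (m + 1) → Hf e)) ∈
          BF K N (Δ + 1) S :=
        units_smul_mem K _ _ (Submodule.sum_mem _ fun h _ => phi_mem_BF K N (Δ + 1) hr p _)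
      simpa using Submodule.add_mem _ h1 h2
    · rw [phi_of_not K N Δ h, map_zero]
      exact Submodule.zero_mem _

/-- The differential of the hairy complex decreases the size, since a contraction removes an
internal vertex. -/
theorem d_mem_AF {r : ℕ ×ₗ ℕ ×ₗ ℕ} {z : (hairyKind N).Space K Δ}
    (hz : z ∈ AF K N Δ (Set.Iic r)) :
    (hairyKind N).d K Δ z ∈ AF K N (Δ + 1) (Set.Iio r) := by
  induction hz using Submodule.span_induction with
  | zero => rw [map_zero]; exact Submodule.zero_mem _
  | add x y _ _ hx hy => rw [map_add]; exact Submodule.add_mem _ hx hy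
  | smul c x _ hx => rw [map_smul]; exact Submodule.smul_mem _ c hx
  | mem z hz =>
    obtain ⟨v, s, e, p, hr, rfl⟩ := hz
    by_cases h : (grOf p).IsHairy
    · rw [d_cls_of_adm K Δ (𝒢 := hairyKind N) h]
      refine Submodule.sum_mem _ fun q _ => ?_
      split_ifs
      · refine units_smul_mem K _ _ (Submodule.subset_span
          ⟨v - 1, s, e - 1, en ((grOf p).contract q), ?_, rfl⟩)
        refine lt_of_lt_of_le (rank_lt ?_) hr
        have := q.v_pos
        change 2 ≤ v at this
        omega
      · exact Submodule.zero_mem _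
    · rw [GraphKind.cls_of_not K (𝒢 := hairyKind N) h, map_zero]
      exact Submodule.zero_mem _

theorem secSum_mem_BF {S : Set (ℕ ×ₗ ℕ ×ₗ ℕ)} (h : rank v s e ∈ S) (p : Hf e → Fin v ⊕ Fin s) :
    secSum K N Δ p ∈ BF K N Δ S := by
  classical
  refine Submodule.sum_mem _ fun t _ => ?_
  split_ifs
  · exact phi_mem_BF K N Δ h p t
  · exact Submodule.zero_mem _

theorem forestMap_mem_BF {S : Set (ℕ ×ₗ ℕ ×ₗ ℕ)} {z : (hairyKind N).Space K Δ}
    (hz : z ∈ AF K N Δ S) : forestMap K N Δ z ∈ BF K (N + 1) (Δ + 1) S := by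
  induction hz using Submodule.span_induction with
  | zero => rw [map_zero]; exact Submodule.zero_mem _
  | add x y _ _ hx hy => rw [map_add]; exact Submodule.add_mem _ hx hy
  | smul c x _ hx => rw [map_smul]; exact Submodule.smul_mem _ c hx
  | mem z hz =>
    obtain ⟨v, s, e, p, hr, rfl⟩ := hz
    by_cases h : (grOf p).IsHairy ∧ (grOf p).degree N = Δ
    · rw [forestMap_cls K N h.1 h.2, forestSum_eq K (Δ + 1) N ((isHairy_iff p).1 h.1)]
      exact units_smul_mem K _ _ (secSum_mem_BF K (N + 1) (Δ + 1) hr p)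
    · have h1 : (hairyKind N).cls K Δ (grOf p) = 0 := dif_neg h
      rw [h1, map_zero]
      exact Submodule.zero_mem _

/-- An element of a span over a set of sizes lies in the span up to some size of the set. -/
theorem exists_Iic_of_mem_span {M R : Type*} [AddCommGroup M] [Module K M] [LinearOrder R]
    (G : R → M → Prop) {S : Set R} (hS : S.Nonempty) {z : M}
    (hz : z ∈ Submodule.span K {z | ∃ r ∈ S, G r z}) :
    ∃ r ∈ S, z ∈ Submodule.span K {z | ∃ r' ∈ Set.Iic r, G r' z} := by
  have hm : ∀ {r r' : R}, r ≤ r' → Submodule.span K {z | ∃ r'' ∈ Set.Iic r, G r'' z} ≤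
      Submodule.span K {z | ∃ r'' ∈ Set.Iic r', G r'' z} := fun h =>
    Submodule.span_mono fun _ ⟨a, h1, h2⟩ => ⟨a, Set.mem_Iic.2 ((Set.mem_Iic.1 h1).trans h), h2⟩
  induction hz using Submodule.span_induction with
  | zero => exact ⟨hS.some, hS.some_mem, Submodule.zero_mem _⟩
  | mem z hz =>
    obtain ⟨r, h1, h2⟩ := hz
    exact ⟨r, h1, Submodule.subset_span ⟨r, Set.mem_Iic.2 le_rfl, h2⟩⟩
  | smul c x _ hx =>
    obtain ⟨r, h1, h2⟩ := hx
    exact ⟨r, h1, Submodule.smul_mem _ c h2⟩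
  | add x y _ _ hx hy =>
    obtain ⟨r, h1, h2⟩ := hx
    obtain ⟨r', h3, h4⟩ := hy
    rcases le_total r r' with h | h
    · exact ⟨r', h3, Submodule.add_mem _ (hm h h2) h4⟩
    · exact ⟨r, h1, Submodule.add_mem _ h2 (hm h h4)⟩

theorem exists_Iic_of_mem_BF {S : Set (ℕ ×ₗ ℕ ×ₗ ℕ)} (hS : S.Nonempty)
    {z : (orientedKind N).Space K Δ} (hz : z ∈ BF K N Δ S) :
    ∃ r ∈ S, z ∈ BF K N Δ (Set.Iic r) := by
  have h : ∀ S, BF K N Δ S = Submodule.span K {z | ∃ r ∈ S, ∃ (v s e m : ℕ)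
      (p : Hf e → Fin v ⊕ Fin s) (l : Fin m → Hf e), rank v s e = r ∧ z = phi K N Δ p l} := by
    intro S
    refine congrArg (Submodule.span K) (Set.ext fun z => ⟨?_, ?_⟩)
    · rintro ⟨v, s, e, m, p, l, hr, hz⟩
      exact ⟨_, hr, v, s, e, m, p, l, rfl, hz⟩
    · rintro ⟨_, hr, v, s, e, m, p, l, rfl, hz⟩
      exact ⟨v, s, e, m, p, l, hr, hz⟩
  rw [h] at hz
  obtain ⟨r, hr, hz'⟩ := exists_Iic_of_mem_span K _ hS hz
  exact ⟨r, hr, (h _).symm ▸ hz'⟩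

theorem exists_Iic_of_mem_AF {S : Set (ℕ ×ₗ ℕ ×ₗ ℕ)} (hS : S.Nonempty)
    {z : (hairyKind N).Space K Δ} (hz : z ∈ AF K N Δ S) :
    ∃ r ∈ S, z ∈ AF K N Δ (Set.Iic r) := by
  have h : ∀ S, AF K N Δ S = Submodule.span K {z | ∃ r ∈ S, ∃ (v s e : ℕ)
      (p : Hf e → Fin v ⊕ Fin s), rank v s e = r ∧ z = (hairyKind N).cls K Δ (grOf p)} := by
    intro S
    refine congrArg (Submodule.span K) (Set.ext fun z => ⟨?_, ?_⟩)
    · rintro ⟨v, s, e, p, hr, hz⟩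
      exact ⟨_, hr, v, s, e, p, rfl, hz⟩
    · rintro ⟨_, hr, v, s, e, p, rfl, hz⟩
      exact ⟨v, s, e, p, hr, hz⟩
  rw [h] at hz
  obtain ⟨r, hr, hz'⟩ := exists_Iic_of_mem_span K _ hS hz
  exact ⟨r, hr, (h _).symm ▸ hz'⟩

end

end HairForest


namespace HairForest

/-! ### Automorphisms and the existence of forests -/

section

variable {v s e m : ℕ} {p : Hf e → Fin v ⊕ Fin s}

/-- A renumbering that fixes all edges is a product of reversals of edges. -/
theorem Sym.flip_induction {P : Sym e → Prop} (h1 : P 1) (hf : ∀ c κ, P κ → P (Sym.flip c * κ))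
    (κ : Sym e) (hκ : Sym.edgePerm κ = 1) : P κ := by
  classical
  have hfst : ∀ κ : Sym e, Sym.edgePerm κ = 1 → ∀ h, (κ.1 h).1 = h.1 := fun κ hκ h => by
    rw [← Sym.edgePerm_apply, hκ]; rfl
  induction hn : (Finset.univ.filter fun b : Fin e => κ.1 (b, false) ≠ (b, false)).card
    using Nat.strong_induction_on generalizing κ with
  | _ n ih =>
    by_cases hc : ∃ c, κ.1 (c, false) ≠ (c, false)
    · obtain ⟨c, hc⟩ := hc
      have hc' : κ.1 (c, false) = (c, true) := by
        refine Prod.ext (hfst κ hκ _) ?_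
        by_contra h
        refine hc (Prod.ext (hfst κ hκ _) ?_)
        simpa using h
      have hκ' : Sym.edgePerm (Sym.flip c * κ) = 1 := by
        rw [map_mul, Sym.edgePerm_flip, hκ, one_mul]
      have h2 : Sym.flip c * (Sym.flip c * κ) = κ := by
        rw [← mul_assoc]
        have : Sym.flip c * Sym.flip c = 1 := Subtype.ext (Equiv.swap_mul_self _ _)
        rw [this, one_mul]
      rw [← h2]
      refine hf c _ (ih _ ?_ _ hκ' rfl)
      rw [← hn]
      have hmul : ∀ h, (Sym.flip c * κ).1 h = (Sym.flip c).1 (κ.1 h) := fun _ => rfl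
      refine Finset.card_lt_card ((Finset.ssubset_iff_of_subset ?_).2 ⟨c, ?_, ?_⟩)
      · intro b hb
        refine Finset.mem_filter.2 ⟨Finset.mem_univ _, fun h => ?_⟩
        refine (Finset.mem_filter.1 hb).2 ?_
        rw [hmul, h, Sym.flip_apply_of_ne]
        rintro rfl
        exact hc h
      · exact Finset.mem_filter.2 ⟨Finset.mem_univ _, hc⟩
      · intro h
        refine (Finset.mem_filter.1 h).2 ?_
        rw [hmul, hc', Sym.flip_apply]
        rfl
    · push Not at hc
      have : κ = 1 := by
        refine Subtype.ext (Equiv.ext fun h => ?_)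
        rcases h with ⟨b, _ | _⟩
        · exact hc b
        · have h3 := Sym.map_bar κ (b, false)
          rw [hc b] at h3
          exact h3
      rw [this]
      exact h1

variable (K : Type*) [Field K] (n D : ℤ)

/-- The class of a hairy graph transforms under all renumberings like its sum over the sections. -/
theorem cls_act (g : Ren v s e) (p : Hf e → Fin v ⊕ Fin s) :
    (hairyKind n).cls K D (grOf (act g p)) =
      (chi (n + 1) g * Equiv.Perm.sign g.1) • (hairyKind n).cls K D (grOf p) := by
  have hmul : ∀ g g' : Ren v s e, (∀ p : Hf e → Fin v ⊕ Fin s,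
      (hairyKind n).cls K D (grOf (act g p)) =
        (chi (n + 1) g * Equiv.Perm.sign g.1) • (hairyKind n).cls K D (grOf p)) →
      (∀ p : Hf e → Fin v ⊕ Fin s, (hairyKind n).cls K D (grOf (act g' p)) =
        (chi (n + 1) g' * Equiv.Perm.sign g'.1) • (hairyKind n).cls K D (grOf p)) →
      ∀ p : Hf e → Fin v ⊕ Fin s, (hairyKind n).cls K D (grOf (act (g * g') p)) =
        (chi (n + 1) (g * g') * Equiv.Perm.sign (g * g').1) • (hairyKind n).cls K D (grOf p) := by
    intro g g' h h' p
    rw [act_mul, h, h', smul_smul, map_mul, Prod.fst_mul, map_mul]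
    congr 1
    ac_rfl
  obtain ⟨σ, ρ, κ⟩ := g
  have hg : ((σ, ρ, κ) : Ren v s e) =
      (σ, ρ, Sym.ofPerm (Sym.edgePerm κ)) * (1, 1, (Sym.ofPerm (Sym.edgePerm κ))⁻¹ * κ) := by
    refine Prod.ext (mul_one σ).symm (Prod.ext (mul_one ρ).symm ?_)
    exact (mul_inv_cancel_left _ _).symm
  rw [hg]
  refine hmul _ _ (fun p => ?_) ?_ p
  · rw [grOf_act_ofPerm, chi_ofPerm]
    exact GraphKind.cls_of_rel K D (.relabel (grOf p) σ ρ _)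
  · refine Sym.flip_induction (P := fun κ => ∀ p : Hf e → Fin v ⊕ Fin s,
      (hairyKind n).cls K D (grOf (act (1, 1, κ) p)) =
        (chi (n + 1) ((1, 1, κ) : Ren v s e) * Equiv.Perm.sign (1 : Equiv.Perm (Fin v))) •
          (hairyKind n).cls K D (grOf p)) ?_ ?_ _ ?_
    · intro p
      have h1 : ((1, 1, 1) : Ren v s e) = 1 := rfl
      rw [h1, act_one, map_one, Equiv.Perm.sign_one, one_mul, one_smul]
    · intro c κ hκ
      refine hmul (1, 1, Sym.flip c) (1, 1, κ) (fun p => ?_) hκ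
      rw [grOf_act_flip, chi_flip, Equiv.Perm.sign_one, mul_one]
      exact GraphKind.cls_of_rel K D (.flip (grOf p) c trivial)
    · rw [map_mul, map_inv, Sym.edgePerm_ofPerm, inv_mul_cancel]

/-- There is a symmetry that exchanges two given half-edges of different edges, and whose sign is
that of the exchange of these edges. -/
theorem exists_exchange {h h' : Hf e} (hb : h.1 ≠ h'.1) : ∃ κ : Sym e, κ.1 h = h' ∧ κ.1 h' = h ∧
    (∀ k, k.1 ≠ h.1 → k.1 ≠ h'.1 → κ.1 k = k) ∧ ∀ ρ : Equiv.Perm (Fin s),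
      chi (n + 1) ((1, ρ, κ) : Ren v s e) =
        Gr.relSign n (1 : Equiv.Perm (Fin v)) ρ (Equiv.swap h.1 h'.1) := by
  have hchi : ∀ ρ : Equiv.Perm (Fin s),
      chi (n + 1) ((1, ρ, Sym.ofPerm (Equiv.swap h.1 h'.1)) : Ren v s e) =
        Gr.relSign n (1 : Equiv.Perm (Fin v)) ρ (Equiv.swap h.1 h'.1) := fun ρ => by
    rw [← chi_ofPerm, Equiv.Perm.sign_one, mul_one]
  have happ : ∀ (b : Fin e) (i : Bool), (Sym.ofPerm (Equiv.swap h.1 h'.1)).1 (b, i) =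
      (Equiv.swap h.1 h'.1 b, i) := fun _ _ => rfl
  obtain ⟨b, i⟩ := h
  obtain ⟨c, j⟩ := h'
  simp only at hb hchi happ
  by_cases hij : i = j
  · subst hij
    refine ⟨Sym.ofPerm (Equiv.swap b c), ?_, ?_, ?_, hchi⟩
    · rw [happ, Equiv.swap_apply_left]
    · rw [happ, Equiv.swap_apply_right]
    · rintro ⟨a, k⟩ h1 h2
      rw [happ, Equiv.swap_apply_of_ne_of_ne h1 h2]
  · have hj : (!i) = j := by
      cases i <;> cases j <;> simp_all
    subst hj
    have hmul : ∀ k, (Sym.ofPerm (Equiv.swap b c) * (Sym.flip b * Sym.flip c)).1 k =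
        (Sym.ofPerm (Equiv.swap b c)).1 ((Sym.flip b).1 ((Sym.flip c).1 k)) := fun _ => rfl
    refine ⟨Sym.ofPerm (Equiv.swap b c) * (Sym.flip b * Sym.flip c), ?_, ?_, ?_, fun ρ => ?_⟩
    · rw [hmul, Sym.flip_apply_of_ne c (h := (b, i)) hb, Sym.flip_apply, happ,
        Equiv.swap_apply_left]
    · rw [hmul, Sym.flip_apply, Bool.not_not, Sym.flip_apply_of_ne b (h := (c, i)) hb.symm, happ,
        Equiv.swap_apply_right]
    · rintro ⟨a, k⟩ h1 h2
      rw [hmul, Sym.flip_apply_of_ne c (h := (a, k)) h2, Sym.flip_apply_of_ne b (h := (a, k)) h1,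
        happ, Equiv.swap_apply_of_ne_of_ne h1 h2]
    · have h1 : ((1, ρ, Sym.ofPerm (Equiv.swap b c) * (Sym.flip b * Sym.flip c)) : Ren v s e) =
          (1, ρ, Sym.ofPerm (Equiv.swap b c)) * ((1, 1, Sym.flip b) * (1, 1, Sym.flip c)) := rfl
      rw [h1, map_mul, map_mul, chi_flip, chi_flip, Int.units_mul_self, mul_one, hchi]

/-- The exchange of two hairs at the same vertex, together with their external vertices, is an odd
automorphism for both parities. -/
theorem cls_eq_zero_of_two_hairs [CharZero K] (hp : Hairy p) {h h' : Hf e} {j j' : Fin s}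
    (hj : p h = Sum.inr j) (hj' : p h' = Sum.inr j') (hne : j ≠ j') {x : Fin v}
    (hx : p (bar h) = Sum.inl x) (hx' : p (bar h') = Sum.inl x) :
    (hairyKind n).cls K D (grOf p) = 0 := by
  have hb : h.1 ≠ h'.1 := by
    intro hb
    rcases eq_or_eq_bar hb with h1 | h1
    · exact hne (Sum.inr_injective (hj.symm.trans (h1 ▸ hj')))
    · rw [h1, hx'] at hj
      exact Sum.inl_ne_inr hj
  obtain ⟨κ, h1, h2, h3, h4⟩ := exists_exchange (v := v) (s := s) n hb
  have hact : act (1, Equiv.swap j j', κ) p = p := by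
    funext k
    obtain ⟨k, rfl⟩ := κ.1.surjective k
    refine (act_apply ((1, Equiv.swap j j', κ) : Ren v s e) p k).trans ?_
    by_cases hk : k.1 = h.1
    · rcases eq_or_eq_bar hk with rfl | rfl
      · rw [h1, hj, hj', Sum.map_inr, Equiv.swap_apply_left]
      · rw [Sym.map_bar, h1, hx, hx', Sum.map_inl]
        rfl
    · by_cases hk' : k.1 = h'.1
      · rcases eq_or_eq_bar hk' with rfl | rfl
        · rw [h2, hj, hj', Sum.map_inr, Equiv.swap_apply_right]
        · rw [Sym.map_bar, h2, hx, hx', Sum.map_inl]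
          rfl
      · rw [h3 k hk hk']
        rcases hk2 : p k with y | i
        · rfl
        · rw [Sum.map_inr, Equiv.swap_apply_of_ne_of_ne]
          · rintro rfl
            exact hk (congrArg Prod.fst ((eq_outer hp hk2).trans (eq_outer hp hj).symm))
          · rintro rfl
            exact hk' (congrArg Prod.fst ((eq_outer hp hk2).trans (eq_outer hp hj').symm))
  have h5 := cls_act K n D (1, Equiv.swap j j', κ) p
  have h6 : Gr.relSign n (1 : Equiv.Perm (Fin v)) (Equiv.swap j j') (Equiv.swap h.1 h'.1) = -1 := by
    unfold Gr.relSign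
    rw [Equiv.Perm.sign_swap hne, Equiv.Perm.sign_swap hb, Equiv.Perm.sign_one, one_mul, ite_self]
  rw [hact, h4, h6, Equiv.Perm.sign_one, mul_one, Units.neg_smul, one_smul] at h5
  have h7 : (2 : K) • (hairyKind n).cls K D (grOf p) = 0 := by
    rw [two_smul]
    exact add_eq_zero_iff_eq_neg.2 h5
  exact (smul_eq_zero.1 h7).resolve_left two_ne_zero

/-- A property that is preserved along all edges holds everywhere if it holds once. -/
theorem Hairy.forall_of_closed (hp : Hairy p) {P : Fin v ⊕ Fin s → Prop}
    (hP : ∀ h, P (p h) → P (p (bar h))) {q : Fin v ⊕ Fin s} (hq : P q) (q' : Fin v ⊕ Fin s) :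
    P q' := by
  have h1 : ∀ q q', Relation.EqvGen (fun q q' => ∃ h, p h = q ∧ p (bar h) = q') q q' →
      (P q ↔ P q') := by
    intro q q' h
    induction h with
    | rel q q' h =>
      obtain ⟨h, rfl, rfl⟩ := h
      refine ⟨hP h, fun h' => ?_⟩
      have := hP _ h'
      rwa [bar_bar] at this
    | refl q => exact Iff.rfl
    | symm q q' _ ih => exact ih.symm
    | trans q q' q'' _ _ ih ih' => exact ih.trans ih'
  exact (h1 q q' (hp.connected q q')).1 hq

/-- The other end of a hair is an internal vertex. -/
theorem Hairy.exists_p_bar (hp : Hairy p) {h : Hf e} {j : Fin s} (hj : p h = Sum.inr j) :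
    ∃ x, p (bar h) = Sum.inl x := by
  rcases hx : p (bar h) with x | j'
  · exact ⟨x, rfl⟩
  have h1 := hp.forall_of_closed (P := fun q => q = p h ∨ q = p (bar h)) (fun k hk => ?_)
    (Or.inl rfl) (Sum.inl ⟨0, hp.v_pos⟩)
  · rw [hj, hx] at h1
    rcases h1 with h1 | h1 <;> exact (Sum.inl_ne_inr h1).elim
  · rcases hk with hk | hk
    · rw [(eq_outer hp (hk.trans hj)).trans (eq_outer hp hj).symm]
      exact Or.inr rfl
    · rw [(eq_outer hp (hk.trans hx)).trans (eq_outer hp hx).symm, bar_bar]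
      exact Or.inl rfl

/-- If no internal vertex has two hairs, then the first steps of shortest paths to the external
vertices form a forest. -/
theorem Hairy.exists_forest (hp : Hairy p) (h2 : ∀ h h' j j', p h = Sum.inr j → p h' = Sum.inr j' →
    p (bar h) = p (bar h') → j = j') : ∃ T, Section p T ∧ Adm p (Set.range T) := by
  classical
  obtain ⟨A, hA0, hA⟩ : ∃ A : ℕ → Fin v → Prop,
      (∀ x, A 0 x ↔ ∃ h j, p h = Sum.inl x ∧ p (bar h) = Sum.inr j) ∧
      ∀ k x, A (k + 1) x ↔ ∃ h y, p h = Sum.inl x ∧ p (bar h) = Sum.inl y ∧ A k y :=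
    ⟨fun k => Nat.rec (fun x => ∃ h j, p h = Sum.inl x ∧ p (bar h) = Sum.inr j)
      (fun _ B x => ∃ h y, p h = Sum.inl x ∧ p (bar h) = Sum.inl y ∧ B y) k,
      fun _ => Iff.rfl, fun _ _ => Iff.rfl⟩
  have hex : ∀ x, ∃ k, A k x := by
    intro x
    refine hp.forall_of_closed (P := Sum.elim (fun x => ∃ k, A k x) fun _ => True) (fun h hh => ?_)
      (q := Sum.inr ⟨0, hp.s_pos⟩) trivial (Sum.inl x)
    rcases hy : p (bar h) with y | j
    · rcases hz : p h with z | j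
      · rw [hz] at hh
        obtain ⟨k, hk⟩ := hh
        exact ⟨k + 1, (hA k y).2 ⟨bar h, z, hy, by rw [bar_bar, hz], hk⟩⟩
      · exact ⟨0, (hA0 y).2 ⟨bar h, j, hy, by rw [bar_bar, hz]⟩⟩
    · trivial
  have hT : ∀ x, ∃ h, p h = Sum.inl x ∧ (∀ y, p (bar h) = Sum.inl y →
      Nat.find (hex y) < Nat.find (hex x)) ∧ (A 0 x → ∃ j, p (bar h) = Sum.inr j) := by
    intro x
    have h3 := Nat.find_spec (hex x)
    rcases hk : Nat.find (hex x) with _ | k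
    · rw [hk] at h3
      obtain ⟨h, j, h4, h5⟩ := (hA0 x).1 h3
      refine ⟨h, h4, fun y hy => ?_, fun _ => ⟨j, h5⟩⟩
      rw [h5] at hy
      exact (Sum.inr_ne_inl hy).elim
    · rw [hk] at h3
      obtain ⟨h, y, h4, h5, h6⟩ := (hA k x).1 h3
      refine ⟨h, h4, fun y' hy => ?_, fun h0 => ?_⟩
      · obtain rfl := Sum.inl_injective (h5.symm.trans hy)
        exact Nat.lt_succ_of_le (Nat.find_min' _ h6)
      · have := Nat.find_min' (hex x) h0
        omega
  choose T hT1 hT2 hT3 using hT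
  refine ⟨T, hT1, (Section.adm_iff hT1).2 ⟨fun h j hj => ?_, _, hT2⟩⟩
  obtain ⟨x, hx⟩ := hp.exists_p_bar hj
  obtain ⟨j', hj'⟩ := hT3 x ((hA0 x).2 ⟨bar h, j, hx, by rw [bar_bar, hj]⟩)
  have h3 : j = j' := h2 h (bar (T x)) j j' hj hj' (by rw [bar_bar, hx, hT1])
  refine ⟨x, ?_⟩
  rw [eq_outer hp hj, h3, ← eq_outer hp hj', bar_bar]

theorem Adm.exists_forest {S : Set (Hf e)} (hS : Adm p S) :
    ∃ T, Section p T ∧ Adm p (Set.range T) := by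
  choose T hT1 hT2 using hS.out
  refine ⟨T, hT2, (Section.adm_iff hT2).2 ⟨fun h j hj => ?_, ?_⟩⟩
  · obtain ⟨x, hx⟩ := hS.src_int _ (hS.hair h j hj)
    exact ⟨x, (hS.sink _ (hS.hair h j hj) j (by rw [bar_bar, hj]) _ (hT1 x)
      ((hT2 x).trans hx.symm)).symm⟩
  · obtain ⟨f, hf⟩ := hS.acyc
    exact ⟨f, fun x y => hf _ (hT1 x) x y (hT2 x)⟩

/-- A hairy graph without forests vanishes, because it has two hairs at the same vertex. -/
theorem cls_eq_zero_of_no_forest [CharZero K] (hp : Hairy p)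
    (h : ¬ ∃ T, Section p T ∧ Adm p (Set.range T)) : (hairyKind n).cls K D (grOf p) = 0 := by
  by_contra h0
  refine h (hp.exists_forest fun h h' j j' hj hj' hb => ?_)
  by_contra hne
  obtain ⟨x, hx⟩ := hp.exists_p_bar hj
  exact h0 (cls_eq_zero_of_two_hairs K n D hp hj hj' hne hx (hb.symm.trans hx))

end

/-! ### Degrees and the separation of sizes -/

section

variable {v s e m : ℕ} {K : Type*} [Field K] {N Δ : ℤ}

theorem le_of_lists {p : Hf e → Fin v ⊕ Fin s} {S : Set (Hf e)} {l : Fin m → Hf e}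
    (L : Lists p S l) : v ≤ m := by
  have h : ∀ x, ∃ i, p (l i) = Sum.inl x := fun x => by
    obtain ⟨h, hh, hx⟩ := L.adm.out x
    rw [← L.range] at hh
    obtain ⟨i, rfl⟩ := hh
    exact ⟨i, hx⟩
  choose i hi using h
  have hinj : Function.Injective i := fun x y hxy => by
    have := hi x
    rw [hxy, hi] at this
    exact (Sum.inl_injective this).symm
  simpa using Fintype.card_le_of_injective i hinj

theorem phi_eq_zero_of_degree (h : dg N v s e m ≠ Δ) (p : Hf e → Fin v ⊕ Fin s)
    (l : Fin m → Hf e) : phi K N Δ p l = 0 := by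
  by_cases hp : Hairy p ∧ Lists p (Set.range l) l
  · obtain ⟨hp, L⟩ := hp
    have nV := Fintype.equivFin (Fin v ⊕ Zig (Set.range l))
    have nE := Fintype.equivFin (Edge p (Set.range l))
    rw [phi_eq K Δ L hp nV nE]
    have h1 : (og p (Set.range l)).cl K N Δ nV nE = 0 :=
      dif_neg fun h' => h (((presOg hp L nV nE).degree_eq N).symm.trans h'.2)
    rw [h1, smul_zero]
  · exact phi_of_not K N Δ hp

theorem dg_eq (n : ℤ) (v s e m : ℕ) (p : Hf e → Fin v ⊕ Fin s) :
    dg (n + 1) v s e m = (grOf p).degree n + m - v + 1 := by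
  have h1 : (grOf p).degree n = (n - 1) * e - n * v - n * s + n := rfl
  rw [h1]
  unfold dg
  ring

theorem dg_inj {m' : ℕ} (h : dg N v s e m = dg N v s e m') : m = m' := by
  unfold dg at h
  have : (m : ℤ) = m' := by linarith
  exact_mod_cast this

/-- The functional of an equivariant function vanishes on the graphs of other sizes. -/
theorem psi_phi_of_ne {v' s' e' m' : ℕ} {θ : (Hf e → Fin v ⊕ Fin s) → (Fin m → Hf e) → K}
    (hθ : Equi N θ) (h : ¬ (rank v' s' e' = rank v s e ∧ m' = m)) (p : Hf e' → Fin v' ⊕ Fin s')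
    (l : Fin m' → Hf e') : psi N Δ hθ (phi K N Δ p l) = 0 := by
  by_cases hp : Hairy p ∧ Lists p (Set.range l) l
  · obtain ⟨hp, L⟩ := hp
    have nV := Fintype.equivFin (Fin v' ⊕ Zig (Set.range l))
    have nE := Fintype.equivFin (Edge p (Set.range l))
    rw [phi_eq K Δ L hp nV nE, Units.smul_def, map_zsmul]
    refine (congrArg _ (psi_cls_of_isEmpty hθ ⟨fun x => h ?_⟩)).trans (smul_zero _)
    have y := presOg hp L nV nE
    obtain rfl := x.core_eq.symm.trans y.core_eq
    obtain rfl := x.sinks_eq.symm.trans y.sinks_eq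
    have h1 := x.card_v
    have h2 := y.card_v
    have h3 := x.card_e
    have h4 := y.card_e
    obtain rfl : e' = e := by omega
    exact ⟨rfl, by omega⟩
  · rw [phi_of_not K N Δ hp, map_zero]

theorem psi_eq_zero_of_mem_BF {θ : (Hf e → Fin v ⊕ Fin s) → (Fin m → Hf e) → K}
    (hθ : Equi N θ) {z : (orientedKind N).Space K Δ} (hz : z ∈ BF K N Δ (Set.Iio (rank v s e))) :
    psi N Δ hθ z = 0 := by
  induction hz using Submodule.span_induction with
  | zero => exact map_zero _
  | add x y _ _ hx hy => rw [map_add, hx, hy, add_zero]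
  | smul c x _ hx => rw [map_smul, hx, smul_zero]
  | mem z hz =>
    obtain ⟨v', s', e', m', p, l, hr, rfl⟩ := hz
    exact psi_phi_of_ne hθ (fun h => (ne_of_lt hr) h.1) p l

end

end HairForest


namespace HairForest

/-! ### Exactness of the cone -/

section

variable {v s e : ℕ} {K : Type*} [Field K] {n : ℤ}

theorem cls_eq_zero_of_degree {Δ : ℤ} {p : Hf e → Fin v ⊕ Fin s} (h : (grOf p).degree n ≠ Δ) :
    (hairyKind n).cls K Δ (grOf p) = 0 := dif_neg fun h' => h h'.2

/-- All graphs of the same size have the same degree. -/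
theorem degree_grOf (p : Hf e → Fin v ⊕ Fin s) :
    (grOf p).degree n = (n - 1) * e - n * v - n * s + n := rfl

theorem map_units_smul {M M' : Type*} [AddCommGroup M] [AddCommGroup M'] [Module K M] [Module K M']
    (f : M →ₗ[K] M') (c : ℤˣ) (x : M) : f (c • x) = c • f x := by
  rw [Units.smul_def, map_zsmul, ← Units.smul_def]

/-- A combination of hairy graphs can be recovered, up to graphs of smaller size, from the values on
its image of the functionals of the forests. -/
theorem mem_AF_Iio_of_psi [CharZero K] {D : ℤ} {a : (hairyKind n).Space K D}
    (ha : a ∈ AF K n D (Set.Iic (rank v s e)))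
    (h : ∀ (q : Hf e → Fin v ⊕ Fin s) (T : Fin v → Hf e),
      psi (n + 1) (D + 1) (equi_theta (n + 1) q T) (forestMap K n D a) = 0) :
    a ∈ AF K n D (Set.Iio (rank v s e)) := by
  classical
  -- graphs without a forest vanish, so their coefficient does not matter
  obtain ⟨lam, hlam⟩ : ∃ lam : (Hf e → Fin v ⊕ Fin s) → (orientedKind (n + 1)).Space K (D + 1) →ₗ[K] K,
      ∀ q, (∃ T, (Section q T ∧ Adm q (Set.range T)) ∧
        lam q = psi (n + 1) (D + 1) (equi_theta (n + 1) q T)) ∨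
        ((¬ ∃ T, Section q T ∧ Adm q (Set.range T)) ∧ lam q = 0) := by
    refine ⟨fun q => if h : ∃ T, Section q T ∧ Adm q (Set.range T) then
      psi (n + 1) (D + 1) (equi_theta (n + 1) q h.choose) else 0, fun q => ?_⟩
    by_cases h : ∃ T, Section q T ∧ Adm q (Set.range T)
    · exact Or.inl ⟨h.choose, h.choose_spec, dif_pos h⟩
    · exact Or.inr ⟨h, dif_neg h⟩
  have key : ∀ a ∈ AF K n D (Set.Iic (rank v s e)),
      (∑ q : Hf e → Fin v ⊕ Fin s, lam q (forestMap K n D a) • (hairyKind n).cls K D (grOf q)) -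
        (Fintype.card (Ren v s e) : K) • forestConst n v s e • a ∈
          AF K n D (Set.Iio (rank v s e)) := by
    intro a ha
    induction ha using Submodule.span_induction with
    | zero => simp
    | add x y _ _ hx hy =>
      have := Submodule.add_mem _ hx hy
      simp only [map_add, add_smul, smul_add, Finset.sum_add_distrib]
      convert this using 1
      abel
    | smul c x _ hx =>
      have := Submodule.smul_mem _ c hx
      rw [smul_sub, Finset.smul_sum] at this
      convert this using 2
      · refine Finset.sum_congr rfl fun q _ => ?_
        rw [map_smul, map_smul, smul_assoc]
      · rw [smul_comm (forestConst n v s e) c x, smul_comm c (Fintype.card (Ren v s e) : K)]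
    | mem z hz =>
      obtain ⟨v', s', e', p, hr, rfl⟩ := hz
      by_cases hp : (grOf p).IsHairy ∧ (grOf p).degree n = D
      swap
      · have h1 : (hairyKind n).cls K D (grOf p) = 0 := dif_neg hp
        simp [h1]
      have hp' := (isHairy_iff p).1 hp.1
      rcases lt_or_eq_of_le (Set.mem_Iic.1 hr) with hlt | heq
      · refine Submodule.sub_mem _ (Submodule.sum_mem _ fun q _ => ?_)
          (Submodule.smul_mem _ _ (units_smul_mem K _ _
            (Submodule.subset_span ⟨v', s', e', p, hlt, rfl⟩)))
        have h1 : lam q (forestMap K n D ((hairyKind n).cls K D (grOf p))) = 0 := by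
          rcases hlam q with ⟨T, -, hT⟩ | ⟨-, hT⟩
          · rw [hT]
            exact psi_eq_zero_of_mem_BF _ (forestMap_mem_BF K n D
              (Submodule.subset_span ⟨v', s', e', p, hlt, rfl⟩))
          · rw [hT, LinearMap.zero_apply]
        rw [h1, zero_smul]
        exact Submodule.zero_mem _
      · obtain ⟨rfl, rfl, rfl⟩ := rank_inj heq
        refine (congrArg (· ∈ AF K n D (Set.Iio (rank v' s' e'))) ?_).mpr (Submodule.zero_mem _)
        rw [sub_eq_zero, forestMap_cls K n hp.1 hp.2, forestSum_eq K (D + 1) n hp']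
        have hdeg : dg (n + 1) v' s' e' v' = D + 1 := by
          rw [dg_eq n v' s' e' v' p, hp.2]
          ring
        have h1 : ∀ q : Hf e' → Fin v' ⊕ Fin s',
            lam q (forestConst n v' s' e' • secSum K (n + 1) (D + 1) p) •
              (hairyKind n).cls K D (grOf q) =
            ∑ g : Ren v' s' e', if act g p = q then
              forestConst n v' s' e' • (hairyKind n).cls K D (grOf p) else 0 := by
          intro q
          have h2 : ∀ g : Ren v' s' e', act g p = q → (hairyKind n).cls K D (grOf p) =
              (chi (n + 1) g * Equiv.Perm.sign g.1) • (hairyKind n).cls K D (grOf q) := by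
            rintro g rfl
            rw [cls_act, smul_smul, Int.units_mul_self, one_smul]
          by_cases hq : ∃ T, Section q T ∧ Adm q (Set.range T) ∧ Hairy q
          · rcases hlam q with ⟨T, ⟨hT1, hT2⟩, hT⟩ | ⟨hT, -⟩
            swap
            · obtain ⟨T, h1, h2, -⟩ := hq
              exact (hT ⟨T, h1, h2⟩).elim
            obtain ⟨-, -, -, hqh⟩ := hq
            have h3 : psi (n + 1) (D + 1) (equi_theta (K := K) (n + 1) q T)
                (secSum K (n + 1) (D + 1) p) = ∑ g : Ren v' s' e', if act g p = q then
                  (((chi (n + 1) g * Equiv.Perm.sign g.1 : ℤˣ) : ℤ) : K) else 0 := by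
              rw [← sum_section_theta (n + 1) hqh hT1 hT2, secSum, map_sum]
              refine Finset.sum_congr rfl fun t _ => ?_
              split_ifs
              · exact psi_phi _ hdeg p t
              · exact map_zero _
            rw [hT, Units.smul_def, map_zsmul, h3, Finset.smul_sum, Finset.sum_smul]
            refine Finset.sum_congr rfl fun g _ => ?_
            split_ifs with hg
            · rw [smul_assoc, h2 g hg, Units.smul_def (forestConst n v' s' e'),
                Units.smul_def (chi (n + 1) g * Equiv.Perm.sign g.1), Int.cast_smul_eq_zsmul]
            · rw [smul_zero, zero_smul]
          · have h3 : (hairyKind n).cls K D (grOf q) = 0 := by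
              by_cases hqh : Hairy q
              · exact cls_eq_zero_of_no_forest K n D hqh
                  fun ⟨T, h1, h2⟩ => hq ⟨T, h1, h2, hqh⟩
              · exact GraphKind.cls_of_not K (𝒢 := hairyKind n) fun h => hqh ((isHairy_iff q).1 h)
            rw [h3, smul_zero]
            symm
            refine Finset.sum_eq_zero fun g _ => ?_
            split_ifs with hg
            · rw [h2 g hg, h3, smul_zero, smul_zero]
            · rfl
        rw [Finset.sum_congr rfl fun q _ => h1 q, Finset.sum_comm]
        simp only [Finset.sum_ite_eq, Finset.mem_univ, if_true, Finset.sum_const, Finset.card_univ]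
        rw [Nat.cast_smul_eq_nsmul]
  have h1 := key a ha
  have h2 : (∑ q : Hf e → Fin v ⊕ Fin s,
      lam q (forestMap K n D a) • (hairyKind n).cls K D (grOf q)) = 0 := by
    refine Finset.sum_eq_zero fun q _ => ?_
    rcases hlam q with ⟨T, -, hT⟩ | ⟨-, hT⟩
    · rw [hT, h q T, zero_smul]
    · rw [hT, LinearMap.zero_apply, zero_smul]
  rw [h2, zero_sub, Submodule.neg_mem_iff, Submodule.smul_mem_iff _
    (Nat.cast_ne_zero.2 Fintype.card_ne_zero)] at h1
  have h3 := units_smul_mem K _ (forestConst n v s e) h1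
  rwa [smul_smul, Int.units_mul_self, one_smul] at h3

/-- A combination of oriented graphs of the largest size, up to smaller sizes, in terms of the
functionals of all graphs with lists. -/
theorem sum_psi_phi_sub_mem {m : ℕ} {N Δ : ℤ} (hm : dg N v s e m = Δ)
    {b : (orientedKind N).Space K Δ} (hb : b ∈ BF K N Δ (Set.Iic (rank v s e))) :
    (∑ q : Hf e → Fin v ⊕ Fin s, ∑ k : Fin m → Hf e,
      psi N Δ (equi_theta N q k) b • phi K N Δ q k) -
        ((Fintype.card (Ren v s e) * m.factorial : ℕ) : K) • b ∈
          BF K N Δ (Set.Iio (rank v s e)) := by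
  induction hb using Submodule.span_induction with
  | zero => simp
  | add x y _ _ hx hy =>
    have := Submodule.add_mem _ hx hy
    simp only [map_add, add_smul, smul_add, Finset.sum_add_distrib]
    convert this using 1
    abel
  | smul c x _ hx =>
    have := Submodule.smul_mem _ c hx
    rw [smul_sub, Finset.smul_sum] at this
    convert this using 2
    · refine Finset.sum_congr rfl fun q _ => ?_
      rw [Finset.smul_sum]
      refine Finset.sum_congr rfl fun k _ => ?_
      rw [map_smul, smul_assoc]
    · rw [smul_comm c]
  | mem z hz =>
    obtain ⟨v', s', e', m', p, l, hr, rfl⟩ := hz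
    rcases lt_or_eq_of_le (Set.mem_Iic.1 hr) with hlt | heq
    · refine Submodule.sub_mem _ (Submodule.sum_mem _ fun q _ => Submodule.sum_mem _ fun k _ => ?_)
        (Submodule.smul_mem _ _ (phi_mem_BF K N Δ (Set.mem_Iio.2 hlt) p l))
      rw [psi_phi_of_ne _ (fun h => (ne_of_lt hlt) h.1), zero_smul]
      exact Submodule.zero_mem _
    · obtain ⟨rfl, rfl, rfl⟩ := rank_inj heq
      by_cases hd : dg N v' s' e' m' = Δ
      · obtain rfl := dg_inj (hd.trans hm.symm)
        rw [← sum_theta_phi N Δ p l]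
        refine (congrArg (· ∈ BF K N Δ (Set.Iio (rank v' s' e'))) ?_).mpr (Submodule.zero_mem _)
        rw [sub_eq_zero]
        refine Finset.sum_congr rfl fun q _ => Finset.sum_congr rfl fun k _ => ?_
        rw [psi_phi _ hd]
      · rw [phi_eq_zero_of_degree hd]
        simp

/-- The functionals are alternating in the list. -/
theorem altF_psi {m : ℕ} {N Δ : ℤ} (q : Hf e → Fin v ⊕ Fin s) (b : (orientedKind N).Space K Δ) :
    AltF q fun k : Fin m → Hf e => psi N Δ (equi_theta (K := K) N q k) b := by
  have hb : b ∈ BF K N Δ Set.univ := by rw [BF_univ]; trivial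
  induction hb using Submodule.span_induction with
  | zero =>
    simp only [map_zero]
    exact AltF.zero
  | add x y _ _ hx hy =>
    simp only [map_add]
    exact hx.add hy
  | smul c x _ hx =>
    simp only [map_smul]
    exact hx.smul c
  | mem z hz =>
    obtain ⟨v', s', e', m', p, l, -, rfl⟩ := hz
    by_cases h : (rank v' s' e' = rank v s e ∧ m' = m) ∧ dg N v s e m = Δ
    · obtain ⟨⟨h1, rfl⟩, hd⟩ := h
      obtain ⟨rfl, rfl, rfl⟩ := rank_inj h1
      simp only [psi_phi _ hd]
      exact altF_theta N l
    · have h1 : (fun k : Fin m → Hf e => psi N Δ (equi_theta (K := K) N q k) (phi K N Δ p l)) = 0 := by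
        funext k
        by_cases h2 : rank v' s' e' = rank v s e ∧ m' = m
        · have h3 : dg N v s e m ≠ Δ := fun h3 => h ⟨h2, h3⟩
          obtain ⟨h1, rfl⟩ := h2
          obtain ⟨rfl, rfl, rfl⟩ := rank_inj h1
          rw [phi_eq_zero_of_degree h3, map_zero]
          rfl
        · exact psi_phi_of_ne _ h2 p l
      rw [h1]
      exact AltF.zero

/-- On functionals, the differential becomes the operator `delta`. -/
theorem exists_delta_psi {N Δ : ℤ} (v s e m : ℕ) (hm : dg N v s e m = Δ) : ∃ c : ℤˣ,
    ∀ (q : Hf e → Fin v ⊕ Fin s) (b : (orientedKind N).Space K Δ),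
      b ∈ BF K N Δ (Set.Iic (rank v s e)) →
      delta q (fun k : Fin m → Hf e => psi N Δ (equi_theta (K := K) N q k) b) =
        fun k => c • psi N (Δ + 1) (equi_theta N q k) ((orientedKind N).d K Δ b) := by
  have hm' : dg N v s e (m + 1) = Δ + 1 := by
    rw [← hm]
    unfold dg
    push_cast
    ring
  obtain ⟨c, hc⟩ := exists_d_phi_mod K N Δ v s e m
  refine ⟨c, fun q b hb => ?_⟩
  induction hb using Submodule.span_induction with
  | zero =>
    simp only [map_zero, smul_zero]
    have := delta_smul (p := q) (0 : K) (0 : (Fin m → Hf e) → K)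
    rwa [zero_smul, zero_smul] at this
  | add x y _ _ hx hy =>
    simp only [map_add, smul_add]
    refine (delta_add _ _).trans ?_
    rw [hx, hy]
    rfl
  | smul a x _ hx =>
    simp only [map_smul]
    refine (delta_smul a _).trans ?_
    rw [hx]
    funext k
    exact smul_comm a c (psi N (Δ + 1) (equi_theta (K := K) N q k) ((orientedKind N).d K Δ x))
  | mem z hz =>
    obtain ⟨v', s', e', m', p, l, hr, rfl⟩ := hz
    have h0 : delta q (0 : (Fin m → Hf e) → K) = 0 := by
      have := delta_smul (p := q) (0 : K) (0 : (Fin m → Hf e) → K)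
      rwa [zero_smul, zero_smul] at this
    rcases lt_or_eq_of_le (Set.mem_Iic.1 hr) with hlt | heq
    · have h1 : (fun k : Fin m → Hf e => psi N Δ (equi_theta (K := K) N q k) (phi K N Δ p l)) = 0 :=
        funext fun k => psi_phi_of_ne _ (fun h => (ne_of_lt hlt) h.1) p l
      rw [h1, h0]
      have h2 := d_mem_BF K N Δ (S := Set.Iio (rank v s e))
        (fun r hr r' hr' => Set.mem_Iio.2 (lt_of_le_of_lt (Set.mem_Iic.1 hr') (Set.mem_Iio.1 hr)))
        (phi_mem_BF K N Δ (Set.mem_Iio.2 hlt) p l)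
      funext k
      exact ((congrArg (c • ·) (psi_eq_zero_of_mem_BF (equi_theta (K := K) N q k) h2)).trans
        (smul_zero c)).symm
    · obtain ⟨rfl, rfl, rfl⟩ := rank_inj heq
      by_cases h : (Hairy p ∧ Lists p (Set.range l) l) ∧ dg N v' s' e' m' = Δ
      · obtain ⟨⟨hp, L⟩, hd⟩ := h
        obtain rfl := dg_inj (hd.trans hm.symm)
        simp only [psi_phi _ hd]
        funext k
        have h1 := psi_eq_zero_of_mem_BF (equi_theta (K := K) N q k) (hc p l hp L)
        rw [map_sub, sub_eq_zero] at h1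
        rw [h1, map_units_smul, smul_smul, Int.units_mul_self, one_smul, map_sum,
          ← sum_theta_cons N L k]
        exact Finset.sum_congr rfl fun h _ => (psi_phi _ hm' p _).symm
      · have h1 : phi K N Δ p l = 0 := by
          by_cases hp : Hairy p ∧ Lists p (Set.range l) l
          · exact phi_eq_zero_of_degree (fun hd => h ⟨hp, hd⟩) p l
          · exact phi_of_not K N Δ hp
        rw [h1]
        simp only [map_zero, smul_zero]
        exact h0

/-- Pairing with a coboundary gives a boundary up to smaller sizes. -/
theorem exists_d_sum_delta_phi {m : ℕ} (N Δ : ℤ) (q : Hf e → Fin v ⊕ Fin s)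
    {y : (Fin m → Hf e) → K} (hy : AltF q y) : ∃ c : (orientedKind N).Space K Δ,
    (∑ l : Fin (m + 1) → Hf e, delta q y l • phi K N (Δ + 1) q l) - (orientedKind N).d K Δ c ∈
      BF K N (Δ + 1) (Set.Iio (rank v s e)) := by
  obtain ⟨c, hc⟩ := exists_d_phi_mod K N Δ v s e m
  refine ⟨((m + 1 : ℕ) : K) • ∑ l, y l • c • phi K N Δ q l, ?_⟩
  rw [sum_delta_phi, map_smul, ← smul_sub, map_sum, ← Finset.sum_sub_distrib]
  refine Submodule.smul_mem _ _ (Submodule.sum_mem _ fun l _ => ?_)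
  by_cases h : Hairy q ∧ Lists q (Set.range l) l
  · have h1 := units_smul_mem K _ c (Submodule.neg_mem _ (hc q l h.1 h.2))
    rw [neg_sub, smul_sub, smul_smul, Int.units_mul_self, one_smul] at h1
    rw [map_smul, ← smul_sub, map_units_smul]
    exact Submodule.smul_mem _ _ h1
  · by_cases hq : Hairy q
    · rw [hy.supp l fun hL => h ⟨hq, hL⟩, zero_smul, zero_smul, map_zero, sub_zero]
      exact Submodule.zero_mem _
    · rw [phi_of_not K N Δ h, smul_zero, smul_zero, map_zero, sub_zero]
      refine Submodule.smul_mem _ _ (Submodule.sum_mem _ fun h _ => ?_)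
      rw [phi_of_not K N (Δ + 1) fun h => hq h.1]
      exact Submodule.zero_mem _

end

end HairForest


namespace HairForest

/-! ### The induction on the size -/

section

variable {v s e : ℕ} {K : Type*} [Field K] {n : ℤ}

theorem mem_BF_Iio_of_phi_eq_zero {N Δ : ℤ} {b : (orientedKind N).Space K Δ}
    (hb : b ∈ BF K N Δ (Set.Iic (rank v s e)))
    (h : ∀ (m : ℕ) (p : Hf e → Fin v ⊕ Fin s) (l : Fin m → Hf e), phi K N Δ p l = 0) :
    b ∈ BF K N Δ (Set.Iio (rank v s e)) := by
  refine (Submodule.span_le.2 ?_ : BF K N Δ (Set.Iic (rank v s e)) ≤ _) hb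
  rintro _ ⟨v', s', e', m', p, l, hr, rfl⟩
  rcases lt_or_eq_of_le (Set.mem_Iic.1 hr) with hlt | heq
  · exact phi_mem_BF K N Δ (Set.mem_Iio.2 hlt) p l
  · obtain ⟨rfl, rfl, rfl⟩ := rank_inj heq
    rw [h]
    exact Submodule.zero_mem _

theorem mem_AF_Iio_of_degree {D : ℤ} {a : (hairyKind n).Space K D}
    (ha : a ∈ AF K n D (Set.Iic (rank v s e)))
    (h : ∀ p : Hf e → Fin v ⊕ Fin s, (grOf p).degree n ≠ D) :
    a ∈ AF K n D (Set.Iio (rank v s e)) := by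
  refine (Submodule.span_le.2 ?_ : AF K n D (Set.Iic (rank v s e)) ≤ _) ha
  rintro _ ⟨v', s', e', p, hr, rfl⟩
  rcases lt_or_eq_of_le (Set.mem_Iic.1 hr) with hlt | heq
  · exact Submodule.subset_span ⟨v', s', e', p, Set.mem_Iio.2 hlt, rfl⟩
  · obtain ⟨rfl, rfl, rfl⟩ := rank_inj heq
    rw [cls_eq_zero_of_degree (h p)]
    exact Submodule.zero_mem _

theorem phi_eq_zero_of_lt {m : ℕ} {N Δ : ℤ} (h : m < v) (p : Hf e → Fin v ⊕ Fin s)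
    (l : Fin m → Hf e) : phi K N Δ p l = 0 :=
  phi_of_not K N Δ fun hp => absurd (le_of_lists hp.2) (not_le_of_gt h)

/-- The combination of forests given by the invariant function `omega` comes from the hairy graph. -/
theorem exists_sum_omega_phi_eq {D : ℤ} {p : Hf e → Fin v ⊕ Fin s} (hd : (grOf p).degree n = D) :
    ∃ a ∈ AF K n D (Set.Iic (rank v s e)),
      ∑ k : Fin v → Hf e, omega (K := K) p k • phi K (n + 1) (D + 1) p k = forestMap K n D a := by
  rw [sum_omega_phi]
  by_cases hp : Hairy p
  · refine ⟨(v.factorial : K) • forestConst n v s e • (hairyKind n).cls K D (grOf p),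
      Submodule.smul_mem _ _ (units_smul_mem K _ _
        (Submodule.subset_span ⟨v, s, e, p, Set.mem_Iic.2 le_rfl, rfl⟩)), ?_⟩
    rw [map_smul, map_units_smul, forestMap_cls K n ((isHairy_iff p).2 hp) hd,
      forestSum_eq K (D + 1) n hp, smul_smul (forestConst n v s e), Int.units_mul_self, one_smul]
  · refine ⟨0, Submodule.zero_mem _, ?_⟩
    rw [map_zero, secSum, Finset.sum_eq_zero, smul_zero]
    intro t _
    rw [phi_of_not K _ _ fun h => hp h.1, ite_self]

variable [CharZero K]

/-- The exactness for a fixed size, in the degrees in which the forests themselves do not occur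
in the target. -/
theorem exists_reduction_of_lists {m : ℕ} {D : ℤ} (hm : dg (n + 1) v s e (m + 1) = D + 1)
    {b : (orientedKind (n + 1)).Space K (D + 1)}
    (hb : b ∈ BF K (n + 1) (D + 1) (Set.Iic (rank v s e)))
    (hdb : (orientedKind (n + 1)).d K (D + 1) b ∈
      BF K (n + 1) (D + 1 + 1) (Set.Iio (rank v s e))) :
    ∃ a ∈ AF K n D (Set.Iic (rank v s e)), ∃ c : (orientedKind (n + 1)).Space K D,
      b - forestMap K n D a - (orientedKind (n + 1)).d K D c ∈
        BF K (n + 1) (D + 1) (Set.Iio (rank v s e)) := by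
  obtain ⟨c, hc⟩ := exists_delta_psi (K := K) v s e (m + 1) hm
  have hZ : ∀ q : Hf e → Fin v ⊕ Fin s,
      ∃ a ∈ AF K n D (Set.Iic (rank v s e)), ∃ c : (orientedKind (n + 1)).Space K D,
        (∑ k : Fin (m + 1) → Hf e, psi (n + 1) (D + 1) (equi_theta (K := K) (n + 1) q k) b •
          phi K (n + 1) (D + 1) q k) - forestMap K n D a - (orientedKind (n + 1)).d K D c ∈
            BF K (n + 1) (D + 1) (Set.Iio (rank v s e)) := by
    intro q
    obtain ⟨z, hz⟩ : ∃ z : (Fin (m + 1) → Hf e) → K,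
      z = fun k => psi (n + 1) (D + 1) (equi_theta (K := K) (n + 1) q k) b := ⟨_, rfl⟩
    have hzA : AltF q z := hz ▸ altF_psi q b
    have hzd : delta q z = 0 := by
      rw [hz, hc q b hb]
      funext k
      exact (congrArg (c • ·) (psi_eq_zero_of_mem_BF (equi_theta (K := K) (n + 1) q k) hdb)).trans
        (smul_zero c)
    have hzk : ∀ k, psi (n + 1) (D + 1) (equi_theta (K := K) (n + 1) q k) b = z k := fun k => by
      rw [hz]
    simp only [hzk]
    clear hz hzk hc
    by_cases hT : ∃ T, Section q T ∧ Adm q (Set.range T)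
    -- the graph has a forest, and the complex of its lists is exact up to `omega`
    · obtain ⟨T, hT, hA⟩ := hT
      by_cases hv : m + 1 = v
      · subst hv
        obtain ⟨x, y, hy, rfl⟩ := exists_eq_omega_add_delta hT hA hzA hzd
        have hd : (grOf q).degree n = D := by
          rw [dg_eq n _ s e _ q] at hm
          linarith
        obtain ⟨a, ha, hoa⟩ := exists_sum_omega_phi_eq (K := K) hd
        obtain ⟨c, hc⟩ := exists_d_sum_delta_phi (n + 1) D q hy
        refine ⟨x • a, Submodule.smul_mem _ _ ha, c, ?_⟩
        convert hc using 2
        simp only [Pi.add_apply, Pi.smul_apply, add_smul, smul_assoc, Finset.sum_add_distrib]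
        rw [← Finset.smul_sum, hoa, map_smul, add_sub_cancel_left]
      · obtain ⟨y, hy, rfl⟩ := exists_eq_delta_of_ne hT hA hv hzA hzd
        obtain ⟨c, hc⟩ := exists_d_sum_delta_phi (n + 1) D q hy
        refine ⟨0, Submodule.zero_mem _, c, ?_⟩
        rwa [map_zero, sub_zero]
    · refine ⟨0, Submodule.zero_mem _, 0, ?_⟩
      rw [map_zero, map_zero, sub_zero, sub_zero, Finset.sum_eq_zero]
      · exact Submodule.zero_mem _
      · intro k _
        rw [hzA.supp k fun L => hT L.adm.exists_forest, zero_smul]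
  -- the orbit functions recover `b`, multiplied by the order of the group
  choose a ha c' hc' using hZ
  obtain ⟨C, hC, hC0⟩ : ∃ C : K, C = ((Fintype.card (Ren v s e) * (m + 1).factorial : ℕ) : K) ∧
      C ≠ 0 := ⟨_, rfl, Nat.cast_ne_zero.2 (mul_ne_zero Fintype.card_ne_zero
        (Nat.factorial_ne_zero _))⟩
  have h1 := Submodule.sub_mem _ (Submodule.sum_mem _ fun q (_ : q ∈ Finset.univ) => hc' q)
    (sum_psi_phi_sub_mem hm hb)
  rw [← hC] at h1
  refine ⟨C⁻¹ • ∑ q, a q, Submodule.smul_mem _ _ (Submodule.sum_mem _ fun q _ => ha q),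
    C⁻¹ • ∑ q, c' q, ?_⟩
  have h2 := Submodule.smul_mem _ C⁻¹ h1
  convert h2 using 1
  rw [Finset.sum_sub_distrib, Finset.sum_sub_distrib, map_smul, map_smul, map_sum, map_sum,
    smul_sub, smul_sub, smul_sub, smul_sub, inv_smul_smul₀ hC0]
  abel

/-- One step of the elimination: a cycle of the cone of the map is changed by a boundary so that
its size decreases. -/
theorem exists_reduction {D : ℤ} {a : (hairyKind n).Space K (D + 1)}
    {b : (orientedKind (n + 1)).Space K (D + 1)}
    (ha : a ∈ AF K n (D + 1) (Set.Iic (rank v s e)))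
    (hb : b ∈ BF K (n + 1) (D + 1) (Set.Iic (rank v s e)))
    (hab : forestMap K n (D + 1) a = (orientedKind (n + 1)).d K (D + 1) b) :
    ∃ (a' : (hairyKind n).Space K D) (c : (orientedKind (n + 1)).Space K D),
      a + (hairyKind n).d K D a' ∈ AF K n (D + 1) (Set.Iio (rank v s e)) ∧
      b - forestMap K n D a' - (orientedKind (n + 1)).d K D c ∈
        BF K (n + 1) (D + 1) (Set.Iio (rank v s e)) := by
  have hdS : ∀ r' ∈ Set.Iio (rank v s e), Set.Iic r' ⊆ Set.Iio (rank v s e) := fun r' hr x hx =>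
    Set.mem_Iio.2 (lt_of_le_of_lt (Set.mem_Iic.1 hx) (Set.mem_Iio.1 hr))
  have htriv : a ∈ AF K n (D + 1) (Set.Iio (rank v s e)) →
      b ∈ BF K (n + 1) (D + 1) (Set.Iio (rank v s e)) →
      ∃ (a' : (hairyKind n).Space K D) (c : (orientedKind (n + 1)).Space K D),
        a + (hairyKind n).d K D a' ∈ AF K n (D + 1) (Set.Iio (rank v s e)) ∧
        b - forestMap K n D a' - (orientedKind (n + 1)).d K D c ∈
          BF K (n + 1) (D + 1) (Set.Iio (rank v s e)) := by
    intro h1 h2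
    refine ⟨0, 0, ?_, ?_⟩
    · rwa [map_zero, add_zero]
    · rwa [map_zero, map_zero, sub_zero, sub_zero]
  by_cases hdeg : (n - 1) * e - n * v - n * s + n = D + 1
  · -- the lists in the degree of `b` are shorter than the forests
    have hb' : b ∈ BF K (n + 1) (D + 1) (Set.Iio (rank v s e)) := by
      refine mem_BF_Iio_of_phi_eq_zero hb fun m p l => ?_
      by_cases hm : dg (n + 1) v s e m = D + 1
      · refine phi_eq_zero_of_lt ?_ p l
        rw [dg_eq n v s e m p, degree_grOf, hdeg] at hm
        omega
      · exact phi_eq_zero_of_degree hm p l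
    refine htriv (mem_AF_Iio_of_psi ha fun q T => ?_) hb'
    rw [hab]
    exact psi_eq_zero_of_mem_BF _ (d_mem_BF K (n + 1) (D + 1) hdS hb')
  · have ha' : a ∈ AF K n (D + 1) (Set.Iio (rank v s e)) :=
      mem_AF_Iio_of_degree ha fun p => by rwa [degree_grOf]
    by_cases hm : ∃ m, dg (n + 1) v s e (m + 1) = D + 1
    · obtain ⟨m, hm⟩ := hm
      obtain ⟨a', ha1, c, hc⟩ := exists_reduction_of_lists hm hb
        (hab ▸ forestMap_mem_BF K n (D + 1) ha')
      exact ⟨a', c, Submodule.add_mem _ ha' (d_mem_AF K n D ha1), hc⟩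
    · refine htriv ha' (mem_BF_Iio_of_phi_eq_zero hb fun m p l => ?_)
      obtain _ | m := m
      · by_cases hp : Hairy p
        · exact phi_eq_zero_of_lt hp.v_pos p l
        · exact phi_of_not K _ _ fun h => hp h.1
      · exact phi_eq_zero_of_degree (fun h => hm ⟨m, h⟩) p l

variable (K n) in
/-- The cone of the map is acyclic. -/
theorem exists_boundary (D : ℤ) (a : (hairyKind n).Space K (D + 1))
    (b : (orientedKind (n + 1)).Space K (D + 1)) (hda : (hairyKind n).d K (D + 1) a = 0)
    (hab : forestMap K n (D + 1) a = (orientedKind (n + 1)).d K (D + 1) b) :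
    ∃ (a' : (hairyKind n).Space K D) (c : (orientedKind (n + 1)).Space K D),
      a = -(hairyKind n).d K D a' ∧
      b = forestMap K n D a' + (orientedKind (n + 1)).d K D c := by
  -- the solutions for all bounds in a set of sizes give a solution for the whole set
  have hset : ∀ S : Set (ℕ ×ₗ ℕ ×ₗ ℕ), (∀ r ∈ S, ∀ (a : (hairyKind n).Space K (D + 1))
      (b : (orientedKind (n + 1)).Space K (D + 1)), a ∈ AF K n (D + 1) (Set.Iic r) →
      b ∈ BF K (n + 1) (D + 1) (Set.Iic r) → (hairyKind n).d K (D + 1) a = 0 →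
      forestMap K n (D + 1) a = (orientedKind (n + 1)).d K (D + 1) b →
      ∃ (a' : (hairyKind n).Space K D) (c : (orientedKind (n + 1)).Space K D),
        a = -(hairyKind n).d K D a' ∧
        b = forestMap K n D a' + (orientedKind (n + 1)).d K D c) →
      ∀ (a : (hairyKind n).Space K (D + 1)) (b : (orientedKind (n + 1)).Space K (D + 1)),
      a ∈ AF K n (D + 1) S → b ∈ BF K (n + 1) (D + 1) S → (hairyKind n).d K (D + 1) a = 0 →
      forestMap K n (D + 1) a = (orientedKind (n + 1)).d K (D + 1) b →
      ∃ (a' : (hairyKind n).Space K D) (c : (orientedKind (n + 1)).Space K D),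
        a = -(hairyKind n).d K D a' ∧
        b = forestMap K n D a' + (orientedKind (n + 1)).d K D c := by
    intro S h a b ha hb hda hab
    rcases S.eq_empty_or_nonempty with rfl | hS
    · have h1 : a = 0 := by
        refine (Submodule.span_le.2 ?_ : AF K n (D + 1) ∅ ≤ ⊥) ha
        rintro _ ⟨_, _, _, _, hr, -⟩
        exact hr.elim
      have h2 : b = 0 := by
        refine (Submodule.span_le.2 ?_ : BF K (n + 1) (D + 1) ∅ ≤ ⊥) hb
        rintro _ ⟨_, _, _, _, _, _, hr, -⟩
        exact hr.elim
      exact ⟨0, 0, by rw [h1, map_zero, neg_zero], by rw [h2, map_zero, map_zero, add_zero]⟩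
    · obtain ⟨r, hr, ha'⟩ := exists_Iic_of_mem_AF K n (D + 1) hS ha
      obtain ⟨r', hr', hb'⟩ := exists_Iic_of_mem_BF K (n + 1) (D + 1) hS hb
      rcases le_total r r' with hle | hle
      · exact h r' hr' a b (AF_mono K n (D + 1) (Set.Iic_subset_Iic.2 hle) ha') hb' hda hab
      · exact h r hr a b ha' (BF_mono K (n + 1) (D + 1) (Set.Iic_subset_Iic.2 hle) hb') hda hab
  refine hset Set.univ (fun r _ => ?_) a b (by rw [AF_univ]; trivial) (by rw [BF_univ]; trivial)
    hda hab
  clear hda hab a b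
  induction r using WellFoundedLT.induction with
  | _ r ih =>
    intro a b ha hb hda hab
    obtain ⟨v, s, e, rfl⟩ : ∃ v s e, r = rank v s e := ⟨_, _, _, rfl⟩
    obtain ⟨a', c, h1, h2⟩ := exists_reduction ha hb hab
    have hdd : ∀ x, (hairyKind n).d K (D + 1) ((hairyKind n).d K D x) = 0 := fun x =>
      LinearMap.congr_fun (GraphKind.d_comp_d K D) x
    have hdd' : ∀ x, (orientedKind (n + 1)).d K (D + 1) ((orientedKind (n + 1)).d K D x) = 0 :=
      fun x => LinearMap.congr_fun (GraphKind.d_comp_d K D) x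
    obtain ⟨a'', c', h3, h4⟩ := hset _ (fun r hr => ih r hr trivial) _ _ h1 h2
      (by rw [map_add, hda, hdd, add_zero])
      (by rw [map_add, map_sub, map_sub, hdd', d_forestMap, hab, sub_zero, sub_neg_eq_add])
    refine ⟨a' + a'', c + c', ?_, ?_⟩
    · rw [map_add, neg_add, ← h3]
      abel
    · rw [map_add, map_add, ← sub_eq_zero]
      rw [← sub_eq_zero] at h4
      rw [← h4]
      abel

end

end HairForest


universe u

/-! ### Quasi-isomorphisms of complexes of modules -/

/-- A chain map of complexes of modules induces an isomorphism in cohomology if its cone is acyclic.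
The choices of elements are made linear by passing to a free module. -/
theorem quasiIsoAt_of_forall_exists {R : Type u} [Ring R]
    {X Y : CochainComplex (ModuleCat.{u} R) ℤ}
    (φ : X ⟶ Y) (i : ℤ)
    (h1 : ∀ (x : X.X (i + 1)) (y : Y.X i), (X.d (i + 1) (i + 1 + 1)).hom x = 0 →
      (φ.f (i + 1)).hom x = (Y.d i (i + 1)).hom y → ∃ x', x = (X.d i (i + 1)).hom x')
    (h2 : ∀ y : Y.X (i + 1), (Y.d (i + 1) (i + 1 + 1)).hom y = 0 →
      ∃ x y', (X.d (i + 1) (i + 1 + 1)).hom x = 0 ∧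
        y = (φ.f (i + 1)).hom x + (Y.d i (i + 1)).hom y') : QuasiIsoAt φ (i + 1) := by
  rw [quasiIsoAt_iff_isIso_homologyMap]
  have hπ : ∀ A : ModuleCat.{u} R, Epi (ModuleCat.ofHom (Finsupp.linearCombination R (id : A → A)) :
      ModuleCat.of R (A →₀ R) ⟶ A) := fun A =>
    (ModuleCat.epi_iff_surjective _).2 (Finsupp.linearCombination_id_surjective R A)
  have hM : Mono (HomologicalComplex.homologyMap φ (i + 1)) := by
    rw [HomologicalComplex.mono_homologyMap_iff_up_to_refinements φ i (i + 1) (i + 1 + 1)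
      (by simp) (by simp)]
    intro A x hx y hxy
    choose x' hx' using fun a : A => h1 (x.hom a) (y.hom a)
      (LinearMap.congr_fun (congrArg ModuleCat.Hom.hom hx) a)
      (LinearMap.congr_fun (congrArg ModuleCat.Hom.hom hxy) a)
    refine ⟨_, _, hπ A, ModuleCat.ofHom (Finsupp.linearCombination R x'), ?_⟩
    refine ModuleCat.hom_ext (Finsupp.lhom_ext' fun a => LinearMap.ext_ring ?_)
    simpa using hx' a
  have hE : Epi (HomologicalComplex.homologyMap φ (i + 1)) := by
    rw [HomologicalComplex.epi_homologyMap_iff_up_to_refinements φ i (i + 1) (i + 1 + 1)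
      (by simp) (by simp)]
    intro A y hy
    choose x y' hx hxy using fun a : A => h2 (y.hom a)
      (LinearMap.congr_fun (congrArg ModuleCat.Hom.hom hy) a)
    refine ⟨_, _, hπ A, ModuleCat.ofHom (Finsupp.linearCombination R x), ?_,
      ModuleCat.ofHom (Finsupp.linearCombination R y'), ?_⟩
    · refine ModuleCat.hom_ext (Finsupp.lhom_ext' fun a => LinearMap.ext_ring ?_)
      simpa using hx a
    · refine ModuleCat.hom_ext (Finsupp.lhom_ext' fun a => LinearMap.ext_ring ?_)
      simpa using hxy a
  exact isIso_of_mono_of_epi _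

namespace HairForest

variable (K : Type*) [Field K] (n : ℤ)

theorem complex_d (𝒢 : GraphKind) (D : ℤ) :
    (𝒢.complex K).d D (D + 1) = ModuleCat.ofHom (𝒢.d K D) :=
  CochainComplex.of_d (fun D => ModuleCat.of K (𝒢.Space K D)) (fun D => ModuleCat.ofHom (𝒢.d K D)) D

theorem shift_d (D : ℤ) : ((OG₀ K (n + 1))⟦(1 : ℤ)⟧).d D (D + 1) =
    -ModuleCat.ofHom ((orientedKind (n + 1)).d K (D + 1)) := by
  rw [CochainComplex.shiftFunctor_obj_d', Int.negOnePow_one, Units.neg_smul, one_smul]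
  exact congrArg Neg.neg (complex_d K (orientedKind (n + 1)) (D + 1))

/-- The map given by the sums over the hair forests, as a morphism of complexes. -/
noncomputable def forestHom [CharZero K] : HG K n ⟶ (OG₀ K (n + 1))⟦(1 : ℤ)⟧ where
  f D := ModuleCat.ofHom (forestMap K n D)
  comm' i j hij := by
    obtain rfl : i + 1 = j := hij
    rw [shift_d]
    refine Eq.trans ?_ (congrArg (· ≫ ModuleCat.ofHom (forestMap K n (i + 1)))
      (complex_d K (hairyKind n) i)).symm
    refine ModuleCat.hom_ext (LinearMap.ext fun z => ?_)
    exact (congrArg Neg.neg (d_forestMap K n i z)).trans (neg_neg _)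

theorem quasiIso_forestHom [CharZero K] : QuasiIso (forestHom K n) where
  quasiIsoAt j := by
    obtain ⟨i, rfl⟩ : ∃ i, j = i + 1 := ⟨j - 1, by ring⟩
    have hdX : ∀ (D : ℤ) (x : (hairyKind n).Space K D),
        ((HG K n).d D (D + 1)).hom x = (hairyKind n).d K D x := fun D x =>
      congrArg (fun f => f.hom x) (complex_d K (hairyKind n) D)
    have hdY : ∀ (D : ℤ) (y : (orientedKind (n + 1)).Space K (D + 1)),
        (((OG₀ K (n + 1))⟦(1 : ℤ)⟧).d D (D + 1)).hom y =
          -(orientedKind (n + 1)).d K (D + 1) y := fun D y =>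
      congrArg (fun f => f.hom y) (shift_d K n D)
    refine quasiIsoAt_of_forall_exists (forestHom K n) i ?_ ?_
    · intro x y hx hxy
      obtain ⟨a, -, ha, -⟩ := exists_boundary K n i x (-y : (orientedKind (n + 1)).Space K (i + 1))
        ((hdX (i + 1) x).symm.trans hx)
        ((hxy.trans (hdY i y)).trans (map_neg _ _).symm)
      refine ⟨(-a : (hairyKind n).Space K i), ?_⟩
      exact ha.trans ((map_neg _ _).symm.trans (hdX i (-a)).symm)
    · intro y hy
      obtain ⟨a, c, ha, hb⟩ := exists_boundary K n (i + 1) 0 y (map_zero _)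
        ((map_zero _).trans (neg_eq_zero.1 ((hdY (i + 1) y).symm.trans hy)).symm)
      refine ⟨a, (-c : (orientedKind (n + 1)).Space K (i + 1)), ?_, ?_⟩
      · exact (hdX (i + 1) a).trans (neg_eq_zero.1 ha.symm)
      · refine hb.trans (congrArg (forestMap K n (i + 1) a + ·) ?_)
        exact ((hdY i (-c)).trans (by rw [map_neg, neg_neg])).symm

end HairForest

theorem mainTheorem8 (K : Type*) [Field K] [CharZero K] (n : ℤ) :
    ∃ f : HG K n ⟶ (OG₀ K (n + 1))⟦(1 : ℤ)⟧,
      (∀ (D : ℤ) (Γ : Gr), Γ.IsHairy → Γ.degree n = D →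
        (f.f D).hom ((hairyKind n).cls K D Γ) = forestSum K n (D + 1) Γ) ∧
      QuasiIso f :=
  ⟨HairForest.forestHom K n, fun _ _ hΓ hD => HairForest.forestMap_cls K n hΓ hD,
    HairForest.quasiIso_forestHom K n⟩
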